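/- **Setting.** Let $R$ be a commutative ring and $F\in R[[x,y]]$ a one-dimensional commutative formal group law ($F(x,0)=x$, $F(x,y)=F(y,x)$, $F(x,F(y,z))=F(F(x,y),z)$). For an abelian group $M$, let $R[[x_M]]$ be the completion of the polynomial ring $R[x_m\mid m\in M]$ with respect to the powers of the ideal of polynomials without constant term, and let $R[\![M]\!]_F$ be the quotient of $R[[x_M]]$ by the closure of the ideal generated by $x_0$ and all $F(x_l,x_m)-x_{l+m}$ ($l,m\in M$). Let $\Sigma\hookrightarrow\Lambda^\vee$, $\alpha\mapsto\alpha^\vee$, be a finite, nonempty, reduced, semisimple root datum with lattice $\Lambda$ (so $\Sigma\subset\Lambda$ and $\Sigma$ spans $\Lambda\otimes\mathbb Q$), with simple roots $\alpha_1,\dots,\alpha_n$, simple reflections $s_i$ and Weyl group $W$. Call $R[\![\Lambda]\!]_F$ *$\Sigma$-regular* if $x_\alpha$ is a non-zero-divisor in $R[\![\Lambda]\!]_F$ for every $\alpha\in\Sigma$. Let $\Gamma=\mathbb Z\gamma$ be infinite cyclic with trivial $W$-action, $S=R[\![\Gamma\oplus\Lambda]\!]_F$, $I_F$ the kernel of the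 augmentation $S\to R$, $x_m\mapsto 0$, $Q=S[\tfrac1{x_\alpha}\mid\alpha\in\Sigma]$, and let $Q_W=Q\rtimes R[W]$ be the twisted group algebra: it is the free left $Q$-module on $\{\delta_w\}_{w\in W}$ with $(u\delta_v)(u'\delta_w)=u\,v(u')\,\delta_{vw}$, and it acts on $Q$ by $(u\delta_w)\cdot q=u\,w(q)$. Put $$X_i=\tfrac1{x_{\alpha_i}}(1-\delta_{s_i}),\qquad T_i=x_\gamma X_i+\delta_{s_i}.$$ The formal affine Hecke algebra $\mathbf H_F$ is the $R$-subalgebra of $Q_W$ generated by $S$ and $T_1,\dots,T_n$. For $j\ge 0$ let $\mathbf H_F^j\subseteq\mathbf H_F$ be the $R$-span of all $uT_{i_1}\cdots T_{i_k}$ with $u\in I_F^j$, $k\ge0$. The degenerate affine Hecke algebra $H_{deg}$ is the ring generated by $\epsilon$, by $\lambda\in\Lambda$ and by $\theta_w$, $w\in W$, such that $\epsilon$ is central, $\lambda\mapsto\lambda$ is additive with commuting image, $w\mapsto\theta_w$ is multiplicative with $\theta_1=1$, and $$\theta_{s_i}\lambda-s_i(\lambda)\theta_{s_i}=\epsilon\langle\lambda,\alpha_i^\vee\rangle\qquad(1\le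 i\le n,\ \lambda\in\Lambda).$$ It is graded by $\deg\epsilon=\deg\lambda=1$, $\deg\theta_w=0$. **Theorem (PBW property).** Suppose that $R[\![\Lambda]\!]_F$ is $\Sigma$-regular. Then: 1. The action of $Q_W$ on $Q$ induces an action of $\mathbf H_F$ on $S$ by $R$-linear maps. One has $\mathbf H_F=\mathbf H_F^0\supseteq\mathbf H_F^1\supseteq\cdots$, $\mathbf H_F^i\cdot\mathbf H_F^j\subseteq\mathbf H_F^{i+j}$ and $\mathbf H_F^j\cdot I_F^k\subseteq I_F^{j+k}$. Hence $\mathrm{Gr}\,\mathbf H_F=\bigoplus_j\mathbf H_F^j/\mathbf H_F^{j+1}$ is a graded $R$-algebra, and it acts on $\mathrm{Gr}\,S=\bigoplus_jI_F^j/I_F^{j+1}$. 2. $H_{deg}$ acts on the symmetric algebra $S^*_{\mathbb Z}(\Gamma\oplus\Lambda)$: $\epsilon$ acts as multiplication by $\gamma$, $\lambda\in\Lambda$ as multiplication by $\lambda$, and $\theta_{s_i}$ by $u\mapsto\gamma\,\frac{u-s_i(u)}{\alpha_i}+s_i(u)$. Consequently $R\otimes_{\mathbb Z}H_{deg}$ acts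 on $S_R^*(\Gamma\oplus\Lambda)=R\otimes_{\mathbb Z}S^*_{\mathbb Z}(\Gamma\oplus\Lambda)$. 3. There are an isomorphism of $R$-algebras $\mathrm{Gr}\,S\cong S_R^*(\Gamma\oplus\Lambda)$ taking the class of $x_m$ in $I_F/I_F^2$ to $m$, for every $m\in\Gamma\oplus\Lambda$, and an isomorphism of graded $R$-algebras $$\mathrm{Gr}\,\mathbf H_F\;\cong\;R\otimes_{\mathbb Z}H_{deg}$$ taking the classes of $x_\gamma$ and $x_\lambda$ in $\mathbf H_F^1/\mathbf H_F^2$ to $\epsilon$ and $\lambda$, and the class of $T_i$ in $\mathbf H_F^0/\mathbf H_F^1$ to $\theta_{s_i}$. Under these isomorphisms the action of $\mathrm{Gr}\,\mathbf H_F$ on $\mathrm{Gr}\,S$ corresponds to the action of $R\otimes_{\mathbb Z}H_{deg}$ on $S_R^*(\Gamma\oplus\Lambda)$. -/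

import Mathlib

noncomputable section

namespace FormalHecke

section FormalGroupAlgebra

open MvPowerSeries

variable {R : Type*} [CommRing R]

/-- The ring `R⟦x_σ⟧`: the completion of the polynomial ring `R[x_s | s ∈ σ]` for the powers of the
ideal of polynomials without constant term. Its elements are the formal series whose homogeneous
component of each degree is a polynomial (no condition if `σ` is finite). -/
def powerSeriesCompletion (R σ : Type*) [CommRing R] : Subalgebra R (MvPowerSeries σ R) where
  carrier := {f | ∀ n : ℕ, {d : σ →₀ ℕ | d.degree = n ∧ coeff d f ≠ 0}.Finite}
  mul_mem' := by
    classical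
    intro f g hf hg n
    have hF : (⋃ k ∈ Finset.range (n + 1), {d : σ →₀ ℕ | d.degree = k ∧ coeff d f ≠ 0}).Finite :=
      Set.Finite.biUnion (Finset.finite_toSet _) fun k _ => hf k
    have hG : (⋃ k ∈ Finset.range (n + 1), {d : σ →₀ ℕ | d.degree = k ∧ coeff d g ≠ 0}).Finite :=
      Set.Finite.biUnion (Finset.finite_toSet _) fun k _ => hg k
    refine (hF.image2 (· + ·) hG).subset ?_
    rintro d ⟨hd, hne⟩
    rw [coeff_mul] at hne
    obtain ⟨p, hp, hpne⟩ := Finset.exists_ne_zero_of_sum_ne_zero hne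
    have hsum : p.1 + p.2 = d := Finset.HasAntidiagonal.mem_antidiagonal.mp hp
    have hdeg : p.1.degree + p.2.degree = n := by rw [← hd, ← hsum, map_add]
    refine ⟨p.1, ?_, p.2, ?_, hsum⟩
    · simp only [Set.mem_iUnion, Finset.mem_range]
      exact ⟨p.1.degree, by omega, rfl, left_ne_zero_of_mul hpne⟩
    · simp only [Set.mem_iUnion, Finset.mem_range]
      exact ⟨p.2.degree, by omega, rfl, right_ne_zero_of_mul hpne⟩
  add_mem' := by
    intro f g hf hg n
    refine ((hf n).union (hg n)).subset ?_
    rintro d ⟨hd, hne⟩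
    by_cases h : coeff d f = 0
    · exact Or.inr ⟨hd, by simpa [h] using hne⟩
    · exact Or.inl ⟨hd, h⟩
  algebraMap_mem' := by
    classical
    intro r n
    refine (Set.finite_singleton (0 : σ →₀ ℕ)).subset ?_
    rintro d ⟨-, hne⟩
    by_contra h
    exact hne (by
      rw [MvPowerSeries.algebraMap_apply, coeff_C, if_neg]
      exact h)

theorem X_mem_powerSeriesCompletion {σ : Type*} (s : σ) :
    (X s : MvPowerSeries σ R) ∈ powerSeriesCompletion R σ := by
  classical
  intro n
  refine (Set.finite_singleton (Finsupp.single s 1)).subset ?_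
  rintro d ⟨-, hne⟩
  by_contra h
  exact hne (by rw [coeff_X, if_neg]; exact h)

theorem subst_mem_powerSeriesCompletion {σ : Type*} (f : MvPowerSeries (Fin 2) R) (s t : σ) :
    f.subst ![(X s : MvPowerSeries σ R), X t] ∈ powerSeriesCompletion R σ := by
  classical
  intro n
  have hfin : ((fun p : ℕ × ℕ => Finsupp.single s p.1 + Finsupp.single t p.2) ''
      ((Set.Iic n) ×ˢ (Set.Iic n))).Finite :=
    ((Set.finite_Iic n).prod (Set.finite_Iic n)).image _
  refine hfin.subset ?_
  rintro d ⟨hd, hne⟩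
  rw [coeff_subst HasSubst.X_X] at hne
  obtain ⟨e, he⟩ : ∃ e : Fin 2 →₀ ℕ, coeff e f • coeff d
      (e.prod fun s' k => (![(X s : MvPowerSeries σ R), X t] s') ^ k) ≠ 0 := by
    by_contra! h
    exact hne (finsum_eq_zero_of_forall_eq_zero h)
  have he' : coeff d (e.prod fun s' k => (![(X s : MvPowerSeries σ R), X t] s') ^ k) ≠ 0 :=
    right_ne_zero_of_smul he
  rw [Finsupp.prod_fintype _ _ (by simp)] at he'
  simp only [Fin.prod_univ_two, Matrix.cons_val_zero, Matrix.cons_val_one,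
    X_pow_eq, monomial_mul_monomial, coeff_monomial] at he'
  have hde : d = Finsupp.single s (e 0) + Finsupp.single t (e 1) := by
    by_contra h
    exact he' (by rw [if_neg h])
  have hdeg : e 0 + e 1 = n := by rw [← hd, hde]; simp
  exact ⟨(e 0, e 1), ⟨by simp; omega, by simp; omega⟩, hde.symm⟩

/-- The closed ideal of series of order at least `n`; these ideals define the topology of `R⟦x_σ⟧`. -/
def orderIdeal (R σ : Type*) [CommRing R] (n : ℕ) : Ideal (powerSeriesCompletion R σ) where
  carrier := {f | ∀ d : σ →₀ ℕ, d.degree < n → coeff d (f : MvPowerSeries σ R) = 0}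
  add_mem' := by
    intro f g hf hg d hd
    simp [hf d hd, hg d hd]
  zero_mem' := by
    intro d _
    simp
  smul_mem' := by
    classical
    intro f g hg d hd
    have : ((f • g : powerSeriesCompletion R σ) : MvPowerSeries σ R) = (f : MvPowerSeries σ R) * g := rfl
    rw [this, coeff_mul]
    refine Finset.sum_eq_zero fun p hp => ?_
    have hsum : p.1 + p.2 = d := Finset.HasAntidiagonal.mem_antidiagonal.mp hp
    have hdeg : p.1.degree + p.2.degree = d.degree := by rw [← hsum, map_add]
    rw [hg p.2 (by omega), mul_zero]

variable (F : FormalGroup R) (M N K : Type*) [AddCommGroup M] [AddCommGroup N] [AddCommGroup K]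

/-- The variable `x_m`. -/
def formalVar (R : Type*) [CommRing R] {M : Type*} (m : M) : powerSeriesCompletion R M :=
  ⟨X m, X_mem_powerSeriesCompletion m⟩

/-- The element `x_l +_F x_m = F(x_l, x_m)`. -/
def formalSum {M : Type*} (l m : M) : powerSeriesCompletion R M :=
  ⟨F.toPowerSeries.subst ![(X l : MvPowerSeries M R), X m],
    subst_mem_powerSeriesCompletion F.toPowerSeries l m⟩

/-- The ideal generated by `x_0` and all `x_l +_F x_m - x_{l+m}`. -/
def relationIdeal : Ideal (powerSeriesCompletion R M) :=
  Ideal.span ({formalVar R (0 : M)} ∪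
    {f | ∃ l m : M, f = formalSum F l m - formalVar R (l + m)})

/-- The closure of `relationIdeal`. -/
def closedRelationIdeal : Ideal (powerSeriesCompletion R M) :=
  ⨅ n : ℕ, relationIdeal F M ⊔ orderIdeal R M n

/-- The formal group algebra `R⟦M⟧_F`. -/
def FormalGroupAlgebra : Type _ := powerSeriesCompletion R M ⧸ closedRelationIdeal F M

instance : CommRing (FormalGroupAlgebra F M) :=
  inferInstanceAs (CommRing (powerSeriesCompletion R M ⧸ closedRelationIdeal F M))

instance : Algebra R (FormalGroupAlgebra F M) :=
  inferInstanceAs (Algebra R (powerSeriesCompletion R M ⧸ closedRelationIdeal F M))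

/-- The quotient map. -/
def FormalGroupAlgebra.mk : powerSeriesCompletion R M →ₐ[R] FormalGroupAlgebra F M :=
  Ideal.Quotient.mkₐ R (closedRelationIdeal F M)

/-- The class of `x_m` in the formal group algebra. -/
def FormalGroupAlgebra.x {M : Type*} [AddCommGroup M] (m : M) : FormalGroupAlgebra F M :=
  FormalGroupAlgebra.mk F M (formalVar R m)

/-- The constant term. -/
def constantTerm (R σ : Type*) [CommRing R] : powerSeriesCompletion R σ →ₐ[R] R :=
  { (constantCoeff (σ := σ) (R := R)).comp (powerSeriesCompletion R σ).val.toRingHom with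
    commutes' := fun r => by simp [MvPowerSeries.algebraMap_apply] }

theorem constantTerm_eq_zero_of_mem (f : powerSeriesCompletion R M)
    (hf : f ∈ closedRelationIdeal F M) : constantTerm R M f = 0 := by
  have h1 : f ∈ relationIdeal F M ⊔ orderIdeal R M 1 := (Submodule.mem_iInf _).mp hf 1
  suffices relationIdeal F M ⊔ orderIdeal R M 1 ≤ RingHom.ker (constantTerm R M) from this h1
  refine sup_le ?_ ?_
  · refine Ideal.span_le.mpr ?_
    rintro g (rfl | ⟨l, m, rfl⟩)
    · change constantCoeff (X (0 : M) : MvPowerSeries M R) = 0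
      simp
    · change constantCoeff (F.toPowerSeries.subst ![(X l : MvPowerSeries M R), X m] -
        X (l + m)) = 0
      rw [map_sub, constantCoeff_subst_eq_zero HasSubst.X_X _ F.zero_constantCoeff]
      · simp
      · intro i
        fin_cases i <;> simp
  · intro g hg
    change coeff (0 : M →₀ ℕ) (g : MvPowerSeries M R) = 0
    exact hg 0 (by simp)

/-- The augmentation `R⟦M⟧_F → R`, `x_m ↦ 0`. -/
def FormalGroupAlgebra.augmentation : FormalGroupAlgebra F M →ₐ[R] R :=
  Ideal.Quotient.liftₐ (closedRelationIdeal F M) (constantTerm R M)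
    (constantTerm_eq_zero_of_mem F M)

/-- The augmentation ideal `I_F`. -/
def FormalGroupAlgebra.augIdeal : Ideal (FormalGroupAlgebra F M) :=
  RingHom.ker (FormalGroupAlgebra.augmentation F M)

theorem rename_mem_powerSeriesCompletion {σ τ : Type*} (e : σ ≃ τ) {f : MvPowerSeries σ R}
    (hf : f ∈ powerSeriesCompletion R σ) :
    renameEquiv R e f ∈ powerSeriesCompletion R τ := by
  intro n
  refine ((hf n).image (Finsupp.mapDomain e)).subset ?_
  rintro d ⟨hd, hne⟩
  have hmap : Finsupp.mapDomain e (Finsupp.mapDomain e.symm d) = d := by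
    rw [← Finsupp.mapDomain_comp]; simp
  refine ⟨Finsupp.mapDomain e.symm d, ⟨?_, ?_⟩, hmap⟩
  · rw [← hd]; exact Finsupp.degree_mapDomain _ _
  · have := coeff_embDomain_rename e.toEmbedding f (Finsupp.mapDomain e.symm d)
    rw [Finsupp.embDomain_eq_mapDomain] at this
    rw [← this]
    simpa [hmap] using hne

/-- Renaming of the variables along a bijection. -/
def powerSeriesCompletion.map {σ τ : Type*} (e : σ ≃ τ) :
    powerSeriesCompletion R σ →ₐ[R] powerSeriesCompletion R τ :=
  ((renameEquiv R e).toAlgHom.comp (powerSeriesCompletion R σ).val).codRestrict _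
    fun f => rename_mem_powerSeriesCompletion e f.2

theorem powerSeriesCompletion.coe_map {σ τ : Type*} (e : σ ≃ τ) (f : powerSeriesCompletion R σ) :
    (powerSeriesCompletion.map e f : MvPowerSeries τ R) = rename e (f : MvPowerSeries σ R) := rfl

variable {M N K}

theorem map_formalVar (e : M ≃+ N) (m : M) :
    powerSeriesCompletion.map (e : M ≃ N) (formalVar R m) = formalVar R (e m) := by
  apply Subtype.ext
  rw [powerSeriesCompletion.coe_map]
  exact rename_X _ _

theorem map_formalSum (e : M ≃+ N) (l m : M) :
    powerSeriesCompletion.map (e : M ≃ N) (formalSum F l m) = formalSum F (e l) (e m) := by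
  apply Subtype.ext
  rw [powerSeriesCompletion.coe_map]
  change rename _ (F.toPowerSeries.subst ![(X l : MvPowerSeries M R), X m]) =
    F.toPowerSeries.subst ![(X (e l) : MvPowerSeries N R), X (e m)]
  rw [rename_eq_subst, subst_comp_subst_apply HasSubst.X_X (HasSubst.X_comp _)]
  congr 1
  funext i
  fin_cases i
  · exact subst_X (HasSubst.X_comp _) l
  · exact subst_X (HasSubst.X_comp _) m

theorem map_mem_relationIdeal (e : M ≃+ N) {f : powerSeriesCompletion R M}
    (hf : f ∈ relationIdeal F M) :
    powerSeriesCompletion.map (e : M ≃ N) f ∈ relationIdeal F N := by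
  suffices relationIdeal F M ≤
      (relationIdeal F N).comap (powerSeriesCompletion.map (e : M ≃ N)) from this hf
  refine Ideal.span_le.mpr ?_
  rintro g (rfl | ⟨l, m, rfl⟩)
  · refine Ideal.subset_span (Or.inl ?_)
    rw [map_formalVar, map_zero]
    rfl
  · refine Ideal.subset_span (Or.inr ⟨e l, e m, ?_⟩)
    rw [map_sub, map_formalVar, map_formalSum, map_add]

theorem map_mem_orderIdeal {σ τ : Type*} (e : σ ≃ τ) {n : ℕ} {f : powerSeriesCompletion R σ}
    (hf : f ∈ orderIdeal R σ n) : powerSeriesCompletion.map e f ∈ orderIdeal R τ n := by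
  intro d hd
  have hmap : Finsupp.mapDomain e (Finsupp.mapDomain e.symm d) = d := by
    rw [← Finsupp.mapDomain_comp]; simp
  have := coeff_embDomain_rename e.toEmbedding (f : MvPowerSeries σ R)
    (Finsupp.mapDomain e.symm d)
  rw [Finsupp.embDomain_eq_mapDomain] at this
  rw [powerSeriesCompletion.coe_map]
  have h2 : coeff (Finsupp.mapDomain e.symm d) (f : MvPowerSeries σ R) = 0 := by
    apply hf
    rwa [Finsupp.degree_mapDomain]
  rw [h2] at this
  simpa [hmap] using this

theorem map_mem_closedRelationIdeal (e : M ≃+ N) (f : powerSeriesCompletion R M)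
    (hf : f ∈ closedRelationIdeal F M) :
    powerSeriesCompletion.map (e : M ≃ N) f ∈ closedRelationIdeal F N := by
  refine (Submodule.mem_iInf _).mpr fun n => ?_
  obtain ⟨g, hg, h, hh, rfl⟩ := Submodule.mem_sup.mp ((Submodule.mem_iInf _).mp hf n)
  rw [map_add]
  exact Submodule.add_mem_sup (map_mem_relationIdeal F e hg) (map_mem_orderIdeal _ hh)

/-- Functoriality: `x_m ↦ x_{e m}`. -/
def FormalGroupAlgebra.map (e : M ≃+ N) : FormalGroupAlgebra F M →ₐ[R] FormalGroupAlgebra F N :=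
  Ideal.quotientMapₐ (closedRelationIdeal F N) (powerSeriesCompletion.map (e : M ≃ N))
    (map_mem_closedRelationIdeal F e)

theorem FormalGroupAlgebra.map_x (e : M ≃+ N) (m : M) :
    FormalGroupAlgebra.map F e (FormalGroupAlgebra.x F m) = FormalGroupAlgebra.x F (e m) :=
  congrArg (FormalGroupAlgebra.mk F N) (map_formalVar e m)

theorem FormalGroupAlgebra.map_refl (f : FormalGroupAlgebra F M) :
    FormalGroupAlgebra.map F (AddEquiv.refl M) f = f := by
  obtain ⟨f, rfl⟩ := Ideal.Quotient.mk_surjective f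
  refine congrArg (FormalGroupAlgebra.mk F M) (Subtype.ext ?_)
  exact rename_id_apply (f : MvPowerSeries M R)

theorem FormalGroupAlgebra.map_trans (e : M ≃+ N) (e' : N ≃+ K) (f : FormalGroupAlgebra F M) :
    FormalGroupAlgebra.map F (e.trans e') f =
      FormalGroupAlgebra.map F e' (FormalGroupAlgebra.map F e f) := by
  obtain ⟨f, rfl⟩ := Ideal.Quotient.mk_surjective f
  refine congrArg (FormalGroupAlgebra.mk F K) (Subtype.ext ?_)
  exact (rename_rename (e : M ≃ N) (e' : N ≃ K) (f : MvPowerSeries M R)).symm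

end FormalGroupAlgebra

section TwistedAlgebra

open FormalGroupAlgebra

variable {R : Type*} [CommRing R] (F : FormalGroup R)
  {ι Λ Λ' : Type*} [AddCommGroup Λ] [AddCommGroup Λ'] (P : RootDatum ι Λ Λ')

/-- The Weyl group acts on `Γ ⊕ Λ = ℤ × Λ` (with `γ = (1, 0)`) through the second factor. -/
def weylAddEquiv (w : P.weylGroup) : ℤ × Λ ≃+ ℤ × Λ :=
  (AddEquiv.refl ℤ).prodCongr (DistribMulAction.toAddEquiv Λ w)

theorem weylAddEquiv_one : weylAddEquiv P 1 = AddEquiv.refl (ℤ × Λ) :=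
  AddEquiv.ext fun x => Prod.ext rfl (one_smul P.weylGroup x.2)

theorem weylAddEquiv_mul (v w : P.weylGroup) :
    weylAddEquiv P (v * w) = (weylAddEquiv P w).trans (weylAddEquiv P v) :=
  AddEquiv.ext fun x => Prod.ext rfl (mul_smul v w x.2)

/-- The algebra `S = R⟦Γ ⊕ Λ⟧_F`, where `Γ = ℤ` and `γ = 1`. -/
abbrev BaseAlgebra (Λ : Type*) [AddCommGroup Λ] : Type _ := FormalGroupAlgebra F (ℤ × Λ)

/-- `w(x_{(n, λ)}) = x_{(n, w λ)}`. -/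
instance weylActionBase : MulSemiringAction P.weylGroup (BaseAlgebra F Λ) where
  smul w f := FormalGroupAlgebra.map F (weylAddEquiv P w) f
  one_smul f := by
    change FormalGroupAlgebra.map F (weylAddEquiv P 1) f = f
    rw [weylAddEquiv_one, map_refl]
  mul_smul v w f := by
    change FormalGroupAlgebra.map F (weylAddEquiv P (v * w)) f = _
    rw [weylAddEquiv_mul, map_trans]
    rfl
  smul_zero w := map_zero (FormalGroupAlgebra.map F (weylAddEquiv P w))
  smul_add w := map_add (FormalGroupAlgebra.map F (weylAddEquiv P w))
  smul_one w := map_one (FormalGroupAlgebra.map F (weylAddEquiv P w))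
  smul_mul w := map_mul (FormalGroupAlgebra.map F (weylAddEquiv P w))

theorem weyl_smul_x (w : P.weylGroup) (n : ℤ) (l : Λ) :
    w • x F (n, l) = x F (n, w • l) :=
  map_x F (weylAddEquiv P w) (n, l)

theorem weyl_smul_algebraMap (w : P.weylGroup) (r : R) :
    w • algebraMap R (BaseAlgebra F Λ) r = algebraMap R (BaseAlgebra F Λ) r :=
  (FormalGroupAlgebra.map F (weylAddEquiv P w)).commutes r

/-- `x_α` for the root `α` with index `i`. -/
def xRoot (i : ι) : BaseAlgebra F Λ := x F ((0 : ℤ), P.root i)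

/-- `x_γ`. -/
def xGamma (Λ : Type*) [AddCommGroup Λ] : BaseAlgebra F Λ := x F ((1 : ℤ), (0 : Λ))

/-- `x_λ` for `λ ∈ Λ`. -/
def xWeight (l : Λ) : BaseAlgebra F Λ := x F ((0 : ℤ), l)

/-- The multiplicative set generated by the `x_α`, `α` a root. Since `x_{-α}` is a unit multiple of
`x_α`, it suffices to invert the `x_α` with `α` positive. -/
def rootSubmonoid : Submonoid (BaseAlgebra F Λ) :=
  Submonoid.closure (Set.range (xRoot F P))

theorem rootSubmonoid_le_comap (w : P.weylGroup) :
    rootSubmonoid F P ≤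
      (rootSubmonoid F P).comap (MulSemiringAction.toRingHom P.weylGroup (BaseAlgebra F Λ) w) := by
  refine Submonoid.closure_le.mpr ?_
  rintro _ ⟨i, rfl⟩
  refine Submonoid.subset_closure ⟨P.weylGroupToPerm w i, ?_⟩
  rw [MulSemiringAction.toRingHom_apply]
  exact (congrArg (fun l => x F ((0 : ℤ), l)) (RootPairing.weylGroup_apply_root P w i)).symm.trans
    (weyl_smul_x F P w 0 (P.root i)).symm

/-- `Q = S[1/x_α | α a root]`. -/
def LocalizedAlgebra : Type _ := Localization (rootSubmonoid F P)

instance : CommRing (LocalizedAlgebra F P) :=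
  inferInstanceAs (CommRing (Localization (rootSubmonoid F P)))

instance : Algebra (BaseAlgebra F Λ) (LocalizedAlgebra F P) :=
  inferInstanceAs (Algebra (BaseAlgebra F Λ) (Localization (rootSubmonoid F P)))

instance : Algebra R (LocalizedAlgebra F P) :=
  inferInstanceAs (Algebra R (Localization (rootSubmonoid F P)))

instance : IsScalarTower R (BaseAlgebra F Λ) (LocalizedAlgebra F P) :=
  inferInstanceAs (IsScalarTower R (BaseAlgebra F Λ) (Localization (rootSubmonoid F P)))

instance : IsLocalization (rootSubmonoid F P) (LocalizedAlgebra F P) :=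
  inferInstanceAs (IsLocalization (rootSubmonoid F P) (Localization (rootSubmonoid F P)))

/-- The automorphism of `Q` that extends the action of `w` on `S`. -/
def weylLocalized (w : P.weylGroup) : LocalizedAlgebra F P →+* LocalizedAlgebra F P :=
  IsLocalization.map (LocalizedAlgebra F P)
    (MulSemiringAction.toRingHom P.weylGroup (BaseAlgebra F Λ) w) (rootSubmonoid_le_comap F P w)

theorem weylLocalized_algebraMap (w : P.weylGroup) (f : BaseAlgebra F Λ) :
    weylLocalized F P w (algebraMap _ _ f) = algebraMap _ _ (w • f) :=
  IsLocalization.map_eq (rootSubmonoid_le_comap F P w) f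

instance weylActionLocalized : MulSemiringAction P.weylGroup (LocalizedAlgebra F P) where
  smul w q := weylLocalized F P w q
  one_smul q := by
    have h : weylLocalized F P 1 = RingHom.id (LocalizedAlgebra F P) := by
      refine IsLocalization.ringHom_ext (rootSubmonoid F P) (RingHom.ext fun f => ?_)
      rw [RingHom.comp_apply, weylLocalized_algebraMap, one_smul]
      rfl
    exact RingHom.congr_fun h q
  mul_smul v w q := by
    have h : weylLocalized F P (v * w) = (weylLocalized F P v).comp (weylLocalized F P w) := by
      refine IsLocalization.ringHom_ext (rootSubmonoid F P) (RingHom.ext fun f => ?_)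
      rw [RingHom.comp_apply, RingHom.comp_apply, RingHom.comp_apply, weylLocalized_algebraMap,
        weylLocalized_algebraMap, weylLocalized_algebraMap, mul_smul]
    exact RingHom.congr_fun h q
  smul_zero w := map_zero (weylLocalized F P w)
  smul_add w := map_add (weylLocalized F P w)
  smul_one w := map_one (weylLocalized F P w)
  smul_mul w := map_mul (weylLocalized F P w)

theorem weyl_smul_algebraMap_localized (w : P.weylGroup) (f : BaseAlgebra F Λ) :
    w • algebraMap (BaseAlgebra F Λ) (LocalizedAlgebra F P) f =
      algebraMap (BaseAlgebra F Λ) (LocalizedAlgebra F P) (w • f) :=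
  weylLocalized_algebraMap F P w f

instance weylActionLocalized_smulComm : SMulCommClass P.weylGroup R (LocalizedAlgebra F P) where
  smul_comm w r q := by
    rw [Algebra.smul_def, Algebra.smul_def, smul_mul',
      IsScalarTower.algebraMap_apply R (BaseAlgebra F Λ) (LocalizedAlgebra F P),
      weyl_smul_algebraMap_localized, weyl_smul_algebraMap]

/-- `Q_W = Q ⋊ R[W]`, where `SkewMonoidAlgebra.single w u` is `u δ_w`: the product is
`u δ_v * u' δ_w = u v(u') δ_{vw}`. -/
abbrev TwistedAlgebra : Type _ := SkewMonoidAlgebra (LocalizedAlgebra F P) P.weylGroup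

/-- The embedding `u ↦ u δ_1` of `S` in `Q_W`. -/
def scalar : BaseAlgebra F Λ →+* TwistedAlgebra F P :=
  (SkewMonoidAlgebra.singleOneRingHom).comp
    (algebraMap (BaseAlgebra F Λ) (LocalizedAlgebra F P))

/-- `δ_w`. -/
def delta (w : P.weylGroup) : TwistedAlgebra F P := SkewMonoidAlgebra.single w 1

/-- The reflection `s_α` as an element of the Weyl group. -/
def simpleRefl (i : ι) : P.weylGroup := RootPairing.weylGroup.ofIdx P i

/-- `1 / x_α`. -/
def invRoot (i : ι) : LocalizedAlgebra F P :=
  IsLocalization.mk' (LocalizedAlgebra F P) 1 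
    (⟨xRoot F P i, Submonoid.subset_closure (Set.mem_range_self i)⟩ : rootSubmonoid F P)

/-- `X_α = 1/x_α - (1/x_α) δ_α`. -/
def demazureElement (i : ι) : TwistedAlgebra F P :=
  SkewMonoidAlgebra.single 1 (invRoot F P i) -
    SkewMonoidAlgebra.single (simpleRefl P i) (invRoot F P i)

/-- `T_α = x_γ X_α + δ_α`. -/
def demazureLusztig (i : ι) : TwistedAlgebra F P :=
  scalar F P (xGamma F Λ) * demazureElement F P i + delta F P (simpleRefl P i)

/-- The formal affine Hecke algebra: the `R`-subalgebra of `Q_W` generated by `S` and the `T_i`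
for the simple roots. -/
def heckeAlgebra (b : P.Base) : Subalgebra R (TwistedAlgebra F P) :=
  Algebra.adjoin R (Set.range (scalar F P) ∪ demazureLusztig F P '' b.support)

/-- An element of `S` as an element of the formal affine Hecke algebra. -/
def heckeScalar (b : P.Base) (u : BaseAlgebra F Λ) : heckeAlgebra F P b :=
  ⟨scalar F P u, Algebra.subset_adjoin (Or.inl ⟨u, rfl⟩)⟩

/-- `T_i` as an element of the formal affine Hecke algebra. -/
def heckeT (b : P.Base) (i : b.support) : heckeAlgebra F P b :=
  ⟨demazureLusztig F P i, Algebra.subset_adjoin (Or.inr ⟨i, i.2, rfl⟩)⟩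

/-- The filtration of the formal affine Hecke algebra: the `R`-span of all `u T_{i_1} ⋯ T_{i_k}` with
`u ∈ I_F ^ j`. -/
def heckeFiltration (b : P.Base) (j : ℕ) : Submodule R (heckeAlgebra F P b) :=
  Submodule.span R {z | ∃ u ∈ augIdeal F (ℤ × Λ) ^ j, ∃ I : List b.support,
    z = heckeScalar F P b u * (I.map (heckeT F P b)).prod}

/-- The filtration of `S` by the powers of `I_F`. -/
def baseFiltration (Λ : Type*) [AddCommGroup Λ] (j : ℕ) : Submodule R (BaseAlgebra F Λ) :=
  (augIdeal F (ℤ × Λ) ^ j).restrictScalars R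

/-- The action of `Q_W` on `Q`: `(u δ_w) · q = u w(q)`. -/
def twistedAct (z : TwistedAlgebra F P) (q : LocalizedAlgebra F P) : LocalizedAlgebra F P :=
  z.sum fun w u => u * w • q

/-- `R⟦Λ⟧_F` is `Σ`-regular: `x_α ∈ R⟦Λ⟧_F` is a non-zero-divisor for each root `α`. -/
def IsSigmaRegular : Prop :=
  ∀ i : ι, IsRegular (x F (P.root i) : FormalGroupAlgebra F Λ)

/-- The root datum is semisimple: the roots span `Λ ⊗ ℚ`. -/
def IsSemisimpleRootDatum : Prop :=
  ∀ l : Λ, ∃ n : ℤ, n ≠ 0 ∧ n • l ∈ Submodule.span ℤ (Set.range P.root)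

theorem x_mem_augIdeal {M : Type*} [AddCommGroup M] (m : M) : x F m ∈ augIdeal F M := by
  change MvPowerSeries.constantCoeff (MvPowerSeries.X m : MvPowerSeries M R) = 0
  simp

theorem x_mem_baseFiltration (m : ℤ × Λ) : x F m ∈ baseFiltration F Λ 1 := by
  change x F m ∈ augIdeal F (ℤ × Λ) ^ 1
  rw [pow_one]
  exact x_mem_augIdeal F m

theorem heckeScalar_mem (b : P.Base) {j : ℕ} {u : BaseAlgebra F Λ}
    (hu : u ∈ baseFiltration F Λ j) : heckeScalar F P b u ∈ heckeFiltration F P b j :=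
  Submodule.subset_span ⟨u, hu, [], by simp⟩

theorem heckeT_mem (b : P.Base) (i : b.support) : heckeT F P b i ∈ heckeFiltration F P b 0 := by
  refine Submodule.subset_span ⟨1, by simp, [i], ?_⟩
  have h : heckeScalar F P b 1 = 1 := Subtype.ext (map_one (scalar F P))
  simp [h]

end TwistedAlgebra

section Graded

variable {R : Type*} [CommRing R]

section Modules

variable {M N L : Type*} [AddCommGroup M] [Module R M] [AddCommGroup N] [Module R N]
  [AddCommGroup L] [Module R L]

/-- The quotient `F i / F (i + 1)`. -/
def GrPiece (F : ℕ → Submodule R M) (i : ℕ) : Type _ :=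
  F i ⧸ (F (i + 1)).submoduleOf (F i)

instance (F : ℕ → Submodule R M) (i : ℕ) : AddCommGroup (GrPiece F i) :=
  inferInstanceAs (AddCommGroup (F i ⧸ (F (i + 1)).submoduleOf (F i)))

instance (F : ℕ → Submodule R M) (i : ℕ) : Module R (GrPiece F i) :=
  inferInstanceAs (Module R (F i ⧸ (F (i + 1)).submoduleOf (F i)))

/-- The projection `F i → F i / F (i + 1)`. -/
def GrPiece.mk (F : ℕ → Submodule R M) (i : ℕ) : F i →ₗ[R] GrPiece F i :=
  ((F (i + 1)).submoduleOf (F i)).mkQ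

/-- The associated graded module `⨁ i, F i / F (i + 1)` of a decreasing filtration. -/
abbrev Gr (F : ℕ → Submodule R M) : Type _ := DirectSum ℕ (GrPiece F)

/-- The class in degree `i` of an element of `F i`. -/
def Gr.mk (F : ℕ → Submodule R M) (i : ℕ) : F i →ₗ[R] Gr F :=
  (DirectSum.lof R ℕ (GrPiece F) i).comp (GrPiece.mk F i)

/-- The homogeneous component of degree `i`. -/
def Gr.component (F : ℕ → Submodule R M) (i : ℕ) : Submodule R (Gr F) :=
  LinearMap.range (DirectSum.lof R ℕ (GrPiece F) i)

theorem GrPiece.mk_eq_zero (F : ℕ → Submodule R M) (i : ℕ) (m : F i) (h : (m : M) ∈ F (i + 1)) :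
    GrPiece.mk F i m = 0 :=
  (Submodule.Quotient.mk_eq_zero _).mpr h

theorem GrPiece.mk_surjective (F : ℕ → Submodule R M) (i : ℕ) :
    Function.Surjective (GrPiece.mk F i) :=
  Submodule.mkQ_surjective _

variable (F : ℕ → Submodule R M) (G : ℕ → Submodule R N) (H : ℕ → Submodule R L)
    (β : M →ₗ[R] N →ₗ[R] L) (h : ∀ i j, ∀ m ∈ F i, ∀ n ∈ G j, β m n ∈ H (i + j))

/-- The map induced by `β m` on `G j / G (j + 1)`, for `m ∈ F i`. -/
def grPairingAux (i j : ℕ) (m : F i) : GrPiece G j →ₗ[R] GrPiece H (i + j) :=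
  Submodule.liftQ ((G (j + 1)).submoduleOf (G j))
    ((GrPiece.mk H (i + j)).comp ((β m).restrict fun n hn => h i j m m.2 n hn))
    fun n hn => GrPiece.mk_eq_zero H (i + j) _ (h i (j + 1) m m.2 n hn)

/-- The map `F i / F (i + 1) × G j / G (j + 1) → H (i + j) / H (i + j + 1)` induced by `β`. -/
def grPairingPiece (i j : ℕ) : GrPiece F i →ₗ[R] GrPiece G j →ₗ[R] GrPiece H (i + j) :=
  Submodule.liftQ ((F (i + 1)).submoduleOf (F i))
    { toFun := grPairingAux F G H β h i j
      map_add' := fun m m' => by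
        refine Submodule.linearMap_qext _ (LinearMap.ext fun n => ?_)
        refine (congrArg (GrPiece.mk H (i + j)) (?_ : (⟨_, _⟩ : H (i + j)) = ⟨_, _⟩ + ⟨_, _⟩)).trans
          (map_add _ _ _)
        exact Subtype.ext (by simp)
      map_smul' := fun r m => by
        refine Submodule.linearMap_qext _ (LinearMap.ext fun n => ?_)
        refine (congrArg (GrPiece.mk H (i + j)) (?_ : (⟨_, _⟩ : H (i + j)) = r • ⟨_, _⟩)).trans
          (map_smul _ _ _)
        exact Subtype.ext (by simp) }
    fun m hm => by
      refine Submodule.linearMap_qext _ (LinearMap.ext fun n => ?_)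
      refine GrPiece.mk_eq_zero H (i + j) _ ?_
      have := h (i + 1) j m hm n n.2
      rwa [Nat.add_right_comm] at this

theorem grPairingPiece_mk (i j : ℕ) (m : F i) (n : G j) :
    grPairingPiece F G H β h i j (GrPiece.mk F i m) (GrPiece.mk G j n) =
      GrPiece.mk H (i + j) ⟨β m n, h i j m m.2 n n.2⟩ := rfl

/-- A bilinear map `β` with `β (F i) (G j) ⊆ H (i + j)` induces a bilinear map
`Gr F × Gr G → Gr H` with `([m], [n]) ↦ [β m n]`. -/
def grPairing : Gr F →ₗ[R] Gr G →ₗ[R] Gr H :=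
  DirectSum.toModule R ℕ _ fun i => LinearMap.flip (DirectSum.toModule R ℕ _ fun j =>
    LinearMap.flip ((grPairingPiece F G H β h i j).compr₂ (DirectSum.lof R ℕ (GrPiece H) (i + j))))

theorem grPairing_mk (i j : ℕ) (m : F i) (n : G j) :
    grPairing F G H β h (Gr.mk F i m) (Gr.mk G j n) =
      Gr.mk H (i + j) ⟨β m n, h i j m m.2 n n.2⟩ := by
  simp [grPairing, Gr.mk, grPairingPiece_mk]

end Modules

section Rings

variable {A : Type*} [Ring A] [Algebra R A]

/-- A decreasing multiplicative filtration `A = F 0 ⊇ F 1 ⊇ F 2 ⊇ ⋯` of an algebra. -/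
class IsDecreasingFiltration (F : ℕ → Submodule R A) : Prop where
  antitone : Antitone F
  zero_eq_top : F 0 = ⊤
  mul_mem : ∀ {i j : ℕ} {a b : A}, a ∈ F i → b ∈ F j → a * b ∈ F (i + j)

variable (F : ℕ → Submodule R A) [IsDecreasingFiltration F]

theorem IsDecreasingFiltration.mem_zero (a : A) : a ∈ F 0 := by
  rw [IsDecreasingFiltration.zero_eq_top (F := F)]
  trivial

theorem GrPiece.sigma_eq {F : ℕ → Submodule R A} {i j : ℕ} (hij : i = j) {a : F i} {b : F j}
    (hab : (a : A) = b) :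
    GradedMonoid.mk (A := GrPiece F) i (GrPiece.mk F i a) = GradedMonoid.mk j (GrPiece.mk F j b) := by
  subst hij
  rw [Subtype.ext hab]

instance GrPiece.gOne : GradedMonoid.GOne (GrPiece F) where
  one := GrPiece.mk F 0 ⟨1, IsDecreasingFiltration.mem_zero F 1⟩

/-- `[a] * [b] = [a * b]`; this makes `Gr F` a ring. -/
instance GrPiece.gMul : GradedMonoid.GMul (GrPiece F) where
  mul {i j} a b := grPairingPiece F F F (LinearMap.mul R A)
    (fun _ _ _ hm _ hn => IsDecreasingFiltration.mul_mem hm hn) i j a b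

instance GrPiece.gRing : DirectSum.GRing (GrPiece F) where
  mul_zero a := map_zero _
  zero_mul b := by
    change grPairingPiece F F F (LinearMap.mul R A) _ _ _ 0 b = 0
    rw [map_zero, LinearMap.zero_apply]
  mul_add a b c := map_add _ _ _
  add_mul a b c := by
    change grPairingPiece F F F (LinearMap.mul R A) _ _ _ (a + b) c = _
    rw [map_add, LinearMap.add_apply]
    rfl
  one_mul a := by
    obtain ⟨i, a⟩ := a
    obtain ⟨a, rfl⟩ := GrPiece.mk_surjective F i a
    exact GrPiece.sigma_eq (zero_add i) (one_mul (a : A))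
  mul_one a := by
    obtain ⟨i, a⟩ := a
    obtain ⟨a, rfl⟩ := GrPiece.mk_surjective F i a
    exact GrPiece.sigma_eq (add_zero i) (mul_one (a : A))
  mul_assoc a b c := by
    obtain ⟨i, a⟩ := a
    obtain ⟨j, b⟩ := b
    obtain ⟨k, c⟩ := c
    obtain ⟨a, rfl⟩ := GrPiece.mk_surjective F i a
    obtain ⟨b, rfl⟩ := GrPiece.mk_surjective F j b
    obtain ⟨c, rfl⟩ := GrPiece.mk_surjective F k c
    exact GrPiece.sigma_eq (add_assoc i j k) (mul_assoc (a : A) b c)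
  natCast n := GrPiece.mk F 0 ⟨n, IsDecreasingFiltration.mem_zero F n⟩
  natCast_zero := GrPiece.mk_eq_zero F 0 _ (by simp)
  natCast_succ n := by
    change _ = GrPiece.mk F 0 _ + GrPiece.mk F 0 ⟨1, IsDecreasingFiltration.mem_zero F 1⟩
    rw [← map_add]
    exact congrArg _ (Subtype.ext (by simp))
  intCast n := GrPiece.mk F 0 ⟨n, IsDecreasingFiltration.mem_zero F n⟩
  intCast_ofNat n := congrArg _ (Subtype.ext (by simp))
  intCast_negSucc_ofNat n := by
    rw [← map_neg]
    exact congrArg _ (Subtype.ext (by simp))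

instance GrPiece.gAlgebra : DirectSum.GAlgebra R (GrPiece F) where
  toFun :=
    { toFun := fun r => GrPiece.mk F 0 ⟨algebraMap R A r, IsDecreasingFiltration.mem_zero F _⟩
      map_zero' := GrPiece.mk_eq_zero F 0 _ (by simp)
      map_add' := fun r s => by
        rw [← map_add]
        exact congrArg _ (Subtype.ext (by simp)) }
  map_one := congrArg _ (Subtype.ext (by simp))
  map_mul r s := GrPiece.sigma_eq (zero_add 0).symm (by simp)
  commutes r a := by
    obtain ⟨i, a⟩ := a
    obtain ⟨a, rfl⟩ := GrPiece.mk_surjective F i a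
    exact GrPiece.sigma_eq (add_comm 0 i) (Algebra.commutes r (a : A))
  smul_def r a := by
    obtain ⟨i, a⟩ := a
    obtain ⟨a, rfl⟩ := GrPiece.mk_surjective F i a
    exact GrPiece.sigma_eq (a := r • a) (zero_add i).symm (Algebra.smul_def r (a : A))

theorem Gr.mk_mul_mk (i j : ℕ) (a : F i) (b : F j) :
    Gr.mk F i a * Gr.mk F j b = Gr.mk F (i + j) ⟨a * b, IsDecreasingFiltration.mul_mem a.2 b.2⟩ := by
  simp only [Gr.mk, LinearMap.comp_apply, DirectSum.lof_eq_of, DirectSum.of_mul_of]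
  rfl

end Rings

instance baseFiltration.isDecreasingFiltration (F : FormalGroup R) (Λ : Type*) [AddCommGroup Λ] :
    IsDecreasingFiltration (baseFiltration F Λ) where
  antitone := fun _ _ h => Ideal.pow_le_pow_right h
  zero_eq_top := by
    ext u
    simp [baseFiltration]
  mul_mem {i j a b} ha hb := by
    change a * b ∈ FormalGroupAlgebra.augIdeal F (ℤ × Λ) ^ (i + j)
    rw [pow_add]
    exact Ideal.mul_mem_mul ha hb
end Graded

section DegenerateHecke

open scoped TensorProduct

variable {κ Λ Λ' : Type*} [AddCommGroup Λ] [AddCommGroup Λ'] {P : RootDatum κ Λ Λ'}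

/-- Generators of the degenerate affine Hecke algebra: `ε`, the weights `λ ∈ Λ` and the elements
`θ_w` for `w ∈ W`. -/
inductive DegGen (P : RootDatum κ Λ Λ') : Type _
  | eps : DegGen P
  | wt (l : Λ) : DegGen P
  | theta (w : P.weylGroup) : DegGen P

/-- The degrees of the generators. -/
def DegGen.degree : DegGen P → ℕ
  | eps => 1
  | wt _ => 1
  | theta _ => 0

open FreeAlgebra (ι)
open DegGen (eps wt theta)

/-- The relations of the degenerate affine Hecke algebra: `ε` is central, the weights generate an
image of the symmetric algebra of `Λ`, the `θ_w` an image of the group algebra of `W`, and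
`θ_i λ - s_i(λ) θ_i = ⟨λ, α_iᵛ⟩ ε` for simple roots `α_i`. -/
inductive DegRel (b : P.Base) : FreeAlgebra ℤ (DegGen P) → FreeAlgebra ℤ (DegGen P) → Prop
  | eps_comm (g : DegGen P) : DegRel b (ι ℤ eps * ι ℤ g) (ι ℤ g * ι ℤ eps)
  | wt_add (l m : Λ) : DegRel b (ι ℤ (wt (l + m))) (ι ℤ (wt l) + ι ℤ (wt m))
  | wt_comm (l m : Λ) : DegRel b (ι ℤ (wt l) * ι ℤ (wt m)) (ι ℤ (wt m) * ι ℤ (wt l))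
  | theta_one : DegRel b (ι ℤ (theta 1)) 1
  | theta_mul (v w : P.weylGroup) :
      DegRel b (ι ℤ (theta (v * w))) (ι ℤ (theta v) * ι ℤ (theta w))
  | cross (i : b.support) (l : Λ) :
      DegRel b
        (ι ℤ (theta (simpleRefl P i)) * ι ℤ (wt l) -
          ι ℤ (wt (P.reflection i l)) * ι ℤ (theta (simpleRefl P i)))
        (P.toLinearMap l (P.coroot i) • ι ℤ eps)

/-- The degenerate affine Hecke algebra `H_deg`, by generators and relations. -/
def DegHecke (b : P.Base) : Type _ := RingQuot (DegRel b)

instance (b : P.Base) : Ring (DegHecke b) := inferInstanceAs (Ring (RingQuot (DegRel b)))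

/-- The image of a generator. -/
def DegHecke.gen (b : P.Base) (g : DegGen P) : DegHecke b :=
  RingQuot.mkAlgHom ℤ (DegRel b) (ι ℤ g)

/-- The homogeneous component of degree `n` for the grading with `deg θ_w = 0`,
`deg ε = deg λ = 1`. -/
def DegHecke.component (b : P.Base) (n : ℕ) : Submodule ℤ (DegHecke b) :=
  Submodule.span ℤ {a | ∃ L : List (DegGen P), (L.map DegGen.degree).sum = n ∧
    a = (L.map (DegHecke.gen b)).prod}

/-- The symmetric algebra of `Γ ⊕ Λ` over `ℤ`, that is `S^*_{ℤ[ε]}(Λ)` with `ε` identified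
with `γ`. -/
abbrev SymEps (Λ : Type*) [AddCommGroup Λ] : Type _ := SymmetricAlgebra ℤ (ℤ × Λ)

/-- `γ`, that is `ε`. -/
def SymEps.gamma (Λ : Type*) [AddCommGroup Λ] : SymEps Λ := SymmetricAlgebra.ι ℤ (ℤ × Λ) (1, 0)

/-- `λ ∈ Λ` in degree one. -/
def SymEps.wt (l : Λ) : SymEps Λ := SymmetricAlgebra.ι ℤ (ℤ × Λ) (0, l)

/-- The reflection `s_α` on the symmetric algebra; it fixes `γ`. -/
def SymEps.refl (P : RootDatum κ Λ Λ') (i : κ) : SymEps Λ →ₐ[ℤ] SymEps Λ :=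
  SymmetricAlgebra.lift ((SymmetricAlgebra.ι ℤ (ℤ × Λ)).comp
    (LinearMap.prodMap LinearMap.id (P.reflection i : Λ →ₗ[ℤ] Λ)))

/-- `π` is the action of `H_deg` on `S^*_{ℤ[ε]}(Λ)`: `ε` and `λ` act by multiplication and `θ_i` acts
by `u ↦ ε (u - s_i(u)) / α_i + s_i(u)`. As the symmetric algebra is a domain and `H_deg` is generated
by `ε`, the weights and the `θ_i`, at most one `π` is such. -/
structure IsPolynomialRep (b : P.Base) (π : DegHecke b →ₐ[ℤ] Module.End ℤ (SymEps Λ)) : Prop where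
  eps : ∀ u, π (DegHecke.gen b DegGen.eps) u = SymEps.gamma Λ * u
  wt : ∀ l u, π (DegHecke.gen b (DegGen.wt l)) u = SymEps.wt l * u
  theta : ∀ i ∈ b.support, ∀ u, ∃ v : SymEps Λ, SymEps.wt (P.root i) * v = u - SymEps.refl P i u ∧
    π (DegHecke.gen b (DegGen.theta (simpleRefl P i))) u =
      SymEps.gamma Λ * v + SymEps.refl P i u

/-- The induced action of `R ⊗ H_deg` on `S^*_R(Γ ⊕ Λ) = R ⊗ S^*_ℤ(Γ ⊕ Λ)`. -/
def baseChangeAction (R : Type*) [CommRing R] (b : P.Base)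
    (π : DegHecke b →ₐ[ℤ] Module.End ℤ (SymEps Λ)) :
    R ⊗[ℤ] DegHecke b →ₐ[R] Module.End R (R ⊗[ℤ] SymEps Λ) :=
  Algebra.TensorProduct.lift (Algebra.ofId R (Module.End R (R ⊗[ℤ] SymEps Λ)))
    ((Module.End.baseChangeHom ℤ R (SymEps Λ)).comp π)
    fun r _ => (show Commute _ _ from Algebra.commutes r _)

theorem baseChangeAction_tmul (R : Type*) [CommRing R] (b : P.Base)
    (π : DegHecke b →ₐ[ℤ] Module.End ℤ (SymEps Λ)) (r s : R) (h : DegHecke b) (u : SymEps Λ) :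
    baseChangeAction R b π (r ⊗ₜ h) (s ⊗ₜ u) = (r * s) ⊗ₜ π h u := by
  rw [baseChangeAction, Algebra.TensorProduct.lift_tmul]
  change r • (s ⊗ₜ[ℤ] π h u) = _
  rw [TensorProduct.smul_tmul', smul_eq_mul]

end DegenerateHecke
end FormalHecke

end

open scoped TensorProduct
open FormalHecke

/-!
The proof has two halves: `H_F` has the PBW basis `T_w` over `S`, with the filtration visible in
coefficients, and this forces `Gr H_F` to be `R ⊗ H_deg`.

*Structure of `S`.* The formal group algebra of a free module is a ring of power series in the `x_m`
for `m` in a basis (`coordEquiv`), the powers of the augmentation ideal being the ideals of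
series of given order. Hence `Gr S` is a polynomial ring, that is, a symmetric algebra
(`grSymEquiv`), and `u - s_α(u)` is divisible by `x_α` with a quotient that loses one degree
(`exists_sub_map_eq_mul`). This gives the action of `T_i` on `S` and the commutation relation of `T_i`
with `S`.

*The PBW basis.* For a simple reflection, `T_i` is `c_i + (1 - c_i) δ_i` with `c_α = x_γ / x_α`. The
products of these along two words with the same product in `W` differ, but they are congruent modulo
`x_γ` times the `S`-span of the products `T_w` along chosen reduced words
(`exists_hopWord_ratio_sub`). To see this one first lets the coefficient ring be a domain of
characteristic zero and replaces the weight lattice by the root lattice. Then `x_α`, `x_γ` and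
`x_α - x_γ` are primes that are not associated to each other except in the obvious cases
(`isPrimeFamily_rootVar`), and the span of the `T_w` is described by the residue conditions of
Ginzburg, Kapranov and Vasserot (`residueModule`), as in their construction of Hecke algebras: the
conditions are preserved by left multiplication by `T_i` (`hop_mem_residueModule`), and an element
that satisfies them is a combination of the `T_w`, by induction on the length of the elements in its
support (`mem_span_of_mem_residueModule`). The difference of the products along two words is
divisible by `x_γ`, and the quotient still satisfies the conditions, because `x_γ` is prime to the
denominators and to the `x_α - x_γ`. The general case is the image of this one, because each
commutative formal group law lifts to one over a subring of a field of characteristic zero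
(`exists_formalGroup_lift`); this is Lazard's theorem, proved by obstruction theory from his lemma on
symmetric cocycles (`IsSymmCocycle.exists_eq_smul`). Consequently the `T_w` span `H_F`, and
`H_F ^ j` consists of the combinations with coefficients in `I_F ^ j` (`mem_heckeFiltration_iff`). They
are linearly independent because the coefficient of `T_w` at `w` is the product of the `1 - c_α` over
the inversions of `w` (`hopWord_leading`), which is regular if the `x_α` are
(`pbwMap_injective`).

*The associated graded ring.* In `Gr H_F` the classes of the `T_w` multiply as in `W`, and the
class of `x_m` satisfies the cross relation of `H_deg` (`grT_mul_grX`). So there is a homomorphism from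
`R ⊗ H_deg` to `Gr H_F`. Its source is spanned by products of elements of the symmetric algebra with
the `θ_w` (`mem_closure_symToDeg_mul_theta`), and the images of these form a basis of the target over
the symmetric algebra; so it is an isomorphism (`degBaseLift_bijective`).

*The actions.* An action of `R ⊗ H_deg` on the symmetric algebra in which `ε` and `λ` act by
multiplication and the `θ_i` fix `1` is unique (`IsPolyAction.eq`). The associated graded of the
action of `H_F` on `S` is one. For the additive formal group law over `ℤ` this provides the
polynomial representation of `H_deg` itself, and in general its base change to `R` must agree with the
associated graded action, by uniqueness.
-/

noncomputable section

namespace FormalHecke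

/-! ### Power series of order at least `n` -/

section Order

open MvPowerSeries

variable {A : Type*} [CommRing A] {σ τ : Type*}

/-- The ideal of power series all of whose terms have degree at least `n`. -/
def ordGE (A σ : Type*) [CommRing A] (n : ℕ) : Ideal (MvPowerSeries σ A) where
  carrier := {f | ∀ d : σ →₀ ℕ, d.degree < n → coeff d f = 0}
  add_mem' := by
    intro f g hf hg d hd
    simp [hf d hd, hg d hd]
  zero_mem' := by
    intro d _
    simp
  smul_mem' := by
    classical
    intro f g hg d hd
    rw [smul_eq_mul, coeff_mul]
    refine Finset.sum_eq_zero fun p hp => ?_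
    have hsum : p.1 + p.2 = d := Finset.HasAntidiagonal.mem_antidiagonal.mp hp
    have hdeg : p.1.degree + p.2.degree = d.degree := by rw [← hsum, map_add]
    rw [hg p.2 (by omega), mul_zero]

theorem ordGE_anti {m n : ℕ} (h : m ≤ n) : ordGE A σ n ≤ ordGE A σ m :=
  fun _ hf d hd => hf d (hd.trans_le h)

theorem mem_ordGE_zero (f : MvPowerSeries σ A) : f ∈ ordGE A σ 0 :=
  fun _ hd => absurd hd (Nat.not_lt_zero _)

theorem mem_ordGE_one {f : MvPowerSeries σ A} : f ∈ ordGE A σ 1 ↔ constantCoeff f = 0 := by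
  constructor
  · intro h
    exact h 0 (by simp)
  · intro h d hd
    have : d = 0 := by
      rw [← Finsupp.degree_eq_zero_iff]
      omega
    rw [this]
    exact h

theorem X_mem_ordGE_one (s : σ) : (X s : MvPowerSeries σ A) ∈ ordGE A σ 1 :=
  mem_ordGE_one.mpr (by simp)

theorem mul_mem_ordGE {m n : ℕ} {f g : MvPowerSeries σ A} (hf : f ∈ ordGE A σ m)
    (hg : g ∈ ordGE A σ n) : f * g ∈ ordGE A σ (m + n) := by
  classical
  intro d hd
  rw [coeff_mul]
  refine Finset.sum_eq_zero fun p hp => ?_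
  have hsum : p.1 + p.2 = d := Finset.HasAntidiagonal.mem_antidiagonal.mp hp
  have hdeg : p.1.degree + p.2.degree = d.degree := by rw [← hsum, map_add]
  rcases lt_or_ge p.1.degree m with h | h
  · rw [hf p.1 h, zero_mul]
  · rw [hg p.2 (by omega), mul_zero]

theorem pow_mem_ordGE {m : ℕ} {f : MvPowerSeries σ A} (hf : f ∈ ordGE A σ m) (n : ℕ) :
    f ^ n ∈ ordGE A σ (n * m) := by
  induction n with
  | zero => simpa using mem_ordGE_zero _
  | succ n ih =>
    rw [pow_succ, Nat.succ_mul]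
    exact mul_mem_ordGE ih hf

theorem eq_of_forall_sub_mem_ordGE {f g : MvPowerSeries σ A}
    (h : ∀ n, f - g ∈ ordGE A σ n) : f = g := by
  ext d
  have := h (d.degree + 1) d (Nat.lt_succ_self _)
  rwa [map_sub, sub_eq_zero] at this

theorem prod_pow_mem_ordGE {a : σ → MvPowerSeries τ A} (ha : ∀ s, a s ∈ ordGE A τ 1)
    (d : σ →₀ ℕ) : d.prod (fun s n => a s ^ n) ∈ ordGE A τ d.degree := by
  classical
  induction d using Finsupp.induction_linear with
  | zero => simpa using mem_ordGE_zero _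
  | add d e hd he =>
    rw [Finsupp.prod_add_index' (by simp) (by simp [pow_add]), map_add]
    exact mul_mem_ordGE hd he
  | single s n =>
    rw [Finsupp.prod_single_index (by simp), Finsupp.degree_single]
    simpa using pow_mem_ordGE (ha s) n

/-- Monomials in two families of series that agree up to order `m` agree up to order
`m + d - 1`, where `d` is the degree. -/
theorem prod_pow_sub_mem_ordGE {m : ℕ} {a b : σ → MvPowerSeries τ A}
    (ha : ∀ s, a s ∈ ordGE A τ 1) (hb : ∀ s, b s ∈ ordGE A τ 1)
    (hab : ∀ s, a s - b s ∈ ordGE A τ m) (d : σ →₀ ℕ) :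
    d.prod (fun s n => a s ^ n) - d.prod (fun s n => b s ^ n) ∈
      ordGE A τ (m + d.degree - 1) := by
  classical
  have key : ∀ d e : σ →₀ ℕ,
      d.prod (fun s n => a s ^ n) - d.prod (fun s n => b s ^ n) ∈ ordGE A τ (m + d.degree - 1) →
      e.prod (fun s n => a s ^ n) - e.prod (fun s n => b s ^ n) ∈ ordGE A τ (m + e.degree - 1) →
      (d + e).prod (fun s n => a s ^ n) - (d + e).prod (fun s n => b s ^ n) ∈
        ordGE A τ (m + (d + e).degree - 1) := by
    intro d e hd he
    rw [Finsupp.prod_add_index' (by simp) (by simp [pow_add]),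
      Finsupp.prod_add_index' (by simp) (by simp [pow_add]), map_add]
    have h1 := ordGE_anti (by omega : m + (d.degree + e.degree) - 1 ≤ d.degree + (m + e.degree - 1))
      (mul_mem_ordGE (prod_pow_mem_ordGE ha d) he)
    have h2 := ordGE_anti (by omega : m + (d.degree + e.degree) - 1 ≤ (m + d.degree - 1) + e.degree)
      (mul_mem_ordGE hd (prod_pow_mem_ordGE hb e))
    convert add_mem h1 h2 using 1
    ring
  have single : ∀ (s : σ) (n : ℕ),
      (Finsupp.single s n).prod (fun s n => a s ^ n) - (Finsupp.single s n).prod (fun s n => b s ^ n)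
        ∈ ordGE A τ (m + (Finsupp.single s n).degree - 1) := by
    intro s n
    induction n with
    | zero => simp
    | succ n ih =>
      rw [Finsupp.single_add]
      refine key _ _ ih ?_
      rw [Finsupp.prod_single_index (by simp), Finsupp.prod_single_index (by simp),
        Finsupp.degree_single]
      simpa using hab s
  induction d using Finsupp.induction_linear with
  | zero => simp
  | add d e hd he => exact key d e hd he
  | single s n => exact single s n

theorem hasSubst_of_mem_ordGE [Finite σ] {a : σ → MvPowerSeries τ A}
    (ha : ∀ s, a s ∈ ordGE A τ 1) : HasSubst a :=
  hasSubst_of_constantCoeff_zero fun s => mem_ordGE_one.mp (ha s)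

theorem subst_mem_ordGE [Finite σ] {n : ℕ} {f : MvPowerSeries σ A} (hf : f ∈ ordGE A σ n)
    {a : σ → MvPowerSeries τ A} (ha : ∀ s, a s ∈ ordGE A τ 1) : f.subst a ∈ ordGE A τ n := by
  intro e he
  rw [coeff_subst (hasSubst_of_mem_ordGE ha)]
  refine finsum_eq_zero_of_forall_eq_zero fun d => ?_
  rcases lt_or_ge d.degree n with h | h
  · rw [hf d h, zero_smul]
  · rw [prod_pow_mem_ordGE ha d e (by omega), smul_zero]

theorem subst_sub_subst_mem_ordGE [Finite σ] {k m : ℕ} {f : MvPowerSeries σ A}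
    (hf : f ∈ ordGE A σ k) {a b : σ → MvPowerSeries τ A}
    (ha : ∀ s, a s ∈ ordGE A τ 1) (hb : ∀ s, b s ∈ ordGE A τ 1)
    (hab : ∀ s, a s - b s ∈ ordGE A τ m) : f.subst a - f.subst b ∈ ordGE A τ (m + k - 1) := by
  intro e he
  have hA := hasSubst_of_mem_ordGE ha
  have hB := hasSubst_of_mem_ordGE hb
  rw [map_sub, coeff_subst hA, coeff_subst hB,
    ← finsum_sub_distrib (coeff_subst_finite hA f e) (coeff_subst_finite hB f e)]
  refine finsum_eq_zero_of_forall_eq_zero fun d => ?_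
  rw [← smul_sub, ← map_sub]
  rcases lt_or_ge d.degree k with h | h
  · rw [hf d h, zero_smul]
  · rw [prod_pow_sub_mem_ordGE ha hb hab d e (by omega), smul_zero]

theorem vec_mem_ordGE {n : ℕ} {f g : MvPowerSeries τ A} (hf : f ∈ ordGE A τ n)
    (hg : g ∈ ordGE A τ n) : ∀ s, ![f, g] s ∈ ordGE A τ n := by
  intro s
  fin_cases s
  · exact hf
  · exact hg

theorem hasSubst_vec {f g : MvPowerSeries τ A} (hf : f ∈ ordGE A τ 1)
    (hg : g ∈ ordGE A τ 1) : HasSubst ![f, g] :=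
  hasSubst_of_mem_ordGE (vec_mem_ordGE hf hg)

theorem powerSeries_hasSubst {f : MvPowerSeries τ A} (hf : f ∈ ordGE A τ 1) :
    PowerSeries.HasSubst f := by
  rw [PowerSeries.HasSubst, mem_ordGE_one.mp hf]
  exact IsNilpotent.zero

end Order

/-! ### Formal sums of power series -/

section FormalGroupBasics

open MvPowerSeries

variable {R : Type*} [CommRing R] {σ : Type*} (F : FormalGroup R)

theorem degree_fin_two (d : Fin 2 →₀ ℕ) : d.degree = d 0 + d 1 := by
  rw [Finsupp.degree_eq_sum, Fin.sum_univ_two]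

/-- A formal group law is `X + Y` up to terms of degree two. -/
theorem formalGroup_sub_mem_ordGE :
    F.toPowerSeries - X 0 - X 1 ∈ ordGE R (Fin 2) 2 := by
  classical
  intro d hd
  rw [degree_fin_two] at hd
  obtain h | h | h : d = 0 ∨ d = Finsupp.single 0 1 ∨ d = Finsupp.single 1 1 := by
    have h0 : (d 0 = 0 ∧ d 1 = 0) ∨ (d 0 = 1 ∧ d 1 = 0) ∨ (d 0 = 0 ∧ d 1 = 1) := by omega
    refine h0.imp ?_ (Or.imp ?_ ?_) <;>
    · rintro ⟨h0, h1⟩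
      ext i
      fin_cases i <;> simp [h0, h1]
  · subst h
    simpa using F.zero_constantCoeff
  · subst h
    simp [F.lin_coeff_X, coeff_X, Finsupp.single_left_inj]
  · subst h
    simp [F.lin_coeff_Y, coeff_X, Finsupp.single_left_inj]

theorem formalGroup_mem_ordGE : F.toPowerSeries ∈ ordGE R (Fin 2) 1 :=
  mem_ordGE_one.mpr F.zero_constantCoeff

variable {f g f' g' : MvPowerSeries σ R}

theorem formalAdd_mem (hf : f ∈ ordGE R σ 1) (hg : g ∈ ordGE R σ 1) :
    F.toPowerSeries.subst ![f, g] ∈ ordGE R σ 1 :=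
  subst_mem_ordGE (formalGroup_mem_ordGE F) (vec_mem_ordGE hf hg)

/-- The formal sum is additive up to higher order terms. -/
theorem formalAdd_sub_formalAdd_mem {m : ℕ} (hf : f ∈ ordGE R σ 1) (hg : g ∈ ordGE R σ 1)
    (hf' : f' ∈ ordGE R σ 1) (hg' : g' ∈ ordGE R σ 1) (hff : f - f' ∈ ordGE R σ m)
    (hgg : g - g' ∈ ordGE R σ m) :
    F.toPowerSeries.subst ![f, g] - F.toPowerSeries.subst ![f', g'] - ((f - f') + (g - g')) ∈
      ordGE R σ (m + 1) := by
  have h := subst_sub_subst_mem_ordGE (m := m) (formalGroup_sub_mem_ordGE F)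
    (vec_mem_ordGE hf hg) (vec_mem_ordGE hf' hg') (by
      intro s
      fin_cases s
      · exact hff
      · exact hgg)
  have e : ∀ a b : MvPowerSeries σ R, a ∈ ordGE R σ 1 → b ∈ ordGE R σ 1 →
      (F.toPowerSeries - X 0 - X 1).subst ![a, b] = F.toPowerSeries.subst ![a, b] - a - b := by
    intro a b ha hb
    have hs := hasSubst_vec ha hb
    rw [subst_sub hs, subst_sub hs, subst_X hs, subst_X hs]
    rfl
  rw [e f g hf hg, e f' g' hf' hg', show m + 2 - 1 = m + 1 by omega] at h
  convert h using 1
  abel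

theorem formalAdd_sub_mem (hf : f ∈ ordGE R σ 1) (hg : g ∈ ordGE R σ 1) :
    F.toPowerSeries.subst ![f, g] - (f + g) ∈ ordGE R σ 2 := by
  have h := formalAdd_sub_formalAdd_mem F (m := 1) hf hg (Ideal.zero_mem _) (Ideal.zero_mem _)
    (by simpa using hf) (by simpa using hg)
  rwa [F.add_zero PowerSeries.HasSubst.zero, sub_zero, sub_zero, sub_zero] at h

end FormalGroupBasics

/-! ### Symmetric additive cocycles -/

section Cocycle

/-- The symmetric two-cocycles of the additive formal group in degree `N` with coefficients in `M`,
in terms of the coefficients `a i` of `x ^ i * y ^ (N - i)`, for `0 < i < N`. -/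
structure IsSymmCocycle {M : Type*} [AddCommGroup M] (N : ℕ) (a : ℕ → M) : Prop where
  symm : ∀ i j, 0 < i → 0 < j → i + j = N → a i = a j
  cocycle : ∀ i j k, 0 < i → 0 < j → 0 < k → i + j + k = N →
    (i + j).choose i • a (i + j) = (j + k).choose j • a i

theorem IsSymmCocycle.map {M M' : Type*} [AddCommGroup M] [AddCommGroup M'] {N : ℕ} {a : ℕ → M}
    (h : IsSymmCocycle N a) (f : M →+ M') : IsSymmCocycle N (fun i => f (a i)) where
  symm i j hi hj hij := by rw [h.symm i j hi hj hij]
  cocycle i j k hi hj hk hijk := by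
    rw [← map_nsmul, ← map_nsmul, h.cocycle i j k hi hj hk hijk]

/-- The greatest common divisor of the binomial coefficients `N.choose i`, `0 < i < N`. -/
def chooseGcd (N : ℕ) : ℕ := (Finset.Ioo 0 N).gcd fun i => N.choose i

theorem chooseGcd_dvd {N i : ℕ} (h0 : 0 < i) (hN : i < N) : chooseGcd N ∣ N.choose i :=
  Finset.gcd_dvd (Finset.mem_Ioo.mpr ⟨h0, hN⟩)

theorem chooseGcd_pos {N : ℕ} (hN : 2 ≤ N) : 0 < chooseGcd N :=
  Nat.pos_of_dvd_of_pos (chooseGcd_dvd (i := 1) one_pos (by omega)) (Nat.choose_pos (by omega))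

/-- The coefficients of the basic cocycle `((x + y) ^ N - x ^ N - y ^ N) / chooseGcd N`. -/
def basicCocycle (N i : ℕ) : ℕ := N.choose i / chooseGcd N

theorem chooseGcd_mul_basicCocycle {N i : ℕ} (h0 : 0 < i) (hN : i < N) :
    chooseGcd N * basicCocycle N i = N.choose i :=
  Nat.mul_div_cancel' (chooseGcd_dvd h0 hN)

theorem isSymmCocycle_basicCocycle {N : ℕ} (hN : 2 ≤ N) :
    IsSymmCocycle N (fun i => (basicCocycle N i : ℤ)) where
  symm i j hi hj hij := by
    have : N.choose i = N.choose j := by rw [← hij]; exact Nat.choose_symm_add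
    simp [basicCocycle, this]
  cocycle i j k hi hj hk hijk := by
    have hpos := chooseGcd_pos hN
    rw [nsmul_eq_mul, nsmul_eq_mul]
    norm_cast
    refine Nat.eq_of_mul_eq_mul_left hpos ?_
    rw [mul_left_comm, chooseGcd_mul_basicCocycle (by omega) (by omega), mul_left_comm,
      chooseGcd_mul_basicCocycle (by omega) (by omega)]
    have h1 := Nat.choose_mul (n := N) (k := i + j) (s := i) (by omega)
    rw [show N - i = j + k by omega, show i + j - i = j by omega] at h1
    rw [mul_comm, h1, mul_comm]

/-- A cocycle modulo `p` in degree `N`, where `p` divides `N` and `p < N`, has no linear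
coefficient. -/
theorem IsSymmCocycle.apply_one_eq_zero {p N : ℕ} [Fact p.Prime] {a : ℕ → ZMod p}
    (ha : IsSymmCocycle N a) (hpN : p ∣ N) (hlt : p < N) : a 1 = 0 := by
  have hp : p.Prime := Fact.out
  have h2 := hp.two_le
  have h := ha.cocycle 1 (p - 1) (N - p) one_pos (by omega) (by omega) (by omega)
  rw [show 1 + (p - 1) = p by omega, Nat.choose_one_right, nsmul_eq_mul, CharP.cast_eq_zero,
    zero_mul, nsmul_eq_mul] at h
  refine (mul_eq_zero.mp h.symm).resolve_left fun h0 => ?_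
  rw [show p - 1 + (N - p) = N - 1 by omega, CharP.cast_eq_zero_iff (ZMod p) p] at h0
  obtain ⟨m, rfl⟩ := hpN
  have hm : 1 ≤ m := by
    rcases m with _ | m
    · omega
    · omega
  -- `p * m - 1 = p * (m - 1) + (p - 1)`, so the binomial coefficient is `1` modulo `p`
  have h3 := Choose.choose_modEq_choose_mod_mul_choose_div_nat (n := p * m - 1) (k := p - 1) (p := p)
  have e1 : p * m - 1 = (p - 1) + p * (m - 1) := by
    obtain ⟨m, rfl⟩ : ∃ m', m = m' + 1 := ⟨m - 1, by omega⟩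
    simp [Nat.mul_succ]
    omega
  rw [e1, Nat.add_mul_mod_self_left, Nat.mod_eq_of_lt (by omega : p - 1 < p), Nat.choose_self,
    Nat.div_eq_of_lt (by omega : p - 1 < p), Nat.choose_zero_right, ← e1] at h3
  have h4 := h3.symm.dvd_iff (dvd_refl p) |>.mpr h0
  simp at h4
  omega

/-- Modulo a prime a symmetric cocycle is determined by one of its coefficients. -/
theorem exists_index_determining_cocycle (p : ℕ) [Fact p.Prime] (N : ℕ) (hN : 2 ≤ N) :
    ∃ i₀, 0 < i₀ ∧ i₀ < N ∧ ∀ a : ℕ → ZMod p, IsSymmCocycle N a → a i₀ = 0 →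
      ∀ i, 0 < i → i < N → a i = 0 := by
  have hp : p.Prime := Fact.out
  -- the coefficients with index prime to `p` are determined by the linear one
  have unit : ∀ N (a : ℕ → ZMod p), IsSymmCocycle N a → a 1 = 0 → ∀ i, 0 < i → i < N → ¬ p ∣ i →
      a i = 0 := by
    intro N a ha h1 i hi hiN hpi
    rcases Nat.lt_or_ge 1 i with hi1 | hi1
    · have h := ha.cocycle 1 (i - 1) (N - i) one_pos (by omega) (by omega) (by omega)
      rw [h1, smul_zero, show 1 + (i - 1) = i by omega, Nat.choose_one_right, nsmul_eq_mul] at h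
      refine (mul_eq_zero.mp h).resolve_left fun h0 => hpi ?_
      rwa [CharP.cast_eq_zero_iff (ZMod p) p] at h0
    · rwa [show i = 1 by omega]
  induction N using Nat.strong_induction_on with
  | _ N ih =>
    by_cases hpN : p ∣ N
    · rcases (Nat.le_of_dvd (by omega) hpN).eq_or_lt with rfl | hlt
      · refine ⟨1, one_pos, by omega, fun a ha h1 i hi hiN => unit p a ha h1 i hi hiN fun h => ?_⟩
        exact absurd (Nat.le_of_dvd hi h) (by omega)
      · obtain ⟨m, rfl⟩ := hpN
        have hm : 2 ≤ m := by
          by_contra h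
          have : m ≤ 1 := by omega
          have := Nat.mul_le_mul_left p this
          omega
        obtain ⟨i₀, h0, hm0, H⟩ := ih m (by nlinarith [hp.two_le]) hm
        refine ⟨p * i₀, Nat.mul_pos hp.pos h0, Nat.mul_lt_mul_of_pos_left hm0 hp.pos,
          fun a ha hz i hi hiN => ?_⟩
        have hlin := ha.apply_one_eq_zero (Dvd.intro _ rfl) hlt
        by_cases hpi : p ∣ i
        · obtain ⟨j, rfl⟩ := hpi
          refine H (fun j => a (p * j)) ⟨?_, ?_⟩ hz j (Nat.pos_of_mul_pos_left hi)
            (Nat.lt_of_mul_lt_mul_left hiN)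
          · intro i j hi hj hij
            exact ha.symm _ _ (Nat.mul_pos hp.pos hi) (Nat.mul_pos hp.pos hj)
              (by rw [← mul_add, hij])
          · intro i j k hi hj hk hijk
            have h := ha.cocycle _ _ _ (Nat.mul_pos hp.pos hi) (Nat.mul_pos hp.pos hj)
              (Nat.mul_pos hp.pos hk) (by rw [← mul_add, ← mul_add, hijk])
            -- Lucas: binomial coefficients do not change modulo `p` when multiplied by `p`
            have lucas : ∀ r s : ℕ, (((p * r).choose (p * s) : ℕ) : ZMod p) = (r.choose s : ℕ) := by
              intro r s
              have := Choose.choose_modEq_choose_mod_mul_choose_div_nat (n := p * r) (k := p * s)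
                (p := p)
              rw [Nat.mul_mod_right, Nat.mul_mod_right, Nat.choose_self, one_mul,
                Nat.mul_div_cancel_left _ hp.pos, Nat.mul_div_cancel_left _ hp.pos] at this
              exact (ZMod.natCast_eq_natCast_iff _ _ _).mpr this
            rw [← mul_add, ← mul_add, nsmul_eq_mul, nsmul_eq_mul, lucas, lucas] at h
            rw [nsmul_eq_mul, nsmul_eq_mul]
            exact h
        · exact unit _ a ha hlin i hi hiN hpi
    · refine ⟨1, one_pos, by omega, fun a ha h1 i hi hiN => ?_⟩
      by_cases hpi : p ∣ i
      · rw [ha.symm i (N - i) hi (by omega) (by omega)]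
        refine unit N a ha h1 _ (by omega) (by omega) fun h => hpN ?_
        have := dvd_add hpi h
        rwa [show i + (N - i) = N by omega] at this
      · exact unit N a ha h1 i hi hiN hpi

/-- A finitely generated abelian group without nonzero homomorphisms to groups of prime order is
trivial. -/
theorem subsingleton_of_forall_hom_zmod_eq_zero (K : Type*) [AddCommGroup K] [Module.Finite ℤ K]
    (h : ∀ p : ℕ, p.Prime → ∀ f : K →+ ZMod p, f = 0) : Subsingleton K := by
  by_contra hK
  rw [not_subsingleton_iff_nontrivial] at hK
  obtain ⟨U, hU⟩ : ∃ U : Submodule ℤ K, IsCoatom U := by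
    obtain h | ⟨U, hU, -⟩ := eq_top_or_exists_le_coatom (⊥ : Submodule ℤ K)
    · exact absurd h bot_ne_top
    · exact ⟨U, hU⟩
  have hs : IsSimpleModule ℤ (K ⧸ U) := isSimpleModule_iff_isCoatom.mpr hU
  obtain ⟨I, hI, ⟨e⟩⟩ := isSimpleModule_iff_quot_maximal.mp hs
  obtain ⟨n, rfl⟩ : ∃ n : ℤ, I = Ideal.span {n} :=
    ⟨Submodule.IsPrincipal.generator I, (Ideal.span_singleton_generator I).symm⟩
  have hn0 : n ≠ 0 := by
    rintro rfl
    rw [Ideal.span_singleton_zero] at hI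
    exact Int.not_isField (Ring.isField_iff_maximal_bot.mpr hI)
  have hprime : Prime n := (Ideal.span_singleton_prime hn0).mp hI.isPrime
  let p := n.natAbs
  have hp : p.Prime := Int.prime_iff_natAbs_prime.mp hprime
  have hspan : Ideal.span {(n : ℤ)} = Ideal.span {(p : ℤ)} := (Int.span_natAbs n).symm
  let f : K →+ ZMod p :=
    ((Int.quotientSpanNatEquivZMod p : ℤ ⧸ Ideal.span {(p : ℤ)} ≃+* ZMod p) :
      ℤ ⧸ Ideal.span {(p : ℤ)} →+ ZMod p).comp
    (((Ideal.quotEquivOfEq hspan : ℤ ⧸ Ideal.span {(n : ℤ)} ≃+* _) :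
      ℤ ⧸ Ideal.span {(n : ℤ)} →+ ℤ ⧸ Ideal.span {(p : ℤ)}).comp
        ((e : (K ⧸ U) →+ _).comp (U.mkQ : K →+ K ⧸ U)))
  have hf := h p hp f
  obtain ⟨k, hk⟩ : ∃ k, k ∉ U := by
    by_contra! hk
    exact hU.1 (eq_top_iff.mpr fun k _ => hk k)
  have := DFunLike.congr_fun hf k
  simp only [f, AddMonoidHom.comp_apply, AddMonoidHom.zero_apply, AddMonoidHom.coe_coe] at this
  rw [EmbeddingLike.map_eq_zero_iff, EmbeddingLike.map_eq_zero_iff,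
    EmbeddingLike.map_eq_zero_iff] at this
  exact hk ((Submodule.Quotient.mk_eq_zero U).mp this)

/-- The relations between the coefficients of a symmetric cocycle of degree `N`. The generator with
index zero is superfluous and set to zero. -/
def cocycleRelations (N : ℕ) : Submodule ℤ (Fin N →₀ ℤ) :=
  Submodule.span ℤ
    ({r | ∃ i : Fin N, (i : ℕ) = 0 ∧ r = Finsupp.single i 1} ∪
      ({r | ∃ i j : Fin N, 0 < (i : ℕ) ∧ 0 < (j : ℕ) ∧ (i : ℕ) + j = N ∧
        r = Finsupp.single i 1 - Finsupp.single j 1} ∪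
      {r | ∃ (i m : Fin N) (j k : ℕ), 0 < (i : ℕ) ∧ 0 < j ∧ 0 < k ∧ (m : ℕ) = i + j ∧
        (i : ℕ) + j + k = N ∧
        r = ((i + j).choose i : ℕ) • Finsupp.single m 1 -
          ((j + k).choose j : ℕ) • Finsupp.single i 1}))

theorem IsSymmCocycle.exists_hom {M : Type*} [AddCommGroup M] {N : ℕ} {a : ℕ → M}
    (ha : IsSymmCocycle N a) : ∃ f : (Fin N →₀ ℤ) ⧸ cocycleRelations N →ₗ[ℤ] M,
      ∀ i : Fin N, 0 < (i : ℕ) → f (Submodule.Quotient.mk (Finsupp.single i 1)) = a i := by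
  let g : (Fin N →₀ ℤ) →ₗ[ℤ] M :=
    Finsupp.linearCombination ℤ fun i : Fin N => if (i : ℕ) = 0 then 0 else a i
  have hg : cocycleRelations N ≤ LinearMap.ker g := by
    refine Submodule.span_le.mpr ?_
    rintro r (⟨i, hi, rfl⟩ | ⟨i, j, hi, hj, hij, rfl⟩ | ⟨i, m, j, k, hi, hj, hk, hm, hijk, rfl⟩)
    · simp [g, hi]
    · simp [g, hi.ne', hj.ne', ha.symm i j hi hj hij]
    · have := ha.cocycle i j k hi hj hk hijk
      simp only [g, SetLike.mem_coe, LinearMap.mem_ker, map_sub, map_nsmul,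
        Finsupp.linearCombination_single, one_smul, hm]
      rw [if_neg (by omega), if_neg (by omega), this, sub_self]
  exact ⟨(cocycleRelations N).liftQ g hg, fun i hi => by
    rw [Submodule.liftQ_apply]
    simp [g, hi.ne']⟩

/-- Lazard's lemma: a symmetric cocycle is a multiple of the basic one. The universal group `U` of
coefficients of cocycles maps onto `ℤ` through the basic cocycle; the kernel vanishes as it
has no homomorphisms to groups of prime order. -/
theorem IsSymmCocycle.exists_eq_smul {M : Type*} [AddCommGroup M] {N : ℕ} (hN : 2 ≤ N) {a : ℕ → M}
    (ha : IsSymmCocycle N a) : ∃ m : M, ∀ i, 0 < i → i < N → a i = basicCocycle N i • m := by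
  let U := (Fin N →₀ ℤ) ⧸ cocycleRelations N
  let u : Fin N → U := fun i => Submodule.Quotient.mk (Finsupp.single i 1)
  have u_zero : ∀ i : Fin N, (i : ℕ) = 0 → u i = 0 := fun i hi =>
    (Submodule.Quotient.mk_eq_zero _).mpr (Submodule.subset_span (Or.inl ⟨i, hi, rfl⟩))
  have ext_zero : ∀ (V : Submodule ℤ U), (∀ i : Fin N, 0 < (i : ℕ) → u i ∈ V) → ∀ x, x ∈ V := by
    intro V hV x
    obtain ⟨x, rfl⟩ := Submodule.Quotient.mk_surjective _ x
    induction x using Finsupp.induction_linear with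
    | zero => exact V.zero_mem
    | add x y hx hy => exact V.add_mem hx hy
    | single i n =>
      have : (Submodule.Quotient.mk (Finsupp.single i n) : U) = n • u i := by
        rw [← Submodule.Quotient.mk_smul, Finsupp.smul_single_one]
      rw [this]
      refine V.smul_mem n ?_
      rcases Nat.eq_zero_or_pos (i : ℕ) with h | h
      · rw [u_zero i h]
        exact V.zero_mem
      · exact hV i h
  obtain ⟨χ, hχ⟩ := (isSymmCocycle_basicCocycle hN).exists_hom
  change ∀ i : Fin N, 0 < (i : ℕ) → χ (u i) = _ at hχ
  have hu : IsSymmCocycle N (fun i => if h : i < N then u ⟨i, h⟩ else 0) := by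
    refine ⟨?_, ?_⟩
    · intro i j hi hj hij
      rw [dif_pos (by omega), dif_pos (by omega)]
      exact (Submodule.Quotient.eq _).mpr (Submodule.subset_span
        (Or.inr (Or.inl ⟨⟨i, by omega⟩, ⟨j, by omega⟩, hi, hj, hij, rfl⟩)))
    · intro i j k hi hj hk hijk
      rw [dif_pos (by omega), dif_pos (by omega)]
      exact (Submodule.Quotient.eq _).mpr (Submodule.subset_span
        (Or.inr (Or.inr ⟨⟨i, by omega⟩, ⟨i + j, by omega⟩, j, k, hi, hj, hk, rfl, hijk, rfl⟩)))
  have hom_cocycle : ∀ {B : Type} [AddCommGroup B] (f : U →+ B),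
      IsSymmCocycle N (fun i => if h : i < N then f (u ⟨i, h⟩) else 0) := by
    intro B _ f
    convert hu.map f using 2
    split <;> simp
  -- a lift of the generator of `ℤ`
  obtain ⟨u₀, hu₀⟩ : ∃ u₀, χ u₀ = 1 := by
    obtain ⟨d, hd⟩ : ∃ d : ℤ, LinearMap.range χ = Ideal.span {d} :=
      ⟨Submodule.IsPrincipal.generator (LinearMap.range χ),
        (Ideal.span_singleton_generator (LinearMap.range χ : Ideal ℤ)).symm⟩
    have hdvd : ∀ i : ℕ, 0 < i → i < N → (d * chooseGcd N).natAbs ∣ N.choose i := by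
      intro i hi hiN
      have h1 : χ (u ⟨i, hiN⟩) ∈ (Ideal.span {d} : Ideal ℤ) := hd ▸ LinearMap.mem_range_self χ _
      rw [hχ _ hi, Ideal.mem_span_singleton] at h1
      have h2 := mul_dvd_mul_right h1 (chooseGcd N : ℤ)
      rw [← Int.natAbs_dvd_natAbs] at h2
      refine h2.trans (dvd_of_eq ?_)
      rw [← Int.natCast_mul, Int.natAbs_natCast, mul_comm]
      exact chooseGcd_mul_basicCocycle hi hiN
    have h3 : (d * chooseGcd N).natAbs ∣ chooseGcd N :=
      Finset.dvd_gcd fun i hi => by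
        rw [Finset.mem_Ioo] at hi
        exact hdvd i hi.1 hi.2
    rw [Int.natAbs_mul, Int.natAbs_natCast] at h3
    have h4 : d.natAbs ∣ 1 :=
      Nat.dvd_of_mul_dvd_mul_right (chooseGcd_pos hN) (by rwa [one_mul])
    have h5 : (1 : ℤ) ∈ (Ideal.span {d} : Ideal ℤ) := by
      rw [Ideal.mem_span_singleton]
      exact Int.natAbs_dvd_natAbs.mp (by simpa using h4)
    rw [← hd] at h5
    exact h5
  let K : Submodule ℤ U := LinearMap.ker χ
  let π : U →ₗ[ℤ] K := LinearMap.codRestrict K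
    (LinearMap.id - (LinearMap.toSpanSingleton ℤ U u₀).comp χ) (by
      intro x
      simp [K, hu₀])
  have hπ : ∀ x, ((π x : K) : U) = x - χ x • u₀ := fun x => rfl
  have hπK : ∀ k : K, π k = k := by
    rintro ⟨k, hk⟩
    have : χ k = 0 := hk
    exact Subtype.ext (by simp [hπ, this])
  have hπ₀ : π u₀ = 0 := Subtype.ext (by simp [hπ, hu₀])
  have : Module.Finite ℤ K := Module.Finite.of_surjective π fun k => ⟨k, hπK k⟩
  have hK : Subsingleton K := by
    refine subsingleton_of_forall_hom_zmod_eq_zero K fun p hp f => ?_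
    have : Fact p.Prime := ⟨hp⟩
    obtain ⟨i₀, h0, h0N, H⟩ := exists_index_determining_cocycle p N hN
    have key : ∀ g : U →+ ZMod p, g (u ⟨i₀, h0N⟩) = 0 → g = 0 := by
      intro g hg
      ext x
      refine ext_zero (LinearMap.ker g.toIntLinearMap) (fun i hi => ?_) x
      have := H _ (hom_cocycle g) (by simpa [h0N] using hg) i hi i.2
      rw [dif_pos i.2] at this
      exact this
    let f' : U →+ ZMod p := f.comp (π : U →+ K)
    let χ' : U →+ ZMod p := (Int.castAddHom (ZMod p)).comp (χ : U →+ ℤ)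
    have hf'0 : f' u₀ = 0 := by
      change f (π u₀) = 0
      rw [hπ₀, map_zero]
    have hχ'0 : χ' u₀ = 1 := by
      change ((χ u₀ : ℤ) : ZMod p) = 1
      rw [hu₀, Int.cast_one]
    let c := χ' (u ⟨i₀, h0N⟩)
    have hc : c ≠ 0 := by
      intro hc
      have := DFunLike.congr_fun (key χ' hc) u₀
      rw [hχ'0] at this
      exact one_ne_zero this
    -- `f'` is proportional to `χ'` and vanishes at `u₀`, so it is zero
    let d := f' (u ⟨i₀, h0N⟩)
    have hprop := key ((AddMonoidHom.mulLeft c).comp f' - (AddMonoidHom.mulLeft d).comp χ')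
      (by
        change c * d - d * c = 0
        ring)
    have hd : d = 0 := by
      have h := DFunLike.congr_fun hprop u₀
      change c * f' u₀ - d * χ' u₀ = 0 at h
      rw [hf'0, hχ'0] at h
      simpa using h
    have hf' := key f' hd
    ext k
    have h := DFunLike.congr_fun hf' (k : U)
    change f (π k) = 0 at h
    rw [hπK] at h
    simpa using h
  obtain ⟨φ, hφ⟩ := ha.exists_hom
  change ∀ i : Fin N, 0 < (i : ℕ) → φ (u i) = _ at hφ
  refine ⟨φ u₀, fun i hi hiN => ?_⟩
  have h := congrArg (Subtype.val) (hK.elim (π (u ⟨i, hiN⟩)) 0)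
  rw [hπ, hχ _ hi, ZeroMemClass.coe_zero, sub_eq_zero] at h
  have h2 := hφ ⟨i, hiN⟩ hi
  rw [h, map_smul, natCast_zsmul] at h2
  exact h2.symm

end Cocycle

/-! ### Lifting formal group laws to torsion-free rings -/

section Conjugate

open MvPowerSeries

variable {K : Type*} [CommRing K] {σ : Type*}

theorem powerSeries_subst_mem {u : PowerSeries K} (hu : u.constantCoeff = 0)
    {a : MvPowerSeries σ K} (ha : a ∈ ordGE K σ 1) : u.subst a ∈ ordGE K σ 1 :=
  subst_mem_ordGE (f := u) (mem_ordGE_one.mpr hu) fun _ => ha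

theorem powerSeries_subst_sub_mem {u : PowerSeries K} (hu : u.constantCoeff = 0)
    (hu1 : u.coeff 1 = 1) {a : MvPowerSeries σ K} (ha : a ∈ ordGE K σ 1) :
    u.subst a - a ∈ ordGE K σ 2 := by
  have h : u - PowerSeries.X ∈ ordGE K Unit 2 := by
    intro d hd
    obtain ⟨n, rfl⟩ : ∃ n, d = Finsupp.single () n := ⟨d (), by ext; simp⟩
    rw [Finsupp.degree_single] at hd
    change PowerSeries.coeff n (u - PowerSeries.X) = 0
    interval_cases n
    · simpa using hu
    · simp [hu1]
  have := subst_mem_ordGE h (a := fun _ => a) fun _ => ha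
  rw [subst_sub (powerSeries_hasSubst ha).const] at this
  have hX := PowerSeries.subst_X (R := K) (powerSeries_hasSubst ha)
  rw [PowerSeries.subst] at hX
  rwa [hX] at this

variable (G : FormalGroup K) (u : PowerSeries K) (hu0 : u.constantCoeff = 0) (hu1 : u.coeff 1 = 1)

theorem substInv_subst (hu0 : u.constantCoeff = 0) [Invertible (u.coeff 1)]
    {a : MvPowerSeries σ K} (ha : a ∈ ordGE K σ 1) : u.substInv.subst (u.subst a) = a := by
  rw [← PowerSeries.subst_comp_subst_apply (PowerSeries.HasSubst.of_constantCoeff_zero' hu0)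
    (powerSeries_hasSubst ha), PowerSeries.subst_substInv_left u hu0,
    PowerSeries.subst_X (powerSeries_hasSubst ha)]

theorem subst_substInv (hu0 : u.constantCoeff = 0) [Invertible (u.coeff 1)]
    {a : MvPowerSeries σ K} (ha : a ∈ ordGE K σ 1) : u.subst (u.substInv.subst a) = a := by
  rw [← PowerSeries.subst_comp_subst_apply (PowerSeries.HasSubst.substInv u)
    (powerSeries_hasSubst ha), PowerSeries.subst_substInv_right u hu0,
    PowerSeries.subst_X (powerSeries_hasSubst ha)]

/-- The series `u⁻¹(G(u(x), u(y)))`, for the inverse of `u` with respect to composition. -/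
def conjugateSeries [Invertible (u.coeff 1)] : MvPowerSeries (Fin 2) K :=
  u.substInv.subst (G.toPowerSeries.subst
    ![u.subst (X 0 : MvPowerSeries (Fin 2) K), u.subst (X 1 : MvPowerSeries (Fin 2) K)])

variable [Invertible (u.coeff 1)]

include hu0 in
theorem conjugateSeries_mem : conjugateSeries G u ∈ ordGE K (Fin 2) 1 :=
  powerSeries_subst_mem (PowerSeries.constantCoeff_substInv u)
    (formalAdd_mem G (powerSeries_subst_mem hu0 (X_mem_ordGE_one 0))
      (powerSeries_subst_mem hu0 (X_mem_ordGE_one 1)))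

include hu0 in
theorem subst_conjugateSeries {a b : MvPowerSeries σ K} (ha : a ∈ ordGE K σ 1)
    (hb : b ∈ ordGE K σ 1) : u.subst ((conjugateSeries G u).subst ![a, b]) =
      G.toPowerSeries.subst ![u.subst a, u.subst b] := by
  have h : u.subst (conjugateSeries G u) = G.toPowerSeries.subst
      ![u.subst (X 0 : MvPowerSeries (Fin 2) K), u.subst (X 1 : MvPowerSeries (Fin 2) K)] :=
    subst_substInv u hu0 (formalAdd_mem G (powerSeries_subst_mem hu0 (X_mem_ordGE_one 0))
      (powerSeries_subst_mem hu0 (X_mem_ordGE_one 1)))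
  have hs := hasSubst_vec ha hb
  have h2 := congrArg (MvPowerSeries.subst ![a, b]) h
  rw [PowerSeries.subst, subst_comp_subst_apply
    (powerSeries_hasSubst (conjugateSeries_mem G u hu0)).const hs, subst_comp_subst_apply
    (hasSubst_vec (powerSeries_subst_mem hu0 (X_mem_ordGE_one 0))
      (powerSeries_subst_mem hu0 (X_mem_ordGE_one 1))) hs] at h2
  refine h2.trans ?_
  congr 1
  have key : ∀ i : Fin 2, subst ![a, b] (u.subst (X i : MvPowerSeries (Fin 2) K)) =
      u.subst (![a, b] i) := by
    intro i
    rw [PowerSeries.subst, subst_comp_subst_apply (powerSeries_hasSubst (X_mem_ordGE_one i)).const hs]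
    congr 1
    funext _
    exact subst_X hs i
  funext i
  fin_cases i
  · exact key 0
  · exact key 1

include hu0 in
theorem powerSeries_subst_injOn {a b : MvPowerSeries σ K} (ha : a ∈ ordGE K σ 1)
    (hb : b ∈ ordGE K σ 1) (h : u.subst a = u.subst b) : a = b := by
  rw [← substInv_subst u hu0 ha, h, substInv_subst u hu0 hb]

theorem self_subst_X (f : MvPowerSeries (Fin 2) K) :
    f.subst ![(X 0 : MvPowerSeries (Fin 2) K), X 1] = f := by
  have : ![(X 0 : MvPowerSeries (Fin 2) K), X 1] = X := by
    funext i
    fin_cases i <;> rfl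
  rw [this, subst_self]
  rfl

include hu0 hu1 in
theorem conjugateSeries_sub_mem :
    conjugateSeries G u - X 0 - X 1 ∈ ordGE K (Fin 2) 2 := by
  have hx := X_mem_ordGE_one (A := K) (0 : Fin 2)
  have hy := X_mem_ordGE_one (A := K) (1 : Fin 2)
  have h1 := powerSeries_subst_sub_mem hu0 hu1 (conjugateSeries_mem G u hu0)
  have h2 := subst_conjugateSeries G u hu0 hx hy
  rw [self_subst_X] at h2
  have h3 := formalAdd_sub_mem G (powerSeries_subst_mem hu0 hx) (powerSeries_subst_mem hu0 hy)
  have h4 := powerSeries_subst_sub_mem hu0 hu1 hx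
  have h5 := powerSeries_subst_sub_mem hu0 hu1 hy
  rw [h2] at h1
  convert add_mem (sub_mem h3 h1) (add_mem h4 h5) using 1
  abel

/-- The formal group law obtained from `G` by the change of variable `u`. -/
def conjugateGroup : FormalGroup K where
  toPowerSeries := conjugateSeries G u
  zero_constantCoeff := mem_ordGE_one.mp (conjugateSeries_mem G u hu0)
  lin_coeff_X := by
    have h := conjugateSeries_sub_mem G u hu0 hu1 (Finsupp.single 0 1) (by simp)
    simpa [coeff_X, Finsupp.single_left_inj, sub_eq_zero] using h
  lin_coeff_Y := by
    have h := conjugateSeries_sub_mem G u hu0 hu1 (Finsupp.single 1 1) (by simp)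
    simpa [coeff_X, Finsupp.single_left_inj, sub_eq_zero] using h
  assoc := by
    have hX := X_mem_ordGE_one (A := K) (σ := Fin 3)
    have hm : ∀ {a b : MvPowerSeries (Fin 3) K}, a ∈ ordGE K _ 1 → b ∈ ordGE K _ 1 →
        (conjugateSeries G u).subst ![a, b] ∈ ordGE K _ 1 := fun ha hb =>
      subst_mem_ordGE (conjugateSeries_mem G u hu0) (vec_mem_ordGE ha hb)
    have hS := fun i => powerSeries_hasSubst (powerSeries_subst_mem hu0 (hX i))
    refine powerSeries_subst_injOn u hu0 (hm (hm (hX 0) (hX 1)) (hX 2))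
      (hm (hX 0) (hm (hX 1) (hX 2))) ?_
    rw [subst_conjugateSeries G u hu0 (hm (hX 0) (hX 1)) (hX 2),
      subst_conjugateSeries G u hu0 (hX 0) (hX 1),
      subst_conjugateSeries G u hu0 (hX 0) (hm (hX 1) (hX 2)),
      subst_conjugateSeries G u hu0 (hX 1) (hX 2), G.assoc' (hS 0) (hS 1) (hS 2)]

theorem conjugateGroup_isComm [G.IsComm] : (conjugateGroup G u hu0 hu1).IsComm where
  comm := by
    have hx := X_mem_ordGE_one (A := K) (0 : Fin 2)
    have hy := X_mem_ordGE_one (A := K) (1 : Fin 2)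
    have hc := conjugateSeries_mem G u hu0
    change conjugateSeries G u = (conjugateSeries G u).subst ![X 1, X 0]
    refine powerSeries_subst_injOn u hu0 hc (subst_mem_ordGE hc (vec_mem_ordGE hy hx)) ?_
    rw [subst_conjugateSeries G u hu0 hy hx, G.comm' (powerSeries_hasSubst
      (powerSeries_subst_mem hu0 hy)) (powerSeries_hasSubst (powerSeries_subst_mem hu0 hx)),
      ← subst_conjugateSeries G u hu0 hx hy, self_subst_X]

end Conjugate

section Step

open MvPowerSeries

variable {K : Type*} [CommRing K]

/-- A change of variable `T + b * T ^ N` alters a formal group law by a coboundary in degree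
`N`. -/
theorem exists_formalGroup_sub_coboundary (G : FormalGroup K) [G.IsComm] (b : K) {N : ℕ}
    (hN : 2 ≤ N) : ∃ G' : FormalGroup K, G'.IsComm ∧
      G'.toPowerSeries - G.toPowerSeries -
        C b * (X 0 ^ N + X 1 ^ N - (X 0 + X 1) ^ N) ∈ ordGE K (Fin 2) (N + 1) := by
  let u : PowerSeries K := PowerSeries.X + PowerSeries.C b * PowerSeries.X ^ N
  have hu0 : u.constantCoeff = 0 := by
    simp [u, show N ≠ 0 by omega]
  have hu1 : u.coeff 1 = 1 := by
    simp [u, PowerSeries.coeff_X_pow, show (1 : ℕ) ≠ N by omega]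
  let : Invertible (u.coeff 1) := hu1 ▸ invertibleOne
  have hsub : ∀ a : MvPowerSeries (Fin 2) K, a ∈ ordGE K (Fin 2) 1 →
      u.subst a = a + C b * a ^ N := by
    intro a ha
    have hs := powerSeries_hasSubst ha
    simp only [u]
    rw [PowerSeries.subst_add hs, PowerSeries.subst_mul hs, PowerSeries.subst_pow hs,
      PowerSeries.subst_X hs]
    congr 2
    rw [← PowerSeries.coe_substAlgHom hs]
    exact (PowerSeries.substAlgHom hs).commutes b
  have hx := X_mem_ordGE_one (A := K) (0 : Fin 2)
  have hy := X_mem_ordGE_one (A := K) (1 : Fin 2)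
  have hc := conjugateSeries_mem G u hu0
  have hpow : ∀ {a : MvPowerSeries (Fin 2) K}, a ∈ ordGE K (Fin 2) 1 →
      C b * a ^ N ∈ ordGE K (Fin 2) N := fun ha =>
    Ideal.mul_mem_left _ _ (by simpa using pow_mem_ordGE ha N)
  refine ⟨conjugateGroup G u hu0 hu1, conjugateGroup_isComm G u hu0 hu1, ?_⟩
  change conjugateSeries G u - _ - _ ∈ _
  have h1 := subst_conjugateSeries G u hu0 hx hy
  rw [self_subst_X, hsub _ hc, hsub _ hx, hsub _ hy] at h1
  have h2 := formalAdd_sub_formalAdd_mem G (m := N) (add_mem hx (ordGE_anti (by omega) (hpow hx)))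
    (add_mem hy (ordGE_anti (by omega) (hpow hy))) hx hy (by simpa using hpow hx)
    (by simpa using hpow hy)
  rw [← h1, self_subst_X] at h2
  have h3 : conjugateSeries G u ^ N - (X 0 + X 1) ^ N ∈ ordGE K (Fin 2) (N + 1) := by
    have h4 := conjugateSeries_sub_mem G u hu0 hu1
    have h5 := prod_pow_sub_mem_ordGE (σ := Unit) (m := 2) (a := fun _ => conjugateSeries G u)
      (b := fun _ => X 0 + X 1) (fun _ => hc) (fun _ => add_mem hx hy)
      (fun _ => by rwa [← sub_sub]) (Finsupp.single () N)
    rw [Finsupp.prod_single_index (by simp), Finsupp.prod_single_index (by simp),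
      Finsupp.degree_single] at h5
    rwa [show N + 1 = 2 + N - 1 by omega]
  convert sub_mem h2 (Ideal.mul_mem_left _ (C b) h3) using 1
  ring

theorem coeff_fin_three_aux (a b c : ℕ) (r : K) (e : Fin 3 →₀ ℕ) :
    coeff e ((X 0 : MvPowerSeries (Fin 3) K) ^ a * X 1 ^ b * X 2 ^ c * C r) =
      if e 0 = a ∧ e 1 = b ∧ e 2 = c then r else 0 := by
  classical
  rw [X_pow_eq, X_pow_eq, X_pow_eq, monomial_mul_monomial, monomial_mul_monomial,
    ← monomial_zero_eq_C_apply, monomial_mul_monomial, coeff_monomial]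
  congr 1
  · rw [eq_iff_iff]
    constructor
    · rintro rfl
      simp
    · rintro ⟨rfl, rfl, rfl⟩
      ext i
      fin_cases i <;> simp
  · simp

/-- The exponent of `x ^ i * y ^ j`. -/
abbrev expTwo (i j : ℕ) : Fin 2 →₀ ℕ := Finsupp.single 0 i + Finsupp.single 1 j

theorem eq_expTwo (d : Fin 2 →₀ ℕ) : d = expTwo (d 0) (d 1) := by
  ext i
  fin_cases i <;> simp

theorem coeff_subst_vec {τ : Type*} (D : MvPowerSeries (Fin 2) K) {a b : MvPowerSeries τ K}
    (ha : a ∈ ordGE K τ 1) (hb : b ∈ ordGE K τ 1) (e : τ →₀ ℕ) (i j : ℕ)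
    (h : ∀ i' j', (i', j') ≠ (i, j) → coeff e (a ^ i' * b ^ j') = 0) :
    coeff e (D.subst ![a, b]) = coeff (expTwo i j) D * coeff e (a ^ i * b ^ j) := by
  rw [coeff_subst (hasSubst_vec ha hb), finsum_eq_single _ (expTwo i j)]
  · rw [Finsupp.prod_fintype _ _ (by simp), smul_eq_mul]
    simp
  · intro d hd
    rw [Finsupp.prod_fintype _ _ (by simp)]
    simp only [Fin.prod_univ_two, Matrix.cons_val_zero, Matrix.cons_val_one]
    rw [h, smul_zero]
    intro hij
    apply hd
    rw [eq_expTwo d, (Prod.mk.inj hij).1, (Prod.mk.inj hij).2]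

theorem coeff_subst_left (D : MvPowerSeries (Fin 2) K) (e : Fin 3 →₀ ℕ) :
    coeff e (D.subst ![(X 0 + X 1 : MvPowerSeries (Fin 3) K), X 2]) =
      coeff (expTwo (e 0 + e 1) (e 2)) D * ((e 0 + e 1).choose (e 0) : ℕ) := by
  have hX := X_mem_ordGE_one (A := K) (σ := Fin 3)
  have key : ∀ i j, coeff e ((X 0 + X 1 : MvPowerSeries (Fin 3) K) ^ i * X 2 ^ j) =
      if i = e 0 + e 1 ∧ j = e 2 then (((e 0 + e 1).choose (e 0) : ℕ) : K) else 0 := by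
    intro i j
    have h2 : (X 0 + X 1 : MvPowerSeries (Fin 3) K) ^ i * X 2 ^ j =
        ∑ m ∈ Finset.range (i + 1), X 0 ^ m * X 1 ^ (i - m) * X 2 ^ j * C ((i.choose m : ℕ) : K) := by
      rw [add_pow, Finset.sum_mul]
      refine Finset.sum_congr rfl fun m _ => ?_
      rw [map_natCast]
      ring
    rw [h2, map_sum]
    simp_rw [coeff_fin_three_aux]
    split_ifs with hij
    · obtain ⟨rfl, rfl⟩ := hij
      rw [Finset.sum_eq_single (e 0)]
      · simp
      · intro m _ hm
        rw [if_neg]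
        rintro ⟨h, -, -⟩
        exact hm h.symm
      · intro h
        simp at h
    · refine Finset.sum_eq_zero fun m hm => ?_
      rw [if_neg]
      rintro ⟨h, h', h''⟩
      rw [Finset.mem_range] at hm
      exact hij ⟨by omega, by omega⟩
  rw [coeff_subst_vec D (add_mem (hX 0) (hX 1)) (hX 2) e (e 0 + e 1) (e 2), key,
    if_pos ⟨rfl, rfl⟩]
  intro i j hij
  rw [key, if_neg]
  rintro ⟨rfl, rfl⟩
  exact hij rfl

theorem coeff_subst_right (D : MvPowerSeries (Fin 2) K) (e : Fin 3 →₀ ℕ) :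
    coeff e (D.subst ![(X 0 : MvPowerSeries (Fin 3) K), X 1 + X 2]) =
      coeff (expTwo (e 0) (e 1 + e 2)) D * ((e 1 + e 2).choose (e 1) : ℕ) := by
  have hX := X_mem_ordGE_one (A := K) (σ := Fin 3)
  have key : ∀ i j, coeff e ((X 0 : MvPowerSeries (Fin 3) K) ^ i * (X 1 + X 2) ^ j) =
      if i = e 0 ∧ j = e 1 + e 2 then (((e 1 + e 2).choose (e 1) : ℕ) : K) else 0 := by
    intro i j
    have h2 : (X 0 : MvPowerSeries (Fin 3) K) ^ i * (X 1 + X 2) ^ j =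
        ∑ m ∈ Finset.range (j + 1), X 0 ^ i * X 1 ^ m * X 2 ^ (j - m) * C ((j.choose m : ℕ) : K) := by
      rw [add_pow, Finset.mul_sum]
      refine Finset.sum_congr rfl fun m _ => ?_
      rw [map_natCast]
      ring
    rw [h2, map_sum]
    simp_rw [coeff_fin_three_aux]
    split_ifs with hij
    · obtain ⟨rfl, rfl⟩ := hij
      rw [Finset.sum_eq_single (e 1)]
      · simp
      · intro m _ hm
        rw [if_neg]
        rintro ⟨-, h, -⟩
        exact hm h.symm
      · intro h
        simp at h
    · refine Finset.sum_eq_zero fun m hm => ?_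
      rw [if_neg]
      rintro ⟨h, h', h''⟩
      rw [Finset.mem_range] at hm
      exact hij ⟨by omega, by omega⟩
  rw [coeff_subst_vec D (hX 0) (add_mem (hX 1) (hX 2)) e (e 0) (e 1 + e 2), key,
    if_pos ⟨rfl, rfl⟩]
  intro i j hij
  rw [key, if_neg]
  rintro ⟨rfl, rfl⟩
  exact hij rfl

theorem coeff_subst_X_X_eq_zero (D : MvPowerSeries (Fin 2) K) (i j k : Fin 3) (hik : i ≠ k)
    (hjk : j ≠ k) (e : Fin 3 →₀ ℕ) (he : e k ≠ 0) :
    coeff e (D.subst ![(X i : MvPowerSeries (Fin 3) K), X j]) = 0 := by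
  classical
  rw [coeff_subst HasSubst.X_X]
  refine finsum_eq_zero_of_forall_eq_zero fun d => ?_
  rw [Finsupp.prod_fintype _ _ (by simp)]
  simp only [Fin.prod_univ_two, Matrix.cons_val_zero, Matrix.cons_val_one, X_pow_eq,
    monomial_mul_monomial, coeff_monomial]
  rw [if_neg, smul_zero]
  rintro rfl
  apply he
  simp [hik, hjk]

/-- A formal group law has no pure terms except the linear ones. -/
theorem formalGroup_coeff_pure (F : FormalGroup K) {n : ℕ} (hn : 2 ≤ n) (i : Fin 2) :
    coeff (Finsupp.single i n) F.toPowerSeries = 0 := by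
  classical
  have hX := X_mem_ordGE_one (A := K) (σ := Unit) ()
  have hpow : ∀ k, coeff (Finsupp.single () n) ((X () : MvPowerSeries Unit K) ^ k) =
      if n = k then 1 else 0 := by
    intro k
    rw [X_pow_eq, coeff_monomial]
    simp [(Finsupp.single_injective (M := ℕ) ()).eq_iff]
  have hlin : coeff (Finsupp.single () n) (X () : MvPowerSeries Unit K) = 0 := by
    have := hpow 1
    rwa [pow_one, if_neg (by omega)] at this
  have h0 : ∀ (k : ℕ), k ≠ 0 → (0 : MvPowerSeries Unit K) ^ k = 0 := fun k hk => zero_pow hk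
  fin_cases i
  · have h := congrArg (coeff (Finsupp.single () n)) (F.add_zero (powerSeries_hasSubst hX))
    rw [coeff_subst_vec _ hX (Ideal.zero_mem _) _ n 0, hlin, pow_zero, mul_one, hpow, if_pos rfl,
      mul_one] at h
    · simpa [expTwo] using h
    · intro i j hij
      rcases Nat.eq_zero_or_pos j with rfl | hj
      · rw [pow_zero, mul_one, hpow, if_neg]
        rintro rfl
        exact hij rfl
      · rw [h0 _ hj.ne', mul_zero, map_zero]
  · have h := congrArg (coeff (Finsupp.single () n)) (F.zero_add (powerSeries_hasSubst hX))
    rw [coeff_subst_vec _ (Ideal.zero_mem _) hX _ 0 n, hlin, pow_zero, one_mul, hpow, if_pos rfl,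
      mul_one] at h
    · simpa [expTwo] using h
    · intro i j hij
      rcases Nat.eq_zero_or_pos i with rfl | hj
      · rw [pow_zero, one_mul, hpow, if_neg]
        rintro rfl
        exact hij rfl
      · rw [h0 _ hj.ne', zero_mul, map_zero]

end Step

section Lift

open MvPowerSeries

variable {R A K : Type*} [CommRing R] [CommRing A] [Field K] [Algebra A K]

theorem map_subst_vec {B C τ : Type*} [CommRing B] [CommRing C] (f : B →+* C)
    (H : MvPowerSeries (Fin 2) B) {a b : MvPowerSeries τ B} (ha : a ∈ ordGE B τ 1)
    (hb : b ∈ ordGE B τ 1) : MvPowerSeries.map f (H.subst ![a, b]) =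
      (MvPowerSeries.map f H).subst ![MvPowerSeries.map f a, MvPowerSeries.map f b] := by
  rw [map_subst (hasSubst_vec ha hb)]
  congr 1
  funext i
  fin_cases i <;> rfl

theorem coeff_expTwo_monomial {B : Type*} [CommRing B] (i j a b : ℕ) :
    coeff (expTwo i j) ((X 0 : MvPowerSeries (Fin 2) B) ^ a * X 1 ^ b) =
      if i = a ∧ j = b then 1 else 0 := by
  classical
  rw [X_pow_eq, X_pow_eq, monomial_mul_monomial, coeff_monomial, mul_one]
  congr 1
  rw [eq_iff_iff]
  constructor
  · intro h
    have h0 := DFunLike.congr_fun h 0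
    have h1 := DFunLike.congr_fun h 1
    simp at h0 h1
    exact ⟨h0, h1⟩
  · rintro ⟨rfl, rfl⟩
    rfl

theorem formalGroup_coeff_swap {B : Type*} [CommRing B] (E : FormalGroup B) [E.IsComm] (i j : ℕ) :
    coeff (expTwo i j) E.toPowerSeries = coeff (expTwo j i) E.toPowerSeries := by
  have hX := X_mem_ordGE_one (A := B) (σ := Fin 2)
  conv_lhs => rw [FormalGroup.IsComm.comm (F := E)]
  rw [coeff_subst_vec _ (hX 1) (hX 0) _ j i, mul_comm (X 1 ^ j), coeff_expTwo_monomial,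
    if_pos ⟨rfl, rfl⟩, mul_one]
  intro i' j' hne
  rw [mul_comm, coeff_expTwo_monomial, if_neg]
  rintro ⟨rfl, rfl⟩
  exact hne rfl

theorem exists_coeff_eq_map_of_degree_le_one (p : A →+* R) (F : FormalGroup R) (G : FormalGroup K)
    (d : Fin 2 →₀ ℕ) (hd : d.degree ≤ 1) :
    ∃ r : A, algebraMap A K r = coeff d G.toPowerSeries ∧ p r = coeff d F.toPowerSeries := by
  have hdeg := degree_fin_two d
  obtain h | h | h : d = 0 ∨ d = Finsupp.single 0 1 ∨ d = Finsupp.single 1 1 := by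
    have h0 : (d 0 = 0 ∧ d 1 = 0) ∨ (d 0 = 1 ∧ d 1 = 0) ∨ (d 0 = 0 ∧ d 1 = 1) := by omega
    refine h0.imp ?_ (Or.imp ?_ ?_) <;>
    · rintro ⟨h0, h1⟩
      ext i
      fin_cases i <;> simp [h0, h1]
  · have h1 := G.zero_constantCoeff
    have h2 := F.zero_constantCoeff
    rw [← coeff_zero_eq_constantCoeff_apply] at h1 h2
    exact ⟨0, by rw [h, h1, map_zero], by rw [h, h2, map_zero]⟩
  · exact ⟨1, by rw [h, G.lin_coeff_X, map_one], by rw [h, F.lin_coeff_X, map_one]⟩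
  · exact ⟨1, by rw [h, G.lin_coeff_Y, map_one], by rw [h, F.lin_coeff_Y, map_one]⟩

theorem associator_sub_mem {σ : Type*} (G : FormalGroup K) (H : MvPowerSeries (Fin 2) K) {N : ℕ}
    (hN : 2 ≤ N) (hD : G.toPowerSeries - H ∈ ordGE K (Fin 2) N) {a b c : MvPowerSeries σ K}
    (ha : a ∈ ordGE K σ 1) (hb : b ∈ ordGE K σ 1) (hc : c ∈ ordGE K σ 1) :
    (H.subst ![a, H.subst ![b, c]] - H.subst ![H.subst ![a, b], c]) -
      ((G.toPowerSeries - H).subst ![a, b] + (G.toPowerSeries - H).subst ![a + b, c] -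
        ((G.toPowerSeries - H).subst ![b, c] + (G.toPowerSeries - H).subst ![a, b + c])) ∈
      ordGE K σ (N + 1) := by
  have hH : H ∈ ordGE K (Fin 2) 1 := by
    have := sub_mem (formalGroup_mem_ordGE G) (ordGE_anti (by omega : 1 ≤ N) hD)
    rwa [sub_sub_cancel] at this
  have sub : ∀ {a b : MvPowerSeries σ K}, a ∈ ordGE K σ 1 → b ∈ ordGE K σ 1 →
      (G.toPowerSeries - H).subst ![a, b] = G.toPowerSeries.subst ![a, b] - H.subst ![a, b] :=
    fun ha hb => subst_sub (hasSubst_vec ha hb) _ _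
  have hHm : ∀ {a b : MvPowerSeries σ K}, a ∈ ordGE K σ 1 → b ∈ ordGE K σ 1 →
      H.subst ![a, b] ∈ ordGE K σ 1 := fun ha hb => subst_mem_ordGE hH (vec_mem_ordGE ha hb)
  have hHadd : ∀ {a b : MvPowerSeries σ K}, a ∈ ordGE K σ 1 → b ∈ ordGE K σ 1 →
      H.subst ![a, b] - (a + b) ∈ ordGE K σ 2 := by
    intro a b ha hb
    have h1 := formalAdd_sub_mem G ha hb
    have h2 := ordGE_anti hN (subst_mem_ordGE hD (vec_mem_ordGE ha hb))
    rw [sub ha hb] at h2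
    convert sub_mem h1 h2 using 1
    abel
  have hz : ∀ {x : MvPowerSeries σ K} {n : ℕ}, x - x ∈ ordGE K σ n := by
    intro x n
    rw [sub_self]
    exact Ideal.zero_mem _
  have hGm := fun {a b : MvPowerSeries σ K} => formalAdd_mem G (f := a) (g := b)
  have e1 := formalAdd_sub_formalAdd_mem G (m := N) (hGm ha hb) hc (hHm ha hb) hc
    (by rw [← sub ha hb]; exact subst_mem_ordGE hD (vec_mem_ordGE ha hb)) hz
  have e2 := formalAdd_sub_formalAdd_mem G (m := N) ha (hGm hb hc) ha (hHm hb hc) hz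
    (by rw [← sub hb hc]; exact subst_mem_ordGE hD (vec_mem_ordGE hb hc))
  have e3 := subst_sub_subst_mem_ordGE hD (m := 2) (vec_mem_ordGE (hHm ha hb) hc)
    (vec_mem_ordGE (add_mem ha hb) hc) (by
      intro s
      fin_cases s
      · exact hHadd ha hb
      · exact hz)
  have e4 := subst_sub_subst_mem_ordGE hD (m := 2) (vec_mem_ordGE ha (hHm hb hc))
    (vec_mem_ordGE ha (add_mem hb hc)) (by
      intro s
      fin_cases s
      · exact hz
      · exact hHadd hb hc)
  have hassoc := G.assoc' (powerSeries_hasSubst ha) (powerSeries_hasSubst hb)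
    (powerSeries_hasSubst hc)
  rw [show 2 + N - 1 = N + 1 by omega] at e3 e4
  rw [sub (hHm ha hb) hc] at e3
  rw [sub ha (hHm hb hc)] at e4
  rw [hassoc] at e1
  rw [← sub ha hb] at e1
  rw [← sub hb hc] at e2
  convert sub_mem (add_mem e1 e3) (add_mem e2 e4) using 1
  abel

/-- The inductive step of the lifting: a formal group law over `K` whose coefficients up to degree
`n` lie in `A` and lift those of `F` can be altered in degree `n + 1` to have this property one degree
further. -/
theorem exists_formalGroup_lift_step [CharZero K] (p : A →+* R) (hp : Function.Surjective p)
    (hinj : Function.Injective (algebraMap A K)) (F : FormalGroup R) [F.IsComm]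
    (G : FormalGroup K) [G.IsComm] {n : ℕ} (hn : 1 ≤ n)
    (hG : ∀ d : Fin 2 →₀ ℕ, d.degree ≤ n → ∃ r : A, algebraMap A K r = coeff d G.toPowerSeries ∧
      p r = coeff d F.toPowerSeries) :
    ∃ G' : FormalGroup K, G'.IsComm ∧ G'.toPowerSeries - G.toPowerSeries ∈ ordGE K (Fin 2) (n + 1) ∧
      ∀ d : Fin 2 →₀ ℕ, d.degree ≤ n + 1 → ∃ r : A, algebraMap A K r = coeff d G'.toPowerSeries ∧
        p r = coeff d F.toPowerSeries := by
  have hex : ∀ d : Fin 2 →₀ ℕ, ∃ r : A, p r = coeff d F.toPowerSeries ∧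
      (d.degree ≤ n → algebraMap A K r = coeff d G.toPowerSeries) := by
    intro d
    by_cases hd : d.degree ≤ n
    · obtain ⟨r, h1, h2⟩ := hG d hd
      exact ⟨r, h2, fun _ => h1⟩
    · obtain ⟨r, hr⟩ := hp (coeff d F.toPowerSeries)
      exact ⟨r, hr, fun h => absurd h hd⟩
  choose H hHF hHG using hex
  let H' : MvPowerSeries (Fin 2) A := H
  have hH'F : MvPowerSeries.map p H' = F.toPowerSeries := by
    ext d
    exact hHF d
  let HK := MvPowerSeries.map (algebraMap A K) H'
  have hHK : ∀ d, coeff d HK = algebraMap A K (H d) := fun d => rfl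
  set D := G.toPowerSeries - HK with hD
  have hDc : ∀ d, coeff d D = coeff d G.toPowerSeries - algebraMap A K (H d) := fun d => rfl
  have hDmem : D ∈ ordGE K (Fin 2) (n + 1) := by
    intro d hd
    rw [hD, map_sub, hHK, hHG d (by omega), sub_self]
  -- coefficients are considered modulo the kernel of the reduction
  let J : AddSubgroup K := (RingHom.ker p).toAddSubgroup.map (algebraMap A K : A →+ K)
  let mk : K →+ K ⧸ J := QuotientAddGroup.mk' J
  have mk_eq_zero : ∀ r : A, p r = 0 → mk (algebraMap A K r) = 0 := fun r hr =>
    (QuotientAddGroup.eq_zero_iff _).mpr ⟨r, hr, rfl⟩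
  have hX3 := X_mem_ordGE_one (A := K) (σ := Fin 3)
  have hassoc := associator_sub_mem G HK (N := n + 1) (by omega) hDmem (hX3 0) (hX3 1) (hX3 2)
  have hHassoc : ∀ e, mk (coeff e (HK.subst ![(X 0 : MvPowerSeries (Fin 3) K),
      HK.subst ![X 1, X 2]] - HK.subst ![HK.subst ![X 0, X 1], X 2])) = 0 := by
    intro e
    have hH0 : H' ∈ ordGE A (Fin 2) 1 := by
      refine mem_ordGE_one.mpr (hinj ?_)
      have := hHG 0 (by simp)
      rw [map_zero]
      refine this.trans ?_
      rw [coeff_zero_eq_constantCoeff_apply]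
      exact G.zero_constantCoeff
    have hX3 := X_mem_ordGE_one (A := A) (σ := Fin 3)
    have hHm : ∀ {a b : MvPowerSeries (Fin 3) A}, a ∈ ordGE A _ 1 → b ∈ ordGE A _ 1 →
      H'.subst ![a, b] ∈ ordGE A _ 1 := fun ha hb => subst_mem_ordGE hH0 (vec_mem_ordGE ha hb)
    let Q := H'.subst ![(X 0 : MvPowerSeries (Fin 3) A), H'.subst ![X 1, X 2]] -
      H'.subst ![H'.subst ![X 0, X 1], X 2]
    have h1 : MvPowerSeries.map (algebraMap A K) Q = HK.subst ![(X 0 : MvPowerSeries (Fin 3) K),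
      HK.subst ![X 1, X 2]] - HK.subst ![HK.subst ![X 0, X 1], X 2] := by
      simp only [Q]
      rw [map_sub, map_subst_vec _ _ (hX3 0) (hHm (hX3 1) (hX3 2)),
        map_subst_vec _ _ (hHm (hX3 0) (hX3 1)) (hX3 2), map_subst_vec _ _ (hX3 0) (hX3 1),
        map_subst_vec _ _ (hX3 1) (hX3 2)]
      simp only [MvPowerSeries.map_X]
      rfl
    have h2 : MvPowerSeries.map p Q = 0 := by
      simp only [Q]
      rw [map_sub, map_subst_vec _ _ (hX3 0) (hHm (hX3 1) (hX3 2)),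
        map_subst_vec _ _ (hHm (hX3 0) (hX3 1)) (hX3 2), map_subst_vec _ _ (hX3 0) (hX3 1),
        map_subst_vec _ _ (hX3 1) (hX3 2), hH'F]
      simp only [MvPowerSeries.map_X]
      rw [F.assoc, sub_self]
    rw [← h1, coeff_map]
    refine mk_eq_zero _ ?_
    rw [← coeff_map, h2, map_zero]
  have hcoc : IsSymmCocycle (n + 1) (fun i => mk (coeff (expTwo i (n + 1 - i)) D)) := by
    refine ⟨?_, ?_⟩
    · intro i j hi hj hij
      rw [show n + 1 - i = j by omega, show n + 1 - j = i by omega, ← sub_eq_zero, ← map_sub,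
        hDc, hDc, formalGroup_coeff_swap G, sub_sub_sub_cancel_left, ← map_sub]
      refine mk_eq_zero _ ?_
      rw [map_sub, hHF, hHF, formalGroup_coeff_swap F, sub_self]
    · intro i j k hi hj hk hijk
      let e : Fin 3 →₀ ℕ := Finsupp.single 0 i + Finsupp.single 1 j + Finsupp.single 2 k
      have he0 : e 0 = i := by simp [e]
      have he1 : e 1 = j := by simp [e]
      have he2 : e 2 = k := by simp [e]
      have hdeg : e.degree < n + 1 + 1 := by
        simp [e]
        omega
      have h1 := hassoc e hdeg
      rw [map_sub, sub_eq_zero] at h1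
      have h2 := hHassoc e
      rw [h1, map_sub, map_add, map_add,
        coeff_subst_X_X_eq_zero _ 0 1 2 (by decide) (by decide) e (by omega),
        coeff_subst_X_X_eq_zero _ 1 2 0 (by decide) (by decide) e (by omega),
        coeff_subst_left, coeff_subst_right, he0, he1, he2, zero_add, zero_add, map_sub,
        sub_eq_zero, mul_comm, ← nsmul_eq_mul, map_nsmul, mul_comm, ← nsmul_eq_mul, map_nsmul] at h2
      rw [show n + 1 - (i + j) = k by omega, show n + 1 - i = j + k by omega]
      exact h2
  obtain ⟨m, hm⟩ := hcoc.exists_eq_smul (by omega)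
  obtain ⟨μ, rfl⟩ := QuotientAddGroup.mk'_surjective J m
  obtain ⟨G', hG'c, hG'⟩ := exists_formalGroup_sub_coboundary G (μ / (chooseGcd (n + 1) : K))
    (N := n + 1) (by omega)
  have hlow : G'.toPowerSeries - G.toPowerSeries ∈ ordGE K (Fin 2) (n + 1) := by
    have hX2 := X_mem_ordGE_one (A := K) (σ := Fin 2)
    have hp : ∀ {x : MvPowerSeries (Fin 2) K}, x ∈ ordGE K _ 1 → x ^ (n + 1) ∈ ordGE K _ (n + 1) :=
      fun hx => by simpa using pow_mem_ordGE hx (n + 1)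
    have h2 := add_mem (ordGE_anti (by omega) hG' : _ ∈ ordGE K (Fin 2) (n + 1))
      (Ideal.mul_mem_left _ (C (μ / (chooseGcd (n + 1) : K)))
      (sub_mem (add_mem (hp (hX2 0)) (hp (hX2 1))) (hp (add_mem (hX2 0) (hX2 1)))))
    rwa [sub_add_cancel] at h2
  refine ⟨G', hG'c, hlow, fun d hd => ?_⟩
  rcases Nat.lt_or_ge n d.degree with hdn | hdn
  · have hdeg := degree_fin_two d
    rw [eq_expTwo d]
    obtain ⟨i, hi⟩ : ∃ i, d 0 = i := ⟨_, rfl⟩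
    obtain ⟨j, hj⟩ : ∃ j, d 1 = j := ⟨_, rfl⟩
    rw [hi, hj]
    rcases Nat.eq_zero_or_pos i with h0 | hi0
    · rw [h0, expTwo, Finsupp.single_zero, zero_add, formalGroup_coeff_pure _ (by omega),
        formalGroup_coeff_pure _ (by omega)]
      exact ⟨0, map_zero _, map_zero _⟩
    rcases Nat.eq_zero_or_pos j with h0 | hj0
    · rw [h0, expTwo, Finsupp.single_zero, add_zero, formalGroup_coeff_pure _ (by omega),
        formalGroup_coeff_pure _ (by omega)]
      exact ⟨0, map_zero _, map_zero _⟩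
    have hjn : j = n + 1 - i := by omega
    -- the coefficient of the coboundary
    have hcob : coeff (expTwo i j) ((X 0 : MvPowerSeries (Fin 2) K) ^ (n + 1) + X 1 ^ (n + 1) -
        (X 0 + X 1) ^ (n + 1)) = -((n + 1).choose i : K) := by
      have hx := coeff_expTwo_monomial (B := K) i j (n + 1) 0
      have hy := coeff_expTwo_monomial (B := K) i j 0 (n + 1)
      rw [pow_zero, mul_one, if_neg (by omega)] at hx
      rw [pow_zero, one_mul, if_neg (by omega)] at hy
      have hsum : coeff (expTwo i j) ((X 0 + X 1 : MvPowerSeries (Fin 2) K) ^ (n + 1)) =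
          ((n + 1).choose i : K) := by
        rw [add_pow, map_sum, Finset.sum_eq_single i]
        · rw [mul_comm, ← nsmul_eq_mul, map_nsmul, coeff_expTwo_monomial, if_pos ⟨rfl, hjn⟩, nsmul_one]
        · intro b _ hb
          rw [mul_comm, ← nsmul_eq_mul, map_nsmul, coeff_expTwo_monomial, if_neg, smul_zero]
          rintro ⟨h, -⟩
          exact hb h.symm
        · intro h
          simp at h
          omega
      rw [map_sub, map_add, hx, hy, hsum]
      ring
    have hcoef : coeff (expTwo i j) G'.toPowerSeries = coeff (expTwo i j) G.toPowerSeries -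
        basicCocycle (n + 1) i • μ := by
      have h1 := hG' (expTwo i j) (by simp; omega)
      rw [map_sub, map_sub, coeff_C_mul, hcob, ← chooseGcd_mul_basicCocycle hi0 (by omega)] at h1
      have hne : (chooseGcd (n + 1) : K) ≠ 0 :=
        Nat.cast_ne_zero.mpr (chooseGcd_pos (by omega)).ne'
      have h2 : μ / (chooseGcd (n + 1) : K) * -((chooseGcd (n + 1) * basicCocycle (n + 1) i : ℕ) : K)
          = -(basicCocycle (n + 1) i • μ) := by
        rw [nsmul_eq_mul]
        push_cast
        field_simp
      rw [h2] at h1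
      linear_combination h1
    have hz : mk (coeff (expTwo i j) G'.toPowerSeries - algebraMap A K (H (expTwo i j))) = 0 := by
      have h1 := hm i hi0 (by omega)
      rw [← hjn] at h1
      change mk _ = _ • mk μ at h1
      rw [hcoef, sub_right_comm, map_sub, map_nsmul, ← h1, hDc, ← map_sub,
        sub_self, map_zero]
    obtain ⟨r, hr, hr2⟩ := (QuotientAddGroup.eq_zero_iff _).mp hz
    refine ⟨H (expTwo i j) + r, ?_, ?_⟩
    · rw [map_add, eq_comm, ← sub_eq_iff_eq_add']
      exact hr2.symm
    · rw [map_add, hHF, show p r = 0 from hr, add_zero]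
  · obtain ⟨r, h1, h2⟩ := hG d hdn
    refine ⟨r, ?_, h2⟩
    have := hlow d (by omega)
    rw [map_sub, sub_eq_zero] at this
    rw [h1, this]

theorem subst_vec_sub_mem {σ : Type*} {H H' : MvPowerSeries (Fin 2) A} {m : ℕ}
    (hH' : H' ∈ ordGE A (Fin 2) 1) (hHH : H - H' ∈ ordGE A (Fin 2) m)
    {a b a' b' : MvPowerSeries σ A} (ha : a ∈ ordGE A σ 1) (hb : b ∈ ordGE A σ 1)
    (ha' : a' ∈ ordGE A σ 1) (hb' : b' ∈ ordGE A σ 1)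
    (haa : a - a' ∈ ordGE A σ m) (hbb : b - b' ∈ ordGE A σ m) :
    H.subst ![a, b] - H'.subst ![a', b'] ∈ ordGE A σ m := by
  have h1 := subst_mem_ordGE hHH (vec_mem_ordGE ha hb)
  rw [subst_sub (hasSubst_vec ha hb)] at h1
  have h2 := subst_sub_subst_mem_ordGE hH' (m := m) (vec_mem_ordGE ha hb) (vec_mem_ordGE ha' hb') (by
    intro s
    fin_cases s
    · exact haa
    · exact hbb)
  have h3 := add_mem h1 h2
  rwa [sub_add_sub_cancel] at h3

/-- Every commutative formal group law lifts along a surjection from a subring of a field of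
characteristic zero. -/
theorem exists_formalGroup_lift [CharZero K] (p : A →+* R) (hp : Function.Surjective p)
    (hinj : Function.Injective (algebraMap A K)) (F : FormalGroup R) [F.IsComm] :
    ∃ E : FormalGroup A, E.IsComm ∧ E.map p = F := by
  let Good : ℕ → FormalGroup K → Prop := fun n G => G.IsComm ∧
    ∀ d : Fin 2 →₀ ℕ, d.degree ≤ n + 1 → ∃ r : A, algebraMap A K r = coeff d G.toPowerSeries ∧
      p r = coeff d F.toPowerSeries
  have step : ∀ n (G : {G // Good n G}), ∃ G' : {G // Good (n + 1) G},
      G'.1.toPowerSeries - G.1.toPowerSeries ∈ ordGE K (Fin 2) (n + 2) := by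
    rintro n ⟨G, hGc, hG⟩
    obtain ⟨G', h1, h2, h3⟩ := exists_formalGroup_lift_step p hp hinj F G (by omega) hG
    exact ⟨⟨G', h1, h3⟩, h2⟩
  choose next hnext using step
  let start : {G // Good 0 G} := ⟨FormalGroup.𝔾ₐ, inferInstance,
    fun d hd => exists_coeff_eq_map_of_degree_le_one p F _ d hd⟩
  let seq : ∀ n, {G // Good n G} := fun n => Nat.rec start next n
  have hseq : ∀ n, (seq (n + 1)).1.toPowerSeries - (seq n).1.toPowerSeries ∈
      ordGE K (Fin 2) (n + 2) := fun n => hnext n (seq n)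
  have hstab : ∀ m n, m ≤ n → (seq n).1.toPowerSeries - (seq m).1.toPowerSeries ∈
      ordGE K (Fin 2) (m + 2) := by
    intro m n hmn
    induction n, hmn using Nat.le_induction with
    | base =>
      rw [sub_self]
      exact Ideal.zero_mem _
    | succ n hmn ih =>
      have := add_mem (ordGE_anti (by omega : m + 2 ≤ n + 2) (hseq n)) ih
      rwa [sub_add_sub_cancel] at this
  have hcoef : ∀ d : Fin 2 →₀ ℕ, ∃ r : A,
      algebraMap A K r = coeff d (seq d.degree).1.toPowerSeries ∧ p r = coeff d F.toPowerSeries :=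
    fun d => (seq d.degree).2.2 d (by omega)
  choose E hEK hEF using hcoef
  let E' : MvPowerSeries (Fin 2) A := E
  have hE'F : MvPowerSeries.map p E' = F.toPowerSeries := by
    ext d
    exact hEF d
  let L := MvPowerSeries.map (algebraMap A K) E'
  have hL : ∀ n, L - (seq n).1.toPowerSeries ∈ ordGE K (Fin 2) (n + 1) := by
    intro n d hd
    have h1 := hstab d.degree n (by omega) d (by omega)
    rw [map_sub, sub_eq_zero] at h1
    rw [map_sub, h1, sub_eq_zero]
    exact hEK d
  have hmapinj : ∀ {τ : Type} {f g : MvPowerSeries τ A},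
      MvPowerSeries.map (algebraMap A K) f = MvPowerSeries.map (algebraMap A K) g → f = g := by
    intro τ f g h
    ext d
    exact hinj (by simpa using congrArg (coeff d) h)
  have hE0 : E' ∈ ordGE A (Fin 2) 1 := by
    refine mem_ordGE_one.mpr (hinj ?_)
    rw [map_zero]
    refine (hEK 0).trans ?_
    rw [coeff_zero_eq_constantCoeff_apply]
    exact FormalGroup.zero_constantCoeff _
  have hGm : ∀ {τ : Type} (n : ℕ) {a b : MvPowerSeries τ K}, a ∈ ordGE K τ 1 → b ∈ ordGE K τ 1 →
      L.subst ![a, b] - (seq n).1.toPowerSeries.subst ![a, b] ∈ ordGE K τ (n + 1) := by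
    intro τ n a b ha hb
    exact subst_vec_sub_mem (formalGroup_mem_ordGE _) (hL n) ha hb ha hb
      (by rw [sub_self]; exact Ideal.zero_mem _) (by rw [sub_self]; exact Ideal.zero_mem _)
  have hLm : L ∈ ordGE K (Fin 2) 1 := by
    have := add_mem (hL 0) (formalGroup_mem_ordGE (seq 0).1)
    rwa [sub_add_cancel] at this
  have hLm' : ∀ {τ : Type} {a b : MvPowerSeries τ K}, a ∈ ordGE K τ 1 → b ∈ ordGE K τ 1 →
      L.subst ![a, b] ∈ ordGE K τ 1 := fun ha hb => subst_mem_ordGE hLm (vec_mem_ordGE ha hb)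
  have hEm : ∀ {τ : Type} {a b : MvPowerSeries τ A}, a ∈ ordGE A τ 1 → b ∈ ordGE A τ 1 →
      E'.subst ![a, b] ∈ ordGE A τ 1 := fun ha hb => subst_mem_ordGE hE0 (vec_mem_ordGE ha hb)
  refine ⟨⟨E', mem_ordGE_one.mp hE0, hinj ?_, hinj ?_, hmapinj ?_⟩, ⟨hmapinj ?_⟩, ?_⟩
  · exact (hEK _).trans (by rw [map_one]; exact FormalGroup.lin_coeff_X _)
  · exact (hEK _).trans (by rw [map_one]; exact FormalGroup.lin_coeff_Y _)
  · have hXA := X_mem_ordGE_one (A := A) (σ := Fin 3)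
    have hX := X_mem_ordGE_one (A := K) (σ := Fin 3)
    rw [map_subst_vec _ _ (hEm (hXA 0) (hXA 1)) (hXA 2), map_subst_vec _ _ (hXA 0) (hXA 1),
      map_subst_vec _ _ (hXA 0) (hEm (hXA 1) (hXA 2)), map_subst_vec _ _ (hXA 1) (hXA 2)]
    simp only [MvPowerSeries.map_X]
    change L.subst ![L.subst ![X 0, X 1], X 2] = L.subst ![X 0, L.subst ![X 1, X 2]]
    refine eq_of_forall_sub_mem_ordGE fun n => ordGE_anti (Nat.le_succ n) ?_
    have h0 : ∀ x : MvPowerSeries (Fin 3) K, x - x ∈ ordGE K (Fin 3) (n + 1) := by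
      intro x
      rw [sub_self]
      exact Ideal.zero_mem _
    have h1 := subst_vec_sub_mem (formalGroup_mem_ordGE (seq n).1) (hL n) (hLm' (hX 0) (hX 1)) (hX 2)
      (formalAdd_mem _ (hX 0) (hX 1)) (hX 2) (hGm n (hX 0) (hX 1)) (h0 _)
    have h2 := subst_vec_sub_mem (formalGroup_mem_ordGE (seq n).1) (hL n) (hX 0) (hLm' (hX 1) (hX 2))
      (hX 0) (formalAdd_mem _ (hX 1) (hX 2)) (h0 _) (hGm n (hX 1) (hX 2))
    rw [(seq n).1.assoc] at h1
    have := sub_mem h1 h2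
    rwa [sub_sub_sub_cancel_right] at this
  · have hXA := X_mem_ordGE_one (A := A) (σ := Fin 2)
    have hX := X_mem_ordGE_one (A := K) (σ := Fin 2)
    rw [map_subst_vec _ _ (hXA 1) (hXA 0)]
    simp only [MvPowerSeries.map_X]
    change L = L.subst ![X 1, X 0]
    refine eq_of_forall_sub_mem_ordGE fun n => ordGE_anti (Nat.le_succ n) ?_
    have h1 := hGm n (hX 1) (hX 0)
    have := (seq n).2.1
    rw [← FormalGroup.IsComm.comm] at h1
    have := sub_mem (hL n) h1
    rwa [sub_sub_sub_cancel_right] at this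
  · exact FormalGroup.ext hE'F

end Lift

/-! ### Ring homomorphisms out of power series rings -/

section PowerSeriesHom

open MvPowerSeries

variable {A B : Type*} [CommRing A] [CommRing B] {σ τ : Type*}

/-- A series of order at least `n + 1` is a combination of the variables with coefficients of order
at least `n`: attribute each monomial to one of the variables that divide it. -/
theorem exists_sum_X_mul [Fintype σ] {n : ℕ} {f : MvPowerSeries σ A} (hf : f ∈ ordGE A σ (n + 1)) :
    ∃ q : σ → MvPowerSeries σ A, (∀ i, q i ∈ ordGE A σ n) ∧ f = ∑ i, X i * q i := by
  classical
  let c : (σ →₀ ℕ) → Option σ := fun d => if h : ∃ i, d i ≠ 0 then some h.choose else none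
  refine ⟨fun i d => if c (d + Finsupp.single i 1) = some i then
    coeff (d + Finsupp.single i 1) f else 0, fun i d hd => ?_, ?_⟩
  · change ite _ _ _ = _
    split_ifs
    · exact hf _ (by simpa using hd)
    · rfl
  · ext d
    rw [map_sum]
    have key : ∀ i, coeff d (X i * (show MvPowerSeries σ A from fun e =>
        if c (e + Finsupp.single i 1) = some i then coeff (e + Finsupp.single i 1) f else 0)) = if c d = some i then coeff d f else 0 := by
      intro i
      rw [X, coeff_monomial_mul]
      by_cases h : Finsupp.single i 1 ≤ d
      · rw [if_pos h, one_mul]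
        change ite _ _ _ = _
        rw [tsub_add_cancel_of_le h]
      · rw [if_neg h, if_neg]
        intro hc
        refine h ?_
        rw [Finsupp.single_le_iff]
        have hex : ∃ i, d i ≠ 0 := by
          by_contra hne
          simp [c, hne] at hc
        have := hex.choose_spec
        simp only [c, dif_pos hex, Option.some.injEq] at hc
        rw [hc] at this
        omega
    refine Eq.trans ?_ (Finset.sum_congr rfl fun i _ => (key i).symm)
    by_cases hd : ∃ i, d i ≠ 0
    · simp [c, hd]
    · have : d = 0 := by
        ext i
        by_contra h
        exact hd ⟨i, h⟩
      rw [hf d (by simp [this])]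
      simp

variable [Finite σ]

theorem ringHom_mem_ordGE (φ : MvPowerSeries σ A →+* MvPowerSeries τ B)
    (hφ : ∀ i, φ (X i) ∈ ordGE B τ 1) {n : ℕ} {f : MvPowerSeries σ A} (hf : f ∈ ordGE A σ n) :
    φ f ∈ ordGE B τ n := by
  have := Fintype.ofFinite σ
  induction n generalizing f with
  | zero => exact mem_ordGE_zero _
  | succ n ih =>
    obtain ⟨q, hq, rfl⟩ := exists_sum_X_mul hf
    rw [map_sum]
    refine sum_mem fun i _ => ?_
    rw [map_mul, add_comm n]
    exact mul_mem_ordGE (hφ i) (ih (hq i))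

/-- A ring homomorphism between power series rings that sends the variables to series without
constant term is determined by its values at constants and variables; no continuity is assumed. -/
theorem ringHom_ext_of_mem_ordGE {φ ψ : MvPowerSeries σ A →+* MvPowerSeries τ B}
    (hφ : ∀ i, φ (X i) ∈ ordGE B τ 1) (hX : ∀ i, φ (X i) = ψ (X i)) (hC : ∀ a, φ (C a) = ψ (C a)) :
    φ = ψ := by
  have := Fintype.ofFinite σ
  refine RingHom.ext fun f => eq_of_forall_sub_mem_ordGE fun n => ?_
  induction n generalizing f with
  | zero => exact mem_ordGE_zero _
  | succ n ih =>
    have hf : f - C (constantCoeff f) ∈ ordGE A σ (0 + 1) := mem_ordGE_one.mpr (by simp)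
    obtain ⟨q, -, hq⟩ := exists_sum_X_mul hf
    rw [sub_eq_iff_eq_add] at hq
    rw [hq, map_add, map_add, hC, add_sub_add_right_eq_sub, map_sum, map_sum,
      ← Finset.sum_sub_distrib]
    refine sum_mem fun i _ => ?_
    rw [map_mul, map_mul, ← hX, ← mul_sub, add_comm n]
    exact mul_mem_ordGE (hφ i) (ih (q i))

/-- Ring homomorphisms commute with substitution into series in two variables. -/
theorem ringHom_subst_vec (φ : MvPowerSeries σ A →+* MvPowerSeries τ B) (ρ : A →+* B)
    (hφ : ∀ i, φ (X i) ∈ ordGE B τ 1) (hC : ∀ a, φ (C a) = C (ρ a))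
    {f g : MvPowerSeries σ A} (hf : f ∈ ordGE A σ 1) (hg : g ∈ ordGE A σ 1)
    (P : MvPowerSeries (Fin 2) A) :
    φ (P.subst ![f, g]) = (MvPowerSeries.map ρ P).subst ![φ f, φ g] := by
  have hs := hasSubst_vec hf hg
  have hs' := hasSubst_vec (ringHom_mem_ordGE φ hφ hf) (ringHom_mem_ordGE φ hφ hg)
  have : φ.comp (substAlgHom (R := A) hs).toRingHom =
      (substAlgHom (R := B) hs').toRingHom.comp (MvPowerSeries.map ρ) := by
    refine ringHom_ext_of_mem_ordGE ?_ ?_ ?_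
    · intro i
      change φ (substAlgHom hs (X i)) ∈ _
      rw [substAlgHom_X]
      exact ringHom_mem_ordGE φ hφ (vec_mem_ordGE hf hg i)
    · intro i
      change φ (substAlgHom hs (X i)) = substAlgHom hs' (MvPowerSeries.map ρ (X i))
      rw [substAlgHom_X, map_X, substAlgHom_X]
      fin_cases i <;> rfl
    · intro a
      change φ (substAlgHom hs (C a)) = substAlgHom hs' (MvPowerSeries.map ρ (C a))
      have h1 : substAlgHom (R := A) hs (C a) = C a := (substAlgHom (R := A) hs).commutes a
      have h2 : substAlgHom (R := B) hs' (C (ρ a)) = C (ρ a) :=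
        (substAlgHom (R := B) hs').commutes (ρ a)
      rw [h1, map_C, h2, hC]
  have h := RingHom.congr_fun this P
  change φ (substAlgHom hs P) = substAlgHom hs' (MvPowerSeries.map ρ P) at h
  rwa [substAlgHom_apply, substAlgHom_apply] at h

end PowerSeriesHom

/-! ### The group of points of a formal group law -/

section Points

open MvPowerSeries

variable {R : Type*} [CommRing R] (F : FormalGroup R)

/-- `F(X, Y) = X + Y + X Y V` for some series `V`. -/
theorem formalGroup_exists_eq_add_mul :
    ∃ V : MvPowerSeries (Fin 2) R, F.toPowerSeries = X 0 + X 1 + X 0 * X 1 * V := by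
  classical
  have hvan : ∀ (i : Fin 2) (d : Fin 2 →₀ ℕ), d i = 0 →
      coeff d (F.toPowerSeries - X 0 - X 1) = 0 := by
    intro i d hd
    rcases lt_or_ge d.degree 2 with h | h
    · exact formalGroup_sub_mem_ordGE F d h
    · obtain ⟨j, hj⟩ : ∃ j, d = Finsupp.single j d.degree := by
        fin_cases i
        · refine ⟨1, Finsupp.ext fun k => ?_⟩
          rw [degree_fin_two]
          fin_cases k <;> simp_all
        · refine ⟨0, Finsupp.ext fun k => ?_⟩
          rw [degree_fin_two]
          fin_cases k <;> simp_all
      have hne : ∀ k : Fin 2, d ≠ Finsupp.single k 1 := by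
        intro k hk
        rw [hk, Finsupp.degree_single] at h
        omega
      rw [map_sub, map_sub, coeff_X, coeff_X, if_neg (hne 0), if_neg (hne 1), sub_zero, sub_zero, hj]
      exact formalGroup_coeff_pure F h j
  obtain ⟨P, hP⟩ := X_dvd_iff.mpr (hvan 0)
  obtain ⟨V, rfl⟩ : X 1 ∣ P := by
    refine X_dvd_iff.mpr fun d hd => ?_
    have h := hvan 1 (Finsupp.single 0 1 + d) (by simp [hd])
    rwa [hP, X, coeff_add_monomial_mul, one_mul] at h
  exact ⟨V, by rw [mul_assoc, ← hP]; ring⟩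

variable {τ : Type*}

/-- The formal group law has inverses: solve `F(f, g) = 0` for `g` by successive approximation. -/
theorem exists_formalAdd_eq_zero {f : MvPowerSeries τ R} (hf : f ∈ ordGE R τ 1) :
    ∃ g ∈ ordGE R τ 1, F.toPowerSeries.subst ![f, g] = 0 := by
  let s : ℕ → MvPowerSeries τ R := fun n => Nat.rec 0 (fun _ g => g - F.toPowerSeries.subst ![f, g]) n
  have hs : ∀ n, s (n + 1) = s n - F.toPowerSeries.subst ![f, s n] := fun n => rfl
  have h : ∀ n, s n ∈ ordGE R τ 1 ∧ F.toPowerSeries.subst ![f, s n] ∈ ordGE R τ (n + 1) := by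
    intro n
    induction n with
    | zero => exact ⟨Ideal.zero_mem _, by
        change F.toPowerSeries.subst ![f, 0] ∈ _
        rwa [F.add_zero (powerSeries_hasSubst hf)]⟩
    | succ n ih =>
      have h1 : s (n + 1) ∈ ordGE R τ 1 := by
        rw [hs]
        exact sub_mem ih.1 (ordGE_anti (by omega) ih.2)
      refine ⟨h1, ?_⟩
      have h2 := formalAdd_sub_formalAdd_mem F (m := n + 1) hf h1 hf ih.1
        (by rw [sub_self]; exact Ideal.zero_mem _)
        (by rw [hs, sub_sub_cancel_left]; exact neg_mem ih.2)
      rw [sub_self, zero_add, hs] at h2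
      convert h2 using 1
      rw [hs]
      ring
  have hstep : ∀ n k, s (n + k) - s n ∈ ordGE R τ (n + 1) := by
    intro n k
    induction k with
    | zero => simp
    | succ k ih =>
      rw [← add_assoc, hs, sub_right_comm]
      exact sub_mem ih (ordGE_anti (by omega) (h (n + k)).2)
  let g : MvPowerSeries τ R := fun d => coeff d (s d.degree)
  have hg : ∀ n, g - s n ∈ ordGE R τ (n + 1) := by
    intro n d hd
    obtain ⟨k, rfl⟩ : ∃ k, n = d.degree + k := ⟨n - d.degree, by omega⟩
    have := hstep d.degree k d (by omega)
    rw [map_sub, sub_eq_zero] at this ⊢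
    exact this.symm
  have hg1 : g ∈ ordGE R τ 1 := by
    have := add_mem (ordGE_anti (by omega) (hg 0)) (h 0).1
    rwa [sub_add_cancel] at this
  refine ⟨g, hg1, eq_of_forall_sub_mem_ordGE fun n => ordGE_anti (Nat.le_succ n) ?_⟩
  have h2 := formalAdd_sub_formalAdd_mem F (m := n + 1) hf hg1 hf (h n).1
    (by rw [sub_self]; exact Ideal.zero_mem _) (hg n)
  rw [sub_self, zero_add] at h2
  have := add_mem (add_mem (ordGE_anti (Nat.le_succ _) h2) (hg n)) (h n).2
  convert this using 1
  ring

/-- The group of points of `F` with values in power series without constant term. -/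
@[ext]
structure OrdPoint (F : FormalGroup R) (τ : Type*) : Type _ where
  /-- The underlying series. -/
  val : MvPowerSeries τ R
  val_mem : val ∈ ordGE R τ 1

namespace OrdPoint

variable {F}

instance : Add (OrdPoint F τ) where
  add p q := ⟨F.toPowerSeries.subst ![p.val, q.val], formalAdd_mem F p.val_mem q.val_mem⟩

instance : Zero (OrdPoint F τ) where
  zero := ⟨0, Ideal.zero_mem _⟩

instance : Neg (OrdPoint F τ) where
  neg p := ⟨(exists_formalAdd_eq_zero F p.val_mem).choose,
    (exists_formalAdd_eq_zero F p.val_mem).choose_spec.1⟩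

variable [F.IsComm]

instance : AddCommGroup (OrdPoint F τ) where
  add_assoc p q r := OrdPoint.ext (F.assoc' (powerSeries_hasSubst p.val_mem) (powerSeries_hasSubst q.val_mem)
    (powerSeries_hasSubst r.val_mem))
  zero_add p := OrdPoint.ext (F.zero_add (powerSeries_hasSubst p.val_mem))
  add_zero p := OrdPoint.ext (F.add_zero (powerSeries_hasSubst p.val_mem))
  add_comm p q := OrdPoint.ext (F.comm' (powerSeries_hasSubst p.val_mem) (powerSeries_hasSubst q.val_mem))
  neg_add_cancel p := OrdPoint.ext ((F.comm' (powerSeries_hasSubst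
    (exists_formalAdd_eq_zero F p.val_mem).choose_spec.1) (powerSeries_hasSubst p.val_mem)).trans
      (exists_formalAdd_eq_zero F p.val_mem).choose_spec.2)
  nsmul := nsmulRec
  zsmul := zsmulRec

end OrdPoint

variable [F.IsComm] {M : Type*} [AddCommGroup M] {σ : Type*} (β : Module.Basis σ ℤ M)

/-- The series `χ(m)` in variables indexed by a basis of `M`: `χ` is additive for the formal
sum, and `χ` of a basis element is the corresponding variable. -/
def chi : M →+ OrdPoint F σ :=
  (β.constr ℤ fun i => (⟨X i, X_mem_ordGE_one i⟩ : OrdPoint F σ)).toAddMonoidHom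

theorem chi_basis (i : σ) : (chi F β (β i)).val = X i := by
  have : chi F β (β i) = (⟨X i, X_mem_ordGE_one i⟩ : OrdPoint F σ) := β.constr_basis ℤ _ i
  rw [this]

theorem chi_add (l m : M) : (chi F β (l + m)).val =
    F.toPowerSeries.subst ![(chi F β l).val, (chi F β m).val] := by
  rw [map_add]
  rfl

theorem chi_zero : (chi F β 0).val = 0 := by
  rw [map_zero]
  rfl

/-- Two families of points that are additive and agree on a basis agree. -/
theorem eq_of_basis {f g : M → MvPowerSeries τ R} (hf : ∀ m, f m ∈ ordGE R τ 1)
    (hg : ∀ m, g m ∈ ordGE R τ 1)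
    (hfa : ∀ l m, f (l + m) = F.toPowerSeries.subst ![f l, f m])
    (hga : ∀ l m, g (l + m) = F.toPowerSeries.subst ![g l, g m])
    (hfg : ∀ i, f (β i) = g (β i)) (m : M) : f m = g m := by
  let f' : M →+ OrdPoint F τ := AddMonoidHom.mk' (fun m => ⟨f m, hf m⟩)
    fun l m => OrdPoint.ext (hfa l m)
  let g' : M →+ OrdPoint F τ := AddMonoidHom.mk' (fun m => ⟨g m, hg m⟩)
    fun l m => OrdPoint.ext (hga l m)
  have h : f'.toIntLinearMap = g'.toIntLinearMap := β.ext fun i => OrdPoint.ext (hfg i)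
  exact congrArg OrdPoint.val (LinearMap.congr_fun h m)

/-- The linear part of `χ(m)` is given by the coordinates of `m`. -/
theorem coeff_single_chi (i : σ) (m : M) :
    coeff (Finsupp.single i 1) (chi F β m).val = ((β.repr m i : ℤ) : R) := by
  classical
  let c : M →+ R := AddMonoidHom.mk' (fun m => coeff (Finsupp.single i 1) (chi F β m).val) (by
    intro l m
    rw [chi_add, ← map_add, ← sub_eq_zero, ← map_sub]
    exact formalAdd_sub_mem F (OrdPoint.val_mem _) (OrdPoint.val_mem _) _ (by simp))
  let c' : M →+ R := (Int.castAddHom R).comp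
    (((Finsupp.applyAddHom i).comp (β.repr : M →ₗ[ℤ] σ →₀ ℤ).toAddMonoidHom))
  have h : c.toIntLinearMap = c'.toIntLinearMap := by
    refine β.ext fun j => ?_
    change coeff _ (chi F β (β j)).val = ((β.repr (β j) i : ℤ) : R)
    rw [chi_basis, coeff_X, β.repr_self, Finsupp.single_apply]
    simp [Finsupp.single_left_inj, eq_comm]
  exact LinearMap.congr_fun h m

end Points

/-! ### Evaluation of series in infinitely many variables -/

section Evaluation

open MvPowerSeries

variable {R : Type*} [CommRing R] {σ τ : Type*}

theorem exists_truncation {f : MvPowerSeries σ R} (hf : f ∈ powerSeriesCompletion R σ) (n : ℕ) :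
    ∃ p : MvPolynomial σ R, f - (p : MvPowerSeries σ R) ∈ ordGE R σ n := by
  classical
  have hfin : (⋃ k ∈ Finset.range n, {d : σ →₀ ℕ | d.degree = k ∧ coeff d f ≠ 0}).Finite :=
    Set.Finite.biUnion (Finset.finite_toSet _) fun k _ => hf k
  refine ⟨∑ d ∈ hfin.toFinset, MvPolynomial.monomial d (coeff d f), fun e he => ?_⟩
  rw [map_sub, MvPolynomial.coeff_coe, MvPolynomial.coeff_sum]
  simp only [MvPolynomial.coeff_monomial]
  rw [Finset.sum_ite_eq']
  split_ifs with h
  · exact sub_self _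
  · rw [sub_zero]
    by_contra hne
    refine h ((Set.Finite.mem_toFinset _).mpr ?_)
    simp only [Set.mem_iUnion, Finset.mem_range]
    exact ⟨e.degree, he, rfl, hne⟩

theorem mvPolynomial_coe_sub (p q : MvPolynomial σ R) :
    ((p - q : MvPolynomial σ R) : MvPowerSeries σ R) = p - q := by
  ext d
  simp

variable (h : σ → MvPowerSeries τ R) (hh : ∀ s, h s ∈ ordGE R τ 1)

include hh in
theorem aeval_mem_ordGE {n : ℕ} {p : MvPolynomial σ R}
    (hp : (p : MvPowerSeries σ R) ∈ ordGE R σ n) : MvPolynomial.aeval h p ∈ ordGE R τ n := by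
  rw [MvPolynomial.aeval_def, MvPolynomial.eval₂_eq]
  refine sum_mem fun d hd => Ideal.mul_mem_left _ _ ?_
  have hdeg : n ≤ d.degree := by
    by_contra hlt
    have := hp d (by omega)
    rw [MvPolynomial.coeff_coe] at this
    exact (MvPolynomial.mem_support_iff.mp hd) this
  exact ordGE_anti hdeg (prod_pow_mem_ordGE hh d)

/-- The value at `h` of a series in `R⟦x_σ⟧`, computed degree by degree from truncations. -/
def evalFun (f : powerSeriesCompletion R σ) : MvPowerSeries τ R := fun e =>
  coeff e (MvPolynomial.aeval h (exists_truncation f.2 (e.degree + 1)).choose)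

include hh in
theorem evalFun_sub_mem {f : powerSeriesCompletion R σ} {n : ℕ} {p : MvPolynomial σ R}
    (hp : (f : MvPowerSeries σ R) - (p : MvPowerSeries σ R) ∈ ordGE R σ n) :
    evalFun h f - MvPolynomial.aeval h p ∈ ordGE R τ n := by
  intro e he
  have h1 := (exists_truncation f.2 (e.degree + 1)).choose_spec
  have h2 : ((p - (exists_truncation f.2 (e.degree + 1)).choose : MvPolynomial σ R) :
      MvPowerSeries σ R) ∈ ordGE R σ (e.degree + 1) := by
    have := sub_mem h1 (ordGE_anti (by omega) hp)
    rw [sub_sub_sub_cancel_left] at this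
    rwa [mvPolynomial_coe_sub]
  have h3 := aeval_mem_ordGE h hh h2 e (by omega)
  rw [map_sub, map_sub, sub_eq_zero] at h3
  rw [map_sub, h3]
  exact sub_self _

/-- Evaluation at series without constant term, as an algebra homomorphism. -/
def evalHom : powerSeriesCompletion R σ →ₐ[R] MvPowerSeries τ R where
  toFun := evalFun h
  map_one' := by
    refine eq_of_forall_sub_mem_ordGE fun n => ?_
    have := evalFun_sub_mem h hh (f := 1) (n := n) (p := 1) (by simp)
    simpa using this
  map_zero' := by
    refine eq_of_forall_sub_mem_ordGE fun n => ?_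
    have := evalFun_sub_mem h hh (f := 0) (n := n) (p := 0) (by simp)
    simpa using this
  map_add' f g := by
    refine eq_of_forall_sub_mem_ordGE fun n => ?_
    obtain ⟨p, hp⟩ := exists_truncation f.2 n
    obtain ⟨q, hq⟩ := exists_truncation g.2 n
    have h1 := evalFun_sub_mem h hh (f := f + g) (n := n) (p := p + q) (by
      have := add_mem hp hq
      convert this using 1
      push_cast
      ring)
    have h2 := add_mem (evalFun_sub_mem h hh hp) (evalFun_sub_mem h hh hq)
    have := sub_mem h1 h2
    rw [map_add] at this
    convert this using 1
    ring
  map_mul' f g := by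
    refine eq_of_forall_sub_mem_ordGE fun n => ?_
    obtain ⟨p, hp⟩ := exists_truncation f.2 n
    obtain ⟨q, hq⟩ := exists_truncation g.2 n
    have h1 := evalFun_sub_mem h hh (f := f * g) (n := n) (p := p * q) (by
      have := add_mem (Ideal.mul_mem_right (g : MvPowerSeries σ R) _ hp)
        (Ideal.mul_mem_left _ (p : MvPowerSeries σ R) hq)
      convert this using 1
      push_cast
      ring)
    have h2 := add_mem (Ideal.mul_mem_right (evalFun h g) _ (evalFun_sub_mem h hh hp))
      (Ideal.mul_mem_left _ (MvPolynomial.aeval h p) (evalFun_sub_mem h hh hq))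
    have := sub_mem h1 h2
    rw [map_mul] at this
    convert this using 1
    ring
  commutes' r := by
    refine eq_of_forall_sub_mem_ordGE fun n => ?_
    have := evalFun_sub_mem h hh (f := algebraMap R _ r) (n := n) (p := MvPolynomial.C r) (by
      rw [MvPolynomial.coe_C, Subalgebra.coe_algebraMap, MvPowerSeries.algebraMap_apply]
      simp)
    rwa [MvPolynomial.aeval_C] at this

theorem evalHom_sub_mem {f : powerSeriesCompletion R σ} {n : ℕ} {p : MvPolynomial σ R}
    (hp : (f : MvPowerSeries σ R) - (p : MvPowerSeries σ R) ∈ ordGE R σ n) :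
    evalHom h hh f - MvPolynomial.aeval h p ∈ ordGE R τ n := evalFun_sub_mem h hh hp

theorem evalHom_var (s : σ) : evalHom h hh (formalVar R s) = h s := by
  refine eq_of_forall_sub_mem_ordGE fun n => ?_
  have := evalHom_sub_mem h hh (f := formalVar R s) (n := n) (p := MvPolynomial.X s) (by
    rw [MvPolynomial.coe_X]
    simp [formalVar])
  rwa [MvPolynomial.aeval_X] at this

theorem evalHom_mem_ordGE {n : ℕ} {f : powerSeriesCompletion R σ} (hf : f ∈ orderIdeal R σ n) :
    evalHom h hh f ∈ ordGE R τ n := by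
  have := evalHom_sub_mem h hh (f := f) (n := n) (p := 0) (by
    rw [MvPolynomial.coe_zero, sub_zero]
    exact hf)
  rwa [map_zero, sub_zero] at this

theorem evalHom_formalSum (F : FormalGroup R) (l m : σ) :
    evalHom h hh (formalSum F l m) = F.toPowerSeries.subst ![h l, h m] := by
  -- `P ↦ P(x_l, x_m)` followed by evaluation is a homomorphism from series in two variables
  have hs := hasSubst_vec (X_mem_ordGE_one (A := R) l) (X_mem_ordGE_one (A := R) m)
  have hs' := hasSubst_vec (hh l) (hh m)
  let u : MvPowerSeries (Fin 2) R →ₐ[R] powerSeriesCompletion R σ :=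
    (substAlgHom hs).codRestrict _ fun P => by
      rw [substAlgHom_apply]
      exact subst_mem_powerSeriesCompletion P l m
  have hu : ∀ i, evalHom h hh (u (X i)) = ![h l, h m] i := by
    intro i
    have : u (X i) = formalVar R (![l, m] i) := by
      refine Subtype.ext ?_
      change substAlgHom hs (X i) = _
      rw [substAlgHom_X]
      fin_cases i <;> rfl
    rw [this, evalHom_var]
    fin_cases i <;> rfl
  have : ((evalHom h hh).comp u).toRingHom = (substAlgHom (R := R) hs').toRingHom := by
    refine ringHom_ext_of_mem_ordGE ?_ ?_ ?_
    · intro i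
      change evalHom h hh (u (X i)) ∈ _
      rw [hu]
      exact vec_mem_ordGE (hh l) (hh m) i
    · intro i
      change evalHom h hh (u (X i)) = substAlgHom hs' (X i)
      rw [hu, substAlgHom_X]
    · intro a
      exact (((evalHom h hh).comp u).commutes a).trans ((substAlgHom (R := R) hs').commutes a).symm
  have h2 := RingHom.congr_fun this F.toPowerSeries
  change evalHom h hh (u F.toPowerSeries) = substAlgHom hs' F.toPowerSeries at h2
  rw [substAlgHom_apply] at h2
  rw [← h2]
  congr 1
  refine Subtype.ext ?_
  change _ = substAlgHom hs F.toPowerSeries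
  rw [substAlgHom_apply]
  rfl

end Evaluation

/-! ### Formal group algebras of free modules -/

section Coordinates

open MvPowerSeries FormalGroupAlgebra

variable {R : Type*} [CommRing R] (F : FormalGroup R)

theorem mem_powerSeriesCompletion_of_forall {σ : Type*} {f : MvPowerSeries σ R}
    (h : ∀ n, ∃ g ∈ powerSeriesCompletion R σ, f - g ∈ ordGE R σ n) :
    f ∈ powerSeriesCompletion R σ := by
  intro n
  obtain ⟨g, hg, hfg⟩ := h (n + 1)
  refine (hg n).subset ?_
  rintro d ⟨hd, hne⟩
  refine ⟨hd, ?_⟩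
  have := hfg d (by omega)
  rw [map_sub, sub_eq_zero] at this
  rwa [← this]

theorem mem_powerSeriesCompletion_of_finite {σ : Type*} [Finite σ] (f : MvPowerSeries σ R) :
    f ∈ powerSeriesCompletion R σ := by
  intro n
  refine (Finsupp.finite_of_degree_le n).subset ?_
  rintro d ⟨hd, -⟩
  exact hd.le

/-- Substituting two series into a polynomial approximation of a series in two variables. -/
theorem exists_subst_sub_aeval_mem {σ : Type*} (P : MvPowerSeries (Fin 2) R) (n : ℕ) :
    ∃ p : MvPolynomial (Fin 2) R, ∀ a b : MvPowerSeries σ R, a ∈ ordGE R σ 1 → b ∈ ordGE R σ 1 →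
      P.subst ![a, b] - MvPolynomial.aeval ![a, b] p ∈ ordGE R σ n := by
  obtain ⟨p, hp⟩ := exists_truncation (mem_powerSeriesCompletion_of_finite P) n
  refine ⟨p, fun a b ha hb => ?_⟩
  have hs := hasSubst_vec ha hb
  have := subst_mem_ordGE hp (vec_mem_ordGE ha hb)
  rwa [subst_sub hs, subst_coe] at this

theorem formalAdd_mem_powerSeriesCompletion {σ : Type*} {a b : MvPowerSeries σ R}
    (ha : a ∈ powerSeriesCompletion R σ) (hb : b ∈ powerSeriesCompletion R σ)
    (ha1 : a ∈ ordGE R σ 1) (hb1 : b ∈ ordGE R σ 1) :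
    F.toPowerSeries.subst ![a, b] ∈ powerSeriesCompletion R σ := by
  refine mem_powerSeriesCompletion_of_forall fun n => ?_
  obtain ⟨p, hp⟩ := exists_subst_sub_aeval_mem (σ := σ) F.toPowerSeries n
  refine ⟨_, ?_, hp a b ha1 hb1⟩
  have h : ∀ i, ![a, b] i = ((![⟨a, ha⟩, ⟨b, hb⟩] : Fin 2 → powerSeriesCompletion R σ) i : _) := by
    intro i
    fin_cases i <;> rfl
  rw [show ![a, b] = fun i => ((powerSeriesCompletion R σ).val
    ((![⟨a, ha⟩, ⟨b, hb⟩] : Fin 2 → powerSeriesCompletion R σ) i)) from funext h,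
    ← MvPolynomial.comp_aeval_apply]
  exact Subtype.property _

variable {M : Type*} [AddCommGroup M]

theorem mem_closedRelationIdeal_of_forall {f : powerSeriesCompletion R M}
    (h : ∀ n, ∃ g ∈ closedRelationIdeal F M,
      (f : MvPowerSeries M R) - (g : MvPowerSeries M R) ∈ ordGE R M n) :
    f ∈ closedRelationIdeal F M := by
  refine (Submodule.mem_iInf _).mpr fun n => ?_
  obtain ⟨g, hg, hfg⟩ := h n
  have h2 : f - g ∈ orderIdeal R M n := hfg
  have := add_mem ((Submodule.mem_iInf _).mp hg n) (Ideal.mem_sup_right h2)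
  rwa [add_sub_cancel] at this

theorem relationIdeal_le_closed : relationIdeal F M ≤ closedRelationIdeal F M :=
  le_iInf fun _ => le_sup_left

/-- Congruences modulo the closed ideal of relations are compatible with formal sums. -/
theorem formalAdd_congr {a b a' b' : powerSeriesCompletion R M}
    (ha : (a : MvPowerSeries M R) ∈ ordGE R M 1) (hb : (b : MvPowerSeries M R) ∈ ordGE R M 1)
    (ha' : (a' : MvPowerSeries M R) ∈ ordGE R M 1) (hb' : (b' : MvPowerSeries M R) ∈ ordGE R M 1)
    (haa : a - a' ∈ closedRelationIdeal F M) (hbb : b - b' ∈ closedRelationIdeal F M) :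
    (⟨_, formalAdd_mem_powerSeriesCompletion F a.2 b.2 ha hb⟩ : powerSeriesCompletion R M) -
      ⟨_, formalAdd_mem_powerSeriesCompletion F a'.2 b'.2 ha' hb'⟩ ∈ closedRelationIdeal F M := by
  refine mem_closedRelationIdeal_of_forall F fun n => ?_
  obtain ⟨p, hp⟩ := exists_subst_sub_aeval_mem (σ := M) F.toPowerSeries n
  refine ⟨MvPolynomial.aeval ![a, b] p - MvPolynomial.aeval ![a', b'] p, ?_, ?_⟩
  · have h : ∀ c c' : powerSeriesCompletion R M,
        FormalGroupAlgebra.mk F M (MvPolynomial.aeval ![c, c'] p) =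
        MvPolynomial.aeval ![FormalGroupAlgebra.mk F M c,
          FormalGroupAlgebra.mk F M c'] p := by
      intro c c'
      refine (MvPolynomial.comp_aeval_apply _ (FormalGroupAlgebra.mk F M)
        p).trans ?_
      congr 2
      funext i
      fin_cases i <;> rfl
    have h1 := Ideal.Quotient.eq.mpr haa
    have h2 := Ideal.Quotient.eq.mpr hbb
    refine Ideal.Quotient.eq.mp ?_
    refine (h a b).trans (Eq.trans ?_ (h a' b').symm)
    congr 2
    funext i
    fin_cases i
    · exact h1
    · exact h2
  · have h : ∀ c c' : powerSeriesCompletion R M,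
        ((MvPolynomial.aeval ![c, c'] p : powerSeriesCompletion R M) : MvPowerSeries M R) =
        MvPolynomial.aeval ![(c : MvPowerSeries M R), (c' : MvPowerSeries M R)] p := by
      intro c c'
      refine (MvPolynomial.comp_aeval_apply _ (powerSeriesCompletion R M).val p).trans ?_
      congr 2
      funext i
      fin_cases i <;> rfl
    have := sub_mem (hp a b ha hb) (hp a' b' ha' hb')
    rw [sub_sub_sub_comm] at this
    simpa only [AddSubgroupClass.coe_sub, Subalgebra.coe_sub, h] using this

variable [F.IsComm] {σ : Type*} (β : Module.Basis σ ℤ M)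

/-- Evaluation at the family `χ`. -/
def evalChi : powerSeriesCompletion R M →ₐ[R] MvPowerSeries σ R :=
  evalHom (fun m => (chi F β m).val) fun m => (chi F β m).val_mem

theorem evalChi_var (m : M) : evalChi F β (formalVar R m) = (chi F β m).val := evalHom_var _ _ m

theorem evalChi_eq_zero {f : powerSeriesCompletion R M} (hf : f ∈ closedRelationIdeal F M) :
    evalChi F β f = 0 := by
  refine eq_of_forall_sub_mem_ordGE fun n => ?_
  rw [sub_zero]
  obtain ⟨g, hg, h, hh, rfl⟩ := Submodule.mem_sup.mp ((Submodule.mem_iInf _).mp hf n)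
  have h0 : evalChi F β g = 0 := by
    suffices relationIdeal F M ≤ RingHom.ker (evalChi F β) from this hg
    refine Ideal.span_le.mpr ?_
    rintro k (rfl | ⟨l, m, rfl⟩)
    · exact (evalChi_var F β 0).trans (chi_zero F β)
    · change evalChi F β _ = 0
      rw [map_sub, sub_eq_zero]
      exact (evalHom_formalSum _ _ F l m).trans ((chi_add F β l m).symm.trans
        (evalChi_var F β _).symm)
  rw [map_add, h0, zero_add]
  exact evalHom_mem_ordGE _ _ hh

/-- The coordinate expression of an element of the formal group algebra. -/
def coord : FormalGroupAlgebra F M →ₐ[R] MvPowerSeries σ R :=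
  Ideal.Quotient.liftₐ (closedRelationIdeal F M) (evalChi F β) fun _ hf => evalChi_eq_zero F β hf

theorem coord_x (m : M) : coord F β (x F m) = (chi F β m).val := evalChi_var F β m

variable [Finite σ]

/-- Series in the basis variables as series in all variables `x_m`. -/
def basisIncl : MvPowerSeries σ R →ₐ[R] powerSeriesCompletion R M :=
  (substAlgHom (R := R) (hasSubst_of_mem_ordGE
    (fun i => X_mem_ordGE_one (A := R) (β i)))).codRestrict _ fun P => by
      refine mem_powerSeriesCompletion_of_forall fun n => ?_
      obtain ⟨p, hp⟩ := exists_truncation (mem_powerSeriesCompletion_of_finite P) n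
      have h := fun i => X_mem_ordGE_one (A := R) (β i)
      have := subst_mem_ordGE hp h
      rw [subst_sub (hasSubst_of_mem_ordGE h), subst_coe] at this
      rw [substAlgHom_apply]
      refine ⟨_, ?_, this⟩
      rw [show (fun i => (X (β i) : MvPowerSeries M R)) = fun i => (powerSeriesCompletion R M).val
        (formalVar R (β i)) from rfl, ← MvPolynomial.comp_aeval_apply]
      exact Subtype.property _

theorem coe_basisIncl (P : MvPowerSeries σ R) :
    ((basisIncl β P : powerSeriesCompletion R M) : MvPowerSeries M R) =
      P.subst fun i => X (β i) :=
  substAlgHom_apply (hasSubst_of_mem_ordGE fun i => X_mem_ordGE_one (A := R) (β i)) P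

theorem basisIncl_mem_ordGE {n : ℕ} {P : MvPowerSeries σ R} (hP : P ∈ ordGE R σ n) :
    ((basisIncl β P : powerSeriesCompletion R M) : MvPowerSeries M R) ∈ ordGE R M n := by
  rw [coe_basisIncl]
  exact subst_mem_ordGE hP fun i => X_mem_ordGE_one _

theorem basisIncl_X (i : σ) : (basisIncl β (X i) : powerSeriesCompletion R M) = formalVar R (β i) :=
  Subtype.ext ((coe_basisIncl β _).trans
    (subst_X (hasSubst_of_mem_ordGE fun i => X_mem_ordGE_one (A := R) (β i)) i))

theorem evalChi_basisIncl (P : MvPowerSeries σ R) : evalChi F β (basisIncl β P) = P := by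
  have : ((evalChi F β).comp (basisIncl β)).toRingHom = RingHom.id _ := by
    have hX : ∀ i, evalChi F β (basisIncl β (X i)) = X i := fun i => by
      rw [basisIncl_X]
      exact (evalChi_var F β _).trans (chi_basis F β i)
    refine ringHom_ext_of_mem_ordGE (fun i => ?_) hX
      fun a => ((evalChi F β).comp (basisIncl β)).commutes a
    change evalChi F β (basisIncl β (X i)) ∈ _
    rw [hX]
    exact X_mem_ordGE_one i
  exact RingHom.congr_fun this P

omit [F.IsComm] in
theorem basisIncl_formalAdd {a b : MvPowerSeries σ R} (ha : a ∈ ordGE R σ 1)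
    (hb : b ∈ ordGE R σ 1) :
    basisIncl β (F.toPowerSeries.subst ![a, b]) =
      (⟨_, formalAdd_mem_powerSeriesCompletion F (basisIncl β a).2 (basisIncl β b).2
        (basisIncl_mem_ordGE β ha) (basisIncl_mem_ordGE β hb)⟩ : powerSeriesCompletion R M) := by
  refine Subtype.ext ((coe_basisIncl β _).trans ?_)
  have hs := hasSubst_of_mem_ordGE fun i => X_mem_ordGE_one (A := R) (β i)
  rw [subst_comp_subst_apply (hasSubst_vec ha hb) hs]
  congr 1
  funext i
  fin_cases i
  · exact (coe_basisIncl β a).symm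
  · exact (coe_basisIncl β b).symm

/-- Modulo the relations, `x_m` is the series `χ(m)` in the basis variables. -/
theorem formalVar_sub_basisIncl_mem (m : M) :
    formalVar R m - basisIncl β (chi F β m).val ∈ closedRelationIdeal F M := by
  have hvar : ∀ m : M, ((formalVar R m : powerSeriesCompletion R M) : MvPowerSeries M R) ∈
      ordGE R M 1 := fun m => X_mem_ordGE_one m
  have hchi : ∀ m, ((basisIncl β (chi F β m).val : powerSeriesCompletion R M) : MvPowerSeries M R) ∈
      ordGE R M 1 := fun m => basisIncl_mem_ordGE β (chi F β m).val_mem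
  have hrel : ∀ l m : M, (⟨_, formalAdd_mem_powerSeriesCompletion F (formalVar R l).2
      (formalVar R m).2 (hvar l) (hvar m)⟩ : powerSeriesCompletion R M) - formalVar R (l + m) ∈
      closedRelationIdeal F M := fun l m =>
    relationIdeal_le_closed F (Ideal.subset_span (Or.inr ⟨l, m, rfl⟩))
  have hzero : (formalVar R (0 : M) : powerSeriesCompletion R M) ∈ closedRelationIdeal F M :=
    relationIdeal_le_closed F (Ideal.subset_span (Or.inl rfl))
  have hchiadd : ∀ l m, basisIncl β (chi F β (l + m)).val =
      (⟨_, formalAdd_mem_powerSeriesCompletion F (basisIncl β (chi F β l).val).2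
        (basisIncl β (chi F β m).val).2 (hchi l) (hchi m)⟩ : powerSeriesCompletion R M) := by
    intro l m
    rw [chi_add, basisIncl_formalAdd F β (chi F β l).val_mem (chi F β m).val_mem]
  let D : AddSubgroup M :=
    { carrier := {m | formalVar R m - basisIncl β (chi F β m).val ∈ closedRelationIdeal F M}
      zero_mem' := by
        change formalVar R 0 - basisIncl β (chi F β 0).val ∈ closedRelationIdeal F M
        rw [chi_zero, map_zero, sub_zero]
        exact hzero
      add_mem' := by
        intro l m hl hm
        have h1 := formalAdd_congr F (hvar l) (hvar m) (hchi l) (hchi m) hl hm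
        have h2 := sub_mem h1 (hrel l m)
        change formalVar R (l + m) - basisIncl β (chi F β (l + m)).val ∈ closedRelationIdeal F M
        rw [hchiadd]
        convert h2 using 1
        ring
      neg_mem' := by
        intro m hm
        change formalVar R (-m) - basisIncl β (chi F β (-m)).val ∈ closedRelationIdeal F M
        set c := basisIncl β (chi F β m).val
        set c' := basisIncl β (chi F β (-m)).val
        have hself : ∀ z : powerSeriesCompletion R M, z - z ∈ closedRelationIdeal F M := fun z => by
          rw [sub_self]
          exact Ideal.zero_mem _
        -- `F(x_{-m}, c)` vanishes modulo the relations, where `c` represents `x_m`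
        have h1 : (⟨_, formalAdd_mem_powerSeriesCompletion F (formalVar R (-m)).2 c.2 (hvar (-m))
            (hchi m)⟩ : powerSeriesCompletion R M) - 0 ∈ closedRelationIdeal F M := by
          have h := formalAdd_congr F (hvar (-m)) (hvar m) (hvar (-m)) (hchi m) (hself _) hm
          have h' := hrel (-m) m
          rw [neg_add_cancel] at h'
          have h2 := add_mem (sub_mem h' h) hzero
          convert h2 using 1
          ring
        have h2 := formalAdd_congr F (formalAdd_mem F (hvar (-m)) (hchi m)) (hchi (-m))
          (Ideal.zero_mem _) (hchi (-m)) h1 (hself c')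
        have e1 : F.toPowerSeries.subst ![F.toPowerSeries.subst
            ![((formalVar R (-m) : powerSeriesCompletion R M) : MvPowerSeries M R), c.1], c'.1] =
            ((formalVar R (-m) : powerSeriesCompletion R M) : MvPowerSeries M R) := by
          rw [F.assoc' (powerSeries_hasSubst (hvar _)) (powerSeries_hasSubst (hchi _))
            (powerSeries_hasSubst (hchi _))]
          have h3 := hchiadd m (-m)
          rw [add_neg_cancel, chi_zero, map_zero] at h3
          have h4 := congrArg Subtype.val h3
          rw [← show (0 : MvPowerSeries M R) = F.toPowerSeries.subst ![c.1, c'.1] from h4]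
          exact F.add_zero (powerSeries_hasSubst (hvar _))
        have e2 : F.toPowerSeries.subst ![(0 : MvPowerSeries M R), c'.1] = c'.1 :=
          F.zero_add (powerSeries_hasSubst (hchi _))
        convert h2 using 2
        · exact Subtype.ext e1.symm
        · exact Subtype.ext e2.symm }
  have hD : Submodule.span ℤ (Set.range β) ≤ AddSubgroup.toIntSubmodule D := by
    refine Submodule.span_le.mpr ?_
    rintro _ ⟨i, rfl⟩
    change formalVar R (β i) - basisIncl β (chi F β (β i)).val ∈ closedRelationIdeal F M
    rw [chi_basis, basisIncl_X, sub_self]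
    exact Ideal.zero_mem _
  rw [β.span_eq] at hD
  exact hD (Submodule.mem_top (x := m))

theorem sub_basisIncl_mem (f : powerSeriesCompletion R M) :
    f - basisIncl β (evalChi F β f) ∈ closedRelationIdeal F M := by
  refine mem_closedRelationIdeal_of_forall F fun n => ?_
  obtain ⟨p, hp⟩ := exists_truncation f.2 n
  let p' : powerSeriesCompletion R M := MvPolynomial.aeval (formalVar R) p
  have hp' : (p' : MvPowerSeries M R) = p := by
    refine (MvPolynomial.comp_aeval_apply _ (powerSeriesCompletion R M).val p).trans ?_
    have h := subst_coe (S := R) (a := (X : M → MvPowerSeries M R)) p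
    rw [subst_self] at h
    exact h.symm
  refine ⟨p' - basisIncl β (MvPolynomial.aeval (fun m => (chi F β m).val) p), ?_, ?_⟩
  · refine Ideal.Quotient.eq.mp ?_
    refine (MvPolynomial.comp_aeval_apply _ (FormalGroupAlgebra.mk F M)
      p).trans (Eq.trans ?_ (MvPolynomial.comp_aeval_apply _
        ((FormalGroupAlgebra.mk F M).comp (basisIncl β)) p).symm)
    congr 2
    funext m
    exact Ideal.Quotient.eq.mpr (formalVar_sub_basisIncl_mem F β m)
  · have h1 := basisIncl_mem_ordGE β (evalHom_sub_mem (fun m => (chi F β m).val)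
      (fun m => (chi F β m).val_mem) hp)
    have h2 := sub_mem hp h1
    rw [← hp'] at h2
    convert h2 using 1
    rw [map_sub]
    change (f : MvPowerSeries M R) - _ - (_ - _) = _ - (_ - _)
    change (f : MvPowerSeries M R) - _ - (_ - _) = _ - ((evalChi F β f |> basisIncl β).1 - _)
    ring

theorem coord_bijective : Function.Bijective (coord F β) := by
  constructor
  · refine (injective_iff_map_eq_zero _).mpr fun f hf => ?_
    obtain ⟨f, rfl⟩ := Ideal.Quotient.mk_surjective f
    have h := sub_basisIncl_mem F β f
    rw [show evalChi F β f = 0 from hf, map_zero, sub_zero] at h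
    exact Ideal.Quotient.eq_zero_iff_mem.mpr h
  · intro P
    exact ⟨FormalGroupAlgebra.mk F M (basisIncl β P), evalChi_basisIncl F β P⟩

/-- The formal group algebra of a free module is a power series ring in the `x_{β i}`, for `β` a
basis. -/
def coordEquiv : FormalGroupAlgebra F M ≃ₐ[R] MvPowerSeries σ R :=
  AlgEquiv.ofBijective (coord F β) (coord_bijective F β)

theorem coordEquiv_x (m : M) : coordEquiv F β (x F m) = (chi F β m).val := coord_x F β m

theorem coordEquiv_x_basis (i : σ) : coordEquiv F β (x F (β i)) = X i :=
  (coordEquiv_x F β _).trans (chi_basis F β i)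

theorem constantCoeff_coordEquiv (f : FormalGroupAlgebra F M) :
    constantCoeff (coordEquiv F β f) = augmentation F M f := by
  obtain ⟨f, rfl⟩ := Ideal.Quotient.mk_surjective f
  change constantCoeff (evalChi F β f) = constantTerm R M f
  have h : f - algebraMap R _ (constantTerm R M f) ∈ orderIdeal R M 1 := by
    refine mem_ordGE_one.mpr ?_
    change constantTerm R M (f - algebraMap R _ (constantTerm R M f)) = 0
    rw [map_sub, AlgHom.commutes]
    exact sub_self _
  have h2 := mem_ordGE_one.mp (evalHom_mem_ordGE (fun m => (chi F β m).val)
    (fun m => (chi F β m).val_mem) h)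
  rw [map_sub, map_sub, sub_eq_zero] at h2
  refine h2.trans ?_
  rw [AlgHom.commutes]
  simp [MvPowerSeries.algebraMap_apply]

theorem ordGE_one_pow (n : ℕ) : ordGE R σ 1 ^ n = ordGE R σ n := by
  have := Fintype.ofFinite σ
  induction n with
  | zero =>
    rw [pow_zero, Ideal.one_eq_top]
    exact (Ideal.eq_top_iff_one _).mpr (mem_ordGE_zero 1) |>.symm
  | succ n ih =>
    refine le_antisymm ?_ ?_
    · rw [pow_succ, ih]
      exact Ideal.mul_le.mpr fun f hf g hg => mul_mem_ordGE hf hg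
    · intro f hf
      obtain ⟨q, hq, rfl⟩ := exists_sum_X_mul hf
      rw [pow_succ', ih]
      exact sum_mem fun i _ => Ideal.mul_mem_mul (X_mem_ordGE_one i) (hq i)

/-- In coordinates, the powers of the augmentation ideal are the ideals of series of given order. -/
theorem mem_augIdeal_pow_iff {n : ℕ} {f : FormalGroupAlgebra F M} :
    f ∈ augIdeal F M ^ n ↔ coordEquiv F β f ∈ ordGE R σ n := by
  have h1 : (augIdeal F M).map (coordEquiv F β).toRingEquiv = ordGE R σ 1 := by
    ext g
    rw [Ideal.mem_map_of_equiv]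
    constructor
    · rintro ⟨f, hf, rfl⟩
      refine mem_ordGE_one.mpr ?_
      exact (constantCoeff_coordEquiv F β f).trans hf
    · intro hg
      refine ⟨(coordEquiv F β).symm g, ?_, (coordEquiv F β).apply_symm_apply g⟩
      refine (constantCoeff_coordEquiv F β _).symm.trans ?_
      rw [AlgEquiv.apply_symm_apply]
      exact mem_ordGE_one.mp hg
  rw [← ordGE_one_pow, ← h1, ← Ideal.map_pow, Ideal.mem_map_of_equiv]
  constructor
  · intro hf
    exact ⟨f, hf, rfl⟩
  · rintro ⟨g, hg, h⟩
    rwa [← (coordEquiv F β).injective h]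

end Coordinates

/-! ### Divided differences of power series -/

section DividedDifference

open MvPowerSeries

variable {A : Type*} [CommRing A] {σ τ : Type*}

theorem prod_pow_sub_eq_mul {a b : σ → MvPowerSeries τ A} (ha : ∀ s, a s ∈ ordGE A τ 1)
    (hb : ∀ s, b s ∈ ordGE A τ 1) {c : MvPowerSeries τ A} {q : σ → MvPowerSeries τ A}
    (hq : ∀ s, a s - b s = c * q s) (d : σ →₀ ℕ) :
    ∃ Q ∈ ordGE A τ (d.degree - 1),
      d.prod (fun s n => a s ^ n) - d.prod (fun s n => b s ^ n) = c * Q := by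
  classical
  have key : ∀ d e : σ →₀ ℕ,
      (∃ Q ∈ ordGE A τ (d.degree - 1),
        d.prod (fun s n => a s ^ n) - d.prod (fun s n => b s ^ n) = c * Q) →
      (∃ Q ∈ ordGE A τ (e.degree - 1),
        e.prod (fun s n => a s ^ n) - e.prod (fun s n => b s ^ n) = c * Q) →
      ∃ Q ∈ ordGE A τ ((d + e).degree - 1),
        (d + e).prod (fun s n => a s ^ n) - (d + e).prod (fun s n => b s ^ n) = c * Q := by
    rintro d e ⟨Q, hQ, h⟩ ⟨Q', hQ', h'⟩
    refine ⟨d.prod (fun s n => a s ^ n) * Q' + Q * e.prod (fun s n => b s ^ n), ?_, ?_⟩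
    · rw [map_add]
      exact add_mem (ordGE_anti (by omega) (mul_mem_ordGE (prod_pow_mem_ordGE ha d) hQ'))
        (ordGE_anti (by omega) (mul_mem_ordGE hQ (prod_pow_mem_ordGE hb e)))
    · rw [Finsupp.prod_add_index' (by simp) (by simp [pow_add]),
        Finsupp.prod_add_index' (by simp) (by simp [pow_add])]
      linear_combination (d.prod fun s n => a s ^ n) * h' + (e.prod fun s n => b s ^ n) * h
  induction d using Finsupp.induction_linear with
  | zero => exact ⟨0, Ideal.zero_mem _, by simp⟩
  | add d e hd he => exact key d e hd he
  | single s n =>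
    induction n with
    | zero => exact ⟨0, Ideal.zero_mem _, by simp⟩
    | succ n ih =>
      rw [Finsupp.single_add]
      refine key _ _ ih ⟨q s, ?_, ?_⟩
      · rw [Finsupp.degree_single]
        exact mem_ordGE_zero _
      · rw [Finsupp.prod_single_index (by simp), Finsupp.prod_single_index (by simp), pow_one,
          pow_one, hq]

/-- If `a s - b s` is divisible by `c` for all `s`, then so is `f(a) - f(b)`, and the quotient has
order at least `j - 1` if `f` has order at least `j`. -/
theorem subst_sub_subst_eq_mul [Finite σ] {j : ℕ} {f : MvPowerSeries σ A} (hf : f ∈ ordGE A σ j)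
    {a b : σ → MvPowerSeries τ A} (ha : ∀ s, a s ∈ ordGE A τ 1) (hb : ∀ s, b s ∈ ordGE A τ 1)
    {c : MvPowerSeries τ A} {q : σ → MvPowerSeries τ A} (hq : ∀ s, a s - b s = c * q s) :
    ∃ Q ∈ ordGE A τ (j - 1), f.subst a - f.subst b = c * Q := by
  classical
  choose Q hQ hQe using prod_pow_sub_eq_mul ha hb hq
  have hfin : ∀ (e : τ →₀ ℕ) (r : A),
      (Function.support fun d => r * (coeff d f * coeff e (Q d))).Finite := by
    intro e r
    refine (Finsupp.finite_of_degree_le (e.degree + 1)).subset fun d hd => ?_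
    by_contra hlt
    refine hd ?_
    change r * (coeff d f * coeff e (Q d)) = 0
    rw [hQ d e (by simp at hlt; omega), mul_zero, mul_zero]
  have hA := hasSubst_of_mem_ordGE ha
  have hB := hasSubst_of_mem_ordGE hb
  let q' : MvPowerSeries τ A := fun e => ∑ᶠ d, coeff d f * coeff e (Q d)
  refine ⟨q', ?_, ?_⟩
  · intro e he
    refine finsum_eq_zero_of_forall_eq_zero fun d => ?_
    rcases lt_or_ge d.degree j with h | h
    · rw [hf d h, zero_mul]
    · rw [hQ d e (by omega), mul_zero]
  · ext e
    rw [map_sub, coeff_subst hA, coeff_subst hB,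
      ← finsum_sub_distrib (coeff_subst_finite hA f e) (coeff_subst_finite hB f e), coeff_mul]
    have h1 : ∀ p ∈ Finset.HasAntidiagonal.antidiagonal e, coeff p.1 c * coeff p.2 q' =
        ∑ᶠ d, coeff p.1 c * (coeff d f * coeff p.2 (Q d)) := by
      intro p _
      exact mul_finsum' _ _ (show (Function.support _).Finite by simpa using hfin p.2 1)
    rw [Finset.sum_congr rfl h1, ← finsum_sum_comm (Finset.HasAntidiagonal.antidiagonal e)
      (fun d p => coeff p.1 c * (coeff d f * coeff p.2 (Q d))) fun p _ => hfin p.2 (coeff p.1 c)]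
    refine finsum_congr fun d => ?_
    rw [← smul_sub, ← map_sub, hQe, coeff_mul, smul_eq_mul, Finset.mul_sum]
    refine Finset.sum_congr rfl fun p _ => ?_
    ring

end DividedDifference

/-! ### The elements `x_m` of a formal group algebra -/

section Elements

open MvPowerSeries FormalGroupAlgebra

variable {R : Type*} [CommRing R] (F : FormalGroup R) [F.IsComm] {M : Type*} [AddCommGroup M]
  [Module.Finite ℤ M] [Module.Free ℤ M]

theorem x_zero : x F (0 : M) = 0 := by
  let β := Module.Free.chooseBasis ℤ M
  refine (coordEquiv F β).injective ?_
  rw [coordEquiv_x, chi_zero, map_zero]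

theorem exists_x_add (l m : M) : ∃ v, x F (l + m) = x F l + x F m + x F l * x F m * v := by
  let β := Module.Free.chooseBasis ℤ M
  obtain ⟨V, hV⟩ := formalGroup_exists_eq_add_mul F
  have hs := hasSubst_vec (chi F β l).val_mem (chi F β m).val_mem
  refine ⟨(coordEquiv F β).symm (V.subst ![(chi F β l).val, (chi F β m).val]), ?_⟩
  refine (coordEquiv F β).injective ?_
  rw [coordEquiv_x, chi_add, hV, map_add, map_add, map_mul, map_mul, AlgEquiv.apply_symm_apply,
    coordEquiv_x, coordEquiv_x, subst_add hs, subst_add hs, subst_mul hs, subst_mul hs, subst_X hs,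
    subst_X hs]
  rfl

omit [F.IsComm] [Module.Finite ℤ M] [Module.Free ℤ M] in
theorem augmentation_x (m : M) : augmentation F M (x F m) = 0 := x_mem_augIdeal F m

theorem isUnit_of_augmentation {u : FormalGroupAlgebra F M} (hu : IsUnit (augmentation F M u)) :
    IsUnit u := by
  let β := Module.Free.chooseBasis ℤ M
  rw [← constantCoeff_coordEquiv F β, ← isUnit_iff_constantCoeff] at hu
  simpa using hu

theorem eq_zero_of_forall_mem_augIdeal_pow {f : FormalGroupAlgebra F M}
    (hf : ∀ n, f ∈ augIdeal F M ^ n) : f = 0 := by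
  let β := Module.Free.chooseBasis ℤ M
  refine (coordEquiv F β).injective ?_
  rw [map_zero]
  refine eq_of_forall_sub_mem_ordGE fun n => ?_
  rw [sub_zero]
  exact (mem_augIdeal_pow_iff F β).mp (hf n)

/-- `x_l - x_m` and `x_{l - m}` differ by a unit. -/
theorem exists_x_sub_x (l m : M) :
    ∃ u, augmentation F M u = 1 ∧ x F l - x F m = x F (l - m) * u := by
  obtain ⟨v, hv⟩ := exists_x_add F (l - m) m
  rw [sub_add_cancel] at hv
  refine ⟨1 + x F m * v, ?_, by rw [hv]; ring⟩
  rw [map_add, map_mul, augmentation_x, map_one, zero_mul, add_zero]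

theorem associated_x_sub_x (l m : M) : Associated (x F (l - m)) (x F l - x F m) := by
  obtain ⟨u, hu, h⟩ := exists_x_sub_x F l m
  have hu' : IsUnit u := isUnit_of_augmentation F (by rw [hu]; exact isUnit_one)
  exact ⟨hu'.unit, h.symm⟩

theorem associated_x_neg (m : M) : Associated (x F (-m)) (x F m) := by
  have := associated_x_sub_x F 0 m
  rw [zero_sub, x_zero, zero_sub] at this
  exact this.neg_right |> fun h => by simpa using h

theorem exists_x_add_x_neg (m : M) : ∃ v, x F m + x F (-m) = x F m * x F (-m) * v := by
  obtain ⟨v, hv⟩ := exists_x_add F m (-m)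
  rw [add_neg_cancel, x_zero] at hv
  exact ⟨-v, by linear_combination -hv⟩

/-- `x_{k α}` is `k x_α` up to terms of higher order divisible by `x_α`. -/
theorem exists_x_zsmul (k : ℤ) (α : M) :
    ∃ q, augmentation F M q = k ∧ x F (k • α) = x F α * q := by
  have hnat : ∀ k : ℕ, ∃ q, augmentation F M q = k ∧ x F (k • α) = x F α * q := by
    intro k
    induction k with
    | zero => exact ⟨0, by simp, by rw [zero_smul, x_zero, mul_zero]⟩
    | succ k ih =>
      obtain ⟨q, hq, h⟩ := ih
      obtain ⟨v, hv⟩ := exists_x_add F (k • α) α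
      refine ⟨q + 1 + q * x F α * v, ?_, ?_⟩
      · rw [map_add, map_add, map_mul, map_mul, augmentation_x, hq]
        simp
      · rw [succ_nsmul, hv, h]
        ring
  obtain ⟨n, rfl | rfl⟩ := Int.eq_nat_or_neg k
  · obtain ⟨q, hq, h⟩ := hnat n
    exact ⟨q, by simpa using hq, by rw [← h, natCast_zsmul]⟩
  · obtain ⟨q, hq, h⟩ := hnat n
    obtain ⟨u, hu, hu'⟩ := exists_x_sub_x F 0 (n • α)
    have hunit : IsUnit u := isUnit_of_augmentation F (by rw [hu]; exact isUnit_one)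
    obtain ⟨u, rfl⟩ := hunit
    rw [x_zero, zero_sub, zero_sub, h] at hu'
    have hinv : augmentation F M (↑u⁻¹ : FormalGroupAlgebra F M) = 1 := by
      have := congrArg (augmentation F M) (u.mul_inv)
      rwa [map_mul, hu, one_mul, map_one] at this
    refine ⟨-q * ↑u⁻¹, ?_, ?_⟩
    · rw [map_mul, map_neg, hq, hinv]
      simp
    · rw [neg_smul, natCast_zsmul, ← mul_assoc, mul_neg, hu', mul_assoc, u.mul_inv, mul_one]

theorem exists_x_add_zsmul (m : M) (k : ℤ) (α : M) :
    ∃ q, augmentation F M q = k ∧ x F (m + k • α) = x F m + x F α * q := by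
  obtain ⟨u, hu, h⟩ := exists_x_sub_x F (m + k • α) m
  obtain ⟨q, hq, h'⟩ := exists_x_zsmul F k α
  refine ⟨q * u, by rw [map_mul, hu, hq, mul_one], ?_⟩
  rw [add_sub_cancel_left, h', sub_eq_iff_eq_add'] at h
  rw [h, mul_assoc]

variable {R' : Type*} [CommRing R'] {F' : FormalGroup R'} [F'.IsComm] {N : Type*} [AddCommGroup N]
  [Module.Finite ℤ N] [Module.Free ℤ N]

/-- Ring homomorphisms between formal group algebras are determined by their values at constants
and at the `x_m`. -/
theorem formalGroupAlgebra_ringHom_ext {φ ψ : FormalGroupAlgebra F M →+* FormalGroupAlgebra F' N}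
    (hφ : ∀ m, φ (x F m) ∈ augIdeal F' N) (hx : ∀ m, φ (x F m) = ψ (x F m))
    (hC : ∀ a, φ (algebraMap R _ a) = ψ (algebraMap R _ a)) : φ = ψ := by
  let β := Module.Free.chooseBasis ℤ M
  let β' := Module.Free.chooseBasis ℤ N
  have hsymm : ∀ i, (coordEquiv F β).symm (X i) = x F (β i) := fun i => by
    rw [AlgEquiv.symm_apply_eq, coordEquiv_x_basis]
  have hsymmC : ∀ a, (coordEquiv F β).symm (C a) = algebraMap R _ a := fun a =>
    (coordEquiv F β).symm.commutes a
  have h : ((coordEquiv F' β').toRingEquiv.toRingHom.comp φ).comp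
      (coordEquiv F β).symm.toRingEquiv.toRingHom =
      ((coordEquiv F' β').toRingEquiv.toRingHom.comp ψ).comp
      (coordEquiv F β).symm.toRingEquiv.toRingHom := by
    refine ringHom_ext_of_mem_ordGE (fun i => ?_) (fun i => ?_) fun a => ?_
    · change coordEquiv F' β' (φ ((coordEquiv F β).symm (X i))) ∈ _
      rw [hsymm, ← mem_augIdeal_pow_iff, pow_one]
      exact hφ _
    · change coordEquiv F' β' (φ ((coordEquiv F β).symm (X i))) =
        coordEquiv F' β' (ψ ((coordEquiv F β).symm (X i)))
      rw [hsymm, hx]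
    · change coordEquiv F' β' (φ ((coordEquiv F β).symm (C a))) =
        coordEquiv F' β' (ψ ((coordEquiv F β).symm (C a)))
      rw [hsymmC, hC]
  refine RingHom.ext fun f => (coordEquiv F' β').injective ?_
  have := RingHom.congr_fun h (coordEquiv F β f)
  change coordEquiv F' β' (φ ((coordEquiv F β).symm (coordEquiv F β f))) =
    coordEquiv F' β' (ψ ((coordEquiv F β).symm (coordEquiv F β f))) at this
  rwa [AlgEquiv.symm_apply_apply] at this

omit [F.IsComm] [Module.Finite ℤ M] [Module.Free ℤ M] [Module.Finite ℤ N] [Module.Free ℤ N] in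
theorem augIdeal_pow_map (e : M ≃+ N) {n : ℕ} {f : FormalGroupAlgebra F M}
    (hf : f ∈ augIdeal F M ^ n) : FormalGroupAlgebra.map F e f ∈ augIdeal F N ^ n := by
  have h : augIdeal F M ≤ (augIdeal F N).comap (FormalGroupAlgebra.map F e) := by
    intro f hf
    have : (augmentation F N).comp (FormalGroupAlgebra.map F e) = augmentation F M := by
      refine AlgHom.ext fun f => ?_
      obtain ⟨f, rfl⟩ := Ideal.Quotient.mk_surjective f
      exact constantCoeff_rename (f := (e : M ≃ N)) (f : MvPowerSeries M R)
    exact (AlgHom.congr_fun this f).trans hf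
  exact (Ideal.pow_right_mono h n).trans (Ideal.le_comap_pow _ n) hf

/-- If `c` divides `x_m - φ(x_m)` for all `m`, then it divides `f - φ(f)` for all `f`, with a quotient
in `I ^ (j - 1)` if `f ∈ I ^ j`. -/
theorem exists_sub_algHom_eq_mul (φ : FormalGroupAlgebra F M →ₐ[R] FormalGroupAlgebra F M)
    (hφ : ∀ m, φ (x F m) ∈ augIdeal F M) {c : FormalGroupAlgebra F M}
    (hc : ∀ m, c ∣ x F m - φ (x F m)) {j : ℕ} {f : FormalGroupAlgebra F M}
    (hf : f ∈ augIdeal F M ^ j) : ∃ q ∈ augIdeal F M ^ (j - 1), f - φ f = c * q := by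
  let β := Module.Free.chooseBasis ℤ M
  have hb : ∀ i, coordEquiv F β (φ (x F (β i))) ∈ ordGE R _ 1 := fun i => by
    rw [← mem_augIdeal_pow_iff, pow_one]
    exact hφ _
  have hs := hasSubst_of_mem_ordGE hb
  choose q hq using fun i => hc (β i)
  have hq' : ∀ i, (X i : MvPowerSeries _ R) - coordEquiv F β (φ (x F (β i))) =
      coordEquiv F β c * coordEquiv F β (q i) := by
    intro i
    rw [← map_mul, ← hq, map_sub, coordEquiv_x_basis]
  obtain ⟨Q, hQ, h⟩ := subst_sub_subst_eq_mul ((mem_augIdeal_pow_iff F β).mp hf)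
    (fun i => X_mem_ordGE_one i) hb hq'
  refine ⟨(coordEquiv F β).symm Q, ?_, ?_⟩
  · rw [mem_augIdeal_pow_iff F β, AlgEquiv.apply_symm_apply]
    exact hQ
  · refine (coordEquiv F β).injective ?_
    rw [map_mul, AlgEquiv.apply_symm_apply, ← h, subst_self, id, map_sub]
    congr 1
    have hcomp : ((coordEquiv F β).toAlgHom.comp (φ.comp
        (coordEquiv F β).symm.toAlgHom)).toRingHom = (substAlgHom (R := R) hs).toRingHom := by
      have hX : ∀ i, coordEquiv F β (φ ((coordEquiv F β).symm (X i))) =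
          coordEquiv F β (φ (x F (β i))) := fun i => by
        rw [← coordEquiv_x_basis F β i, AlgEquiv.symm_apply_apply]
      refine ringHom_ext_of_mem_ordGE (fun i => ?_) (fun i => ?_) fun a => ?_
      · change coordEquiv F β (φ ((coordEquiv F β).symm (X i))) ∈ _
        rw [hX]
        exact hb i
      · refine (hX i).trans ?_
        exact (substAlgHom_X hs i).symm
      · exact (((coordEquiv F β).toAlgHom.comp (φ.comp
          (coordEquiv F β).symm.toAlgHom)).commutes a).trans ((substAlgHom (R := R) hs).commutes a).symm
    have := RingHom.congr_fun hcomp (coordEquiv F β f)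
    change coordEquiv F β (φ ((coordEquiv F β).symm (coordEquiv F β f))) =
      substAlgHom hs (coordEquiv F β f) at this
    rwa [AlgEquiv.symm_apply_apply, substAlgHom_apply] at this

/-- For an automorphism `e` of the form `m ↦ m - k(m) α`, the difference of `f` and `e(f)` is
divisible by `x_α`, with a quotient in `I ^ (j - 1)` if `f ∈ I ^ j`. -/
theorem exists_sub_map_eq_mul (e : M ≃+ M) (α : M) (k : M → ℤ) (he : ∀ m, e m = m - k m • α)
    {j : ℕ} {f : FormalGroupAlgebra F M} (hf : f ∈ augIdeal F M ^ j) :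
    ∃ q ∈ augIdeal F M ^ (j - 1), f - FormalGroupAlgebra.map F e f = x F α * q := by
  refine exists_sub_algHom_eq_mul F (FormalGroupAlgebra.map F e) (fun m => ?_) (fun m => ?_) hf
  · rw [map_x]
    exact x_mem_augIdeal F _
  · obtain ⟨q, -, h⟩ := exists_x_add_zsmul F m (-k m) α
    refine ⟨-q, ?_⟩
    rw [map_x, he, sub_eq_add_neg m, ← neg_smul, h]
    ring

omit [Module.Finite ℤ M] [Module.Free ℤ M] in
/-- If `x_m` divides `x_{m'}` then the coordinates of `m'` are proportional to those of `m`. -/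
theorem exists_repr_eq_mul_of_x_dvd_x {σ : Type*} [Finite σ] (β : Module.Basis σ ℤ M) {m m' : M}
    (h : x F m ∣ x F m') : ∃ r : R, ∀ i, ((β.repr m' i : ℤ) : R) = r * ((β.repr m i : ℤ) : R) := by
  classical
  obtain ⟨q, hq⟩ := h
  refine ⟨constantCoeff (coordEquiv F β q), fun i => ?_⟩
  rw [← coeff_single_chi F β, ← coeff_single_chi F β, ← coordEquiv_x, ← coordEquiv_x, hq, map_mul]
  have h1 : coordEquiv F β (x F m) * coordEquiv F β q - C (constantCoeff (coordEquiv F β q)) *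
      coordEquiv F β (x F m) ∈ ordGE R σ 2 := by
    have h2 : coordEquiv F β q - C (constantCoeff (coordEquiv F β q)) ∈ ordGE R σ 1 :=
      mem_ordGE_one.mpr (by simp)
    have h3 : coordEquiv F β (x F m) ∈ ordGE R σ 1 := by
      rw [coordEquiv_x]
      exact (chi F β m).val_mem
    have := mul_mem_ordGE h3 h2
    convert this using 1
    ring
  have h4 := h1 (Finsupp.single i 1) (by simp)
  rwa [map_sub, coeff_C_mul, sub_eq_zero] at h4

/-- Functoriality for change of the coefficient ring and additive maps of the lattice. -/
theorem exists_formalGroupAlgebra_hom (p : R →+* R') (hp : F.map p = F') (φ : M →+ N) :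
    ∃ j : FormalGroupAlgebra F M →+* FormalGroupAlgebra F' N,
      (∀ m, j (x F m) = x F' (φ m)) ∧ ∀ a, j (algebraMap R _ a) = algebraMap R' _ (p a) := by
  let β := Module.Free.chooseBasis ℤ M
  let β' := Module.Free.chooseBasis ℤ N
  have hb : ∀ i, (chi F' β' (φ (β i))).val ∈ ordGE R' _ 1 := fun i => (chi F' β' (φ (β i))).val_mem
  have hs := hasSubst_of_mem_ordGE hb
  let u : MvPowerSeries _ R →+* MvPowerSeries _ R' :=
    (substAlgHom (R := R') hs).toRingHom.comp (MvPowerSeries.map p)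
  have hu : ∀ i, u (X i) = (chi F' β' (φ (β i))).val := by
    intro i
    change substAlgHom hs (MvPowerSeries.map p (X i)) = _
    rw [map_X, substAlgHom_X]
  have hu1 : ∀ i, u (X i) ∈ ordGE R' _ 1 := fun i => by
    rw [hu]
    exact hb i
  have huC : ∀ a, u (C a) = C (p a) := by
    intro a
    change substAlgHom hs (MvPowerSeries.map p (C a)) = _
    rw [map_C]
    exact (substAlgHom (R := R') hs).commutes (p a)
  have hchi : ∀ m, u (chi F β m).val = (chi F' β' (φ m)).val := by
    refine eq_of_basis F' β (fun m => ringHom_mem_ordGE u hu1 (chi F β m).val_mem)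
      (fun m => (chi F' β' (φ m)).val_mem) (fun l m => ?_) (fun l m => ?_) fun i => ?_
    · rw [chi_add, ringHom_subst_vec u p hu1 huC (chi F β l).val_mem (chi F β m).val_mem]
      rw [← hp]
      rfl
    · rw [map_add, chi_add]
    · rw [chi_basis, hu]
  refine ⟨((coordEquiv F' β').symm.toRingEquiv.toRingHom.comp u).comp
    (coordEquiv F β).toRingEquiv.toRingHom, fun m => ?_, fun a => ?_⟩
  · change (coordEquiv F' β').symm (u (coordEquiv F β (x F m))) = _
    rw [coordEquiv_x, hchi, ← coordEquiv_x, AlgEquiv.symm_apply_apply]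
  · change (coordEquiv F' β').symm (u (coordEquiv F β (algebraMap R _ a))) = _
    rw [AlgEquiv.commutes]
    change (coordEquiv F' β').symm (u (C a)) = _
    rw [huC]
    exact (coordEquiv F' β').symm.commutes (p a)

end Elements

/-! ### Regular and prime elements -/

section Regular

open MvPowerSeries FormalGroupAlgebra

variable {R : Type*} [CommRing R] {σ : Type*}

theorem X_prime [IsDomain R] (i : σ) : Prime (X i : MvPowerSeries σ R) := by
  classical
  let e : {j // j ≠ i} ↪ σ := Function.Embedding.subtype _
  have hker : ∀ f : MvPowerSeries σ R, X i ∣ f ↔ killCompl e f = 0 := by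
    intro f
    rw [X_dvd_iff]
    constructor
    · intro h
      ext d
      rw [coeff_killCompl, map_zero]
      refine h _ ?_
      rw [Finsupp.embDomain_of_notMem_range]
      rintro ⟨j, hj⟩
      exact j.2 hj
    · intro h d hd
      have hd' : d = Finsupp.embDomain e (Finsupp.subtypeDomain (· ≠ i) d) := by
        ext j
        by_cases hj : j = i
        · rw [hj, hd, Finsupp.embDomain_of_notMem_range]
          rintro ⟨k, hk⟩
          exact k.2 hk
        · exact (Finsupp.embDomain_apply_self e (Finsupp.subtypeDomain (· ≠ i) d) ⟨j, hj⟩).symm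
      rw [hd', ← coeff_killCompl, h, map_zero]
  refine ⟨?_, ?_, ?_⟩
  · intro h
    have h2 := congrArg (coeff (Finsupp.single i 1)) h
    simp [coeff_X] at h2
  · intro h
    rw [isUnit_iff_constantCoeff] at h
    simp at h
  · intro f g h
    rw [hker, map_mul, mul_eq_zero] at h
    rwa [hker, hker]

theorem X_isRegular (i : σ) : IsRegular (X i : MvPowerSeries σ R) := by
  refine isRegular_iff_mem_nonZeroDivisors.mpr (mem_nonZeroDivisors_iff_right.mpr fun f hf => ?_)
  ext d
  have := congrArg (coeff (d + Finsupp.single i 1)) hf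
  rwa [X, coeff_add_mul_monomial, mul_one, map_zero] at this

variable (F : FormalGroup R) [F.IsComm] {M : Type*} [AddCommGroup M]
  [Module.Finite ℤ M] [Module.Free ℤ M]

theorem isRegular_of_ringEquiv {A B : Type*} [CommRing A] [CommRing B] (e : A ≃+* B) {a : A}
    (h : IsRegular (e a)) : IsRegular a := by
  rw [← isLeftRegular_iff_isRegular]
  intro b c hbc
  refine e.injective (h.left ?_)
  change e a * e b = e a * e c
  rw [← map_mul, ← map_mul]
  exact congrArg e hbc

omit [Module.Finite ℤ M] [Module.Free ℤ M] in
theorem x_basis_isRegular [Finite σ] (β : Module.Basis σ ℤ M) (i : σ) : IsRegular (x F (β i)) := by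
  refine isRegular_of_ringEquiv (coordEquiv F β).toRingEquiv ?_
  change IsRegular (coordEquiv F β (x F (β i)))
  rw [coordEquiv_x_basis]
  exact X_isRegular i

omit [Module.Finite ℤ M] [Module.Free ℤ M] in
theorem x_basis_prime [IsDomain R] [Finite σ] (β : Module.Basis σ ℤ M) (i : σ) :
    Prime (x F (β i)) := by
  rw [← MulEquiv.prime_iff (coordEquiv F β).toRingEquiv.toMulEquiv]
  change Prime (coordEquiv F β (x F (β i)))
  rw [coordEquiv_x_basis]
  exact X_prime i

variable {N : Type*} [AddCommGroup N]

/-- An isomorphism of lattices induces a ring isomorphism of formal group algebras. -/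
def formalGroupAlgebraEquiv (e : M ≃+ N) : FormalGroupAlgebra F M ≃+* FormalGroupAlgebra F N :=
  RingEquiv.ofRingHom (FormalGroupAlgebra.map F e).toRingHom
    (FormalGroupAlgebra.map F e.symm).toRingHom
    (RingHom.ext fun f => by
      change FormalGroupAlgebra.map F e (FormalGroupAlgebra.map F e.symm f) = f
      rw [← map_trans, AddEquiv.symm_trans_self, map_refl])
    (RingHom.ext fun f => by
      change FormalGroupAlgebra.map F e.symm (FormalGroupAlgebra.map F e f) = f
      rw [← map_trans, AddEquiv.self_trans_symm, map_refl])

/-- The automorphism `(n, m) ↦ (n, m + n α)` of `ℤ × M`. -/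
def shearEquiv (α : M) : ℤ × M ≃+ ℤ × M where
  toFun p := (p.1, p.2 + p.1 • α)
  invFun p := (p.1, p.2 - p.1 • α)
  left_inv p := by simp
  right_inv p := by simp
  map_add' p q := by
    refine Prod.ext rfl ?_
    simp [add_smul]
    abel

/-- The elements `x_{α - γ}` and `x_γ` correspond under an automorphism, up to a unit. -/
theorem associated_shear (α : M) :
    Associated (formalGroupAlgebraEquiv F (shearEquiv α) (x F ((0 : ℤ), α) - x F ((1 : ℤ), (0 : M))))
      (x F ((1 : ℤ), (0 : M))) := by
  have h1 := associated_x_sub_x F ((0 : ℤ), α) ((1 : ℤ), (0 : M))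
  have h2 := h1.symm.map (formalGroupAlgebraEquiv F (shearEquiv α)).toRingHom
  refine h2.trans ?_
  change Associated (FormalGroupAlgebra.map F (shearEquiv α) (x F (((0 : ℤ), α) - ((1 : ℤ), (0 : M)))))
    _
  rw [map_x]
  have h3 : shearEquiv α (((0 : ℤ), α) - ((1 : ℤ), (0 : M))) = -((1 : ℤ), (0 : M)) := by
    refine Prod.ext ?_ ?_ <;> simp [shearEquiv]
  rw [h3]
  exact associated_x_neg F _

/-- The basis of `ℤ × M` that extends a basis of `M` by `γ = (1, 0)`. -/
def gammaBasis (β : Module.Basis σ ℤ M) : Module.Basis (Unit ⊕ σ) ℤ (ℤ × M) :=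
  (Module.Basis.singleton Unit ℤ).prod β

omit [Module.Finite ℤ M] [Module.Free ℤ M] in
theorem gammaBasis_inl (β : Module.Basis σ ℤ M) :
    gammaBasis β (Sum.inl ()) = ((1 : ℤ), (0 : M)) := by
  simp [gammaBasis]

omit [Module.Finite ℤ M] [Module.Free ℤ M] in
theorem gammaBasis_inr (β : Module.Basis σ ℤ M) (i : σ) :
    gammaBasis β (Sum.inr i) = ((0 : ℤ), β i) := by
  simp [gammaBasis]

theorem xGamma_isRegular : IsRegular (x F ((1 : ℤ), (0 : M))) := by
  have := x_basis_isRegular F (gammaBasis (Module.Free.chooseBasis ℤ M)) (Sum.inl ())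
  rwa [gammaBasis_inl] at this

theorem isRegular_of_associated {A : Type*} [CommRing A] {a c : A} (h : Associated a c)
    (ha : IsRegular a) : IsRegular c := by
  obtain ⟨u, rfl⟩ := h
  exact ha.mul u.isUnit.isRegular

theorem xRoot_sub_xGamma_isRegular (α : M) :
    IsRegular (x F ((0 : ℤ), α) - x F ((1 : ℤ), (0 : M))) :=
  isRegular_of_ringEquiv (formalGroupAlgebraEquiv F (shearEquiv α))
    (isRegular_of_associated (associated_shear F α).symm (xGamma_isRegular F))

theorem xGamma_prime [IsDomain R] : Prime (x F ((1 : ℤ), (0 : M))) := by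
  have := x_basis_prime F (gammaBasis (Module.Free.chooseBasis ℤ M)) (Sum.inl ())
  rwa [gammaBasis_inl] at this

theorem xRoot_sub_xGamma_prime [IsDomain R] (α : M) :
    Prime (x F ((0 : ℤ), α) - x F ((1 : ℤ), (0 : M))) := by
  rw [← MulEquiv.prime_iff (formalGroupAlgebraEquiv F (shearEquiv α)).toMulEquiv]
  exact (associated_shear F α).symm.prime (xGamma_prime F)

/-- If `x_α` is regular in `R⟦M⟧_F`, it is regular in `R⟦ℤ × M⟧_F`: the latter is a ring of power
series in `x_γ` over the former. -/
theorem x_zero_isRegular {α : M} (hα : IsRegular (x F α)) : IsRegular (x F ((0 : ℤ), α)) := by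
  have hid : F.map (RingHom.id R) = F := by
    refine FormalGroup.ext ?_
    change MvPowerSeries.map (RingHom.id R) F.toPowerSeries = _
    rw [MvPowerSeries.map_id]
    rfl
  obtain ⟨j, hj, hjC⟩ := exists_formalGroupAlgebra_hom F (RingHom.id R) hid (AddMonoidHom.snd ℤ M)
  obtain ⟨i, hi, hiC⟩ := exists_formalGroupAlgebra_hom F (RingHom.id R) hid (AddMonoidHom.inr ℤ M)
  let φ : FormalGroupAlgebra F (ℤ × M) →ₐ[R] FormalGroupAlgebra F (ℤ × M) :=
    { i.comp j with
      commutes' := fun a => by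
        change i (j (algebraMap R _ a)) = _
        rw [hjC, hiC]
        rfl }
  have hφ : ∀ p : ℤ × M, φ (x F p) = x F ((0 : ℤ), p.2) := fun p => by
    change i (j (x F p)) = _
    rw [hj, hi]
    rfl
  -- `f - φ(f)` is a multiple of `x_γ`
  have hdvd : ∀ f, j f = 0 → ∃ q, f = x F ((1 : ℤ), (0 : M)) * q := by
    intro f hf
    obtain ⟨q, -, hq⟩ := exists_sub_algHom_eq_mul F φ (fun p => by
      rw [hφ]
      exact x_mem_augIdeal F _) (c := x F ((1 : ℤ), (0 : M))) (fun p => by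
        obtain ⟨q, -, hq⟩ := exists_x_add_zsmul F ((0 : ℤ), p.2) p.1 ((1 : ℤ), (0 : M))
        refine ⟨q, ?_⟩
        rw [hφ, sub_eq_iff_eq_add', ← hq]
        congr 1
        refine Prod.ext ?_ ?_ <;> simp) (j := 0) (f := f) (by simp)
    refine ⟨q, ?_⟩
    rw [← hq]
    change f = f - i (j f)
    rw [hf, map_zero, sub_zero]
  have hzero : ∀ n f, x F ((0 : ℤ), α) * f = 0 →
      ∃ q, f = x F ((1 : ℤ), (0 : M)) ^ n * q ∧ x F ((0 : ℤ), α) * q = 0 := by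
    intro n
    induction n with
    | zero => exact fun f hf => ⟨f, by simp, hf⟩
    | succ n ih =>
      intro f hf
      obtain ⟨q, rfl, hq⟩ := ih f hf
      have h1 : j q = 0 := by
        have := congrArg j hq
        rw [map_mul, hj, map_zero] at this
        exact hα.left.mul_left_eq_zero_iff.mp this
      obtain ⟨r, rfl⟩ := hdvd q h1
      refine ⟨r, by ring, ?_⟩
      rw [mul_left_comm] at hq
      exact (xGamma_isRegular F).left.mul_left_eq_zero_iff.mp hq
  rw [← isLeftRegular_iff_isRegular, isLeftRegular_iff_right_eq_zero_of_mul]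
  intro f hf
  refine eq_zero_of_forall_mem_augIdeal_pow F fun n => ?_
  obtain ⟨q, rfl, -⟩ := hzero n f hf
  exact Ideal.mul_mem_right _ _ (Ideal.pow_mem_pow (x_mem_augIdeal F _) n)

end Regular

/-! ### Combinatorics of the Weyl group -/

section Weyl

variable {ι Λ Λ' : Type*} [AddCommGroup Λ] [AddCommGroup Λ'] (P : RootDatum ι Λ Λ')

theorem weyl_ext {v w : P.weylGroup} (h : ∀ m : Λ, v • m = w • m) : v = w :=
  Subtype.ext (RootPairing.Equiv.weightHom_injective P (LinearEquiv.ext h))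

theorem simpleRefl_smul (i : ι) (m : Λ) : simpleRefl P i • m = P.reflection i m := rfl

theorem simpleRefl_perm (i j : ι) :
    P.weylGroupToPerm (simpleRefl P i) j = P.reflectionPerm i j := rfl

theorem simpleRefl_mul_self (i : ι) : simpleRefl P i * simpleRefl P i = 1 := by
  refine weyl_ext P fun m => ?_
  rw [mul_smul, simpleRefl_smul, simpleRefl_smul, one_smul]
  simp

theorem simpleRefl_inv (i : ι) : (simpleRefl P i)⁻¹ = simpleRefl P i :=
  inv_eq_of_mul_eq_one_left (simpleRefl_mul_self P i)

theorem simpleRefl_mul_cancel (i : ι) (w : P.weylGroup) :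
    simpleRefl P i * (simpleRefl P i * w) = w := by
  rw [← mul_assoc, simpleRefl_mul_self, one_mul]

theorem simpleRefl_reflectionPerm (i j : ι) : simpleRefl P (P.reflectionPerm i j) =
    simpleRefl P i * simpleRefl P j * simpleRefl P i := by
  refine weyl_ext P fun m => ?_
  rw [mul_smul, mul_smul, simpleRefl_smul, simpleRefl_smul, simpleRefl_smul, simpleRefl_smul,
    RootPairing.reflection_reflectionPerm]
  rfl

/-- The index of the root `-α`. -/
abbrev negIdx (i : ι) : ι := P.reflectionPerm i i

theorem root_negIdx (i : ι) : P.root (negIdx P i) = -P.root i := by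
  simp [negIdx]

theorem negIdx_negIdx (i : ι) : negIdx P (negIdx P i) = i := by
  refine P.root.injective ?_
  rw [root_negIdx, root_negIdx, neg_neg]

theorem perm_negIdx (w : P.weylGroup) (i : ι) :
    P.weylGroupToPerm w (negIdx P i) = negIdx P (P.weylGroupToPerm w i) := by
  refine P.root.injective ?_
  rw [root_negIdx, ← RootPairing.weylGroup_apply_root, ← RootPairing.weylGroup_apply_root,
    root_negIdx, smul_neg]

theorem simpleRefl_negIdx (i : ι) : simpleRefl P (negIdx P i) = simpleRefl P i := by
  rw [simpleRefl_reflectionPerm, simpleRefl_mul_self, one_mul]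

theorem simpleRefl_perm_mul (i j : ι) (w : P.weylGroup) :
    simpleRefl P (P.reflectionPerm i j) * (simpleRefl P i * w) =
      simpleRefl P i * (simpleRefl P j * w) := by
  rw [simpleRefl_reflectionPerm, mul_assoc, mul_assoc, simpleRefl_mul_cancel]

theorem perm_mul (v w : P.weylGroup) (i : ι) :
    P.weylGroupToPerm (v * w) i = P.weylGroupToPerm v (P.weylGroupToPerm w i) := by
  rw [map_mul]
  rfl

variable {P} (b : P.Base)

/-- The product of the simple reflections in a word. -/
def wordProd (I : List b.support) : P.weylGroup := (I.map fun i => simpleRefl P i).prod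

theorem wordProd_nil : wordProd b [] = 1 := rfl

theorem wordProd_cons (i : b.support) (I : List b.support) :
    wordProd b (i :: I) = simpleRefl P i * wordProd b I := List.prod_cons

theorem wordProd_append (I J : List b.support) :
    wordProd b (I ++ J) = wordProd b I * wordProd b J := by
  simp [wordProd]

theorem isPos_negIdx (i : ι) : b.IsPos (negIdx P i) ↔ ¬ b.IsPos i :=
  RootPairing.Base.IsPos.neg_iff_not b i

variable [Finite ι] [P.IsReduced]

/-- The simple reflections generate the Weyl group. -/
theorem exists_wordProd_eq (w : P.weylGroup) : ∃ I, wordProd b I = w := by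
  let H : Subgroup P.weylGroup :=
    { carrier := Set.range (wordProd b)
      one_mem' := ⟨[], rfl⟩
      mul_mem' := by
        rintro _ _ ⟨I, rfl⟩ ⟨J, rfl⟩
        exact ⟨I ++ J, wordProd_append b I J⟩
      inv_mem' := by
        rintro _ ⟨I, rfl⟩
        refine ⟨I.reverse, ?_⟩
        induction I with
        | nil => simp [wordProd]
        | cons i I ih =>
          rw [List.reverse_cons, wordProd_append, ih, wordProd_cons, wordProd_cons, wordProd_nil,
            mul_one, mul_inv_rev, simpleRefl_inv] }
  have hrefl : ∀ i, simpleRefl P i ∈ H := by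
    intro i
    refine b.induction_reflect i (p := fun i => simpleRefl P i ∈ H) (fun i hi => ?_)
      (fun i hi => ?_) fun i j hi hj => ?_
    · change simpleRefl P (negIdx P i) ∈ H
      rwa [simpleRefl_negIdx]
    · exact ⟨[⟨i, hi⟩], by rw [wordProd_cons, wordProd_nil, mul_one]⟩
    · have hj' : simpleRefl P j ∈ H := ⟨[⟨j, hj⟩], by rw [wordProd_cons, wordProd_nil, mul_one]⟩
      rw [simpleRefl_reflectionPerm]
      exact mul_mem (mul_mem hj' hi) hj'
  suffices ∀ (w : P.Aut) (hw : w ∈ P.weylGroup), (⟨w, hw⟩ : P.weylGroup) ∈ H from this w.1 w.2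
  intro w hw
  induction hw using RootPairing.weylGroup.induction with
  | mem i => exact hrefl i
  | one => exact one_mem H
  | mul v w hv hw h1 h2 => exact mul_mem h1 h2

/-- The length: the minimal number of simple reflections in a word for `w`. -/
def len (w : P.weylGroup) : ℕ := sInf {n | ∃ I : List b.support, I.length = n ∧ wordProd b I = w}

theorem exists_reduced (w : P.weylGroup) : ∃ I, I.length = len b w ∧ wordProd b I = w := by
  obtain ⟨I, hI⟩ := exists_wordProd_eq b w
  exact Nat.sInf_mem (s := {n | ∃ I : List b.support, I.length = n ∧ wordProd b I = w})
    ⟨I.length, I, rfl, hI⟩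

omit [Finite ι] [P.IsReduced] in
theorem len_wordProd_le (I : List b.support) : len b (wordProd b I) ≤ I.length :=
  Nat.sInf_le ⟨I, rfl, rfl⟩

/-- Strong exchange: if `α > 0` and `u⁻¹ α < 0`, then a word for `s_α u` is obtained by deleting a
letter from any word for `u`. -/
theorem exists_exchange (I : List b.support) {α : ι} (hα : b.IsPos α)
    (hu : ¬ b.IsPos (P.weylGroupToPerm (wordProd b I)⁻¹ α)) :
    ∃ J : List b.support, J.length + 1 = I.length ∧
      wordProd b J = simpleRefl P α * wordProd b I := by
  induction I generalizing α with
  | nil =>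
    rw [wordProd_nil, inv_one, map_one] at hu
    exact absurd hα hu
  | cons i I ih =>
    by_cases h : α = i
    · refine ⟨I, rfl, ?_⟩
      rw [h, wordProd_cons, simpleRefl_mul_cancel]
    · have hpos : b.IsPos (P.reflectionPerm i α) := hα.reflectionPerm i.2 h
      rw [wordProd_cons, mul_inv_rev, simpleRefl_inv, perm_mul, simpleRefl_perm] at hu
      obtain ⟨J, hJ, hJ'⟩ := ih hpos hu
      refine ⟨i :: J, by simp [hJ], ?_⟩
      rw [wordProd_cons, hJ', wordProd_cons, ← simpleRefl_perm_mul]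
      congr 2
      simp

theorem len_refl_mul_lt {v : P.weylGroup} {α : ι} (hα : b.IsPos α)
    (hv : ¬ b.IsPos (P.weylGroupToPerm v⁻¹ α)) : len b (simpleRefl P α * v) < len b v := by
  obtain ⟨I, hI, rfl⟩ := exists_reduced b v
  obtain ⟨J, hJ, hJ'⟩ := exists_exchange b I hα hv
  rw [← hJ']
  have := len_wordProd_le b J
  omega

theorem len_lt_refl_mul {v : P.weylGroup} {α : ι} (hα : b.IsPos α)
    (hv : b.IsPos (P.weylGroupToPerm v⁻¹ α)) : len b v < len b (simpleRefl P α * v) := by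
  have := len_refl_mul_lt b (v := simpleRefl P α * v) hα (by
    rw [mul_inv_rev, simpleRefl_inv, perm_mul, simpleRefl_perm]
    change ¬ b.IsPos (P.weylGroupToPerm v⁻¹ (negIdx P α))
    rw [perm_negIdx, isPos_negIdx, not_not]
    exact hv)
  rwa [simpleRefl_mul_cancel] at this

theorem isPos_inv_iff {v : P.weylGroup} {α : ι} (hα : b.IsPos α) :
    b.IsPos (P.weylGroupToPerm v⁻¹ α) ↔ len b v < len b (simpleRefl P α * v) := by
  refine ⟨len_lt_refl_mul b hα, fun h => ?_⟩
  by_contra hn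
  exact absurd (len_refl_mul_lt b hα hn) (by omega)

/-- The first letter of a reduced word can be removed: what remains is reduced. -/
theorem reduced_of_cons {i : b.support} {I : List b.support}
    (h : (i :: I).length = len b (wordProd b (i :: I))) :
    I.length = len b (wordProd b I) ∧ len b (wordProd b (i :: I)) = len b (wordProd b I) + 1 ∧
      b.IsPos (P.weylGroupToPerm (wordProd b I)⁻¹ i) := by
  have h1 : len b (wordProd b (i :: I)) ≤ len b (wordProd b I) + 1 := by
    obtain ⟨J, hJ, hJ'⟩ := exists_reduced b (wordProd b I)
    have := len_wordProd_le b (i :: J)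
    rw [wordProd_cons, hJ'] at this
    rw [wordProd_cons, ← hJ]
    exact this
  have h2 := len_wordProd_le b I
  rw [List.length_cons] at h
  refine ⟨by omega, by omega, ?_⟩
  rw [isPos_inv_iff b (RootPairing.Base.isPos_of_mem_support i.2), ← wordProd_cons]
  omega

open scoped Classical in
/-- The inversion set: the positive roots `α` with `v⁻¹ α < 0`. -/
def inversions (v : P.weylGroup) : Finset ι :=
  (Set.toFinite {α | b.IsPos α ∧ ¬ b.IsPos (P.weylGroupToPerm v⁻¹ α)}).toFinset

omit [P.IsReduced] in
theorem mem_inversions {v : P.weylGroup} {α : ι} :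
    α ∈ inversions b v ↔ b.IsPos α ∧ ¬ b.IsPos (P.weylGroupToPerm v⁻¹ α) :=
  Set.Finite.mem_toFinset _

omit [P.IsReduced] in
theorem inversions_one : inversions b (1 : P.weylGroup) = ∅ := by
  ext α
  rw [mem_inversions, inv_one, map_one]
  simp

/-- If `v⁻¹ α_i > 0`, the inversion set of `s_i v` consists of `α_i` and of the image under `s_i` of
the inversion set of `v`. -/
theorem prod_inversions_mul {A : Type*} [CommMonoid A] (f : ι → A) (i : b.support)
    {v : P.weylGroup} (hv : b.IsPos (P.weylGroupToPerm v⁻¹ i)) :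
    ∏ β ∈ inversions b (simpleRefl P i * v), f β =
      f i * ∏ β ∈ inversions b v, f (P.reflectionPerm i β) := by
  classical
  have hi := RootPairing.Base.isPos_of_mem_support i.2
  have hne : ∀ β ∈ inversions b v, β ≠ i := by
    rintro β hβ rfl
    exact (mem_inversions b |>.mp hβ).2 hv
  have hset : inversions b (simpleRefl P i * v) =
      insert (i : ι) ((inversions b v).map (P.reflectionPerm i).toEmbedding) := by
    ext α
    rw [Finset.mem_insert, Finset.mem_map_equiv, mem_inversions, mem_inversions, mul_inv_rev,
      simpleRefl_inv, perm_mul, simpleRefl_perm]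
    have hsymm : (P.reflectionPerm i).symm α = P.reflectionPerm i α := by simp
    rw [hsymm]
    constructor
    · rintro ⟨h1, h2⟩
      by_cases h : α = i
      · exact Or.inl h
      · exact Or.inr ⟨h1.reflectionPerm i.2 h, h2⟩
    · rintro (rfl | ⟨h1, h2⟩)
      · refine ⟨hi, ?_⟩
        change ¬ b.IsPos (P.weylGroupToPerm v⁻¹ (negIdx P i))
        rw [perm_negIdx, isPos_negIdx, not_not]
        exact hv
      · refine ⟨?_, h2⟩
        have hne' : P.reflectionPerm i α ≠ i := hne _ (mem_inversions b |>.mpr ⟨h1, h2⟩)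
        have := h1.reflectionPerm i.2 hne'
        simpa using this
  rw [hset, Finset.prod_insert, Finset.prod_map]
  · rfl
  · rw [Finset.mem_map_equiv]
    intro h
    have h1 := (mem_inversions b |>.mp h).1
    have hsymm : (P.reflectionPerm i).symm (i : ι) = negIdx P i := by simp [negIdx]
    rw [hsymm, isPos_negIdx] at h1
    exact h1 hi

end Weyl

/-! ### Demazure-Lusztig operators on functions on the Weyl group -/

section Hop

variable {ι Λ Λ' : Type*} [AddCommGroup Λ] [AddCommGroup Λ'] {P : RootDatum ι Λ Λ'} (b : P.Base)
  {L : Type*} [CommRing L] [MulSemiringAction P.weylGroup L]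

/-- Left multiplication by `c_i + (1 - c_i) δ_i` in a twisted group algebra with coefficients in
`L`, an element of which is viewed as the function of its coefficients. -/
def hop (c : ι → L) (i : ι) (z : P.weylGroup → L) : P.weylGroup → L := fun u =>
  c i * z u + (1 - c i) * simpleRefl P i • z (simpleRefl P i * u)

open scoped Classical in
/-- The coefficients of the product of the `c_i + (1 - c_i) δ_i` along a word. -/
def hopWord (c : ι → L) (I : List b.support) : P.weylGroup → L :=
  I.foldr (fun (i : b.support) z => hop c (i : ι) z) (Pi.single 1 1)

theorem hopWord_cons (c : ι → L) (i : b.support) (I : List b.support) :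
    hopWord b c (i :: I) = hop c i (hopWord b c I) := rfl

theorem hopWord_support_finite (c : ι → L) (I : List b.support) :
    (Function.support (hopWord b c I)).Finite := by
  classical
  induction I with
  | nil => exact (Set.finite_singleton 1).subset (by
      intro u hu
      by_contra h
      exact hu (Pi.single_eq_of_ne h 1))
  | cons i I ih =>
    refine (ih.union (ih.image fun u => simpleRefl P i * u)).subset fun u hu => ?_
    by_contra h
    rw [Set.mem_union, not_or] at h
    refine hu ?_
    have h1 : hopWord b c I u = 0 := Function.notMem_support.mp h.1
    have h2 : hopWord b c I (simpleRefl P i * u) = 0 := by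
      by_contra h2
      exact h.2 ⟨_, h2, simpleRefl_mul_cancel P i u⟩
    rw [hopWord_cons, hop, h1, h2, smul_zero, mul_zero, mul_zero, add_zero]

/-- If all `c_i` are multiples of `g`, the product along a word is `δ_w` modulo `g`. -/
theorem exists_hopWord_eq_add (c d : ι → L) (g : L) (hg : ∀ w : P.weylGroup, w • g = g)
    (hc : ∀ i, c i = g * d i) (I : List b.support) [DecidableEq P.weylGroup] :
    ∃ r : P.weylGroup → L, ∀ u, hopWord b c I u =
      (Pi.single (wordProd b I) 1 : P.weylGroup → L) u + g * r u := by
  induction I with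
  | nil =>
    refine ⟨0, fun u => ?_⟩
    rw [Pi.zero_apply, mul_zero, add_zero, wordProd_nil, hopWord, List.foldr_nil]
    congr
  | cons i I ih =>
    obtain ⟨r, hr⟩ := ih
    refine ⟨fun u => d i * hopWord b c I u + simpleRefl P i • r (simpleRefl P i * u) -
      d i * simpleRefl P i • hopWord b c I (simpleRefl P i * u), fun u => ?_⟩
    have h1 : simpleRefl P i • (Pi.single (wordProd b I) 1 : P.weylGroup → L)
        (simpleRefl P i * u) = (Pi.single (wordProd b (i :: I)) 1 : P.weylGroup → L) u := by
      rw [wordProd_cons, Pi.single_apply, Pi.single_apply]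
      by_cases h : simpleRefl P i * u = wordProd b I
      · rw [if_pos h, if_pos, smul_one]
        rw [← h, simpleRefl_mul_cancel]
      · rw [if_neg h, if_neg, smul_zero]
        rintro rfl
        exact h (simpleRefl_mul_cancel P i _)
    have h2 : simpleRefl P i • hopWord b c I (simpleRefl P i * u) =
        (Pi.single (wordProd b (i :: I)) 1 : P.weylGroup → L) u +
          g * simpleRefl P i • r (simpleRefl P i * u) := by
      rw [hr, smul_add, smul_mul', hg, h1]
    rw [hopWord_cons, hop, hc]
    linear_combination h2

variable [Finite ι] [P.IsReduced]

omit [MulSemiringAction P.weylGroup L] in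
theorem len_mul_le (i : b.support) (u : P.weylGroup) :
    len b (simpleRefl P i * u) ≤ len b u + 1 := by
  obtain ⟨J, hJ, rfl⟩ := exists_reduced b u
  rw [← wordProd_cons, ← hJ]
  exact len_wordProd_le b (i :: J)

/-- Along a reduced word for `v`, the product is supported on `v` and on shorter elements. -/
theorem eq_or_len_lt_of_hopWord_ne_zero (c : ι → L) {I : List b.support}
    (hI : I.length = len b (wordProd b I)) {u : P.weylGroup} (hu : hopWord b c I u ≠ 0) :
    u = wordProd b I ∨ len b u < len b (wordProd b I) := by
  classical
  induction I generalizing u with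
  | nil =>
    refine Or.inl ?_
    by_contra h
    exact hu (Pi.single_eq_of_ne h 1)
  | cons i I ih =>
    obtain ⟨h1, h2, -⟩ := reduced_of_cons b hI
    rw [h2]
    by_cases h3 : hopWord b c I u = 0
    · by_cases h4 : hopWord b c I (simpleRefl P i * u) = 0
      · refine absurd ?_ hu
        rw [hopWord_cons, hop, h3, h4, smul_zero, mul_zero, mul_zero, add_zero]
      · rcases ih h1 h4 with h5 | h5
        · refine Or.inl ?_
          rw [wordProd_cons, ← h5, simpleRefl_mul_cancel]
        · refine Or.inr ?_
          have := len_mul_le b i (simpleRefl P i * u)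
          rw [simpleRefl_mul_cancel] at this
          omega
    · rcases ih h1 h3 with h5 | h5
      · exact Or.inr (by rw [h5]; omega)
      · exact Or.inr (by omega)

/-- Along a reduced word for `v`, the coefficient at `v` is the product of the `1 - c_β` over the
inversions `β` of `v`. -/
theorem hopWord_leading (c : ι → L) (hc : ∀ (w : P.weylGroup) i, w • c i = c (P.weylGroupToPerm w i))
    {I : List b.support} (hI : I.length = len b (wordProd b I)) :
    hopWord b c I (wordProd b I) = ∏ β ∈ inversions b (wordProd b I), (1 - c β) := by
  classical
  induction I with
  | nil =>
    rw [wordProd_nil, inversions_one, Finset.prod_empty]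
    exact Pi.single_eq_same 1 1
  | cons i I ih =>
    obtain ⟨h1, h2, h3⟩ := reduced_of_cons b hI
    have h4 : hopWord b c I (wordProd b (i :: I)) = 0 := by
      by_contra h
      rcases eq_or_len_lt_of_hopWord_ne_zero b c h1 h with h5 | h5
      · rw [h5] at h2
        omega
      · omega
    rw [hopWord_cons, hop, h4, mul_zero, zero_add, wordProd_cons, simpleRefl_mul_cancel, ih h1,
      prod_inversions_mul b _ i h3, Finset.smul_prod']
    congr 1
    refine Finset.prod_congr rfl fun β _ => ?_
    rw [smul_sub, smul_one, hc, simpleRefl_perm]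

end Hop

/-! ### Residue conditions -/

section Residues

variable {ι Λ Λ' : Type*} [AddCommGroup Λ] [AddCommGroup Λ'] {P : RootDatum ι Λ Λ'} (b : P.Base)
  {S : Type*} [CommRing S] [MulSemiringAction P.weylGroup S] (x : ι → S) (g : S)
  {L : Type*} [CommRing L] [Algebra S L] [MulSemiringAction P.weylGroup L]
  (xi : ι → L)

/-- The divisibility properties, in a domain with an action of the Weyl group, of a family `x` of
elements indexed by the roots and an invariant element `g` that make the residue argument work:
`x_α`, `g` and `x_α - g` are primes without unexpected associations. -/
structure IsPrimeFamily (x : ι → S) (g : S) : Prop where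
  smul_x : ∀ (w : P.weylGroup) i, w • x i = x (P.weylGroupToPerm w i)
  smul_g : ∀ w : P.weylGroup, w • g = g
  prime_x : ∀ i, Prime (x i)
  prime_g : Prime g
  prime_y : ∀ i, Prime (x i - g)
  not_x_dvd_x : ∀ i j, j ≠ i → j ≠ negIdx P i → ¬ x i ∣ x j
  not_g_dvd_x : ∀ i, ¬ g ∣ x i
  not_y_dvd_x : ∀ i j, ¬ x i - g ∣ x j
  not_y_dvd_y : ∀ i j, i ≠ j → ¬ x i - g ∣ x j - g
  dvd_sub_smul : ∀ i f, x i ∣ f - simpleRefl P i • f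
  dvd_add_neg : ∀ i, x i * x (negIdx P i) ∣ x i + x (negIdx P i)

/-- `L` is the localization of `S` at the `x_α`, with the induced action; `xi α` is `1 / x_α`. -/
structure IsRootLocalization (P : RootDatum ι Λ Λ') {S : Type*} [CommRing S]
    [MulSemiringAction P.weylGroup S] (x : ι → S)
    {L : Type*} [CommRing L] [Algebra S L] [MulSemiringAction P.weylGroup L]
    (xi : ι → L) : Prop where
  smul_algebraMap : ∀ (w : P.weylGroup) (f : S), w • algebraMap S L f = algebraMap S L (w • f)
  mul_xi : ∀ i, algebraMap S L (x i) * xi i = 1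
  surj : ∀ q : L, ∃ s ∈ Submonoid.closure (Set.range x), ∃ f, algebraMap S L s * q = algebraMap S L f
  inj : Function.Injective (algebraMap S L)

/-- The fractions whose denominators do not involve `x_α` and `x_{-α}`. -/
def intAt (P : RootDatum ι Λ Λ') (x : ι → S) (L : Type*) [CommRing L] [Algebra S L] (α : ι) :
    Subalgebra S L :=
  Algebra.adjoin S {q | ∃ β, β ≠ α ∧ β ≠ negIdx P α ∧ algebraMap S L (x β) * q = 1}

omit [MulSemiringAction (↥(RootPairing.weylGroup P)) S]
  [MulSemiringAction (↥(RootPairing.weylGroup P)) L] in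
theorem intAt_negIdx (α : ι) : intAt P x L (negIdx P α) = intAt P x L α := by
  rw [intAt, intAt]
  congr 1
  ext q
  refine exists_congr fun β => ?_
  rw [negIdx_negIdx]
  tauto

variable {x g xi} (hL : IsRootLocalization P x xi)

include hL

theorem xi_mem_intAt {α β : ι} (h1 : β ≠ α) (h2 : β ≠ negIdx P α) : xi β ∈ intAt P x L α :=
  Algebra.subset_adjoin ⟨β, h1, h2, hL.mul_xi β⟩

omit [MulSemiringAction (↥(RootPairing.weylGroup P)) S]
  [MulSemiringAction (↥(RootPairing.weylGroup P)) L] hL in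
theorem exists_denominator {α : ι} {q : L} (hq : q ∈ intAt P x L α) :
    ∃ s ∈ Submonoid.closure (x '' {β | β ≠ α ∧ β ≠ negIdx P α}), ∃ f,
      algebraMap S L s * q = algebraMap S L f := by
  induction hq using Algebra.adjoin_induction with
  | mem q hq =>
    obtain ⟨β, h1, h2, h3⟩ := hq
    exact ⟨x β, Submonoid.subset_closure ⟨β, ⟨h1, h2⟩, rfl⟩, 1, by rw [h3, map_one]⟩
  | algebraMap f => exact ⟨1, one_mem _, f, by rw [map_one, one_mul]⟩
  | add q r _ _ hq hr =>
    obtain ⟨s, hs, f, hf⟩ := hq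
    obtain ⟨t, ht, h, hh⟩ := hr
    refine ⟨s * t, mul_mem hs ht, t * f + s * h, ?_⟩
    rw [map_mul, map_add, map_mul, map_mul, ← hf, ← hh]
    ring
  | mul q r _ _ hq hr =>
    obtain ⟨s, hs, f, hf⟩ := hq
    obtain ⟨t, ht, h, hh⟩ := hr
    refine ⟨s * t, mul_mem hs ht, f * h, ?_⟩
    rw [map_mul, map_mul, ← hf, ← hh]
    ring

theorem mem_intAt_of_denominator {α : ι} {q : L} {s f : S}
    (hs : s ∈ Submonoid.closure (x '' {β | β ≠ α ∧ β ≠ negIdx P α}))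
    (h : algebraMap S L s * q = algebraMap S L f) : q ∈ intAt P x L α := by
  have hinv : ∃ t ∈ intAt P x L α, t * algebraMap S L s = 1 := by
    clear h
    induction hs using Submonoid.closure_induction with
    | mem s hs =>
      obtain ⟨β, ⟨h1, h2⟩, rfl⟩ := hs
      exact ⟨xi β, xi_mem_intAt hL h1 h2, by rw [mul_comm]; exact hL.mul_xi β⟩
    | one => exact ⟨1, one_mem _, by rw [map_one, one_mul]⟩
    | mul s s' _ _ h h' =>
      obtain ⟨t, ht, e⟩ := h
      obtain ⟨t', ht', e'⟩ := h'
      refine ⟨t * t', mul_mem ht ht', ?_⟩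
      rw [map_mul]
      linear_combination (t' * algebraMap S L s') * e + e'
  obtain ⟨t, ht, e⟩ := hinv
  have : q = t * algebraMap S L f := by rw [← h, ← mul_assoc, e, one_mul]
  rw [this]
  exact mul_mem ht (Subalgebra.algebraMap_mem _ f)

variable (hx : IsPrimeFamily (P := P) x g)

include hx

theorem smul_xi (w : P.weylGroup) (i : ι) : w • xi i = xi (P.weylGroupToPerm w i) := by
  have h1 : algebraMap S L (x (P.weylGroupToPerm w i)) * w • xi i = 1 := by
    rw [← hx.smul_x, ← hL.smul_algebraMap, ← smul_mul', hL.mul_xi, smul_one]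
  have h2 := hL.mul_xi (P.weylGroupToPerm w i)
  linear_combination xi (P.weylGroupToPerm w i) * h1 - (w • xi i) * h2

theorem smul_mem_intAt (w : P.weylGroup) {α : ι} {q : L} (hq : q ∈ intAt P x L α) :
    w • q ∈ intAt P x L (P.weylGroupToPerm w α) := by
  induction hq using Algebra.adjoin_induction with
  | mem q hq =>
    obtain ⟨β, h1, h2, h3⟩ := hq
    refine Algebra.subset_adjoin ⟨P.weylGroupToPerm w β, ?_, ?_, ?_⟩
    · exact fun h => h1 ((P.weylGroupToPerm w).injective h)
    · rw [← perm_negIdx]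
      exact fun h => h2 ((P.weylGroupToPerm w).injective h)
    · rw [← hx.smul_x, ← hL.smul_algebraMap, ← smul_mul', h3, smul_one]
  | algebraMap f =>
    rw [hL.smul_algebraMap]
    exact Subalgebra.algebraMap_mem _ _
  | add q r _ _ hq hr =>
    rw [smul_add]
    exact add_mem hq hr
  | mul q r _ _ hq hr =>
    rw [smul_mul']
    exact mul_mem hq hr

theorem simpleRefl_smul_mem_intAt {i : ι} {q : L} (hq : q ∈ intAt P x L i) :
    simpleRefl P i • q ∈ intAt P x L i := by
  have := smul_mem_intAt hL hx (simpleRefl P i) hq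
  rw [simpleRefl_perm] at this
  rwa [← intAt_negIdx]

theorem exists_sub_smul_eq (i : ι) {q : L} (hq : q ∈ intAt P x L i) :
    ∃ r ∈ intAt P x L i, q - simpleRefl P i • q = algebraMap S L (x i) * r := by
  induction hq using Algebra.adjoin_induction with
  | mem q hq =>
    obtain ⟨β, h1, h2, h3⟩ := hq
    have hq' : q ∈ intAt P x L i := Algebra.subset_adjoin ⟨β, h1, h2, h3⟩
    obtain ⟨t, ht⟩ := hx.dvd_sub_smul i (x β)
    have h4 : algebraMap S L (simpleRefl P i • x β) * simpleRefl P i • q = 1 := by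
      rw [← hL.smul_algebraMap, ← smul_mul', h3, smul_one]
    refine ⟨-(algebraMap S L t * (q * simpleRefl P i • q)), neg_mem (mul_mem
      (Subalgebra.algebraMap_mem _ _) (mul_mem hq' (simpleRefl_smul_mem_intAt hL hx hq'))), ?_⟩
    have h5 : algebraMap S L (x β) - algebraMap S L (simpleRefl P i • x β) =
        algebraMap S L (x i) * algebraMap S L t := by rw [← map_sub, ht, map_mul]
    linear_combination (-(q * simpleRefl P i • q)) * h5 + (simpleRefl P i • q) * h3 - q * h4
  | algebraMap f =>
    obtain ⟨t, ht⟩ := hx.dvd_sub_smul i f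
    exact ⟨algebraMap S L t, Subalgebra.algebraMap_mem _ _, by
      rw [hL.smul_algebraMap, ← map_sub, ht, map_mul]⟩
  | add q r _ _ hq hr =>
    obtain ⟨q', h1, h2⟩ := hq
    obtain ⟨r', h3, h4⟩ := hr
    exact ⟨q' + r', add_mem h1 h3, by rw [smul_add]; linear_combination h2 + h4⟩
  | mul q r hq0 hr0 hq hr =>
    obtain ⟨q', h1, h2⟩ := hq
    obtain ⟨r', h3, h4⟩ := hr
    exact ⟨q' * r + simpleRefl P i • q * r',
      add_mem (mul_mem h1 hr0) (mul_mem (simpleRefl_smul_mem_intAt hL hx hq0) h3), by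
        rw [smul_mul']
        linear_combination r * h2 + (simpleRefl P i • q) * h4⟩

omit hL [MulSemiringAction P.weylGroup L] [Algebra S L] in
theorem x_dvd_x_negIdx (i : ι) : x i ∣ x (negIdx P i) := by
  have h := hx.dvd_sub_smul i (x i)
  rw [hx.smul_x, simpleRefl_perm] at h
  exact (dvd_sub_right (dvd_refl _)).mp h

theorem add_smul_mem_intAt (i : ι) {q : L} (hq : algebraMap S L (x i) * q ∈ intAt P x L i) :
    q + simpleRefl P i • q ∈ intAt P x L i := by
  obtain ⟨r, hr, h⟩ := exists_sub_smul_eq hL hx i hq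
  obtain ⟨v, hv⟩ := hx.dvd_add_neg i
  have hp := simpleRefl_smul_mem_intAt hL hx hq
  rw [smul_mul', hL.smul_algebraMap, hx.smul_x, simpleRefl_perm] at h hp
  have h1 := hL.mul_xi i
  have h2 := hL.mul_xi (negIdx P i)
  have h3 : algebraMap S L (x i) + algebraMap S L (x (negIdx P i)) =
      algebraMap S L (x i) * algebraMap S L (x (negIdx P i)) * algebraMap S L v := by
    rw [← map_add, hv, map_mul, map_mul]
  have key : q + simpleRefl P i • q =
      r + algebraMap S L v * (algebraMap S L (x (negIdx P i)) * simpleRefl P i • q) := by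
    have h4 : algebraMap S L (x i) * (q + simpleRefl P i • q) = algebraMap S L (x i) *
        (r + algebraMap S L v * (algebraMap S L (x (negIdx P i)) * simpleRefl P i • q)) := by
      linear_combination h + simpleRefl P i • q * h3
    have h5 := congrArg (xi i * ·) h4
    simp only [← mul_assoc] at h5
    rw [mul_comm (xi i), h1, one_mul, one_mul] at h5
    rw [h5]
    ring
  rw [key]
  exact add_mem hr (mul_mem (Subalgebra.algebraMap_mem _ _) hp)

end Residues

section Residues

variable {ι Λ Λ' : Type*} [AddCommGroup Λ] [AddCommGroup Λ'] {P : RootDatum ι Λ Λ'} (b : P.Base)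
  {S : Type*} [CommRing S] [MulSemiringAction P.weylGroup S] (x : ι → S) (g : S)
  {L : Type*} [CommRing L] [Algebra S L] [MulSemiringAction P.weylGroup L]
  (xi : ι → L)

/-- The functions on the Weyl group that satisfy the residue conditions of Ginzburg, Kapranov and
Vasserot: simple poles along the `x_α`, opposite residues at `u` and `s_α u`, and zeros along
`x_α - g` at the `u` of which `α` is an inversion. -/
def residueModule (b : P.Base) (x : ι → S) (g : S) (L : Type*) [CommRing L] [Algebra S L] :
    Submodule S (P.weylGroup → L) where
  carrier := {z | (∀ α u, algebraMap S L (x α) * z u ∈ intAt P x L α) ∧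
    (∀ α u, z u + z (simpleRefl P α * u) ∈ intAt P x L α) ∧
    ∀ α u, b.IsPos α → ¬ b.IsPos (P.weylGroupToPerm u⁻¹ α) → algebraMap S L (x α - g) ∣ z u}
  add_mem' := by
    rintro z w ⟨h1, h2, h3⟩ ⟨h4, h5, h6⟩
    refine ⟨fun α u => ?_, fun α u => ?_, fun α u h h' => ?_⟩
    · rw [Pi.add_apply, mul_add]
      exact add_mem (h1 α u) (h4 α u)
    · rw [Pi.add_apply, Pi.add_apply, add_add_add_comm]
      exact add_mem (h2 α u) (h5 α u)
    · exact dvd_add (h3 α u h h') (h6 α u h h')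
  zero_mem' := by
    refine ⟨fun α u => ?_, fun α u => ?_, fun α u _ _ => dvd_zero _⟩
    · rw [Pi.zero_apply, mul_zero]
      exact zero_mem _
    · rw [Pi.zero_apply, Pi.zero_apply, add_zero]
      exact zero_mem _
  smul_mem' := by
    rintro s z ⟨h1, h2, h3⟩
    refine ⟨fun α u => ?_, fun α u => ?_, fun α u h h' => ?_⟩
    · rw [Pi.smul_apply, mul_smul_comm]
      exact Subalgebra.smul_mem _ (h1 α u) s
    · rw [Pi.smul_apply, Pi.smul_apply, ← smul_add]
      exact Subalgebra.smul_mem _ (h2 α u) s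
    · rw [Pi.smul_apply, Algebra.smul_def]
      exact (h3 α u h h').mul_left _

variable {x g xi}

omit [MulSemiringAction P.weylGroup S] [MulSemiringAction P.weylGroup L] in
theorem single_mem_residueModule [DecidableEq P.weylGroup] :
    (Pi.single 1 1 : P.weylGroup → L) ∈ residueModule b x g L := by
  have h (α : ι) (u : P.weylGroup) : (Pi.single 1 1 : P.weylGroup → L) u ∈ intAt P x L α := by
    rw [Pi.single_apply]
    split_ifs
    exacts [one_mem _, zero_mem _]
  refine ⟨fun α u => mul_mem (Subalgebra.algebraMap_mem _ _) (h α u),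
    fun α u => add_mem (h α u) (h α _), fun α u hα hu => ?_⟩
  rw [Pi.single_eq_of_ne]
  · exact dvd_zero _
  · rintro rfl
    rw [inv_one, map_one] at hu
    exact hu hα

omit [MulSemiringAction (↥(RootPairing.weylGroup P)) S]
  [MulSemiringAction (↥(RootPairing.weylGroup P)) L] in
theorem intAt_congr {x : ι → S} {i α : ι} (h : α = i ∨ α = negIdx P i) : intAt P x L α = intAt P x L i := by
  rcases h with rfl | rfl
  exacts [rfl, intAt_negIdx x i]

variable (hL : IsRootLocalization P x xi) (hx : IsPrimeFamily (P := P) x g)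

include hL

theorem one_sub_g_mul_xi (i : ι) :
    1 - algebraMap S L g * xi i = algebraMap S L (x i - g) * xi i := by
  rw [map_sub, sub_mul, hL.mul_xi]

include hx

/-- The residue conditions are preserved by the Demazure-Lusztig operators of the simple roots. -/
theorem hop_mem_residueModule [Finite ι] [P.IsReduced] {i : ι} (hi : i ∈ b.support)
    {z : P.weylGroup → L} (hz : z ∈ residueModule b x g L) :
    hop (fun i => algebraMap S L g * xi i) i z ∈ residueModule b x g L := by
  obtain ⟨h1, h2, h3⟩ := hz
  have hne {α : ι} (h : ¬ (α = i ∨ α = negIdx P i)) : algebraMap S L g * xi i ∈ intAt P x L α := by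
    refine mul_mem (Subalgebra.algebraMap_mem _ _) (xi_mem_intAt hL ?_ ?_)
    · exact fun h' => h (Or.inl h'.symm)
    · exact fun h' => h (Or.inr (by rw [h', negIdx_negIdx]))
  have hxi (α : ι) (h : α = i ∨ α = negIdx P i) : x i ∣ x α := by
    rcases h with rfl | rfl
    exacts [dvd_rfl, x_dvd_x_negIdx hx i]
  have hs (u : P.weylGroup) : algebraMap S L (x i) * simpleRefl P i • z u ∈ intAt P x L i := by
    have h4 := h1 (negIdx P i) u
    rw [intAt_negIdx] at h4
    have h5 := simpleRefl_smul_mem_intAt hL hx h4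
    rw [smul_mul', hL.smul_algebraMap, hx.smul_x, simpleRefl_perm] at h5
    rwa [show P.reflectionPerm i (negIdx P i) = i by simp] at h5
  have hr (α : ι) : P.weylGroupToPerm (simpleRefl P i) (P.weylGroupToPerm (simpleRefl P i) α) = α := by
    rw [← perm_mul, simpleRefl_mul_self, map_one]
    rfl
  refine ⟨fun α u => ?_, fun α u => ?_, fun α u hα hu => ?_⟩
  · by_cases h : α = i ∨ α = negIdx P i
    · rw [intAt_congr h]
      obtain ⟨r, hr⟩ := hxi α h
      have h4 : algebraMap S L (x α) * hop (fun i => algebraMap S L g * xi i) i z u =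
          algebraMap S L r * (algebraMap S L (x i) * simpleRefl P i • z (simpleRefl P i * u)
            + algebraMap S L g * ((z u + z (simpleRefl P i * u)) -
            (z (simpleRefl P i * u) + simpleRefl P i • z (simpleRefl P i * u)))) := by
        rw [hop, hr, map_mul]
        linear_combination algebraMap S L r * algebraMap S L g *
          (z u - simpleRefl P i • z (simpleRefl P i * u)) * hL.mul_xi i
      rw [h4]
      refine mul_mem (Subalgebra.algebraMap_mem _ _) (add_mem (hs _) (mul_mem
        (Subalgebra.algebraMap_mem _ _) (sub_mem (h2 i u) (add_smul_mem_intAt hL hx i (h1 i _)))))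
    · have h4 : algebraMap S L (x α) * simpleRefl P i • z (simpleRefl P i * u) ∈
          intAt P x L α := by
        have := smul_mem_intAt hL hx (simpleRefl P i)
          (h1 (P.weylGroupToPerm (simpleRefl P i) α) (simpleRefl P i * u))
        rwa [smul_mul', hL.smul_algebraMap, hx.smul_x, hr] at this
      rw [hop, mul_add, mul_left_comm, mul_left_comm (algebraMap S L (x α))]
      exact add_mem (mul_mem (hne h) (h1 α u)) (mul_mem (sub_mem (one_mem _) (hne h)) h4)
  · by_cases h : α = i ∨ α = negIdx P i
    · rw [intAt_congr h]
      have h5 : simpleRefl P α = simpleRefl P i := by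
        rcases h with rfl | rfl
        exacts [rfl, simpleRefl_negIdx P i]
      obtain ⟨r, hr, e⟩ := exists_sub_smul_eq hL hx i (h2 i u)
      have h6 : hop (fun i => algebraMap S L g * xi i) i z u +
          hop (fun i => algebraMap S L g * xi i) i z (simpleRefl P i * u) =
          simpleRefl P i • (z u + z (simpleRefl P i * u)) + algebraMap S L g * r := by
        rw [smul_add] at e ⊢
        rw [hop, hop, simpleRefl_mul_cancel]
        linear_combination algebraMap S L g * xi i * e + algebraMap S L g * r * hL.mul_xi i
      rw [h5, h6]
      exact add_mem (simpleRefl_smul_mem_intAt hL hx (h2 i u))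
        (mul_mem (Subalgebra.algebraMap_mem _ _) hr)
    · have h4 : simpleRefl P i • (z (simpleRefl P i * u) +
          z (simpleRefl P i * (simpleRefl P α * u))) ∈ intAt P x L α := by
        have := smul_mem_intAt hL hx (simpleRefl P i)
          (h2 (P.weylGroupToPerm (simpleRefl P i) α) (simpleRefl P i * u))
        rw [hr] at this
        convert this using 4
        rw [simpleRefl_perm]
        exact (simpleRefl_perm_mul P i α u).symm
      have h5 : hop (fun i => algebraMap S L g * xi i) i z u +
          hop (fun i => algebraMap S L g * xi i) i z (simpleRefl P α * u) =
          algebraMap S L g * xi i * (z u + z (simpleRefl P α * u)) +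
          (1 - algebraMap S L g * xi i) * simpleRefl P i • (z (simpleRefl P i * u) +
          z (simpleRefl P i * (simpleRefl P α * u))) := by
        rw [hop, hop, smul_add]
        ring
      rw [h5]
      exact add_mem (mul_mem (hne h) (h2 α u)) (mul_mem (sub_mem (one_mem _) (hne h)) h4)
  · refine dvd_add ((h3 α u hα hu).mul_left _) ?_
    by_cases h : α = i
    · subst h
      rw [one_sub_g_mul_xi hL]
      exact dvd_mul_of_dvd_left (dvd_mul_right _ _) _
    · have h4 : b.IsPos (P.weylGroupToPerm (simpleRefl P i) α) := by
        rw [simpleRefl_perm]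
        exact hα.reflectionPerm hi h
      obtain ⟨k, hk⟩ := h3 (P.weylGroupToPerm (simpleRefl P i) α) (simpleRefl P i * u) h4 (by
        rwa [← perm_mul, mul_inv_rev, simpleRefl_inv, mul_assoc, simpleRefl_mul_self, mul_one])
      refine Dvd.dvd.mul_left ⟨simpleRefl P i • k, ?_⟩ _
      rw [hk, smul_mul', hL.smul_algebraMap, smul_sub, hx.smul_x, hx.smul_g, hr]

theorem hopWord_mem_residueModule [Finite ι] [P.IsReduced] (I : List b.support) :
    hopWord b (fun i => algebraMap S L g * xi i) I ∈ residueModule b x g L := by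
  classical
  induction I with
  | nil =>
    convert single_mem_residueModule (x := x) (g := g) (L := L) b
    rw [hopWord, List.foldr_nil]
  | cons i I ih => exact hop_mem_residueModule b hL hx i.2 ih

omit hx in
theorem isUnit_of_mem_closure {s : S} (hs : s ∈ Submonoid.closure (Set.range x)) :
    IsUnit (algebraMap S L s) := by
  induction hs using Submonoid.closure_induction with
  | mem s hs =>
    obtain ⟨i, rfl⟩ := hs
    exact IsUnit.of_mul_eq_one _ (hL.mul_xi i)
  | one =>
    rw [map_one]
    exact isUnit_one
  | mul s t _ _ h h' =>
    rw [map_mul]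
    exact h.mul h'

omit hL hx [MulSemiringAction P.weylGroup S] in
theorem not_dvd_of_mem_closure {p : S} (hp : Prime p) {T : Set S} (hT : ∀ t ∈ T, ¬ p ∣ t)
    {s : S} (hs : s ∈ Submonoid.closure T) : ¬ p ∣ s := by
  induction hs using Submonoid.closure_induction with
  | mem s hs => exact hT s hs
  | one => exact fun h => hp.not_isUnit (isUnit_of_dvd_one h)
  | mul s t _ _ h h' => exact fun h'' => (hp.dvd_or_dvd h'').elim h h'

omit hx in
theorem dvd_of_algebraMap_dvd {p : S} (hp : Prime p) (hpx : ∀ i, ¬ p ∣ x i) {f : S}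
    (h : algebraMap S L p ∣ algebraMap S L f) : p ∣ f := by
  obtain ⟨k, hk⟩ := h
  obtain ⟨t, ht, k', hk'⟩ := hL.surj k
  have h1 : t * f = p * k' := by
    refine hL.inj ?_
    rw [map_mul, map_mul, hk, ← hk']
    ring
  exact (hp.dvd_or_dvd (Dvd.intro _ h1.symm)).resolve_left
    (not_dvd_of_mem_closure hp (by rintro _ ⟨i, rfl⟩; exact hpx i) ht)

omit hx in
theorem algebraMap_dvd_of_dvd_mul {p : S} (hp : Prime p) (hpx : ∀ i, ¬ p ∣ x i) {f : S}
    (hf : ¬ p ∣ f) {q : L} (h : algebraMap S L p ∣ algebraMap S L f * q) :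
    algebraMap S L p ∣ q := by
  obtain ⟨t, ht, k, hk⟩ := hL.surj q
  have h1 : algebraMap S L p ∣ algebraMap S L (f * k) := by
    rw [map_mul, ← hk, mul_left_comm]
    exact h.mul_left _
  have h2 := (hp.dvd_or_dvd (dvd_of_algebraMap_dvd hL hp hpx h1)).resolve_left hf
  have h3 := map_dvd (algebraMap S L) h2
  rw [← hk] at h3
  exact (isUnit_of_mem_closure hL ht).dvd_mul_left.mp h3

omit hL in
theorem not_y_dvd_g (i : ι) : ¬ x i - g ∣ g := fun h =>
  hx.not_y_dvd_x i i (by simpa using dvd_add (dvd_refl (x i - g)) h)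

variable [IsDomain L]

theorem mem_intAt_of_g_mul {α : ι} {q : L} (h : algebraMap S L g * q ∈ intAt P x L α) :
    q ∈ intAt P x L α := by
  obtain ⟨s, hs, f, hf⟩ := exists_denominator h
  have hs' : s ∈ Submonoid.closure (Set.range x) :=
    Submonoid.closure_mono (Set.image_subset_range _ _) hs
  have h1 : algebraMap S L g ∣ algebraMap S L f := by
    rw [← hf, mul_left_comm]
    exact dvd_mul_right _ _
  obtain ⟨f', rfl⟩ := dvd_of_algebraMap_dvd hL hx.prime_g hx.not_g_dvd_x h1
  refine mem_intAt_of_denominator hL hs (f := f') ?_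
  have hg : algebraMap S L g ≠ 0 := by
    rw [Ne, ← map_zero (algebraMap S L), hL.inj.eq_iff]
    exact hx.prime_g.ne_zero
  refine mul_left_cancel₀ hg ?_
  rw [← map_mul, ← hf]
  ring

theorem mem_residueModule_of_g_smul {z : P.weylGroup → L} (h : g • z ∈ residueModule b x g L) :
    z ∈ residueModule b x g L := by
  obtain ⟨h1, h2, h3⟩ := h
  refine ⟨fun α u => mem_intAt_of_g_mul hL hx ?_, fun α u => mem_intAt_of_g_mul hL hx ?_,
    fun α u hα hu => ?_⟩
  · have := h1 α u
    rwa [Pi.smul_apply, Algebra.smul_def, mul_left_comm] at this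
  · have := h2 α u
    rwa [Pi.smul_apply, Pi.smul_apply, ← smul_add, Algebra.smul_def] at this
  · have := h3 α u hα hu
    rw [Pi.smul_apply, Algebra.smul_def] at this
    exact algebraMap_dvd_of_dvd_mul hL (hx.prime_y α) (hx.not_y_dvd_x α) (not_y_dvd_g hx α) this

/-- A fraction without poles lies in `S`. -/
theorem exists_eq_algebraMap_of_mem_intAt {q : L} (hq : ∀ α, q ∈ intAt P x L α) :
    ∃ f, q = algebraMap S L f := by
  obtain ⟨t, ht, h, hh⟩ := hL.surj q
  induction ht using Submonoid.closure_induction generalizing q h with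
  | mem t ht =>
    obtain ⟨β, rfl⟩ := ht
    obtain ⟨s, hs, f, hf⟩ := exists_denominator (hq β)
    have h1 : s * h = x β * f := by
      refine hL.inj ?_
      rw [map_mul, map_mul, ← hf, ← hh]
      ring
    obtain ⟨h', rfl⟩ := ((hx.prime_x β).dvd_or_dvd (Dvd.intro _ h1.symm)).resolve_left
      (not_dvd_of_mem_closure (hx.prime_x β) (by
        rintro _ ⟨γ, ⟨h2, h3⟩, rfl⟩
        exact hx.not_x_dvd_x β γ h2 h3) hs)
    refine ⟨h', ?_⟩
    rw [map_mul] at hh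
    exact mul_left_cancel₀ (left_ne_zero_of_mul_eq_one (hL.mul_xi β)) hh
  | one => exact ⟨h, by rw [← hh, map_one, one_mul]⟩
  | mul t t' _ _ h1 h2 =>
    rw [map_mul, mul_assoc] at hh
    obtain ⟨f, hf⟩ := h1 (fun α => mul_mem (Subalgebra.algebraMap_mem _ _) (hq α)) h hh
    exact h2 hq f hf

variable [Finite ι] [P.IsReduced]

/-- The coefficient of a longest element `v` in the support of `z` is a multiple of the leading
coefficient of a product along a reduced word for `v`. -/
theorem exists_eq_mul_leading {z : P.weylGroup → L} (hz : z ∈ residueModule b x g L)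
    (v : P.weylGroup) (hv : ∀ u, len b v < len b u → z u = 0) :
    ∃ e : S, z v = algebraMap S L e * ∏ β ∈ inversions b v, (1 - algebraMap S L g * xi β) := by
  classical
  obtain ⟨h1, h2, h3⟩ := hz
  have hmem (α : ι) : z v * ∏ β ∈ inversions b v, algebraMap S L (x β) ∈ intAt P x L α := by
    obtain ⟨α', h4, h5⟩ : ∃ α', b.IsPos α' ∧ intAt P x L α = intAt P x L α' := by
      by_cases h : b.IsPos α
      · exact ⟨α, h, rfl⟩
      · exact ⟨negIdx P α, (isPos_negIdx b α).mpr h, (intAt_negIdx x α).symm⟩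
    rw [h5]
    by_cases h6 : α' ∈ inversions b v
    · rw [← Finset.mul_prod_erase _ _ h6, ← mul_assoc, mul_comm (z v)]
      exact mul_mem (h1 α' v) (prod_mem fun β _ => Subalgebra.algebraMap_mem _ _)
    · refine mul_mem ?_ (prod_mem fun β _ => Subalgebra.algebraMap_mem _ _)
      have h7 : b.IsPos (P.weylGroupToPerm v⁻¹ α') := by
        by_contra h
        exact h6 ((mem_inversions b).mpr ⟨h4, h⟩)
      have h8 := h2 α' v
      rwa [hv _ (len_lt_refl_mul b h4 h7), add_zero] at h8
  obtain ⟨f, hf⟩ := exists_eq_algebraMap_of_mem_intAt hL hx hmem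
  have hdvd : ∏ β ∈ inversions b v, (x β - g) ∣ f := by
    have : ∀ T ⊆ inversions b v, ∏ β ∈ T, (x β - g) ∣ f := by
      intro T
      induction T using Finset.induction_on with
      | empty => exact fun _ => by simp
      | insert β T hβ ih =>
        intro hT
        obtain ⟨k, hk⟩ := ih fun γ hγ => hT (Finset.mem_insert_of_mem hγ)
        obtain ⟨h4, h5⟩ := (mem_inversions b).mp (hT (Finset.mem_insert_self β T))
        have h6 : x β - g ∣ f := by
          refine dvd_of_algebraMap_dvd hL (hx.prime_y β) (hx.not_y_dvd_x β) ?_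
          rw [← hf]
          exact (h3 β v h4 h5).mul_right _
        rw [hk] at h6 ⊢
        rw [Finset.prod_insert hβ, mul_comm]
        refine mul_dvd_mul_left _ (((hx.prime_y β).dvd_or_dvd h6).resolve_left fun h7 => ?_)
        obtain ⟨γ, hγ, h8⟩ := (hx.prime_y β).exists_mem_finset_dvd h7
        exact hx.not_y_dvd_y β γ (fun h => hβ (h ▸ hγ)) h8
    exact this _ (Finset.Subset.refl _)
  obtain ⟨e, rfl⟩ := hdvd
  refine ⟨e, ?_⟩
  have h4 : (∏ β ∈ inversions b v, algebraMap S L (x β)) * ∏ β ∈ inversions b v, xi β = 1 := by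
    rw [← Finset.prod_mul_distrib]
    exact Finset.prod_eq_one fun β _ => hL.mul_xi β
  rw [Finset.prod_congr rfl fun β _ => one_sub_g_mul_xi hL β, Finset.prod_mul_distrib,
    ← map_prod]
  rw [map_mul] at hf
  linear_combination (∏ β ∈ inversions b v, xi β) * hf - z v * h4

/-- The products along reduced words span all functions that satisfy the residue conditions. -/
theorem mem_span_of_mem_residueModule {z : P.weylGroup → L} (hz : z ∈ residueModule b x g L)
    (hfin : (Function.support z).Finite) (word : P.weylGroup → List b.support)
    (hlen : ∀ v, (word v).length = len b v) (hword : ∀ v, wordProd b (word v) = v) :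
    z ∈ Submodule.span S (Set.range fun v =>
      hopWord b (fun i => algebraMap S L g * xi i) (word v)) := by
  classical
  obtain ⟨n, hn⟩ : ∃ n, ∀ u, n ≤ len b u → z u = 0 := by
    obtain ⟨n, hn⟩ := (hfin.image (len b)).bddAbove
    refine ⟨n + 1, fun u hu => ?_⟩
    by_contra h
    have := hn ⟨u, h, rfl⟩
    omega
  induction n generalizing z with
  | zero =>
    have : z = 0 := funext fun u => hn u (Nat.zero_le _)
    rw [this]
    exact zero_mem _
  | succ n ih =>
    set t : P.weylGroup → P.weylGroup → L := fun v =>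
      hopWord b (fun i => algebraMap S L g * xi i) (word v) with ht
    have hex (v : P.weylGroup) : ∃ e : S, len b v = n → z v = algebraMap S L e * t v v := by
      by_cases hv : len b v = n
      · obtain ⟨e, he⟩ := exists_eq_mul_leading b hL hx hz v fun u hu => hn u (by omega)
        refine ⟨e, fun _ => ?_⟩
        rw [he]
        have := hopWord_leading b (fun i => algebraMap S L g * xi i) (fun w i => by
          rw [smul_mul', hL.smul_algebraMap, hx.smul_g, smul_xi hL hx]) (I := word v) (by
          rw [hword, hlen])
        rw [hword] at this
        rw [ht]
        simp only [this]
      · exact ⟨0, fun h => absurd h hv⟩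
    choose e he using hex
    have ht0 (u v : P.weylGroup) (h : t v u ≠ 0) : u = v ∨ len b u < len b v := by
      have := eq_or_len_lt_of_hopWord_ne_zero b _ (by rw [hword, hlen]) h
      rwa [hword] at this
    set T : Finset P.weylGroup := hfin.toFinset.filter fun v => len b v = n with hT
    have hmem : ∀ v ∈ T, e v • t v ∈ residueModule b x g L := fun v _ =>
      Submodule.smul_mem _ _ (hopWord_mem_residueModule b hL hx _)
    have hspan : ∑ v ∈ T, e v • t v ∈ Submodule.span S (Set.range t) :=
      Submodule.sum_mem _ fun v _ => Submodule.smul_mem _ _ (Submodule.subset_span ⟨v, rfl⟩)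
    have key := ih (z := z - ∑ v ∈ T, e v • t v) (sub_mem hz (sum_mem hmem)) ?_ ?_
    · have := add_mem key hspan
      rwa [sub_add_cancel] at this
    · refine Set.Finite.subset (hfin.union (Set.Finite.biUnion T.finite_toSet fun v _ =>
        hopWord_support_finite b (fun i => algebraMap S L g * xi i) (word v))) fun u hu => ?_
      by_contra h
      rw [Set.mem_union, not_or] at h
      refine hu ?_
      rw [Pi.sub_apply, Function.notMem_support.mp h.1, Finset.sum_apply,
        Finset.sum_eq_zero, sub_zero]
      intro v hv
      have : t v u = 0 := by
        by_contra h'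
        exact h.2 (Set.mem_biUnion hv h')
      rw [Pi.smul_apply, this, smul_zero]
    · intro u hu
      rw [Pi.sub_apply, Finset.sum_apply]
      by_cases hun : len b u = n
      · by_cases huz : z u = 0
        · rw [huz, Finset.sum_eq_zero, sub_zero]
          intro v hv
          rw [hT, Finset.mem_filter, Set.Finite.mem_toFinset] at hv
          have : t v u = 0 := by
            by_contra h'
            rcases ht0 u v h' with rfl | h'
            · exact hv.1 huz
            · omega
          rw [Pi.smul_apply, this, smul_zero]
        · have huT : u ∈ T := by
            rw [hT, Finset.mem_filter, Set.Finite.mem_toFinset]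
            exact ⟨huz, hun⟩
          rw [Finset.sum_eq_single_of_mem u huT, Pi.smul_apply, Algebra.smul_def, ← he u hun,
            sub_self]
          intro v hv hvu
          rw [hT, Finset.mem_filter, Set.Finite.mem_toFinset] at hv
          have : t v u = 0 := by
            by_contra h'
            rcases ht0 u v h' with rfl | h'
            · exact hvu rfl
            · omega
          rw [Pi.smul_apply, this, smul_zero]
      · rw [hn u (by omega), Finset.sum_eq_zero, sub_zero]
        intro v hv
        rw [hT, Finset.mem_filter] at hv
        have : t v u = 0 := by
          by_contra h'
          rcases ht0 u v h' with rfl | h'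
          · omega
          · omega
        rw [Pi.smul_apply, this, smul_zero]

/-- The product along a word agrees modulo `g` with the product along a reduced word. -/
theorem exists_hopWord_sub_eq_smul (word : P.weylGroup → List b.support)
    (hlen : ∀ v, (word v).length = len b v) (hword : ∀ v, wordProd b (word v) = v)
    (I : List b.support) :
    ∃ z ∈ Submodule.span S (Set.range fun v =>
        hopWord b (fun i => algebraMap S L g * xi i) (word v)),
      hopWord b (fun i => algebraMap S L g * xi i) I =
        hopWord b (fun i => algebraMap S L g * xi i) (word (wordProd b I)) + g • z := by
  classical
  have hg : algebraMap S L g ≠ 0 := by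
    rw [Ne, ← map_zero (algebraMap S L), hL.inj.eq_iff]
    exact hx.prime_g.ne_zero
  have hgw (w : P.weylGroup) : w • algebraMap S L g = algebraMap S L g := by
    rw [hL.smul_algebraMap, hx.smul_g]
  obtain ⟨r, hr⟩ := exists_hopWord_eq_add b (fun i => algebraMap S L g * xi i) xi _ hgw
    (fun _ => rfl) I
  obtain ⟨r', hr'⟩ := exists_hopWord_eq_add b (fun i => algebraMap S L g * xi i) xi _ hgw
    (fun _ => rfl) (word (wordProd b I))
  rw [hword] at hr'
  have key : g • (r - r') = hopWord b (fun i => algebraMap S L g * xi i) I -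
      hopWord b (fun i => algebraMap S L g * xi i) (word (wordProd b I)) := by
    funext u
    have h1 := hr u
    have h2 := hr' u
    rw [Pi.smul_apply, Pi.sub_apply, Pi.sub_apply, Algebra.smul_def]
    linear_combination h2 - h1
  refine ⟨r - r', ?_, by rw [key]; abel⟩
  refine mem_span_of_mem_residueModule b hL hx (mem_residueModule_of_g_smul b hL hx ?_) ?_
    word hlen hword
  · rw [key]
    exact sub_mem (hopWord_mem_residueModule b hL hx _) (hopWord_mem_residueModule b hL hx _)
  · refine ((hopWord_support_finite b (fun i => algebraMap S L g * xi i) I).union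
      (hopWord_support_finite b (fun i => algebraMap S L g * xi i)
        (word (wordProd b I)))).subset fun u hu => ?_
    by_contra h
    rw [Set.mem_union, not_or] at h
    have h1 := congrFun key u
    rw [Pi.smul_apply, Pi.sub_apply (hopWord b _ _), Function.notMem_support.mp h.1,
      Function.notMem_support.mp h.2, sub_zero, Algebra.smul_def] at h1
    exact hu ((mul_eq_zero.mp h1).resolve_left hg)

end Residues

open FormalGroupAlgebra

/-! ### The universal case over the root lattice -/

section RootLattice

variable {R : Type*} [CommRing R] (F : FormalGroup R) [F.IsComm]

theorem exists_forall_hom_eq_mul_of_x_dvd_x {M : Type*} [AddCommGroup M] [Module.Finite ℤ M]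
    [Module.Free ℤ M] {m m' : M} (h : x F m ∣ x F m') :
    ∃ r : R, ∀ f : M →+ ℤ, ((f m' : ℤ) : R) = r * ((f m : ℤ) : R) := by
  let β := Module.Free.chooseBasis ℤ M
  obtain ⟨r, hr⟩ := exists_repr_eq_mul_of_x_dvd_x F β h
  have key (f : M →+ ℤ) (n : M) : ((f n : ℤ) : R) =
      ∑ i, ((β.repr n i : ℤ) : R) * ((f (β i) : ℤ) : R) := by
    conv_lhs => rw [← β.sum_repr n]
    rw [map_sum, Int.cast_sum]
    exact Finset.sum_congr rfl fun i _ => by rw [map_zsmul, smul_eq_mul, Int.cast_mul]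
  refine ⟨r, fun f => ?_⟩
  rw [key f m', key f m, Finset.mul_sum]
  exact Finset.sum_congr rfl fun i _ => by rw [hr, mul_assoc]

theorem eq_of_forall_hom_eq {M : Type*} [AddCommGroup M] [Module.Free ℤ M] {m m' : M}
    (h : ∀ f : M →+ ℤ, f m = f m') : m = m' := by
  let β := Module.Free.chooseBasis ℤ M
  refine β.repr.injective (Finsupp.ext fun i => ?_)
  exact h (β.coord i).toAddMonoidHom

instance isDomain_formalGroupAlgebra [IsDomain R] {M : Type*} [AddCommGroup M] [Module.Finite ℤ M]
    [Module.Free ℤ M] : IsDomain (FormalGroupAlgebra F M) := by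
  have : IsDomain (MvPowerSeries (Module.Free.ChooseBasisIndex ℤ M) R) := NoZeroDivisors.to_isDomain _
  exact (coordEquiv F (Module.Free.chooseBasis ℤ M)).toRingEquiv.toMulEquiv.isDomain _

variable {ι Λ Λ' : Type*} [AddCommGroup Λ] [AddCommGroup Λ'] (P : RootDatum ι Λ Λ')

theorem weyl_smul_mem_rootSpan (w : P.weylGroup) {m : Λ} (hm : m ∈ P.rootSpan ℤ) :
    w • m ∈ P.rootSpan ℤ := by
  induction hm using Submodule.span_induction with
  | mem m hm =>
    obtain ⟨i, rfl⟩ := hm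
    rw [RootPairing.weylGroup_apply_root]
    exact Submodule.subset_span ⟨_, rfl⟩
  | zero =>
    rw [smul_zero]
    exact zero_mem _
  | add m n _ _ hm hn =>
    rw [smul_add]
    exact add_mem hm hn
  | smul k m _ hm =>
    rw [smul_comm]
    exact Submodule.smul_mem _ _ hm

/-- The action of the Weyl group on `ℤ × Q`, where `Q` is the root lattice. -/
def rootLatticeEquiv (w : P.weylGroup) : ℤ × P.rootSpan ℤ ≃+ ℤ × P.rootSpan ℤ where
  toFun m := (m.1, ⟨w • (m.2 : Λ), weyl_smul_mem_rootSpan P w m.2.2⟩)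
  invFun m := (m.1, ⟨w⁻¹ • (m.2 : Λ), weyl_smul_mem_rootSpan P w⁻¹ m.2.2⟩)
  left_inv m := by simp
  right_inv m := by simp
  map_add' m n := by
    refine Prod.ext rfl (Subtype.ext ?_)
    exact smul_add w (m.2 : Λ) n.2

/-- The formal group algebra of `ℤ × Q`, where `Q` is the root lattice. -/
abbrev RootAlgebra : Type _ := FormalGroupAlgebra F (ℤ × P.rootSpan ℤ)

instance weylActionRootAlgebra : MulSemiringAction P.weylGroup (RootAlgebra F P) where
  smul w f := FormalGroupAlgebra.map F (rootLatticeEquiv P w) f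
  one_smul f := by
    change FormalGroupAlgebra.map F (rootLatticeEquiv P 1) f = f
    have : rootLatticeEquiv P 1 = AddEquiv.refl _ :=
      AddEquiv.ext fun m => Prod.ext rfl (Subtype.ext (one_smul P.weylGroup (m.2 : Λ)))
    rw [this, map_refl]
  mul_smul v w f := by
    change FormalGroupAlgebra.map F (rootLatticeEquiv P (v * w)) f = _
    have : rootLatticeEquiv P (v * w) = (rootLatticeEquiv P w).trans (rootLatticeEquiv P v) :=
      AddEquiv.ext fun m => Prod.ext rfl (Subtype.ext (mul_smul v w (m.2 : Λ)))
    rw [this, map_trans]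
    rfl
  smul_zero w := map_zero (FormalGroupAlgebra.map F (rootLatticeEquiv P w))
  smul_add w := map_add (FormalGroupAlgebra.map F (rootLatticeEquiv P w))
  smul_one w := map_one (FormalGroupAlgebra.map F (rootLatticeEquiv P w))
  smul_mul w := map_mul (FormalGroupAlgebra.map F (rootLatticeEquiv P w))

omit [F.IsComm] in
theorem weyl_smul_rootAlgebra (w : P.weylGroup) (f : RootAlgebra F P) :
    w • f = FormalGroupAlgebra.map F (rootLatticeEquiv P w) f := rfl

/-- `x_α` in the formal group algebra of the root lattice. -/
def rootVar (i : ι) : RootAlgebra F P := x F ((0 : ℤ), P.rootSpanMem ℤ i)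

/-- `x_γ` in the formal group algebra of the root lattice. -/
def gammaVar : RootAlgebra F P := x F ((1 : ℤ), (0 : P.rootSpan ℤ))

omit [F.IsComm] in
theorem weyl_smul_rootVar (w : P.weylGroup) (i : ι) :
    w • rootVar F P i = rootVar F P (P.weylGroupToPerm w i) := by
  rw [weyl_smul_rootAlgebra, rootVar, map_x, rootVar]
  congr 1
  exact Prod.ext rfl (Subtype.ext (RootPairing.weylGroup_apply_root P w i))

omit [F.IsComm] in
theorem weyl_smul_gammaVar (w : P.weylGroup) : w • gammaVar F P = gammaVar F P := by
  rw [weyl_smul_rootAlgebra, gammaVar, map_x]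
  congr 1
  exact Prod.ext rfl (Subtype.ext (smul_zero w))

variable {P}

theorem finite_free_rootSpan (b : P.Base) :
    Module.Finite ℤ (P.rootSpan ℤ) ∧ Module.Free ℤ (P.rootSpan ℤ) :=
  ⟨Module.Finite.of_basis b.toWeightBasisInt, Module.Free.of_basis b.toWeightBasisInt⟩

/-- The coroot of index `i` as a functional on `ℤ × Q`. -/
def corootHom (i : ι) : ℤ × P.rootSpan ℤ →+ ℤ :=
  (P.coroot' i).toAddMonoidHom.comp
    ((P.rootSpan ℤ).subtype.toAddMonoidHom.comp (AddMonoidHom.snd ℤ (P.rootSpan ℤ)))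

theorem corootHom_root (i j : ι) (n : ℤ) :
    corootHom (P := P) i (n, P.rootSpanMem ℤ j) = P.pairing j i := rfl

variable [IsDomain R] [CharZero R] [Finite ι] [P.IsReduced] (b : P.Base)

include b

omit [CharZero R] in
theorem rootVar_prime (i : ι) : Prime (rootVar F P i) := by
  obtain ⟨_, _⟩ := finite_free_rootSpan b
  refine b.induction_reflect i (p := fun i => Prime (rootVar F P i)) (fun i hi => ?_)
    (fun i hi => ?_) fun i j hi hj => ?_
  · have h : rootVar F P (negIdx P i) = x F (-((0 : ℤ), P.rootSpanMem ℤ i)) := by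
      rw [rootVar]
      congr 1
      exact Prod.ext rfl (Subtype.ext (root_negIdx P i))
    change Prime (rootVar F P (negIdx P i))
    rw [h]
    exact (associated_x_neg F _).symm.prime hi
  · have := x_basis_prime F (gammaBasis b.toWeightBasisInt) (Sum.inr ⟨i, hi⟩)
    have h : b.toWeightBasisInt ⟨i, hi⟩ = P.rootSpanMem ℤ i :=
      Subtype.ext (b.coe_toWeightBasisInt_apply ⟨i, hi⟩)
    rwa [gammaBasis_inr, h] at this
  · have h : rootVar F P (P.reflectionPerm j i) =
        formalGroupAlgebraEquiv F (rootLatticeEquiv P (simpleRefl P j)) (rootVar F P i) :=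
      (weyl_smul_rootVar F P (simpleRefl P j) i).symm
    rw [h]
    exact (MulEquiv.prime_iff (formalGroupAlgebraEquiv F _).toMulEquiv).mpr hi

/-- Over a domain of characteristic zero, the `x_α` in the formal group algebra of the root
lattice have the divisibility properties of the residue argument. -/
theorem isPrimeFamily_rootVar : IsPrimeFamily (P := P) (rootVar F P) (gammaVar F P) := by
  obtain ⟨_, _⟩ := finite_free_rootSpan b
  have hy (i : ι) : Associated (x F (((0 : ℤ), P.rootSpanMem ℤ i) - ((1 : ℤ), (0 : P.rootSpan ℤ))))
      (rootVar F P i - gammaVar F P) := associated_x_sub_x F _ _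
  have hy' (i : ι) : ((0 : ℤ), P.rootSpanMem ℤ i) - ((1 : ℤ), (0 : P.rootSpan ℤ)) =
      ((-1 : ℤ), P.rootSpanMem ℤ i) := Prod.ext (by simp) (by simp)
  have h2 : ((2 : ℤ) : R) ≠ 0 := Int.cast_ne_zero.mpr two_ne_zero
  refine
    { smul_x := weyl_smul_rootVar F P
      smul_g := weyl_smul_gammaVar F P
      prime_x := rootVar_prime F b
      prime_g := xGamma_prime F
      prime_y := fun i => xRoot_sub_xGamma_prime F _
      not_x_dvd_x := fun i j h1 h2 h => ?_
      not_g_dvd_x := fun i h => ?_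
      not_y_dvd_x := fun i j h => ?_
      not_y_dvd_y := fun i j hij h => ?_
      dvd_sub_smul := fun i f => ?_
      dvd_add_neg := fun i => ?_ }
  · obtain ⟨r, hr⟩ := exists_forall_hom_eq_mul_of_x_dvd_x F h
    have h3 : ((P.pairing j i : ℤ) : R) = r * ((2 : ℤ) : R) := by
      have := hr (corootHom i)
      rwa [corootHom_root, corootHom_root, P.pairing_same] at this
    have h4 : (2 : ℤ) • P.rootSpanMem ℤ j = P.pairing j i • P.rootSpanMem ℤ i := by
      refine eq_of_forall_hom_eq fun f => ?_
      have h5 := hr (f.comp (AddMonoidHom.snd ℤ (P.rootSpan ℤ)))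
      change ((f (P.rootSpanMem ℤ j) : ℤ) : R) = r * ((f (P.rootSpanMem ℤ i) : ℤ) : R) at h5
      rw [map_zsmul, map_zsmul, smul_eq_mul, smul_eq_mul, ← Int.cast_inj (α := R), Int.cast_mul,
        Int.cast_mul, h5, h3]
      ring
    have h5 : (2 : ℤ) • P.root j = P.pairing j i • P.root i := congrArg Subtype.val h4
    have h6 : ¬ LinearIndependent ℤ ![P.root i, P.root j] := by
      rw [LinearIndependent.pair_iff]
      intro h
      have := (h (P.pairing j i) (-2) (by rw [← h5, neg_smul, add_neg_cancel])).2
      omega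
    rcases RootPairing.IsReduced.eq_or_eq_neg i j h6 with h7 | h7
    · exact h1 (P.root.injective h7).symm
    · refine h2 (P.root.injective ?_)
      rw [root_negIdx, h7, neg_neg]
  · obtain ⟨r, hr⟩ := exists_forall_hom_eq_mul_of_x_dvd_x F h
    have := hr (corootHom i)
    rw [corootHom_root, P.pairing_same] at this
    refine h2 (this.trans ?_)
    have h0 : corootHom (P := P) i ((1 : ℤ), (0 : P.rootSpan ℤ)) = 0 := by simp [corootHom]
    rw [h0, Int.cast_zero, mul_zero]
  · obtain ⟨r, hr⟩ := exists_forall_hom_eq_mul_of_x_dvd_x F ((hy i).dvd.trans h)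
    rw [hy'] at hr
    have h3 := hr (AddMonoidHom.fst ℤ _)
    have h4 := hr (corootHom j)
    rw [corootHom_root, corootHom_root, P.pairing_same] at h4
    have h5 : r = 0 := by simpa using h3.symm
    rw [h5, zero_mul] at h4
    exact h2 h4
  · obtain ⟨r, hr⟩ := exists_forall_hom_eq_mul_of_x_dvd_x F
      (((hy i).dvd.trans h).trans (hy j).symm.dvd)
    rw [hy', hy'] at hr
    have h3 := hr (AddMonoidHom.fst ℤ _)
    have h5 : r = 1 := by simpa using h3.symm
    refine hij (P.root.injective (congrArg Subtype.val (?_ :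
      P.rootSpanMem ℤ i = P.rootSpanMem ℤ j)))
    refine eq_of_forall_hom_eq fun f => ?_
    have h6 := hr (f.comp (AddMonoidHom.snd ℤ (P.rootSpan ℤ)))
    rw [h5, one_mul, Int.cast_inj] at h6
    exact h6.symm
  · have he : ∀ m, rootLatticeEquiv P (simpleRefl P i) m =
        m - corootHom i m • ((0 : ℤ), P.rootSpanMem ℤ i) := fun m =>
      Prod.ext (by simp [rootLatticeEquiv]) (Subtype.ext (P.reflection_apply i m.2))
    obtain ⟨q, -, hq⟩ := exists_sub_map_eq_mul F _ _ _ he (j := 0) (f := f) (by simp)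
    exact ⟨q, hq⟩
  · obtain ⟨v, hv⟩ := exists_x_add_x_neg F ((0 : ℤ), P.rootSpanMem ℤ i)
    have h : rootVar F P (negIdx P i) = x F (-((0 : ℤ), P.rootSpanMem ℤ i)) := by
      rw [rootVar]
      congr 1
      exact Prod.ext rfl (Subtype.ext (root_negIdx P i))
    rw [h]
    exact ⟨v, hv⟩

end RootLattice

/-! ### Products of Demazure-Lusztig elements over arbitrary coefficient rings and lattices -/

section Transport

variable {ι Λ Λ' : Type*} [AddCommGroup Λ] [AddCommGroup Λ'] {P : RootDatum ι Λ Λ'}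

/-- The action on the localization of a ring at a family permuted by the group. -/
@[reducible]
def localizationAction {S : Type*} [CommRing S] [MulSemiringAction P.weylGroup S] (x : ι → S)
    (hx : ∀ (w : P.weylGroup) i, w • x i = x (P.weylGroupToPerm w i)) :
    MulSemiringAction P.weylGroup (Localization (Submonoid.closure (Set.range x))) :=
  have hle (w : P.weylGroup) : Submonoid.closure (Set.range x) ≤
      (Submonoid.closure (Set.range x)).comap (MulSemiringAction.toRingHom P.weylGroup S w) := by
    refine Submonoid.closure_le.mpr ?_
    rintro _ ⟨i, rfl⟩
    exact Submonoid.subset_closure ⟨P.weylGroupToPerm w i, (hx w i).symm⟩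
  let act (w : P.weylGroup) : Localization (Submonoid.closure (Set.range x)) →+*
      Localization (Submonoid.closure (Set.range x)) :=
    IsLocalization.map _ (MulSemiringAction.toRingHom P.weylGroup S w) (hle w)
  have hact (w : P.weylGroup) (f : S) : act w (algebraMap _ _ f) = algebraMap _ _ (w • f) :=
    IsLocalization.map_eq (hle w) f
  { smul := fun w q => act w q
    one_smul := fun q => by
      have h : act 1 = RingHom.id _ := by
        refine IsLocalization.ringHom_ext (Submonoid.closure (Set.range x))
          (RingHom.ext fun f => ?_)
        rw [RingHom.comp_apply, hact, one_smul]
        rfl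
      exact RingHom.congr_fun h q
    mul_smul := fun v w q => by
      have h : act (v * w) = (act v).comp (act w) := by
        refine IsLocalization.ringHom_ext (Submonoid.closure (Set.range x))
          (RingHom.ext fun f => ?_)
        rw [RingHom.comp_apply, RingHom.comp_apply, RingHom.comp_apply, hact, hact, hact, mul_smul]
      exact RingHom.congr_fun h q
    smul_zero := fun w => map_zero (act w)
    smul_add := fun w => map_add (act w)
    smul_one := fun w => map_one (act w)
    smul_mul := fun w => map_mul (act w) }

theorem hopWord_map (b : P.Base) {L L' : Type*} [CommRing L] [CommRing L']
    [MulSemiringAction P.weylGroup L] [MulSemiringAction P.weylGroup L'] (J : L →+* L')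
    (hJ : ∀ (w : P.weylGroup) q, J (w • q) = w • J q) (c : ι → L) (I : List b.support)
    (u : P.weylGroup) : J (hopWord b c I u) = hopWord b (fun i => J (c i)) I u := by
  classical
  induction I generalizing u with
  | nil =>
    rw [hopWord, hopWord, List.foldr_nil, List.foldr_nil, Pi.single_apply, Pi.single_apply,
      apply_ite J, map_one, map_zero]
  | cons i I ih =>
    rw [hopWord_cons, hopWord_cons, hop, hop, map_add, map_mul, map_mul, map_sub, map_one, hJ, ih, ih]

theorem algebraMap_xRoot_mul_invRoot {R : Type*} [CommRing R] (F : FormalGroup R) (i : ι) :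
    algebraMap (BaseAlgebra F Λ) (LocalizedAlgebra F P) (xRoot F P i) * invRoot F P i = 1 := by
  rw [mul_comm, invRoot]
  exact (IsLocalization.mk'_spec _ _ _).trans (map_one _)

/-- The coefficients `c_α = x_γ / x_α` of the Demazure-Lusztig elements. -/
def ratio {R : Type*} [CommRing R] (F : FormalGroup R) (P : RootDatum ι Λ Λ') (i : ι) :
    LocalizedAlgebra F P :=
  algebraMap (BaseAlgebra F Λ) (LocalizedAlgebra F P) (xGamma F Λ) * invRoot F P i

/-- In the coefficient functions of the twisted group algebra, the product of the `T_i` along a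
word agrees, modulo `x_γ` times the `S`-span of the `T_v`, with the product along a reduced word
with the same product in the Weyl group. This is proved in the universal case, where the
coefficient ring is a domain of characteristic zero and the lattice is the root lattice. -/
theorem exists_hopWord_ratio_sub {R : Type*} [CommRing R] (F : FormalGroup R) [F.IsComm]
    [Module.Finite ℤ Λ] [Module.Free ℤ Λ] [Finite ι] [P.IsReduced] (b : P.Base)
    (word : P.weylGroup → List b.support)
    (hlen : ∀ v, (word v).length = len b v) (hword : ∀ v, wordProd b (word v) = v)
    (I : List b.support) :
    ∃ z ∈ Submodule.span (BaseAlgebra F Λ) (Set.range fun v => hopWord b (ratio F P) (word v)),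
      hopWord b (ratio F P) I =
        hopWord b (ratio F P) (word (wordProd b I)) + xGamma F Λ • z := by
  obtain ⟨_, _⟩ := finite_free_rootSpan b
  let p : MvPolynomial R ℤ →+* R := (MvPolynomial.aeval (id : R → R)).toRingHom
  have hp : Function.Surjective p := fun r => ⟨MvPolynomial.X r, MvPolynomial.aeval_X _ r⟩
  obtain ⟨E, hE, hEF⟩ := exists_formalGroup_lift (K := FractionRing (MvPolynomial R ℤ)) p hp
    (IsFractionRing.injective _ _) F
  obtain ⟨j, hj, hjC⟩ := exists_formalGroupAlgebra_hom E p hEF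
    ((AddMonoidHom.id ℤ).prodMap (P.rootSpan ℤ).subtype.toAddMonoidHom)
  have hx := isPrimeFamily_rootVar E b
  let M := Submonoid.closure (Set.range (rootVar E P))
  let : MulSemiringAction P.weylGroup (Localization M) := localizationAction _ hx.smul_x
  have hM : M ≤ nonZeroDivisors (RootAlgebra E P) := by
    refine Submonoid.closure_le.mpr ?_
    rintro _ ⟨i, rfl⟩
    exact mem_nonZeroDivisors_of_ne_zero (hx.prime_x i).ne_zero
  have : IsDomain (Localization M) := IsLocalization.isDomain_localization hM
  let xi : ι → Localization M := fun i =>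
    IsLocalization.mk' (Localization M) 1 (⟨rootVar E P i, Submonoid.subset_closure ⟨i, rfl⟩⟩ : M)
  have hact (w : P.weylGroup) (f : RootAlgebra E P) :
      w • algebraMap (RootAlgebra E P) (Localization M) f = algebraMap _ _ (w • f) :=
    IsLocalization.map_eq _ f
  have hL : IsRootLocalization P (rootVar E P) xi :=
    { smul_algebraMap := hact
      mul_xi := fun i => by
        rw [mul_comm]
        exact (IsLocalization.mk'_spec _ _ _).trans (map_one _)
      surj := fun q => by
        obtain ⟨⟨f, s⟩, h⟩ := IsLocalization.surj M q
        exact ⟨s, s.2, f, by rw [mul_comm]; exact h⟩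
      inj := IsLocalization.injective _ hM }
  obtain ⟨z, hz, e⟩ := exists_hopWord_sub_eq_smul b hL hx word hlen hword I
  have hjx (i : ι) : j (rootVar E P i) = xRoot F P i := hj _
  have hjg : j (gammaVar E P) = xGamma F Λ := hj _
  have hunit (s : M) : IsUnit (((algebraMap (BaseAlgebra F Λ) (LocalizedAlgebra F P)).comp j) s) := by
    obtain ⟨s, hs⟩ := s
    refine IsLocalization.map_units (LocalizedAlgebra F P) (⟨j s, ?_⟩ : rootSubmonoid F P)
    have : M ≤ (rootSubmonoid F P).comap j := by
      refine Submonoid.closure_le.mpr ?_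
      rintro _ ⟨i, rfl⟩
      exact Submonoid.subset_closure ⟨i, (hjx i).symm⟩
    exact this hs
  let J : Localization M →+* LocalizedAlgebra F P := IsLocalization.lift hunit
  have hJ (f : RootAlgebra E P) : J (algebraMap _ _ f) = algebraMap _ _ (j f) :=
    IsLocalization.lift_eq hunit f
  have hjw (w : P.weylGroup) (f : RootAlgebra E P) : j (w • f) = w • j f := by
    have : j.comp (MulSemiringAction.toRingHom P.weylGroup (RootAlgebra E P) w) =
        (MulSemiringAction.toRingHom P.weylGroup (BaseAlgebra F Λ) w).comp j := by
      refine formalGroupAlgebra_ringHom_ext E (fun m => ?_) (fun m => ?_) fun a => ?_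
      · change j (w • x E m) ∈ _
        rw [weyl_smul_rootAlgebra, map_x, hj]
        exact x_mem_augIdeal F _
      · change j (w • x E m) = w • j (x E m)
        rw [weyl_smul_rootAlgebra, map_x, hj, hj]
        exact (weyl_smul_x F P w _ _).symm
      · change j (w • algebraMap _ _ a) = w • j (algebraMap _ _ a)
        rw [weyl_smul_rootAlgebra, AlgHom.commutes, hjC, weyl_smul_algebraMap]
    exact RingHom.congr_fun this f
  have hJw (w : P.weylGroup) (q : Localization M) : J (w • q) = w • J q := by
    have : J.comp (MulSemiringAction.toRingHom P.weylGroup (Localization M) w) =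
        (MulSemiringAction.toRingHom P.weylGroup (LocalizedAlgebra F P) w).comp J := by
      refine IsLocalization.ringHom_ext M (RingHom.ext fun f => ?_)
      change J (w • algebraMap _ _ f) = w • J (algebraMap _ _ f)
      rw [hact, hJ, hJ, hjw, weyl_smul_algebraMap_localized]
    exact RingHom.congr_fun this q
  have hJc (i : ι) : J (algebraMap _ _ (gammaVar E P) * xi i) = ratio F P i := by
    have h1 := congrArg J (hL.mul_xi i)
    rw [map_mul, map_one, hJ, hjx] at h1
    have h2 := algebraMap_xRoot_mul_invRoot (P := P) F i
    rw [map_mul, hJ, hjg, ratio]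
    linear_combination (algebraMap _ (LocalizedAlgebra F P) (xGamma F Λ)) *
      (invRoot F P i * h1 - J (xi i) * h2)
  have hword' (I : List b.support) (u : P.weylGroup) :
      J (hopWord b (fun i => algebraMap _ _ (gammaVar E P) * xi i) I u) =
        hopWord b (ratio F P) I u := by
    rw [hopWord_map b J hJw]
    simp only [hJc]
  refine ⟨fun u => J (z u), ?_, funext fun u => ?_⟩
  · clear e
    induction hz using Submodule.span_induction with
    | mem z hz =>
      obtain ⟨v, rfl⟩ := hz
      refine Submodule.subset_span ⟨v, funext fun u => ?_⟩
      exact (hword' (word v) u).symm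
    | zero =>
      have : (fun u => J ((0 : P.weylGroup → Localization M) u)) = 0 := funext fun u => map_zero J
      rw [this]
      exact zero_mem _
    | add z z' _ _ h h' =>
      have : (fun u => J ((z + z') u)) = (fun u => J (z u)) + fun u => J (z' u) :=
        funext fun u => map_add J _ _
      rw [this]
      exact add_mem h h'
    | smul s z _ h =>
      have : (fun u => J ((s • z) u)) = j s • fun u => J (z u) := by
        funext u
        rw [Pi.smul_apply, Pi.smul_apply, Algebra.smul_def, Algebra.smul_def, map_mul, hJ]
      rw [this]
      exact Submodule.smul_mem _ _ h
  · have := congrArg J (congrFun e u)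
    rw [Pi.add_apply, map_add, hword', hword', Pi.smul_apply, Algebra.smul_def, map_mul, hJ,
      hjg] at this
    rw [this, Pi.add_apply, Pi.smul_apply, Algebra.smul_def]

end Transport

/-! ### The PBW basis of the formal affine Hecke algebra -/

section Hecke

variable {R : Type*} [CommRing R] (F : FormalGroup R)
  {ι Λ Λ' : Type*} [AddCommGroup Λ] [AddCommGroup Λ'] {P : RootDatum ι Λ Λ'}

theorem demazureLusztig_eq (i : ι) : demazureLusztig F P i =
    SkewMonoidAlgebra.single 1 (ratio F P i) +
      SkewMonoidAlgebra.single (simpleRefl P i) (1 - ratio F P i) := by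
  have h : scalar F P (xGamma F Λ) =
      SkewMonoidAlgebra.single 1 (algebraMap _ (LocalizedAlgebra F P) (xGamma F Λ)) := rfl
  rw [demazureLusztig, demazureElement, h, delta, mul_sub, SkewMonoidAlgebra.single_mul_single,
    SkewMonoidAlgebra.single_mul_single, one_mul, one_mul, one_smul, sub_eq_add_neg,
    ← SkewMonoidAlgebra.single_neg, add_assoc, ← SkewMonoidAlgebra.single_add, neg_add_eq_sub]
  rfl

/-- Left multiplication by `T_i` in terms of coefficient functions. -/
theorem coeff_demazureLusztig_mul (i : ι) (z : TwistedAlgebra F P) (u : P.weylGroup) :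
    (demazureLusztig F P i * z).coeff u = hop (ratio F P) i z.coeff u := by
  rw [demazureLusztig_eq, add_mul, SkewMonoidAlgebra.coeff_add, Finsupp.add_apply,
    SkewMonoidAlgebra.coeff_single_mul, SkewMonoidAlgebra.coeff_single_mul, inv_one, one_mul,
    one_smul, simpleRefl_inv, hop]

theorem demazureLusztig_mul_scalar (i : ι) {u q : BaseAlgebra F Λ}
    (h : u - simpleRefl P i • u = xRoot F P i * q) :
    demazureLusztig F P i * scalar F P u =
      scalar F P (simpleRefl P i • u) * demazureLusztig F P i + scalar F P (xGamma F Λ * q) := by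
  have hs (u : BaseAlgebra F Λ) : scalar F P u =
      SkewMonoidAlgebra.single 1 (algebraMap _ (LocalizedAlgebra F P) u) := rfl
  have h1 := congrArg (algebraMap (BaseAlgebra F Λ) (LocalizedAlgebra F P)) h
  rw [map_sub, map_mul] at h1
  have h2 := algebraMap_xRoot_mul_invRoot (P := P) F i
  rw [demazureLusztig_eq, hs, hs, hs, add_mul, mul_add, SkewMonoidAlgebra.single_mul_single,
    SkewMonoidAlgebra.single_mul_single, SkewMonoidAlgebra.single_mul_single,
    SkewMonoidAlgebra.single_mul_single, one_mul, one_mul, mul_one, one_smul, one_smul, one_smul,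
    add_right_comm, ← SkewMonoidAlgebra.single_add, weyl_smul_algebraMap_localized,
    mul_comm (1 - ratio F P i)]
  congr 2
  rw [ratio, map_mul]
  linear_combination (algebraMap _ (LocalizedAlgebra F P) (xGamma F Λ)) * (invRoot F P i * h1 +
    algebraMap _ (LocalizedAlgebra F P) q * h2)

variable (b : P.Base)

theorem scalar_algebraMap (r : R) :
    scalar F P (algebraMap R _ r) = algebraMap R (TwistedAlgebra F P) r := by
  rw [SkewMonoidAlgebra.coe_algebraMap]
  change SkewMonoidAlgebra.single 1 (algebraMap _ (LocalizedAlgebra F P) (algebraMap R _ r)) = _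
  rw [← IsScalarTower.algebraMap_apply]
  rfl

/-- The embedding of `S` in the formal affine Hecke algebra. -/
def heckeScalarHom : BaseAlgebra F Λ →ₐ[R] heckeAlgebra F P b where
  toFun := heckeScalar F P b
  map_one' := Subtype.ext (map_one (scalar F P))
  map_mul' u v := Subtype.ext (map_mul (scalar F P) u v)
  map_zero' := Subtype.ext (map_zero (scalar F P))
  map_add' u v := Subtype.ext (map_add (scalar F P) u v)
  commutes' r := Subtype.ext (scalar_algebraMap F r)

theorem heckeScalar_eq (u : BaseAlgebra F Λ) : heckeScalar F P b u = heckeScalarHom F b u := rfl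

/-- The product of the `T_i` along a word. -/
def tProd (I : List b.support) : heckeAlgebra F P b := (I.map (heckeT F P b)).prod

theorem coe_heckeScalar (u : BaseAlgebra F Λ) :
    (heckeScalar F P b u : TwistedAlgebra F P) = scalar F P u := rfl

theorem coe_heckeT (i : b.support) :
    (heckeT F P b i : TwistedAlgebra F P) = demazureLusztig F P i := rfl

theorem tProd_nil : tProd F b [] = 1 := rfl

theorem tProd_cons (i : b.support) (I : List b.support) :
    tProd F b (i :: I) = heckeT F P b i * tProd F b I := List.prod_cons

theorem coeff_tProd (I : List b.support) :
    ((tProd F b I : heckeAlgebra F P b) : TwistedAlgebra F P).coeff = hopWord b (ratio F P) I := by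
  classical
  induction I with
  | nil =>
    funext u
    change (1 : TwistedAlgebra F P).coeff u = (Pi.single 1 1 : P.weylGroup → _) u
    rw [SkewMonoidAlgebra.coeff_one, Finsupp.single_apply, Pi.single_apply]
    simp only [eq_comm]
  | cons i I ih =>
    funext u
    rw [tProd_cons, hopWord_cons, ← ih, Subalgebra.coe_mul, coe_heckeT, coeff_demazureLusztig_mul]

theorem coeff_heckeScalar_mul (s : BaseAlgebra F Λ) (z : heckeAlgebra F P b) (u : P.weylGroup) :
    ((heckeScalar F P b s * z : heckeAlgebra F P b) : TwistedAlgebra F P).coeff u =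
      algebraMap _ (LocalizedAlgebra F P) s * (z : TwistedAlgebra F P).coeff u := by
  rw [Subalgebra.coe_mul, coe_heckeScalar]
  exact SkewMonoidAlgebra.coeff_single_one_mul _ _ u

/-- The map that takes a family `f` of elements of `S` to `∑ f_v T_v`, where `T_v` is the product
along a chosen word for `v`. -/
def pbwMap (word : P.weylGroup → List b.support) :
    (P.weylGroup →₀ BaseAlgebra F Λ) →ₗ[R] heckeAlgebra F P b :=
  Finsupp.lsum R fun v =>
    (LinearMap.mulRight R (tProd F b (word v))).comp (heckeScalarHom F b).toLinearMap

variable (word : P.weylGroup → List b.support)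

theorem pbwMap_single (v : P.weylGroup) (u : BaseAlgebra F Λ) :
    pbwMap F b word (Finsupp.single v u) = heckeScalar F P b u * tProd F b (word v) := by
  rw [pbwMap, Finsupp.lsum_single]
  rfl

theorem pbwMap_smul (s : BaseAlgebra F Λ) (f : P.weylGroup →₀ BaseAlgebra F Λ) :
    pbwMap F b word (s • f) = heckeScalar F P b s * pbwMap F b word f := by
  induction f using Finsupp.induction_linear with
  | zero => rw [smul_zero, map_zero, mul_zero]
  | add f g hf hg => rw [smul_add, map_add, map_add, mul_add, hf, hg]
  | single v u =>
    rw [Finsupp.smul_single, pbwMap_single, pbwMap_single, heckeScalar_eq, heckeScalar_eq,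
      heckeScalar_eq, smul_eq_mul, map_mul, mul_assoc]

theorem coeff_pbwMap (f : P.weylGroup →₀ BaseAlgebra F Λ) (u : P.weylGroup) :
    (pbwMap F b word f : TwistedAlgebra F P).coeff u =
      (f.sum fun v s => s • hopWord b (ratio F P) (word v)) u := by
  induction f using Finsupp.induction_linear with
  | zero => rw [map_zero, Finsupp.sum_zero_index]; rfl
  | add f g hf hg =>
    rw [Finsupp.sum_add_index' (h := fun v s => s • hopWord b (ratio F P) (word v))
      (fun _ => zero_smul _ _) (fun _ _ _ => add_smul _ _ _), map_add, Pi.add_apply, ← hf, ← hg,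
      Subalgebra.coe_add, SkewMonoidAlgebra.coeff_add, Finsupp.add_apply]
  | single v s =>
    rw [Finsupp.sum_single_index (h := fun v s => s • hopWord b (ratio F P) (word v))
      (zero_smul _ _), pbwMap_single, coeff_heckeScalar_mul,
      coeff_tProd, Pi.smul_apply, Algebra.smul_def]

theorem tProd_mem_heckeFiltration (I : List b.support) {j : ℕ} {u : BaseAlgebra F Λ}
    (hu : u ∈ augIdeal F (ℤ × Λ) ^ j) :
    heckeScalar F P b u * tProd F b I ∈ heckeFiltration F P b j :=
  Submodule.subset_span ⟨u, hu, I, rfl⟩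

theorem heckeFiltration_antitone : Antitone (heckeFiltration F P b) := by
  intro j k hjk
  refine Submodule.span_mono ?_
  rintro _ ⟨u, hu, I, rfl⟩
  exact ⟨u, Ideal.pow_le_pow_right hjk hu, I, rfl⟩

theorem heckeScalar_mul_mem {j k : ℕ} {u : BaseAlgebra F Λ} (hu : u ∈ augIdeal F (ℤ × Λ) ^ j)
    {z : heckeAlgebra F P b} (hz : z ∈ heckeFiltration F P b k) :
    heckeScalar F P b u * z ∈ heckeFiltration F P b (j + k) := by
  induction hz using Submodule.span_induction with
  | mem z hz =>
    obtain ⟨v, hv, I, rfl⟩ := hz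
    rw [← mul_assoc, heckeScalar_eq, heckeScalar_eq, ← map_mul]
    refine tProd_mem_heckeFiltration F b I ?_
    rw [pow_add]
    exact Ideal.mul_mem_mul hu hv
  | zero => rw [mul_zero]; exact zero_mem _
  | add z w _ _ hz hw => rw [mul_add]; exact add_mem hz hw
  | smul r z _ hz => rw [mul_smul_comm]; exact Submodule.smul_mem _ r hz

theorem weyl_smul_mem_augIdeal_pow [F.IsComm] [Module.Finite ℤ Λ] [Module.Free ℤ Λ]
    (w : P.weylGroup) {j : ℕ} {u : BaseAlgebra F Λ}
    (hu : u ∈ augIdeal F (ℤ × Λ) ^ j) : w • u ∈ augIdeal F (ℤ × Λ) ^ j :=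
  augIdeal_pow_map F (weylAddEquiv P w) hu

theorem xGamma_mul_mem {j : ℕ} {q : BaseAlgebra F Λ} (hq : q ∈ augIdeal F (ℤ × Λ) ^ (j - 1)) :
    xGamma F Λ * q ∈ augIdeal F (ℤ × Λ) ^ j := by
  have h : xGamma F Λ * q ∈ augIdeal F (ℤ × Λ) ^ (1 + (j - 1)) := by
    rw [pow_add, pow_one]
    exact Ideal.mul_mem_mul (x_mem_augIdeal F _) hq
  exact Ideal.pow_le_pow_right (by omega) h

variable [F.IsComm] [Module.Finite ℤ Λ] [Module.Free ℤ Λ]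

theorem exists_sub_simpleRefl_smul_eq (i : ι) {j : ℕ} {u : BaseAlgebra F Λ}
    (hu : u ∈ augIdeal F (ℤ × Λ) ^ j) :
    ∃ q ∈ augIdeal F (ℤ × Λ) ^ (j - 1), u - simpleRefl P i • u = xRoot F P i * q := by
  refine exists_sub_map_eq_mul F (weylAddEquiv P (simpleRefl P i)) ((0 : ℤ), P.root i)
    ((P.coroot' i).toAddMonoidHom.comp (AddMonoidHom.snd ℤ Λ)) (fun m => ?_) hu
  refine Prod.ext ?_ (P.reflection_apply i m.2)
  exact (congrArg (m.1 - ·) (smul_zero (P.coroot' i m.2)) |>.trans (sub_zero _)).symm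

omit [F.IsComm] [Module.Finite ℤ Λ] [Module.Free ℤ Λ] in
/-- The commutation relation of `T_i` with elements of `S`, where `q` is the divided difference. -/
theorem heckeT_mul_heckeScalar (i : b.support) {u q : BaseAlgebra F Λ}
    (h : u - simpleRefl P i • u = xRoot F P i * q) :
    heckeT F P b i * heckeScalar F P b u =
      heckeScalar F P b (simpleRefl P i • u) * heckeT F P b i +
        heckeScalar F P b (xGamma F Λ * q) := by
  refine Subtype.ext ?_
  rw [Subalgebra.coe_add, Subalgebra.coe_mul, Subalgebra.coe_mul, coe_heckeScalar, coe_heckeScalar,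
    coe_heckeScalar, coe_heckeT, demazureLusztig_mul_scalar F _ h]

theorem heckeT_mul_mem (i : b.support) {j : ℕ} {z : heckeAlgebra F P b}
    (hz : z ∈ heckeFiltration F P b j) : heckeT F P b i * z ∈ heckeFiltration F P b j := by
  induction hz using Submodule.span_induction with
  | mem z hz =>
    obtain ⟨u, hu, I, rfl⟩ := hz
    obtain ⟨q, hq, h⟩ := exists_sub_simpleRefl_smul_eq F (P := P) i hu
    rw [← mul_assoc, heckeT_mul_heckeScalar F b i h, add_mul, mul_assoc]
    exact add_mem (tProd_mem_heckeFiltration F b (i :: I) (weyl_smul_mem_augIdeal_pow F _ hu))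
      (tProd_mem_heckeFiltration F b I (xGamma_mul_mem F hq))
  | zero => rw [mul_zero]; exact zero_mem _
  | add z w _ _ hz hw => rw [mul_add]; exact add_mem hz hw
  | smul r z _ hz => rw [mul_smul_comm]; exact Submodule.smul_mem _ r hz

theorem mul_mem_heckeFiltration {j k : ℕ} {z w : heckeAlgebra F P b}
    (hz : z ∈ heckeFiltration F P b j) (hw : w ∈ heckeFiltration F P b k) :
    z * w ∈ heckeFiltration F P b (j + k) := by
  have hI : ∀ I : List b.support, tProd F b I * w ∈ heckeFiltration F P b k := by
    intro I
    induction I with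
    | nil => rwa [tProd_nil, one_mul]
    | cons i I ih =>
      rw [tProd_cons, mul_assoc]
      exact heckeT_mul_mem F b i ih
  induction hz using Submodule.span_induction with
  | mem z hz =>
    obtain ⟨u, hu, I, rfl⟩ := hz
    rw [mul_assoc]
    exact heckeScalar_mul_mem F b hu (hI I)
  | zero => rw [zero_mul]; exact zero_mem _
  | add z z' _ _ hz hz' => rw [add_mul]; exact add_mem hz hz'
  | smul r z _ hz => rw [smul_mul_assoc]; exact Submodule.smul_mem _ r hz

theorem heckeFiltration_zero : heckeFiltration F P b 0 = ⊤ := by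
  refine eq_top_iff.mpr fun z _ => ?_
  have h1 : (1 : heckeAlgebra F P b) ∈ heckeFiltration F P b 0 := by
    have := tProd_mem_heckeFiltration F b [] (j := 0) (u := 1) (by simp)
    rwa [heckeScalar_eq, map_one, one_mul] at this
  obtain ⟨z, hz⟩ := z
  induction hz using Algebra.adjoin_induction with
  | mem z hz =>
    rcases hz with ⟨u, rfl⟩ | ⟨i, hi, rfl⟩
    · exact heckeScalar_mem F P b (j := 0) (by
        change u ∈ augIdeal F (ℤ × Λ) ^ 0
        simp)
    · exact heckeT_mem F P b ⟨i, hi⟩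
  | algebraMap r =>
    have := Submodule.smul_mem _ r h1
    rwa [← Algebra.algebraMap_eq_smul_one] at this
  | add z w hz hw h h' => exact add_mem (h trivial) (h' trivial)
  | mul z w hz hw h h' =>
    have h2 := mul_mem_heckeFiltration F b (h trivial) (h' trivial)
    rw [add_zero] at h2
    exact h2

instance isDecreasingFiltration_hecke : IsDecreasingFiltration (heckeFiltration F P b) where
  antitone := heckeFiltration_antitone F b
  zero_eq_top := heckeFiltration_zero F b
  mul_mem := mul_mem_heckeFiltration F b

variable [Finite ι] [P.IsReduced] {word}
  (hlen : ∀ v, (word v).length = len b v) (hword : ∀ v, wordProd b (word v) = v)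

include hlen hword

/-- Modulo `x_γ`, products of the `T_i` obey the relations of the Weyl group. -/
theorem exists_tProd_eq (I : List b.support) : ∃ f, tProd F b I =
    tProd F b (word (wordProd b I)) + heckeScalar F P b (xGamma F Λ) * pbwMap F b word f := by
  obtain ⟨z, hz, h⟩ := exists_hopWord_ratio_sub F b word hlen hword I
  obtain ⟨f, rfl⟩ := Finsupp.mem_span_range_iff_exists_finsupp.mp hz
  refine ⟨f, Subtype.ext (SkewMonoidAlgebra.ext fun u => ?_)⟩
  have h1 := congrFun h u
  rw [Pi.add_apply, Pi.smul_apply, Algebra.smul_def, ← coeff_pbwMap, ← coeff_tProd, ← coeff_tProd,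
    ← coeff_heckeScalar_mul] at h1
  rw [h1, Subalgebra.coe_add, SkewMonoidAlgebra.coeff_add, Finsupp.add_apply]

/-- The elements of the filtration are the combinations of the `T_v` with coefficients in powers of
the augmentation ideal. -/
theorem mem_heckeFiltration_iff {j : ℕ} {z : heckeAlgebra F P b} :
    z ∈ heckeFiltration F P b j ↔
      ∃ f, (∀ v, f v ∈ augIdeal F (ℤ × Λ) ^ j) ∧ pbwMap F b word f = z := by
  constructor
  · intro hz
    induction hz using Submodule.span_induction with
    | mem z hz =>
      classical
      obtain ⟨u, hu, I, rfl⟩ := hz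
      obtain ⟨f, hf⟩ := exists_tProd_eq F b hlen hword I
      refine ⟨Finsupp.single (wordProd b I) u + (u * xGamma F Λ) • f, fun v => ?_, ?_⟩
      · rw [Finsupp.add_apply, Finsupp.smul_apply, smul_eq_mul, mul_assoc]
        refine add_mem ?_ (Ideal.mul_mem_right _ _ hu)
        rw [Finsupp.single_apply]
        split_ifs
        exacts [hu, zero_mem _]
      · change _ = _ * tProd F b I
        rw [hf, map_add, pbwMap_single, pbwMap_smul, mul_add, heckeScalar_eq, heckeScalar_eq,
          heckeScalar_eq, map_mul, mul_assoc]
    | zero => exact ⟨0, fun v => zero_mem _, map_zero _⟩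
    | add z w _ _ hz hw =>
      obtain ⟨f, hf, rfl⟩ := hz
      obtain ⟨g, hg, rfl⟩ := hw
      exact ⟨f + g, fun v => add_mem (hf v) (hg v), map_add _ _ _⟩
    | smul r z _ hz =>
      obtain ⟨f, hf, rfl⟩ := hz
      refine ⟨r • f, fun v => ?_, map_smul _ _ _⟩
      rw [Finsupp.smul_apply, Algebra.smul_def]
      exact Ideal.mul_mem_left _ _ (hf v)
  · rintro ⟨f, hf, rfl⟩
    rw [pbwMap, Finsupp.lsum_apply]
    exact Submodule.sum_mem _ fun v _ => tProd_mem_heckeFiltration F b _ (hf v)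

omit hlen hword [Finite ι] [P.IsReduced] in
theorem rootSubmonoid_le_nonZeroDivisors (hreg : IsSigmaRegular F P) :
    rootSubmonoid F P ≤ nonZeroDivisors (BaseAlgebra F Λ) := by
  refine Submonoid.closure_le.mpr ?_
  rintro _ ⟨i, rfl⟩
  exact (x_zero_isRegular F (hreg i)).mem_nonZeroDivisors

omit hlen hword [Finite ι] [P.IsReduced] in
theorem algebraMap_localized_injective (hreg : IsSigmaRegular F P) :
    Function.Injective (algebraMap (BaseAlgebra F Λ) (LocalizedAlgebra F P)) :=
  IsLocalization.injective _ (rootSubmonoid_le_nonZeroDivisors F hreg)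

omit hlen hword [Finite ι] [P.IsReduced] in
theorem one_sub_ratio_isRegular (hreg : IsSigmaRegular F P) (i : ι) :
    IsRegular (1 - ratio F P i) := by
  have h1 := algebraMap_xRoot_mul_invRoot (P := P) F i
  have h2 : 1 - ratio F P i = algebraMap _ (LocalizedAlgebra F P) (xRoot F P i - xGamma F Λ) *
      invRoot F P i := by
    rw [map_sub, ratio]
    linear_combination -h1
  rw [h2]
  refine IsRegular.mul ?_ (IsUnit.isRegular (IsUnit.of_mul_eq_one _ (by rw [mul_comm]; exact h1)))
  rw [isRegular_iff_mem_nonZeroDivisors, mem_nonZeroDivisors_iff_left]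
  intro q hq
  obtain ⟨⟨f, s⟩, h⟩ := IsLocalization.surj (rootSubmonoid F P) q
  have h3 : (xRoot F P i - xGamma F Λ) * f = 0 := by
    refine algebraMap_localized_injective F hreg ?_
    rw [map_mul, map_zero, ← h, ← mul_assoc, hq, zero_mul]
  have h4 : f = 0 := (xRoot_sub_xGamma_isRegular F (P.root i)).left (by
    change (xRoot F P i - xGamma F Λ) * f = (xRoot F P i - xGamma F Λ) * 0
    rw [h3, mul_zero])
  have h5 := IsLocalization.map_units (LocalizedAlgebra F P) s
  rw [h4, map_zero] at h
  exact h5.mul_left_eq_zero.mp h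

/-- The `T_v` are linearly independent over `S`, because the coefficient of `T_v` at `v` is a
regular element and its other coefficients are at shorter elements. -/
theorem pbwMap_injective (hreg : IsSigmaRegular F P) : Function.Injective (pbwMap F b word) := by
  rw [← LinearMap.ker_eq_bot, LinearMap.ker_eq_bot']
  intro f hf
  by_contra hne
  obtain ⟨v, hv, hmax⟩ := f.support.exists_max_image (len b) (Finsupp.support_nonempty_iff.mpr hne)
  have h1 := coeff_pbwMap F b word f v
  rw [hf, Finsupp.sum, Finset.sum_apply, Finset.sum_eq_single_of_mem v hv, Pi.smul_apply,
    Algebra.smul_def] at h1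
  · have h2 := hopWord_leading b (ratio F P) (fun w i => by
      rw [ratio, smul_mul', weyl_smul_algebraMap_localized]
      have h3 : w • xGamma F Λ = xGamma F Λ := (weyl_smul_x F P w 1 0).trans (by rw [smul_zero]; rfl)
      rw [h3, ratio]
      congr 1
      have h4 := algebraMap_xRoot_mul_invRoot (P := P) F (P.weylGroupToPerm w i)
      have h5 := congrArg (w • ·) (algebraMap_xRoot_mul_invRoot (P := P) F i)
      have h6 : w • xRoot F P i = xRoot F P (P.weylGroupToPerm w i) :=
        (weyl_smul_x F P w 0 _).trans (by rw [RootPairing.weylGroup_apply_root]; rfl)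
      simp only [smul_mul', smul_one, weyl_smul_algebraMap_localized, h6] at h5
      linear_combination (invRoot F P (P.weylGroupToPerm w i)) * h5 - (w • invRoot F P i) * h4)
      (I := word v) (by rw [hlen, hword])
    rw [hword] at h2
    rw [h2] at h1
    have h3 : IsRegular (∏ β ∈ inversions b v, (1 - ratio F P β)) := by
      refine Finset.prod_induction _ IsRegular (fun _ _ => IsRegular.mul) isRegular_one
        fun β _ => one_sub_ratio_isRegular F hreg β
    have h4 : algebraMap _ (LocalizedAlgebra F P) (f v) = 0 := h3.right (by
      change _ * _ = 0 * _
      rw [zero_mul, ← h1]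
      rfl)
    rw [← map_zero (algebraMap (BaseAlgebra F Λ) (LocalizedAlgebra F P))] at h4
    exact (Finsupp.mem_support_iff.mp hv) (algebraMap_localized_injective F hreg h4)
  · intro u hu huv
    have : hopWord b (ratio F P) (word u) v = 0 := by
      by_contra h
      rcases eq_or_len_lt_of_hopWord_ne_zero b (ratio F P) (by rw [hlen, hword]) h with h | h
      · rw [hword] at h
        exact huv h.symm
      · rw [hword] at h
        have := hmax u hu
        omega
    rw [Pi.smul_apply, this, smul_zero]

end Hecke

/-! ### The action of the formal affine Hecke algebra -/

section Action

variable {R : Type*} [CommRing R] (F : FormalGroup R)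
  {ι Λ Λ' : Type*} [AddCommGroup Λ] [AddCommGroup Λ'] (P : RootDatum ι Λ Λ')

/-- The action of `Q_W` on `Q` as a homomorphism of algebras. -/
def twistedActHom : TwistedAlgebra F P →ₐ[R] Module.End R (LocalizedAlgebra F P) :=
  SkewMonoidAlgebra.liftNCAlgHom (Algebra.lmul R (LocalizedAlgebra F P))
    (DistribMulAction.toModuleEnd R (LocalizedAlgebra F P)) fun {q w} => LinearMap.ext fun q' => by
      change (w • q) * (w • q') = w • (q * q')
      rw [smul_mul']

theorem twistedActHom_single (w : P.weylGroup) (u q : LocalizedAlgebra F P) :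
    twistedActHom F P (SkewMonoidAlgebra.single w u) q = u * w • q := by
  have h : twistedActHom F P (SkewMonoidAlgebra.single w u) =
      Algebra.lmul R (LocalizedAlgebra F P) u *
        DistribMulAction.toModuleEnd R (LocalizedAlgebra F P) w :=
    SkewMonoidAlgebra.liftNC_single _ _ _ _
  rw [h]
  rfl

theorem twistedActHom_apply (z : TwistedAlgebra F P) (q : LocalizedAlgebra F P) :
    twistedActHom F P z q = twistedAct F P z q := by
  induction z using SkewMonoidAlgebra.induction_on' with
  | single w u =>
    rw [twistedActHom_single, twistedAct, SkewMonoidAlgebra.sum_single_index (zero_mul _)]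
  | add z z' h h' =>
    rw [map_add, LinearMap.add_apply, h, h', twistedAct, twistedAct, twistedAct,
      SkewMonoidAlgebra.sum_add_index' (fun _ => zero_mul _) (fun _ _ _ => add_mul _ _ _)]

theorem twistedActHom_scalar (s : BaseAlgebra F Λ) (q : LocalizedAlgebra F P) :
    twistedActHom F P (scalar F P s) q = algebraMap _ _ s * q := by
  change twistedActHom F P (SkewMonoidAlgebra.single 1 (algebraMap _ _ s)) q = _
  rw [twistedActHom_single, one_smul]

theorem twistedActHom_demazureLusztig (i : ι) {u q : BaseAlgebra F Λ}
    (h : u - simpleRefl P i • u = xRoot F P i * q) :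
    twistedActHom F P (demazureLusztig F P i) (algebraMap _ _ u) =
      algebraMap _ _ (xGamma F Λ * q + simpleRefl P i • u) := by
  have h1 := congrArg (algebraMap (BaseAlgebra F Λ) (LocalizedAlgebra F P)) h
  rw [map_sub, map_mul] at h1
  have h2 := algebraMap_xRoot_mul_invRoot (P := P) F i
  rw [demazureLusztig_eq, map_add, LinearMap.add_apply, twistedActHom_single, twistedActHom_single,
    one_smul, weyl_smul_algebraMap_localized, map_add, map_mul, ratio]
  linear_combination (algebraMap _ (LocalizedAlgebra F P) (xGamma F Λ)) * (invRoot F P i * h1 +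
    algebraMap _ (LocalizedAlgebra F P) q * h2)

variable {P} (b : P.Base) [F.IsComm] [Module.Finite ℤ Λ] [Module.Free ℤ Λ]

theorem exists_twistedActHom_eq (z : heckeAlgebra F P b) (u : BaseAlgebra F Λ) :
    ∃ v : BaseAlgebra F Λ, twistedActHom F P z (algebraMap _ _ u) = algebraMap _ _ v := by
  obtain ⟨z, hz⟩ := z
  change ∃ v : BaseAlgebra F Λ, twistedActHom F P z (algebraMap _ _ u) = algebraMap _ _ v
  induction hz using Algebra.adjoin_induction generalizing u with
  | mem z hz =>
    rcases hz with ⟨s, rfl⟩ | ⟨i, hi, rfl⟩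
    · exact ⟨s * u, by rw [twistedActHom_scalar, map_mul]⟩
    · obtain ⟨q, -, h⟩ := exists_sub_simpleRefl_smul_eq F (P := P) i (j := 0) (u := u) (by simp)
      exact ⟨_, twistedActHom_demazureLusztig F P i h⟩
  | algebraMap r =>
    refine ⟨r • u, ?_⟩
    rw [AlgHom.commutes, Module.algebraMap_end_apply, Algebra.smul_def, Algebra.smul_def, map_mul,
      ← IsScalarTower.algebraMap_apply]
  | add z w _ _ hz hw =>
    obtain ⟨v, hv⟩ := hz u
    obtain ⟨v', hv'⟩ := hw u
    exact ⟨v + v', by rw [map_add, LinearMap.add_apply, hv, hv', map_add]⟩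
  | mul z w _ _ hz hw =>
    obtain ⟨v, hv⟩ := hw u
    obtain ⟨v', hv'⟩ := hz v
    exact ⟨v', by rw [map_mul, Module.End.mul_apply, hv, hv']⟩

/-- The action of `Q_W` on `Q` restricts to an action of the formal affine Hecke algebra on `S`. -/
theorem exists_heckeAction (hreg : IsSigmaRegular F P) :
    ∃ ρ : heckeAlgebra F P b →ₐ[R] Module.End R (BaseAlgebra F Λ),
      ∀ z u, algebraMap (BaseAlgebra F Λ) (LocalizedAlgebra F P) (ρ z u) =
        twistedAct F P z (algebraMap _ _ u) := by
  have hinj := algebraMap_localized_injective F hreg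
  have hr (r : R) (u : BaseAlgebra F Λ) :
      algebraMap (BaseAlgebra F Λ) (LocalizedAlgebra F P) (r • u) = r • algebraMap _ _ u := by
    rw [Algebra.smul_def, Algebra.smul_def, map_mul, ← IsScalarTower.algebraMap_apply]
  choose f hf using exists_twistedActHom_eq F b
  let g (z : heckeAlgebra F P b) : Module.End R (BaseAlgebra F Λ) :=
    { toFun := f z
      map_add' := fun u v => hinj (by rw [← hf, map_add, map_add, map_add, hf, hf])
      map_smul' := fun r u => hinj (by
        rw [← hf, hr, map_smul, hf, RingHom.id_apply, hr]) }
  have hg (z : heckeAlgebra F P b) (u : BaseAlgebra F Λ) :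
      algebraMap (BaseAlgebra F Λ) (LocalizedAlgebra F P) (g z u) =
        twistedActHom F P z (algebraMap _ _ u) := (hf z u).symm
  refine ⟨AlgHom.ofLinearMap
    { toFun := g
      map_add' := fun z w => LinearMap.ext fun u => hinj ?_
      map_smul' := fun r z => LinearMap.ext fun u => hinj ?_ }
    (LinearMap.ext fun u => hinj ?_) fun z w => LinearMap.ext fun u => hinj ?_, fun z u => ?_⟩
  · rw [hg, LinearMap.add_apply, map_add, hg, hg, Subalgebra.coe_add, map_add, LinearMap.add_apply]
  · rw [hg, Subalgebra.coe_smul, map_smul, LinearMap.smul_apply, ← hg, ← hr]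
    rfl
  · change algebraMap _ _ (g 1 u) = algebraMap _ _ u
    rw [hg, Subalgebra.coe_one, map_one, Module.End.one_apply]
  · change algebraMap _ _ (g (z * w) u) = algebraMap _ _ (g z (g w u))
    rw [hg, hg, hg, Subalgebra.coe_mul, map_mul, Module.End.mul_apply]
  · exact (hg z u).trans (twistedActHom_apply F P z (algebraMap _ _ u))

variable {F b} (hreg : IsSigmaRegular F P)
  {ρ : heckeAlgebra F P b →ₐ[R] Module.End R (BaseAlgebra F Λ)}
  (hρ : ∀ z u, algebraMap (BaseAlgebra F Λ) (LocalizedAlgebra F P) (ρ z u) =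
    twistedAct F P z (algebraMap _ _ u))

include hreg hρ

theorem heckeAction_scalar (s u : BaseAlgebra F Λ) : ρ (heckeScalar F P b s) u = s * u :=
  algebraMap_localized_injective F hreg (by
    rw [hρ, ← twistedActHom_apply, coe_heckeScalar, twistedActHom_scalar, map_mul])

theorem heckeAction_T (i : b.support) {u q : BaseAlgebra F Λ}
    (h : u - simpleRefl P i • u = xRoot F P i * q) :
    ρ (heckeT F P b i) u = xGamma F Λ * q + simpleRefl P (i : ι) • u :=
  algebraMap_localized_injective F hreg (by
    rw [hρ, ← twistedActHom_apply, coe_heckeT, twistedActHom_demazureLusztig F P _ h])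

theorem heckeAction_T_one (i : b.support) : ρ (heckeT F P b i) 1 = 1 := by
  rw [heckeAction_T hreg hρ i (u := 1) (q := 0) (by rw [smul_one, sub_self, mul_zero]), mul_zero,
    zero_add, smul_one]

theorem heckeAction_mem {j k : ℕ} {z : heckeAlgebra F P b} (hz : z ∈ heckeFiltration F P b j)
    {u : BaseAlgebra F Λ} (hu : u ∈ baseFiltration F Λ k) :
    ρ z u ∈ baseFiltration F Λ (j + k) := by
  have hI (I : List b.support) : ρ (tProd F b I) u ∈ augIdeal F (ℤ × Λ) ^ k := by
    induction I with
    | nil =>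
      rw [tProd_nil, map_one]
      exact hu
    | cons i I ih =>
      obtain ⟨q, hq, h⟩ := exists_sub_simpleRefl_smul_eq F (P := P) i ih
      rw [tProd_cons, map_mul, Module.End.mul_apply, heckeAction_T hreg hρ i h]
      exact add_mem (xGamma_mul_mem F hq) (weyl_smul_mem_augIdeal_pow F _ ih)
  induction hz using Submodule.span_induction with
  | mem z hz =>
    obtain ⟨s, hs, I, rfl⟩ := hz
    rw [map_mul, Module.End.mul_apply, heckeAction_scalar hreg hρ]
    change _ ∈ augIdeal F (ℤ × Λ) ^ (j + k)
    rw [pow_add]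
    exact Ideal.mul_mem_mul hs (hI I)
  | zero =>
    rw [map_zero, LinearMap.zero_apply]
    exact zero_mem _
  | add z w _ _ hz hw =>
    rw [map_add, LinearMap.add_apply]
    exact add_mem hz hw
  | smul r z _ hz =>
    rw [map_smul, LinearMap.smul_apply]
    exact Submodule.smul_mem _ r hz

end Action

open scoped TensorProduct

/-! ### Associated graded rings -/

section GradedModules

variable {R : Type*} [CommRing R] {M : Type*} [AddCommGroup M] [Module R M] (F : ℕ → Submodule R M)

theorem Gr.mk_eq_mk_of_sub_mem {i : ℕ} {a c : F i} (h : (a : M) - c ∈ F (i + 1)) :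
    Gr.mk F i a = Gr.mk F i c := by
  rw [← sub_eq_zero, ← map_sub, Gr.mk, LinearMap.comp_apply, GrPiece.mk_eq_zero F i (a - c) h,
    map_zero]

theorem Gr.mk_congr {i j : ℕ} (hij : i = j) {a : F i} {c : F j} (h : (a : M) = c) :
    Gr.mk F i a = Gr.mk F j c := by
  subst hij
  rw [Subtype.ext h]

theorem Gr.induction {p : Gr F → Prop} (h0 : p 0) (hadd : ∀ a c, p a → p c → p (a + c))
    (hmk : ∀ i (a : F i), p (Gr.mk F i a)) (a : Gr F) : p a := by
  induction a using DirectSum.induction_on with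
  | zero => exact h0
  | of i a =>
    obtain ⟨a, rfl⟩ := GrPiece.mk_surjective F i a
    exact hmk i a
  | add a c ha hc => exact hadd a c ha hc

theorem Gr.mk_add_zsmul (i : ℕ) (a c : F i) (k : ℤ) :
    Gr.mk F i (a + k • c) = Gr.mk F i a + k • Gr.mk F i c := by
  rw [map_add, map_zsmul]

theorem Gr.mk_mem_component (i : ℕ) (m : F i) : Gr.mk F i m ∈ Gr.component F i := ⟨_, rfl⟩

theorem Gr.mem_component_iff (i : ℕ) {a : Gr F} : a ∈ Gr.component F i ↔ ∃ m, Gr.mk F i m = a := by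
  constructor
  · rintro ⟨c, rfl⟩
    obtain ⟨m, rfl⟩ := GrPiece.mk_surjective F i c
    exact ⟨m, rfl⟩
  · rintro ⟨m, rfl⟩
    exact Gr.mk_mem_component F i m

end GradedModules

section GradedRings

variable {R : Type*} [CommRing R] {A : Type*} [Ring A] [Algebra R A] (F : ℕ → Submodule R A)
  [IsDecreasingFiltration F]

theorem Gr.one_eq : (1 : Gr F) = Gr.mk F 0 ⟨1, IsDecreasingFiltration.mem_zero F 1⟩ := rfl

end GradedRings

/-! ### The associated graded ring of the formal group algebra -/

section GrBase

variable {R : Type*} [CommRing R] (F : FormalGroup R) {Λ : Type*} [AddCommGroup Λ]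

instance grBaseCommRing : CommRing (Gr (baseFiltration F Λ)) where
  mul_comm a c := by
    induction a using Gr.induction with
    | h0 => rw [zero_mul, mul_zero]
    | hadd a a' h h' => rw [add_mul, mul_add, h, h']
    | hmk i a =>
      induction c using Gr.induction with
      | h0 => rw [zero_mul, mul_zero]
      | hadd a a' h h' => rw [add_mul, mul_add, h, h']
      | hmk j c =>
        rw [Gr.mk_mul_mk, Gr.mk_mul_mk]
        exact Gr.mk_congr _ (add_comm i j) (mul_comm _ _)

/-- The class of `x_m` in degree one. -/
def grX (m : ℤ × Λ) : Gr (baseFiltration F Λ) :=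
  Gr.mk (baseFiltration F Λ) 1 ⟨x F m, x_mem_baseFiltration F m⟩

variable [F.IsComm] [Module.Finite ℤ Λ] [Module.Free ℤ Λ]

theorem grX_add (l m : ℤ × Λ) : grX F (l + m) = grX F l + grX F m := by
  rw [grX, grX, grX, ← map_add]
  refine Gr.mk_eq_mk_of_sub_mem _ ?_
  obtain ⟨v, hv⟩ := exists_x_add F l m
  change x F (l + m) - (x F l + x F m) ∈ augIdeal F (ℤ × Λ) ^ (1 + 1)
  rw [hv, add_sub_cancel_left, pow_add, pow_one]
  exact Ideal.mul_mem_right _ _ (Ideal.mul_mem_mul (x_mem_augIdeal F l) (x_mem_augIdeal F m))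

/-- The additive map `m ↦ [x_m]`. -/
def grXHom : ℤ × Λ →+ Gr (baseFiltration F Λ) :=
  AddMonoidHom.mk' (grX F) (grX_add F)

variable {σ : Type*} (β : Module.Basis σ ℤ (ℤ × Λ))

/-- The homomorphism from the polynomial ring that takes the variables to the classes of the `x_m`
for `m` in a basis. -/
def grPoly : MvPolynomial σ R →ₐ[R] Gr (baseFiltration F Λ) :=
  MvPolynomial.aeval fun i => grX F (β i)

variable [Finite σ]

omit [Module.Finite ℤ Λ] [Module.Free ℤ Λ] in
theorem coordEquiv_symm_monomial_mem (d : σ →₀ ℕ) (r : R) {n : ℕ} (hn : d.degree = n) :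
    (coordEquiv F β).symm (MvPowerSeries.monomial d r) ∈ baseFiltration F Λ n := by
  classical
  change _ ∈ augIdeal F (ℤ × Λ) ^ n
  rw [mem_augIdeal_pow_iff F β, AlgEquiv.apply_symm_apply]
  intro e he
  rw [MvPowerSeries.coeff_monomial, if_neg]
  rintro rfl
  omega

omit [Module.Finite ℤ Λ] [Module.Free ℤ Λ] in
theorem grPoly_monomial_one (d : σ →₀ ℕ) : grPoly F β (MvPolynomial.monomial d 1) =
    Gr.mk (baseFiltration F Λ) d.degree
      ⟨_, coordEquiv_symm_monomial_mem F β d (1 : R) rfl⟩ := by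
  induction d using Finsupp.induction_linear with
  | zero =>
    rw [← MvPolynomial.C_apply, map_one, map_one, Gr.one_eq]
    refine Gr.mk_congr _ (by simp) ?_
    change 1 = (coordEquiv F β).symm (MvPowerSeries.monomial 0 1)
    rw [MvPowerSeries.monomial_zero_one, map_one]
  | add d e hd he =>
    have h1 : (MvPolynomial.monomial (d + e) 1 : MvPolynomial σ R) =
        MvPolynomial.monomial d 1 * MvPolynomial.monomial e 1 := by
      rw [MvPolynomial.monomial_mul, one_mul]
    rw [h1, map_mul, hd, he, Gr.mk_mul_mk]
    refine Gr.mk_congr _ (by simp) ?_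
    change (coordEquiv F β).symm _ * (coordEquiv F β).symm _ = (coordEquiv F β).symm _
    rw [← map_mul, MvPowerSeries.monomial_mul_monomial, one_mul]
  | single i n =>
    induction n with
    | zero =>
      rw [Finsupp.single_zero, ← MvPolynomial.C_apply, map_one, map_one, Gr.one_eq]
      refine Gr.mk_congr _ (by simp) ?_
      change 1 = (coordEquiv F β).symm (MvPowerSeries.monomial _ 1)
      rw [MvPowerSeries.monomial_zero_one, map_one]
    | succ n ih =>
      have h1 : (MvPolynomial.monomial (Finsupp.single i (n + 1)) 1 : MvPolynomial σ R) =
          MvPolynomial.monomial (Finsupp.single i n) 1 * MvPolynomial.X i := by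
        rw [MvPolynomial.X, MvPolynomial.monomial_mul, one_mul, ← Finsupp.single_add]
      have h2 : grPoly F β (MvPolynomial.X i) = grX F (β i) := MvPolynomial.aeval_X _ i
      rw [h1, map_mul, ih, h2, grX, Gr.mk_mul_mk]
      refine Gr.mk_congr _ (by simp) ?_
      change (coordEquiv F β).symm _ * x F (β i) = (coordEquiv F β).symm _
      rw [AlgEquiv.eq_symm_apply, map_mul, AlgEquiv.apply_symm_apply, coordEquiv_x_basis,
        MvPowerSeries.X, MvPowerSeries.monomial_mul_monomial, one_mul, ← Finsupp.single_add]

omit [Module.Finite ℤ Λ] [Module.Free ℤ Λ] in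
theorem grPoly_monomial (d : σ →₀ ℕ) (r : R) {n : ℕ} (hn : d.degree = n) :
    grPoly F β (MvPolynomial.monomial d r) =
      Gr.mk (baseFiltration F Λ) n ⟨_, coordEquiv_symm_monomial_mem F β d r hn⟩ := by
  subst hn
  have h1 : (MvPolynomial.monomial d r : MvPolynomial σ R) = r • MvPolynomial.monomial d 1 := by
    rw [MvPolynomial.smul_monomial, smul_eq_mul, mul_one]
  rw [h1, map_smul, grPoly_monomial_one, ← map_smul]
  refine congrArg _ (Subtype.ext ?_)
  change r • (coordEquiv F β).symm _ = (coordEquiv F β).symm _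
  rw [← map_smul, ← LinearMap.map_smul, smul_eq_mul, mul_one]

variable [Fintype σ] [DecidableEq σ]

/-- The homogeneous component of degree `n` of an element of the formal group algebra, as a
polynomial in the variables of a basis. -/
def leadingForm (n : ℕ) : BaseAlgebra F Λ →ₗ[R] MvPolynomial σ R :=
  ∑ d ∈ Finset.univ.finsuppAntidiag n,
    (MvPolynomial.monomial d).comp ((MvPowerSeries.coeff d).comp (coordEquiv F β).toLinearMap)

omit [Module.Finite ℤ Λ] [Module.Free ℤ Λ] in
theorem leadingForm_apply (n : ℕ) (f : BaseAlgebra F Λ) : leadingForm F β n f =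
    ∑ d ∈ Finset.univ.finsuppAntidiag n,
      MvPolynomial.monomial d (MvPowerSeries.coeff d (coordEquiv F β f)) := by
  rw [leadingForm, LinearMap.sum_apply]
  rfl

omit [F.IsComm] [Module.Finite ℤ Λ] [Module.Free ℤ Λ] [Finite σ] in
theorem mem_finsuppAntidiag_univ {n : ℕ} {d : σ →₀ ℕ} :
    d ∈ Finset.univ.finsuppAntidiag n ↔ d.degree = n := by
  rw [Finset.mem_finsuppAntidiag, Finsupp.degree_eq_sum]
  simp

/-- The leading form of a class in degree `n`. -/
def grLeadPiece (n : ℕ) : GrPiece (baseFiltration F Λ) n →ₗ[R] MvPolynomial σ R :=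
  Submodule.liftQ ((baseFiltration F Λ (n + 1)).submoduleOf (baseFiltration F Λ n))
    ((leadingForm F β n).comp (baseFiltration F Λ n).subtype) fun f hf => by
      rw [LinearMap.mem_ker, LinearMap.comp_apply, leadingForm_apply]
      refine Finset.sum_eq_zero fun d hd => ?_
      have h1 : (f : BaseAlgebra F Λ) ∈ augIdeal F (ℤ × Λ) ^ (n + 1) := hf
      rw [mem_augIdeal_pow_iff F β] at h1
      have h2 := mem_finsuppAntidiag_univ.mp hd
      rw [Submodule.subtype_apply, h1 d (by omega), map_zero]

/-- The linear map that takes a class to its leading form. -/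
def grLead : Gr (baseFiltration F Λ) →ₗ[R] MvPolynomial σ R :=
  DirectSum.toModule R ℕ _ (grLeadPiece F β)

omit [Module.Finite ℤ Λ] [Module.Free ℤ Λ] in
theorem grLead_mk (n : ℕ) (f : baseFiltration F Λ n) :
    grLead F β (Gr.mk (baseFiltration F Λ) n f) = leadingForm F β n f := by
  rw [Gr.mk, LinearMap.comp_apply, grLead, DirectSum.toModule_lof]
  rfl

omit [Module.Finite ℤ Λ] [Module.Free ℤ Λ] in
theorem grLead_grPoly (p : MvPolynomial σ R) : grLead F β (grPoly F β p) = p := by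
  induction p using MvPolynomial.induction_on' with
  | monomial d r =>
    rw [grPoly_monomial F β d r rfl, grLead_mk, leadingForm_apply, Finset.sum_eq_single d]
    · rw [AlgEquiv.apply_symm_apply, MvPowerSeries.coeff_monomial_same]
    · intro e _ he
      rw [AlgEquiv.apply_symm_apply, MvPowerSeries.coeff_monomial_ne he, map_zero]
    · intro h
      exact absurd (mem_finsuppAntidiag_univ.mpr rfl) h
  | add p q hp hq => rw [map_add, map_add, hp, hq]

omit [Module.Finite ℤ Λ] [Module.Free ℤ Λ] in
theorem grPoly_grLead (a : Gr (baseFiltration F Λ)) : grPoly F β (grLead F β a) = a := by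
  induction a using Gr.induction with
  | h0 => rw [map_zero, map_zero]
  | hadd a c ha hc => rw [map_add, map_add, ha, hc]
  | hmk n f =>
    let t (d : σ →₀ ℕ) : baseFiltration F Λ n :=
      if hd : d.degree = n then
        ⟨_, coordEquiv_symm_monomial_mem F β d (MvPowerSeries.coeff d (coordEquiv F β f)) hd⟩
      else 0
    have ht (d : σ →₀ ℕ) (hd : d.degree = n) : (t d : BaseAlgebra F Λ) =
        (coordEquiv F β).symm (MvPowerSeries.monomial d
          (MvPowerSeries.coeff d (coordEquiv F β f))) := by
      simp only [t, dif_pos hd]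
    have h1 : grPoly F β (grLead F β (Gr.mk (baseFiltration F Λ) n f)) =
        Gr.mk (baseFiltration F Λ) n (∑ d ∈ Finset.univ.finsuppAntidiag n, t d) := by
      rw [grLead_mk, leadingForm_apply, map_sum, map_sum]
      refine Finset.sum_congr rfl fun d hd => ?_
      have hd' := mem_finsuppAntidiag_univ.mp hd
      rw [grPoly_monomial F β d _ hd']
      exact congrArg _ (Subtype.ext (ht d hd').symm)
    rw [h1]
    refine Gr.mk_eq_mk_of_sub_mem _ ?_
    change _ ∈ augIdeal F (ℤ × Λ) ^ (n + 1)
    rw [mem_augIdeal_pow_iff F β]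
    intro d hd
    have hf : (f : BaseAlgebra F Λ) ∈ augIdeal F (ℤ × Λ) ^ n := f.2
    rw [mem_augIdeal_pow_iff F β] at hf
    have h2 : coordEquiv F β ((∑ d ∈ Finset.univ.finsuppAntidiag n, t d :
        baseFiltration F Λ n) : BaseAlgebra F Λ) = ∑ d ∈ Finset.univ.finsuppAntidiag n,
        MvPowerSeries.monomial d (MvPowerSeries.coeff d (coordEquiv F β f)) := by
      rw [Submodule.coe_sum, map_sum]
      refine Finset.sum_congr rfl fun d hd => ?_
      rw [ht d (mem_finsuppAntidiag_univ.mp hd), AlgEquiv.apply_symm_apply]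
    rw [map_sub, h2, map_sub, map_sum, sub_eq_zero]
    by_cases hdn : d.degree = n
    · rw [Finset.sum_eq_single_of_mem d (mem_finsuppAntidiag_univ.mpr hdn),
        MvPowerSeries.coeff_monomial_same]
      intro e _ he
      rw [MvPowerSeries.coeff_monomial_ne he.symm]
    · rw [hf d (by omega), Finset.sum_eq_zero]
      intro e he
      rw [MvPowerSeries.coeff_monomial_ne]
      rintro rfl
      exact hdn (mem_finsuppAntidiag_univ.mp he)

/-- The associated graded ring is a polynomial ring in the classes of the `x_m` for `m` in a
basis. -/
def grPolyEquiv : MvPolynomial σ R ≃ₐ[R] Gr (baseFiltration F Λ) :=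
  AlgEquiv.ofBijective (grPoly F β)
    ⟨Function.LeftInverse.injective (grLead_grPoly F β),
      Function.RightInverse.surjective (grPoly_grLead F β)⟩

end GrBase

section GrSym

variable {R : Type*} [CommRing R] (F : FormalGroup R) [F.IsComm] (Λ : Type*) [AddCommGroup Λ]
  [Module.Finite ℤ Λ] [Module.Free ℤ Λ]

open Classical in
/-- The isomorphism of the symmetric algebra with the associated graded ring. -/
def grSymEquiv : R ⊗[ℤ] SymEps Λ ≃ₐ[R] Gr (baseFiltration F Λ) :=
  ((Algebra.TensorProduct.congr AlgEquiv.refl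
    (SymmetricAlgebra.equivMvPolynomial (Module.Free.chooseBasis ℤ (ℤ × Λ)))).trans
    (MvPolynomial.algebraTensorAlgEquiv ℤ R)).trans
    (grPolyEquiv F (Module.Free.chooseBasis ℤ (ℤ × Λ)))

theorem grSymEquiv_ι (m : ℤ × Λ) :
    grSymEquiv F Λ (1 ⊗ₜ SymmetricAlgebra.ι ℤ (ℤ × Λ) m) = grX F m := by
  let β := Module.Free.chooseBasis ℤ (ℤ × Λ)
  let f : ℤ × Λ →+ Gr (baseFiltration F Λ) :=
    ((grSymEquiv F Λ).toAlgHom.toRingHom.toAddMonoidHom.comp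
      (Algebra.TensorProduct.includeRight (R := ℤ) (A := R)
        (B := SymEps Λ)).toRingHom.toAddMonoidHom).comp
      (SymmetricAlgebra.ι ℤ (ℤ × Λ)).toAddMonoidHom
  have h : ∀ i, f (β i) = grXHom F (β i) := by
    intro i
    change grSymEquiv F Λ (1 ⊗ₜ SymmetricAlgebra.ι ℤ (ℤ × Λ) (β i)) = grX F (β i)
    have h1 : Algebra.TensorProduct.congr (AlgEquiv.refl : R ≃ₐ[R] R)
        (SymmetricAlgebra.equivMvPolynomial β) (1 ⊗ₜ SymmetricAlgebra.ι ℤ (ℤ × Λ) (β i)) =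
        1 ⊗ₜ MvPolynomial.X i := by
      rw [Algebra.TensorProduct.congr_apply, Algebra.TensorProduct.map_tmul]
      exact congrArg (fun t => (1 : R) ⊗ₜ[ℤ] t) (SymmetricAlgebra.equivMvPolynomial_ι_apply β i)
    have h2 : MvPolynomial.algebraTensorAlgEquiv ℤ R (1 ⊗ₜ MvPolynomial.X i) =
        MvPolynomial.X i := by
      rw [MvPolynomial.algebraTensorAlgEquiv_tmul, one_smul, MvPolynomial.map_X]
    rw [grSymEquiv, AlgEquiv.trans_apply, AlgEquiv.trans_apply]
    refine (congrArg _ ((congrArg _ h1).trans h2)).trans ?_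
    exact MvPolynomial.aeval_X _ i
  change f m = grXHom F m
  rw [← β.sum_repr m, map_sum, map_sum]
  exact Finset.sum_congr rfl fun i _ => by rw [map_zsmul, map_zsmul, h]

end GrSym

/-! ### The associated graded ring of the formal affine Hecke algebra -/

section GrMap

variable {R : Type*} [CommRing R] {M N : Type*} [AddCommGroup M] [Module R M] [AddCommGroup N]
  [Module R N] (F : ℕ → Submodule R M) (G : ℕ → Submodule R N) (φ : M →ₗ[R] N)
  (h : ∀ i, ∀ m ∈ F i, φ m ∈ G i)

/-- The map induced on `F i / F (i + 1)` by a linear map that respects the filtrations. -/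
def grMapPiece (i : ℕ) : GrPiece F i →ₗ[R] GrPiece G i :=
  Submodule.liftQ ((F (i + 1)).submoduleOf (F i)) ((GrPiece.mk G i).comp (φ.restrict (h i)))
    fun m hm => GrPiece.mk_eq_zero G i _ (h (i + 1) m hm)

/-- The map induced on the associated graded modules by a linear map that respects the
filtrations. -/
def grMap : Gr F →ₗ[R] Gr G :=
  DirectSum.toModule R ℕ _ fun i => (DirectSum.lof R ℕ (GrPiece G) i).comp (grMapPiece F G φ h i)

theorem grMap_mk (i : ℕ) (m : F i) :
    grMap F G φ h (Gr.mk F i m) = Gr.mk G i ⟨φ m, h i m m.2⟩ := by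
  rw [Gr.mk, LinearMap.comp_apply, grMap, DirectSum.toModule_lof]
  rfl

end GrMap

section GrHecke

variable {R : Type*} [CommRing R] (F : FormalGroup R)
  {ι Λ Λ' : Type*} [AddCommGroup Λ] [AddCommGroup Λ'] {P : RootDatum ι Λ Λ'} (b : P.Base)
  [F.IsComm] [Module.Finite ℤ Λ] [Module.Free ℤ Λ]

omit [F.IsComm] [Module.Finite ℤ Λ] [Module.Free ℤ Λ] in
theorem heckeScalarHom_mem (i : ℕ) (u : BaseAlgebra F Λ) (hu : u ∈ baseFiltration F Λ i) :
    (heckeScalarHom F b).toLinearMap u ∈ heckeFiltration F P b i :=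
  heckeScalar_mem F P b hu

/-- The linear map of associated graded modules induced by the embedding of `S`. -/
def grScalarLin : Gr (baseFiltration F Λ) →ₗ[R] Gr (heckeFiltration F P b) :=
  grMap (baseFiltration F Λ) (heckeFiltration F P b) (heckeScalarHom F b).toLinearMap
    (heckeScalarHom_mem F b)

omit [F.IsComm] [Module.Finite ℤ Λ] [Module.Free ℤ Λ] in
theorem grScalarLin_mk (n : ℕ) (u : baseFiltration F Λ n) :
    grScalarLin F b (Gr.mk (baseFiltration F Λ) n u) =
      Gr.mk (heckeFiltration F P b) n ⟨heckeScalar F P b u, heckeScalar_mem F P b u.2⟩ :=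
  grMap_mk (baseFiltration F Λ) (heckeFiltration F P b) (heckeScalarHom F b).toLinearMap
    (heckeScalarHom_mem F b) n u

theorem grScalarLin_one : grScalarLin (P := P) F b 1 = 1 := by
  rw [Gr.one_eq, grScalarLin_mk, Gr.one_eq]
  refine Gr.mk_congr _ rfl ?_
  change heckeScalar F P b 1 = 1
  rw [heckeScalar_eq, map_one]

instance grHeckeRing : Ring (Gr (heckeFiltration F P b)) :=
  DirectSum.ring (GrPiece (heckeFiltration F P b))

theorem grScalarLin_mul (a c : Gr (baseFiltration F Λ)) :
    grScalarLin (P := P) F b (a * c) = grScalarLin F b a * grScalarLin F b c := by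
  induction a using Gr.induction with
  | h0 => rw [zero_mul, map_zero, zero_mul]
  | hadd a a' h h' => rw [add_mul, map_add, map_add, add_mul, h, h']
  | hmk i a =>
    induction c using Gr.induction with
    | h0 => rw [mul_zero, map_zero, mul_zero]
    | hadd a a' h h' => rw [mul_add, map_add, map_add, mul_add, h, h']
    | hmk j c =>
      rw [Gr.mk_mul_mk, grScalarLin_mk, grScalarLin_mk, grScalarLin_mk, Gr.mk_mul_mk]
      refine Gr.mk_congr _ rfl ?_
      change heckeScalar F P b (a * c) = heckeScalar F P b a * heckeScalar F P b c
      rw [heckeScalar_eq, map_mul, heckeScalar_eq, heckeScalar_eq]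

/-- The homomorphism of associated graded rings induced by the embedding of `S`. -/
def grScalar : Gr (baseFiltration F Λ) →ₐ[R] Gr (heckeFiltration F P b) :=
  AlgHom.ofLinearMap (grScalarLin F b) (grScalarLin_one F b) (grScalarLin_mul F b)

theorem grScalar_mk (n : ℕ) (u : baseFiltration F Λ n) :
    grScalar F b (Gr.mk (baseFiltration F Λ) n u) =
      Gr.mk (heckeFiltration F P b) n ⟨heckeScalar F P b u, heckeScalar_mem F P b u.2⟩ :=
  grScalarLin_mk F b n u

theorem tProd_mem_zero (I : List b.support) : tProd F b I ∈ heckeFiltration F P b 0 :=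
  IsDecreasingFiltration.mem_zero _ _

variable [Finite ι] [P.IsReduced]

/-- A chosen reduced word. -/
def redWord (v : P.weylGroup) : List b.support := (exists_reduced b v).choose

omit [Module.Finite ℤ Λ] [Module.Free ℤ Λ] in
theorem length_redWord (v : P.weylGroup) : (redWord b v).length = len b v :=
  (exists_reduced b v).choose_spec.1

omit [Module.Finite ℤ Λ] [Module.Free ℤ Λ] in
theorem wordProd_redWord (v : P.weylGroup) : wordProd b (redWord b v) = v :=
  (exists_reduced b v).choose_spec.2

/-- The class of `T_v` in degree zero. -/
def grT (v : P.weylGroup) : Gr (heckeFiltration F P b) :=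
  Gr.mk (heckeFiltration F P b) 0 ⟨tProd F b (redWord b v), tProd_mem_zero F b _⟩

/-- The class of the product of the `T_i` along a word depends only on the product of the simple
reflections. -/
theorem mk_tProd (I : List b.support) :
    Gr.mk (heckeFiltration F P b) 0 ⟨tProd F b I, tProd_mem_zero F b I⟩ =
      grT F b (wordProd b I) := by
  obtain ⟨f, hf⟩ := exists_tProd_eq F b (length_redWord b) (wordProd_redWord b) I
  refine Gr.mk_eq_mk_of_sub_mem _ ?_
  change tProd F b I - tProd F b (redWord b (wordProd b I)) ∈ heckeFiltration F P b (0 + 1)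
  rw [hf, add_sub_cancel_left]
  have h1 := heckeScalar_mul_mem F b (j := 1) (u := xGamma F Λ) (by
    rw [pow_one]
    exact x_mem_augIdeal F _) (IsDecreasingFiltration.mem_zero (heckeFiltration F P b)
      (pbwMap F b (redWord b) f))
  rwa [add_comm] at h1

theorem grT_one : grT F b 1 = 1 := by
  rw [← wordProd_nil b, ← mk_tProd, Gr.one_eq]
  exact Gr.mk_congr _ rfl rfl

omit [F.IsComm] [Module.Finite ℤ Λ] [Module.Free ℤ Λ] [Finite ι] [P.IsReduced] in
theorem tProd_append (I J : List b.support) : tProd F b (I ++ J) = tProd F b I * tProd F b J := by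
  rw [tProd, List.map_append, List.prod_append, tProd, tProd]

theorem grT_mul (v w : P.weylGroup) : grT F b (v * w) = grT F b v * grT F b w := by
  have h : grT F b (v * w) = grT F b (wordProd b (redWord b v ++ redWord b w)) := by
    rw [wordProd_append, wordProd_redWord, wordProd_redWord]
  rw [h, ← mk_tProd, grT, grT, Gr.mk_mul_mk]
  exact Gr.mk_congr _ rfl (tProd_append F b _ _)

theorem grT_simpleRefl (i : b.support) : grT F b (simpleRefl P i) =
    Gr.mk (heckeFiltration F P b) 0 ⟨heckeT F P b i, heckeT_mem F P b i⟩ := by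
  have h : grT F b (simpleRefl P i) = grT F b (wordProd b [i]) := by
    rw [wordProd_cons, wordProd_nil, mul_one]
  rw [h, ← mk_tProd]
  refine Gr.mk_congr _ rfl ?_
  change tProd F b [i] = heckeT F P b i
  rw [tProd_cons, tProd_nil, mul_one]

/-- The cross relation: `T_i x_m - x_{s_i(m)} T_i` is `x_γ` times the divided difference of `x_m`,
whose constant term is the pairing of `m` with the coroot. -/
theorem grT_mul_grX (i : b.support) (n : ℤ) (l : Λ) :
    grT F b (simpleRefl P i) * grScalar F b (grX F (n, l)) =
      grScalar F b (grX F (n, P.reflection i l)) * grT F b (simpleRefl P i) +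
        (P.toLinearMap l (P.coroot i)) • grScalar F b (grX F (1, 0)) := by
  set k : ℤ := P.toLinearMap l (P.coroot i)
  obtain ⟨q, hq, h⟩ := exists_x_add_zsmul F (n, l) (-k) ((0 : ℤ), P.root i)
  have hs : (n, l) + (-k) • ((0 : ℤ), P.root i) = (n, P.reflection i l) := by
    refine Prod.ext ?_ ?_
    · simp
    · change l + (-k) • P.root i = P.reflection i l
      rw [neg_smul, ← sub_eq_add_neg]
      exact (P.reflection_apply i l).symm
  have hs' : simpleRefl P (i : ι) • x F (n, l) = x F (n, P.reflection i l) :=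
    weyl_smul_x F P _ n l
  have h1 : x F (n, l) - simpleRefl P (i : ι) • x F (n, l) = xRoot F P i * (-q) := by
    rw [hs', ← hs, h, xRoot]
    ring
  have h2 : grScalar F b (grX F (n, P.reflection i l)) * grT F b (simpleRefl P i) +
      k • grScalar F b (grX F (1, 0)) = Gr.mk (heckeFiltration F P b) 1
        (⟨heckeScalar F P b (x F (n, P.reflection i l)) * heckeT F P b i,
          IsDecreasingFiltration.mul_mem (i := 1) (j := 0)
            (heckeScalar_mem F P b (x_mem_baseFiltration F _)) (heckeT_mem F P b i)⟩ +
        k • ⟨heckeScalar F P b (xGamma F Λ), heckeScalar_mem F P b (x_mem_baseFiltration F _)⟩) := by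
    rw [grX, grX, grScalar_mk, grScalar_mk, grT_simpleRefl, Gr.mk_mul_mk]
    exact (Gr.mk_add_zsmul (heckeFiltration F P b) 1 _ _ k).symm
  rw [h2, grX, grScalar_mk, grT_simpleRefl, Gr.mk_mul_mk]
  refine (Gr.mk_congr _ (zero_add 1) rfl).trans (Gr.mk_eq_mk_of_sub_mem (i := 1)
    (a := ⟨heckeT F P b i * heckeScalar F P b (x F (n, l)), ?_⟩) _ ?_)
  · have := IsDecreasingFiltration.mul_mem (heckeT_mem F P b i)
      (heckeScalar_mem F P b (x_mem_baseFiltration F (n, l)))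
    rwa [zero_add] at this
  · change heckeT F P b i * heckeScalar F P b (x F (n, l)) -
      (heckeScalar F P b (x F (n, P.reflection i l)) * heckeT F P b i +
        k • heckeScalar F P b (xGamma F Λ)) ∈ heckeFiltration F P b (1 + 1)
    rw [heckeT_mul_heckeScalar F b i h1, hs', add_sub_add_left_eq_sub, heckeScalar_eq,
      heckeScalar_eq, ← map_zsmul, ← map_sub]
    refine heckeScalar_mem F P b ?_
    change _ ∈ augIdeal F (ℤ × Λ) ^ (1 + 1)
    have h3 : xGamma F Λ * -q - k • xGamma F Λ = xGamma F Λ * (-q - (k : BaseAlgebra F Λ)) := by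
      rw [zsmul_eq_mul]
      ring
    rw [h3, pow_add, pow_one]
    refine Ideal.mul_mem_mul (x_mem_augIdeal F _) ?_
    change augmentation F _ (-q - (k : BaseAlgebra F Λ)) = 0
    rw [map_sub, map_neg, hq, map_intCast]
    simp

/-- The map `∑ a_v v ↦ ∑ a_v [T_v]`. -/
def grPbw : (P.weylGroup →₀ Gr (baseFiltration F Λ)) →+ Gr (heckeFiltration F P b) :=
  Finsupp.liftAddHom fun v =>
    (AddMonoidHom.mulRight (grT F b v)).comp (grScalar (P := P) F b : _ →+ _)

theorem grPbw_single (v : P.weylGroup) (a : Gr (baseFiltration F Λ)) :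
    grPbw F b (Finsupp.single v a) = grScalar F b a * grT F b v := by
  rw [grPbw, Finsupp.liftAddHom_apply_single]
  rfl

theorem grScalar_mk_mul_grT (v : P.weylGroup) (n : ℕ) (u : baseFiltration F Λ n) :
    grScalar F b (Gr.mk (baseFiltration F Λ) n u) * grT F b v =
      Gr.mk (heckeFiltration F P b) n ⟨heckeScalar F P b u * tProd F b (redWord b v),
        tProd_mem_heckeFiltration F b _ u.2⟩ := by
  rw [grScalar_mk, grT, Gr.mk_mul_mk]
  exact Gr.mk_congr _ (add_zero n) rfl

theorem grPbw_surjective : Function.Surjective (grPbw (P := P) F b) := by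
  intro a
  induction a using Gr.induction with
  | h0 => exact ⟨0, map_zero _⟩
  | hadd a c h h' =>
    obtain ⟨f, rfl⟩ := h
    obtain ⟨g, rfl⟩ := h'
    exact ⟨f + g, map_add _ f g⟩
  | hmk n z =>
    obtain ⟨z, hz⟩ := z
    induction hz using Submodule.closure_induction with
    | zero => exact ⟨0, (map_zero _).trans (map_zero (Gr.mk (heckeFiltration F P b) n)).symm⟩
    | add z w hz hw h h' =>
      obtain ⟨f, hf⟩ := h
      obtain ⟨g, hg⟩ := h'
      refine ⟨f + g, (map_add _ f g).trans ?_⟩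
      rw [hf, hg]
      exact (map_add (Gr.mk (heckeFiltration F P b) n) ⟨z, hz⟩ ⟨w, hw⟩).symm
    | smul_mem r z hz =>
      obtain ⟨u, hu, I, rfl⟩ := hz
      refine ⟨Finsupp.single (wordProd b I) (Gr.mk (baseFiltration F Λ) n
        ⟨r • u, Submodule.smul_mem _ r hu⟩), ?_⟩
      rw [grPbw_single, ← mk_tProd, grScalar_mk, Gr.mk_mul_mk]
      refine Gr.mk_congr _ (add_zero n) ?_
      change heckeScalar F P b (r • u) * tProd F b I = r • (heckeScalar F P b u * tProd F b I)
      rw [heckeScalar_eq, map_smul, Algebra.smul_mul_assoc, heckeScalar_eq]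

/-- The coefficients with respect to the basis `T_v` respect the filtrations, so they induce maps of
associated graded modules that recover the coefficients of a combination of the classes. -/
theorem grPbw_injective (hreg : IsSigmaRegular F P) :
    Function.Injective (grPbw (P := P) F b) := by
  classical
  have hinj := pbwMap_injective F b (length_redWord b) (wordProd_redWord b) hreg
  have hsurj : Function.Surjective (pbwMap F b (redWord b)) := fun z => by
    obtain ⟨f, -, hf⟩ := (mem_heckeFiltration_iff F b (length_redWord b) (wordProd_redWord b)).mp
      (IsDecreasingFiltration.mem_zero (heckeFiltration F P b) z)
    exact ⟨f, hf⟩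
  let E := LinearEquiv.ofBijective (pbwMap F b (redWord b)) ⟨hinj, hsurj⟩
  have hE (f) : E.symm (pbwMap F b (redWord b) f) = f := E.symm_apply_apply f
  let coef (w : P.weylGroup) : heckeAlgebra F P b →ₗ[R] BaseAlgebra F Λ :=
    (Finsupp.lapply w).comp E.symm.toLinearMap
  have hcoef (w : P.weylGroup) (n : ℕ) (z) (hz : z ∈ heckeFiltration F P b n) :
      coef w z ∈ baseFiltration F Λ n := by
    obtain ⟨f, hf, rfl⟩ :=
      (mem_heckeFiltration_iff F b (length_redWord b) (wordProd_redWord b)).mp hz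
    change E.symm (pbwMap F b (redWord b) f) w ∈ _
    rw [hE]
    exact hf w
  have key (w : P.weylGroup) (g : P.weylGroup →₀ Gr (baseFiltration F Λ)) :
      grMap _ _ (coef w) (hcoef w) (grPbw F b g) = g w := by
    induction g using Finsupp.induction_linear with
    | zero => rw [map_zero, map_zero, Finsupp.zero_apply]
    | add g g' h h' => rw [map_add, map_add, h, h', Finsupp.add_apply]
    | single v a =>
      rw [grPbw_single]
      induction a using Gr.induction with
      | h0 => rw [map_zero, zero_mul, map_zero, Finsupp.single_zero, Finsupp.zero_apply]
      | hadd a c h h' => rw [map_add, add_mul, map_add, h, h', Finsupp.single_add,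
          Finsupp.add_apply]
      | hmk n u =>
        have h1 : coef w (heckeScalar F P b u * tProd F b (redWord b v)) =
            (Finsupp.single v (u : BaseAlgebra F Λ)) w := by
          rw [← pbwMap_single]
          change E.symm (pbwMap F b (redWord b) _) w = _
          rw [hE]
        rw [grScalar_mk_mul_grT, grMap_mk, Finsupp.single_apply]
        rw [Finsupp.single_apply] at h1
        split_ifs at h1 ⊢ with hvw
        · exact Gr.mk_congr _ rfl h1
        · rw [← map_zero (Gr.mk (baseFiltration F Λ) n)]
          exact Gr.mk_congr _ rfl h1
  intro g g' h
  refine Finsupp.ext fun w => ?_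
  rw [← key w g, h, key w g']

end GrHecke

/-! ### The degenerate affine Hecke algebra -/

section DegHecke

variable {κ Λ Λ' : Type*} [AddCommGroup Λ] [AddCommGroup Λ'] {P : RootDatum κ Λ Λ'} (b : P.Base)

theorem DegHecke.gen_eq (g : DegGen P) :
    DegHecke.gen b g = RingQuot.mkRingHom (DegRel b) (FreeAlgebra.ι ℤ g) := by
  rw [← RingQuot.mkAlgHom_coe ℤ]
  rfl

theorem DegHecke.induction {p : DegHecke b → Prop} (hint : ∀ n : ℤ, p n)
    (hgen : ∀ g, p (DegHecke.gen b g)) (hadd : ∀ a c, p a → p c → p (a + c))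
    (hmul : ∀ a c, p a → p c → p (a * c)) (a : DegHecke b) : p a := by
  obtain ⟨a, rfl⟩ := RingQuot.mkRingHom_surjective (DegRel b) a
  induction a using FreeAlgebra.induction with
  | grade0 n =>
    rw [eq_intCast, map_intCast]
    exact hint n
  | grade1 g =>
    rw [← DegHecke.gen_eq]
    exact hgen g
  | mul a c ha hc =>
    rw [map_mul]
    exact hmul _ _ ha hc
  | add a c ha hc =>
    rw [map_add]
    exact hadd _ _ ha hc

theorem mem_span_prod_gen (a : DegHecke b) : a ∈ Submodule.span ℤ
    {a | ∃ L : List (DegGen P), a = (L.map (DegHecke.gen b)).prod} := by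
  set C := Submodule.span ℤ {a | ∃ L : List (DegGen P), a = (L.map (DegHecke.gen b)).prod}
  have hall : ∀ c ∈ C, a * c ∈ C := by
    induction a using DegHecke.induction with
    | hint n =>
      intro c hc
      rw [← zsmul_eq_mul]
      exact zsmul_mem hc n
    | hgen g =>
      intro c hc
      induction hc using Submodule.span_induction with
      | mem c hc =>
        obtain ⟨L, rfl⟩ := hc
        exact Submodule.subset_span ⟨g :: L, by rw [List.map_cons, List.prod_cons]⟩
      | zero => rw [mul_zero]; exact zero_mem _
      | add c c' _ _ h h' => rw [mul_add]; exact add_mem h h'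
      | smul n c _ h => rw [mul_smul_comm]; exact zsmul_mem h n
    | hadd a a' h h' =>
      intro c hc
      rw [add_mul]
      exact add_mem (h c hc) (h' c hc)
    | hmul a a' h h' =>
      intro c hc
      rw [mul_assoc]
      exact h _ (h' c hc)
  simpa using hall 1 (Submodule.subset_span ⟨[], rfl⟩)

theorem DegHecke.mk_eq_of_rel {x y : FreeAlgebra ℤ (DegGen P)} (h : DegRel b x y) :
    RingQuot.mkRingHom (DegRel b) x = RingQuot.mkRingHom (DegRel b) y :=
  RingQuot.mkRingHom_rel h

theorem DegHecke.gen_eps_comm (g : DegGen P) :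
    DegHecke.gen b .eps * DegHecke.gen b g = DegHecke.gen b g * DegHecke.gen b .eps := by
  have h := DegHecke.mk_eq_of_rel b (DegRel.eps_comm g)
  rwa [map_mul, map_mul, ← DegHecke.gen_eq, ← DegHecke.gen_eq] at h

theorem DegHecke.gen_wt_add (l m : Λ) :
    DegHecke.gen b (.wt (l + m)) = DegHecke.gen b (.wt l) + DegHecke.gen b (.wt m) := by
  have h := DegHecke.mk_eq_of_rel b (DegRel.wt_add l m)
  rwa [map_add, ← DegHecke.gen_eq, ← DegHecke.gen_eq, ← DegHecke.gen_eq] at h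

theorem DegHecke.gen_wt_comm (l m : Λ) : DegHecke.gen b (.wt l) * DegHecke.gen b (.wt m) =
    DegHecke.gen b (.wt m) * DegHecke.gen b (.wt l) := by
  have h := DegHecke.mk_eq_of_rel b (DegRel.wt_comm l m)
  rwa [map_mul, map_mul, ← DegHecke.gen_eq, ← DegHecke.gen_eq] at h

theorem DegHecke.gen_theta_one : DegHecke.gen b (.theta 1) = 1 := by
  have h := DegHecke.mk_eq_of_rel b DegRel.theta_one
  rwa [map_one, ← DegHecke.gen_eq] at h

theorem DegHecke.gen_theta_mul (v w : P.weylGroup) : DegHecke.gen b (.theta (v * w)) =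
    DegHecke.gen b (.theta v) * DegHecke.gen b (.theta w) := by
  have h := DegHecke.mk_eq_of_rel b (DegRel.theta_mul v w)
  rwa [map_mul, ← DegHecke.gen_eq, ← DegHecke.gen_eq, ← DegHecke.gen_eq] at h

theorem DegHecke.gen_cross (i : b.support) (l : Λ) :
    DegHecke.gen b (.theta (simpleRefl P i)) * DegHecke.gen b (.wt l) =
      DegHecke.gen b (.wt (P.reflection i l)) * DegHecke.gen b (.theta (simpleRefl P i)) +
        P.toLinearMap l (P.coroot i) • DegHecke.gen b .eps := by
  have h := DegHecke.mk_eq_of_rel b (DegRel.cross i l)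
  rw [map_sub, map_mul, map_mul, map_zsmul, ← DegHecke.gen_eq, ← DegHecke.gen_eq,
    ← DegHecke.gen_eq, ← DegHecke.gen_eq] at h
  exact eq_add_of_sub_eq' h

/-- Elements of a ring that satisfy the relations of the degenerate affine Hecke algebra: `s (n, l)`
in the role of `n ε + l` and `τ w` in the role of `θ_w`. -/
structure IsDegSystem {G : Type*} [Ring G] (s : ℤ × Λ →+ G) (τ : P.weylGroup →* G) : Prop where
  comm : ∀ l m, s l * s m = s m * s l
  cross : ∀ (i : b.support) (n : ℤ) (l : Λ), τ (simpleRefl P i) * s (n, l) =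
    s (n, P.reflection i l) * τ (simpleRefl P i) + P.toLinearMap l (P.coroot i) • s (1, 0)

section Lift

variable {b} {G : Type*} [Ring G] {s : ℤ × Λ →+ G} {τ : P.weylGroup →* G}

/-- The relations for the simple reflections imply that `s (1, 0)` is central. -/
theorem IsDegSystem.comm_tau [Finite κ] [P.IsReduced] (h : IsDegSystem b s τ) (w : P.weylGroup) :
    s (1, 0) * τ w = τ w * s (1, 0) := by
  obtain ⟨I, rfl⟩ := exists_wordProd_eq b w
  induction I with
  | nil => rw [wordProd_nil, map_one, one_mul, mul_one]
  | cons i I ih =>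
    have h1 := h.cross i 1 0
    rw [map_zero, map_zero, LinearMap.zero_apply, zero_smul, add_zero] at h1
    rw [wordProd_cons, map_mul, ← mul_assoc, ← h1, mul_assoc, ih, mul_assoc]

/-- The value of a generator in a system of elements that satisfy the relations. -/
def degValue (s : ℤ × Λ →+ G) (τ : P.weylGroup →* G) : DegGen P → G
  | .eps => s (1, 0)
  | .wt l => s (0, l)
  | .theta w => τ w

variable [Finite κ] [P.IsReduced]

/-- The homomorphism out of the degenerate affine Hecke algebra determined by elements that satisfy
its relations. -/
def degLift (h : IsDegSystem b s τ) : DegHecke b →+* G :=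
  RingQuot.lift ⟨(FreeAlgebra.lift ℤ (degValue s τ)).toRingHom, by
    have hι (g : DegGen P) : (FreeAlgebra.lift ℤ (degValue s τ)).toRingHom (FreeAlgebra.ι ℤ g) =
        degValue s τ g := FreeAlgebra.lift_ι_apply _ _
    intro x y hxy
    induction hxy with
    | eps_comm g =>
      rw [map_mul, map_mul, hι, hι]
      cases g with
      | eps => rfl
      | wt l => exact h.comm _ _
      | theta w => exact h.comm_tau w
    | wt_add l m =>
      rw [map_add, hι, hι, hι, degValue, degValue, degValue, ← map_add, Prod.mk_add_mk, add_zero]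
    | wt_comm l m =>
      rw [map_mul, map_mul, hι, hι]
      exact h.comm _ _
    | theta_one =>
      rw [map_one, hι]
      exact map_one τ
    | theta_mul v w =>
      rw [map_mul, hι, hι, hι]
      exact map_mul τ v w
    | cross i l =>
      rw [map_sub, map_mul, map_mul, map_zsmul, hι, hι, hι, hι]
      exact sub_eq_of_eq_add' (h.cross i 0 l)⟩

theorem degLift_gen (h : IsDegSystem b s τ) (g : DegGen P) :
    degLift h (DegHecke.gen b g) = degValue s τ g := by
  rw [DegHecke.gen_eq]
  exact (RingQuot.lift_mkRingHom_apply _ _ _).trans (FreeAlgebra.lift_ι_apply _ _)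

end Lift

/-- The elements `n ε + λ`. -/
def degLin : ℤ × Λ →+ DegHecke b where
  toFun m := m.1 • DegHecke.gen b .eps + DegHecke.gen b (.wt m.2)
  map_zero' := by
    have h := DegHecke.gen_wt_add b 0 0
    rw [add_zero, left_eq_add] at h
    rw [Prod.fst_zero, Prod.snd_zero, zero_smul, zero_add, h]
  map_add' l m := by
    rw [Prod.fst_add, Prod.snd_add, add_smul, DegHecke.gen_wt_add, add_add_add_comm]

theorem degLin_apply (n : ℤ) (l : Λ) :
    degLin b (n, l) = n • DegHecke.gen b .eps + DegHecke.gen b (.wt l) := rfl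

theorem degLin_zero_left (l : Λ) : degLin b (0, l) = DegHecke.gen b (.wt l) := by
  rw [degLin_apply, zero_smul, zero_add]

theorem degLin_one_zero : degLin b (1, 0) = DegHecke.gen b .eps := by
  have h := map_zero (degLin b)
  rw [← Prod.mk_zero_zero, degLin_zero_left] at h
  rw [degLin_apply, one_smul, h, add_zero]

/-- The elements `θ_w`. -/
def degTheta : P.weylGroup →* DegHecke b where
  toFun w := DegHecke.gen b (.theta w)
  map_one' := DegHecke.gen_theta_one b
  map_mul' := DegHecke.gen_theta_mul b

theorem degTheta_apply (w : P.weylGroup) : degTheta b w = DegHecke.gen b (.theta w) := rfl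

theorem isDegSystem_gen : IsDegSystem b (degLin b) (degTheta b) where
  comm l m := by
    rw [degLin_apply b l.1 l.2, degLin_apply b m.1 m.2]
    have h (n : ℤ) (g : DegGen P) : Commute (n • DegHecke.gen b .eps) (DegHecke.gen b g) :=
      Commute.smul_left (DegHecke.gen_eps_comm b g) n
    exact ((Commute.smul_right (h _ _) _).add_right (h _ _)).add_left
      ((h _ _).symm.add_right (DegHecke.gen_wt_comm b _ _))
  cross i n l := by
    rw [degLin_one_zero, degLin_apply, degLin_apply, degTheta_apply, mul_add, add_mul,
      DegHecke.gen_cross, mul_smul_comm, smul_mul_assoc, DegHecke.gen_eps_comm, add_assoc]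

section SymLift

variable {G : Type*} [Ring G] (s : ℤ × Λ →+ G) (hs : ∀ l m, s l * s m = s m * s l)

include hs in
theorem exists_symHom : ∃ σ : SymEps Λ →ₐ[ℤ] G, ∀ m, σ (SymmetricAlgebra.ι ℤ (ℤ × Λ) m) = s m := by
  have hc : IsMulCommutative (Algebra.adjoin ℤ (Set.range s)) :=
    Algebra.isMulCommutative_adjoin ℤ (by
      rintro _ ⟨l, rfl⟩ _ ⟨m, rfl⟩
      exact hs l m)
  open scoped IsMulCommutative in
  let f : ℤ × Λ →ₗ[ℤ] Algebra.adjoin ℤ (Set.range s) :=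
    { toFun := fun m => ⟨s m, Algebra.subset_adjoin ⟨m, rfl⟩⟩
      map_add' := fun l m => Subtype.ext (map_add s l m)
      map_smul' := fun n m => Subtype.ext (by simp) }
  exact ⟨(Algebra.adjoin ℤ (Set.range s)).val.comp (SymmetricAlgebra.lift f), fun m => by
    rw [AlgHom.comp_apply, SymmetricAlgebra.lift_ι_apply]
    rfl⟩

end SymLift

theorem SymEps.refl_ι (i : κ) (n : ℤ) (l : Λ) :
    SymEps.refl P i (SymmetricAlgebra.ι ℤ (ℤ × Λ) (n, l)) =
      SymmetricAlgebra.ι ℤ (ℤ × Λ) (n, P.reflection i l) := by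
  rw [SymEps.refl, SymmetricAlgebra.lift_ι_apply]
  rfl

/-- The inclusion of the symmetric algebra into the degenerate affine Hecke algebra. -/
def symToDeg : SymEps Λ →ₐ[ℤ] DegHecke b :=
  (exists_symHom (degLin b) (isDegSystem_gen b).comm).choose

theorem symToDeg_ι (m : ℤ × Λ) : symToDeg b (SymmetricAlgebra.ι ℤ (ℤ × Λ) m) = degLin b m :=
  (exists_symHom (degLin b) (isDegSystem_gen b).comm).choose_spec m

/-- The correction term in `θ_i u = s_i(u) θ_i + ε Δ_i(u)` is the divided difference
`Δ_i(u) = (u - s_i(u)) / α_i`. -/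
theorem exists_theta_mul_symToDeg (i : b.support) (u : SymEps Λ) :
    ∃ v, SymEps.wt (P.root i) * v = u - SymEps.refl P i u ∧
      degTheta b (simpleRefl P i) * symToDeg b u =
        symToDeg b (SymEps.refl P i u) * degTheta b (simpleRefl P i) +
          symToDeg b (SymEps.gamma Λ * v) := by
  induction u using SymmetricAlgebra.induction with
  | algebraMap n =>
    refine ⟨0, by rw [AlgHom.commutes, sub_self, mul_zero], ?_⟩
    rw [AlgHom.commutes, AlgHom.commutes, AlgHom.commutes, mul_zero, map_zero, add_zero]
    exact (Algebra.commutes _ _).symm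
  | ι m =>
    refine ⟨(P.toLinearMap m.2 (P.coroot i) : ℤ), ?_, ?_⟩
    · have h := SymEps.refl_ι (P := P) (i : κ) m.1 m.2
      rw [Prod.mk.eta] at h
      rw [h, ← map_sub, mul_comm, ← zsmul_eq_mul, SymEps.wt, ← map_zsmul]
      congr 1
      refine Prod.ext ?_ ?_
      · simp
      · rw [Prod.smul_snd, Prod.snd_sub, P.reflection_apply, sub_sub_cancel]
        rfl
    · rw [mul_comm, ← zsmul_eq_mul, map_zsmul, SymEps.gamma, symToDeg_ι, symToDeg_ι,
        SymEps.refl_ι (i : κ) m.1 m.2, symToDeg_ι]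
      exact (isDegSystem_gen b).cross i m.1 m.2
  | mul u u' h h' =>
    obtain ⟨v, h1, h⟩ := h
    obtain ⟨v', h1', h'⟩ := h'
    refine ⟨SymEps.refl P i u * v' + v * u', ?_, ?_⟩
    · rw [map_mul]
      linear_combination SymEps.refl P i u * h1' + u' * h1
    · rw [map_mul (symToDeg b) u u', ← mul_assoc, h, add_mul, mul_assoc, h',
        map_mul (SymEps.refl P i), mul_add (SymEps.gamma Λ), map_add, mul_add,
        mul_left_comm (SymEps.gamma Λ), ← mul_assoc (SymEps.gamma Λ) v, map_mul (symToDeg b) _ u',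
        map_mul (symToDeg b) (SymEps.refl P i u) (SymEps.refl P i u'),
        map_mul (symToDeg b) (SymEps.refl P i u) (_ * v'), mul_assoc, add_assoc]
  | add u u' h h' =>
    obtain ⟨v, h1, h⟩ := h
    obtain ⟨v', h1', h'⟩ := h'
    refine ⟨v + v', by rw [mul_add, h1, h1', map_add, add_sub_add_comm], ?_⟩
    rw [map_add, mul_add, h, h', map_add, map_add, mul_add, map_add, add_mul, add_add_add_comm]

variable [Finite κ] [P.IsReduced]

/-- The algebra is spanned by the products of elements of the symmetric algebra with the `θ_w`. -/
theorem mem_closure_symToDeg_mul_theta (a : DegHecke b) :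
    a ∈ AddSubgroup.closure {a | ∃ u w, a = symToDeg b u * degTheta b w} := by
  set C := AddSubgroup.closure {a | ∃ u w, a = symToDeg b u * degTheta b w}
  have hmem (u : SymEps Λ) (w : P.weylGroup) : symToDeg b u * degTheta b w ∈ C :=
    AddSubgroup.subset_closure ⟨u, w, rfl⟩
  have hext (d : DegHecke b) (hd : ∀ u w, d * (symToDeg b u * degTheta b w) ∈ C) :
      ∀ c ∈ C, d * c ∈ C := by
    intro c hc
    induction hc using AddSubgroup.closure_induction with
    | mem c hc =>
      obtain ⟨u, w, rfl⟩ := hc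
      exact hd u w
    | zero => rw [mul_zero]; exact zero_mem _
    | add c c' _ _ h h' => rw [mul_add]; exact add_mem h h'
    | neg c _ h => rw [mul_neg]; exact neg_mem h
  have hlin (m : ℤ × Λ) : ∀ c ∈ C, degLin b m * c ∈ C := hext _ fun u w => by
    rw [← symToDeg_ι, ← mul_assoc, ← map_mul]
    exact hmem _ _
  have hsimple (i : b.support) : ∀ c ∈ C, degTheta b (simpleRefl P i) * c ∈ C :=
    hext _ fun u w => by
      obtain ⟨v, -, h⟩ := exists_theta_mul_symToDeg b i u
      rw [← mul_assoc, h, add_mul, mul_assoc, ← map_mul]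
      exact add_mem (hmem _ _) (hmem _ _)
  have htheta (I : List b.support) : ∀ c ∈ C, degTheta b (wordProd b I) * c ∈ C := by
    induction I with
    | nil =>
      intro c hc
      rwa [wordProd_nil, map_one, one_mul]
    | cons i I ih =>
      intro c hc
      rw [wordProd_cons, map_mul, mul_assoc]
      exact hsimple i _ (ih c hc)
  have hall : ∀ c ∈ C, a * c ∈ C := by
    induction a using DegHecke.induction with
    | hint n =>
      intro c hc
      rw [← zsmul_eq_mul]
      exact zsmul_mem hc n
    | hgen g =>
      cases g with
      | eps =>
        rw [← degLin_one_zero]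
        exact hlin _
      | wt l =>
        rw [← degLin_zero_left]
        exact hlin _
      | theta w =>
        obtain ⟨I, rfl⟩ := exists_wordProd_eq b w
        exact htheta I
    | hadd a a' h h' =>
      intro c hc
      rw [add_mul]
      exact add_mem (h c hc) (h' c hc)
    | hmul a a' h h' =>
      intro c hc
      rw [mul_assoc]
      exact h _ (h' c hc)
  have h1 := hmem 1 1
  rw [map_one, map_one, mul_one] at h1
  simpa using hall 1 h1

end DegHecke

/-! ### Rings with a basis indexed by the Weyl group over the symmetric algebra -/

section PBW

variable {R : Type*} [CommRing R]
  {κ Λ Λ' : Type*} [AddCommGroup Λ] [AddCommGroup Λ'] {P : RootDatum κ Λ Λ'} {b : P.Base}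
  [Finite κ] [P.IsReduced] {G : Type*} [Ring G] [Algebra R G]
  {s : ℤ × Λ →+ G} {τ : P.weylGroup →* G}

/-- The `R`-linear extension of the homomorphism determined by elements that satisfy the
relations. -/
def degBaseLift (R : Type*) [CommRing R] [Algebra R G] (h : IsDegSystem b s τ) :
    R ⊗[ℤ] DegHecke b →ₐ[R] G :=
  Algebra.TensorProduct.lift (Algebra.ofId R G) (degLift h).toIntAlgHom
    fun r _ => (show Commute _ _ from Algebra.commutes r _)

theorem degBaseLift_tmul (h : IsDegSystem b s τ) (r : R) (a : DegHecke b) :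
    degBaseLift R h (r ⊗ₜ a) = r • degLift h a := by
  rw [degBaseLift, Algebra.TensorProduct.lift_tmul, Algebra.smul_def]
  rfl

theorem degBaseLift_degLin (h : IsDegSystem b s τ) (m : ℤ × Λ) :
    degBaseLift R h (1 ⊗ₜ degLin b m) = s m := by
  rw [degBaseLift_tmul, one_smul, degLin_apply b m.1 m.2, map_add, map_zsmul, degLift_gen,
    degLift_gen, degValue, degValue, ← map_zsmul, ← map_add]
  congr 1
  ext <;> simp

theorem degBaseLift_degTheta (h : IsDegSystem b s τ) (w : P.weylGroup) :
    degBaseLift R h (1 ⊗ₜ degTheta b w) = τ w := by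
  rw [degBaseLift_tmul, one_smul, degTheta_apply, degLift_gen, degValue]

/-- The homomorphism of the symmetric algebra to the degenerate affine Hecke algebra over `R`. -/
def symToDegBase (R : Type*) [CommRing R] (b : P.Base) : R ⊗[ℤ] SymEps Λ →ₐ[R] R ⊗[ℤ] DegHecke b :=
  Algebra.TensorProduct.map (AlgHom.id R R) (symToDeg b)

omit [Finite κ] [P.IsReduced] in
theorem symToDegBase_tmul (r : R) (u : SymEps Λ) :
    symToDegBase R b (r ⊗ₜ u) = r ⊗ₜ symToDeg b u := rfl

theorem degBaseLift_symToDegBase (h : IsDegSystem b s τ) (σ : R ⊗[ℤ] SymEps Λ →ₐ[R] G)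
    (hσ : ∀ m, σ (1 ⊗ₜ SymmetricAlgebra.ι ℤ (ℤ × Λ) m) = s m) (t : R ⊗[ℤ] SymEps Λ) :
    degBaseLift R h (symToDegBase R b t) = σ t := by
  have key (u : SymEps Λ) : degBaseLift R h (1 ⊗ₜ symToDeg b u) = σ (1 ⊗ₜ u) := by
    induction u using SymmetricAlgebra.induction with
    | algebraMap n =>
      have h1 : (1 : R) ⊗ₜ[ℤ] (n : DegHecke b) = n :=
        map_intCast (Algebra.TensorProduct.includeRight (R := ℤ) (A := R) (B := DegHecke b)) n
      have h2 : (1 : R) ⊗ₜ[ℤ] (n : SymEps Λ) = n :=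
        map_intCast (Algebra.TensorProduct.includeRight (R := ℤ) (A := R) (B := SymEps Λ)) n
      rw [eq_intCast, map_intCast, h1, h2, map_intCast, map_intCast]
    | ι m => rw [symToDeg_ι, degBaseLift_degLin, hσ]
    | mul u v hu hv =>
      rw [map_mul, ← one_mul (1 : R), ← Algebra.TensorProduct.tmul_mul_tmul, map_mul, hu, hv,
        ← map_mul, Algebra.TensorProduct.tmul_mul_tmul]
    | add u v hu hv => rw [map_add, TensorProduct.tmul_add, map_add, hu, hv, TensorProduct.tmul_add,
        map_add]
  induction t with
  | zero => rw [map_zero, map_zero, map_zero]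
  | add t t' h h' => rw [map_add, map_add, map_add, h, h']
  | tmul r u =>
    have h1 : r ⊗ₜ[ℤ] u = r • ((1 : R) ⊗ₜ[ℤ] u) := by
      rw [TensorProduct.smul_tmul', smul_eq_mul, mul_one]
    rw [h1, map_smul, map_smul, map_smul, symToDegBase_tmul, key]

/-- If the elements `τ w` form a basis over the symmetric algebra, then the homomorphism is
bijective: the products of elements of the symmetric algebra with the `θ_w` span its source. -/
theorem degBaseLift_bijective (h : IsDegSystem b s τ) (σ : R ⊗[ℤ] SymEps Λ →ₐ[R] G)
    (hσ : ∀ m, σ (1 ⊗ₜ SymmetricAlgebra.ι ℤ (ℤ × Λ) m) = s m)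
    (B : (P.weylGroup →₀ R ⊗[ℤ] SymEps Λ) →+ G) (hB : Function.Bijective B)
    (hB' : ∀ w t, B (Finsupp.single w t) = σ t * τ w) :
    Function.Bijective (degBaseLift R h) := by
  let D : (P.weylGroup →₀ R ⊗[ℤ] SymEps Λ) →+ R ⊗[ℤ] DegHecke b :=
    Finsupp.liftAddHom fun w => (AddMonoidHom.mulRight (1 ⊗ₜ degTheta b w)).comp
      (symToDegBase R b : _ →+ _)
  have hD (w t) : D (Finsupp.single w t) = symToDegBase R b t * (1 ⊗ₜ degTheta b w) :=
    Finsupp.liftAddHom_apply_single _ _ _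
  have hDB (f) : degBaseLift R h (D f) = B f := by
    induction f using Finsupp.induction_linear with
    | zero => rw [map_zero, map_zero, map_zero]
    | add f g hf hg => rw [map_add, map_add, map_add, hf, hg]
    | single w t => rw [hD, map_mul, degBaseLift_symToDegBase h σ hσ, degBaseLift_degTheta, hB']
  have hDsurj : Function.Surjective D := by
    intro a
    change a ∈ D.range
    induction a with
    | zero => exact zero_mem _
    | add a a' h h' => exact add_mem h h'
    | tmul r a =>
      have ha := mem_closure_symToDeg_mul_theta b a
      induction ha using AddSubgroup.closure_induction with
      | mem a ha =>
        obtain ⟨u, w, rfl⟩ := ha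
        refine ⟨Finsupp.single w (r ⊗ₜ u), ?_⟩
        rw [hD, symToDegBase_tmul, Algebra.TensorProduct.tmul_mul_tmul, mul_one]
      | zero =>
        rw [TensorProduct.tmul_zero]
        exact zero_mem _
      | add a a' _ _ h h' =>
        rw [TensorProduct.tmul_add]
        exact add_mem h h'
      | neg a _ h =>
        rw [TensorProduct.tmul_neg]
        exact neg_mem h
  refine ⟨fun a c hac => ?_, fun g => ?_⟩
  · obtain ⟨f, rfl⟩ := hDsurj a
    obtain ⟨f', rfl⟩ := hDsurj c
    rw [hDB, hDB] at hac
    rw [hB.1 hac]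
  · obtain ⟨f, rfl⟩ := hB.2 g
    exact ⟨D f, hDB f⟩

/-- The isomorphism is one of graded rings as soon as it respects the degrees of the generators. -/
theorem map_degBaseLift_component (h : IsDegSystem b s τ) (𝒢 : ℕ → Submodule R G)
    (hone : (1 : G) ∈ 𝒢 0) (hmul : ∀ {i j x y}, x ∈ 𝒢 i → y ∈ 𝒢 j → x * y ∈ 𝒢 (i + j))
    (pr : ℕ → G →+ G) (hpr : ∀ {n x}, x ∈ 𝒢 n → pr n x = x)
    (hpr' : ∀ {m n x}, x ∈ 𝒢 m → m ≠ n → pr n x = 0)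
    (hs : ∀ m, s m ∈ 𝒢 1) (hτ : ∀ w, τ w ∈ 𝒢 0)
    (e : G ≃ₐ[R] R ⊗[ℤ] DegHecke b) (he : ∀ a, e (degBaseLift R h a) = a) (n : ℕ) :
    (𝒢 n).map e.toLinearMap = (DegHecke.component b n).baseChange R := by
  have hprod (L : List (DegGen P)) : degLift h (L.map (DegHecke.gen b)).prod ∈
      𝒢 (L.map DegGen.degree).sum := by
    induction L with
    | nil =>
      rw [List.map_nil, List.map_nil, List.prod_nil, map_one]
      exact hone
    | cons g L ih =>
      rw [List.map_cons, List.map_cons, List.prod_cons, map_mul, List.sum_cons, degLift_gen]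
      refine hmul ?_ ih
      cases g with
      | eps => exact hs _
      | wt l => exact hs _
      | theta w => exact hτ w
  have hcomp {a : R ⊗[ℤ] DegHecke b} (ha : a ∈ (DegHecke.component b n).baseChange R) :
      degBaseLift R h a ∈ 𝒢 n := by
    rw [Submodule.baseChange_eq_span] at ha
    induction ha using Submodule.span_induction with
    | mem a ha =>
      obtain ⟨a, ha, rfl⟩ := ha
      change degBaseLift R h (1 ⊗ₜ a) ∈ 𝒢 n
      rw [degBaseLift_tmul, one_smul]
      induction ha using Submodule.span_induction with
      | mem a ha =>
        obtain ⟨L, rfl, rfl⟩ := ha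
        exact hprod L
      | zero => rw [map_zero]; exact zero_mem _
      | add a c _ _ ha hc => rw [map_add]; exact add_mem ha hc
      | smul k a _ ha => rw [map_zsmul]; exact zsmul_mem ha k
    | zero => rw [map_zero]; exact zero_mem _
    | add a c _ _ ha hc => rw [map_add]; exact add_mem ha hc
    | smul r a _ ha => rw [map_smul]; exact Submodule.smul_mem _ r ha
  have hproj (a : R ⊗[ℤ] DegHecke b) : ∃ a' ∈ (DegHecke.component b n).baseChange R,
      degBaseLift R h a' = pr n (degBaseLift R h a) := by
    induction a with
    | zero => exact ⟨0, zero_mem _, by rw [map_zero, map_zero]⟩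
    | add a c ha hc =>
      obtain ⟨a', ha', h1⟩ := ha
      obtain ⟨c', hc', h2⟩ := hc
      exact ⟨a' + c', add_mem ha' hc', by rw [map_add, map_add, map_add, h1, h2]⟩
    | tmul r a =>
      have ha := mem_span_prod_gen b a
      induction ha using Submodule.span_induction with
      | mem a ha =>
        obtain ⟨L, rfl⟩ := ha
        have h1 : degBaseLift R h (r ⊗ₜ (L.map (DegHecke.gen b)).prod) ∈
            𝒢 (L.map DegGen.degree).sum := by
          rw [degBaseLift_tmul]
          exact Submodule.smul_mem _ r (hprod L)
        by_cases hn : (L.map DegGen.degree).sum = n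
        · refine ⟨_, ?_, (hpr (hn ▸ h1)).symm⟩
          exact Submodule.tmul_mem_baseChange_of_mem r (Submodule.subset_span ⟨L, hn, rfl⟩)
        · exact ⟨0, zero_mem _, by rw [hpr' h1 hn, map_zero]⟩
      | zero => exact ⟨0, zero_mem _, by rw [TensorProduct.tmul_zero, map_zero, map_zero]⟩
      | add a c _ _ ha hc =>
        obtain ⟨a', ha', h1⟩ := ha
        obtain ⟨c', hc', h2⟩ := hc
        exact ⟨a' + c', add_mem ha' hc', by
          rw [TensorProduct.tmul_add, map_add, map_add, map_add, h1, h2]⟩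
      | smul k a _ ha =>
        obtain ⟨a', ha', h1⟩ := ha
        exact ⟨k • a', zsmul_mem ha' k, by
          rw [TensorProduct.tmul_smul, map_zsmul, map_zsmul, map_zsmul, h1]⟩
  refine le_antisymm ?_ fun a ha => ⟨degBaseLift R h a, hcomp ha, he a⟩
  rintro _ ⟨g, hg, rfl⟩
  have hg' : degBaseLift R h (e g) = g := e.injective (he _)
  obtain ⟨a', ha', h1⟩ := hproj (e g)
  rw [hg', hpr hg] at h1
  change e g ∈ _
  rwa [← h1, he]

end PBW

/-! ### The associated graded ring as a degenerate affine Hecke algebra -/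

section GrDeg

variable {R : Type*} [CommRing R] (F : FormalGroup R)
  {ι Λ Λ' : Type*} [AddCommGroup Λ] [AddCommGroup Λ'] {P : RootDatum ι Λ Λ'} (b : P.Base)
  [F.IsComm] [Module.Finite ℤ Λ] [Module.Free ℤ Λ] [Finite ι] [P.IsReduced]

/-- The classes of the `x_m` in the associated graded ring of the formal affine Hecke algebra. -/
def grLin : ℤ × Λ →+ Gr (heckeFiltration F P b) :=
  (grScalar F b : Gr (baseFiltration F Λ) →+ Gr (heckeFiltration F P b)).comp (grXHom F)

omit [Finite ι] [P.IsReduced] in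
theorem grLin_apply (m : ℤ × Λ) : grLin F b m = grScalar F b (grX F m) := rfl

/-- The classes of the `T_w`. -/
def grTheta : P.weylGroup →* Gr (heckeFiltration F P b) where
  toFun := grT F b
  map_one' := grT_one F b
  map_mul' := grT_mul F b

theorem isDegSystem_gr : IsDegSystem b (grLin F b) (grTheta F b) where
  comm l m := by
    rw [grLin_apply, grLin_apply, ← map_mul, ← map_mul, mul_comm]
  cross := grT_mul_grX F b

/-- The homomorphism from the degenerate affine Hecke algebra to the associated graded ring. -/
def degToGr : R ⊗[ℤ] DegHecke b →ₐ[R] Gr (heckeFiltration F P b) :=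
  degBaseLift R (isDegSystem_gr F b)

theorem degToGr_degLin (m : ℤ × Λ) : degToGr F b (1 ⊗ₜ degLin b m) = grScalar F b (grX F m) :=
  degBaseLift_degLin (isDegSystem_gr F b) m

theorem degToGr_degTheta (w : P.weylGroup) : degToGr F b (1 ⊗ₜ degTheta b w) = grT F b w :=
  degBaseLift_degTheta (isDegSystem_gr F b) w

theorem degToGr_bijective (hreg : IsSigmaRegular F P) : Function.Bijective (degToGr F b) := by
  refine degBaseLift_bijective (isDegSystem_gr F b)
    ((grScalar F b).comp (grSymEquiv F Λ : R ⊗[ℤ] SymEps Λ →ₐ[R] Gr (baseFiltration F Λ)))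
    (fun m => congrArg (grScalar F b) (grSymEquiv_ι F Λ m))
    ((grPbw F b).comp (Finsupp.mapRange.addMonoidHom
      ((grSymEquiv F Λ : R ⊗[ℤ] SymEps Λ →ₐ[R] Gr (baseFiltration F Λ)) :
        R ⊗[ℤ] SymEps Λ →+ Gr (baseFiltration F Λ)))) ?_ fun w t => ?_
  · refine Function.Bijective.comp (g := grPbw F b)
      ⟨grPbw_injective F b hreg, grPbw_surjective F b⟩ ⟨?_, ?_⟩
    · exact Finsupp.mapRange_injective _ (map_zero _) (grSymEquiv F Λ).injective
    · exact Finsupp.mapRange_surjective _ (map_zero _) (grSymEquiv F Λ).surjective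
  · change grPbw F b (Finsupp.mapRange (grSymEquiv F Λ) (map_zero _) (Finsupp.single w t)) = _
    rw [Finsupp.mapRange_single, grPbw_single]
    rfl

/-- The isomorphism of the degenerate affine Hecke algebra with the associated graded ring. -/
def degEquivGr (hreg : IsSigmaRegular F P) : R ⊗[ℤ] DegHecke b ≃ₐ[R] Gr (heckeFiltration F P b) :=
  AlgEquiv.ofBijective (degToGr F b) (degToGr_bijective F b hreg)

theorem degEquivGr_symm_degToGr (hreg : IsSigmaRegular F P) (a : R ⊗[ℤ] DegHecke b) :
    (degEquivGr F b hreg).symm (degToGr F b a) = a :=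
  (degEquivGr F b hreg).symm_apply_apply a

/-- The isomorphism is one of graded rings. -/
theorem map_component (hreg : IsSigmaRegular F P) (n : ℕ) :
    (Gr.component (heckeFiltration F P b) n).map (degEquivGr F b hreg).symm.toLinearMap =
      (DegHecke.component b n).baseChange R := by
  refine map_degBaseLift_component (isDegSystem_gr F b) (Gr.component (heckeFiltration F P b))
    (Gr.mk_mem_component _ 0 _) ?_ (fun n => ((DirectSum.lof R ℕ (GrPiece (heckeFiltration F P b)) n).comp
      (DirectSum.component R ℕ (GrPiece (heckeFiltration F P b)) n)).toAddMonoidHom) ?_ ?_ ?_ ?_ _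
    (degEquivGr_symm_degToGr F b hreg) n
  · intro i j x y hx hy
    obtain ⟨x, rfl⟩ := (Gr.mem_component_iff _ i).mp hx
    obtain ⟨y, rfl⟩ := (Gr.mem_component_iff _ j).mp hy
    rw [Gr.mk_mul_mk]
    exact Gr.mk_mem_component _ _ _
  · rintro n _ ⟨x, rfl⟩
    change DirectSum.lof R ℕ _ n (DirectSum.component R ℕ _ n (DirectSum.lof R ℕ _ n x)) = _
    rw [DirectSum.component.lof_self]
  · rintro m n _ ⟨x, rfl⟩ hmn
    change DirectSum.lof R ℕ _ n (DirectSum.component R ℕ _ n (DirectSum.lof R ℕ _ m x)) = _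
    rw [DirectSum.component.of, dif_neg hmn, map_zero]
  · intro m
    rw [grLin_apply, grX, grScalar_mk]
    exact Gr.mk_mem_component _ 1 _
  · intro w
    exact Gr.mk_mem_component _ 0 _

end GrDeg

section GrAction

variable {R : Type*} [CommRing R] {A : Type*} [Ring A] [Algebra R A] (F : ℕ → Submodule R A)
  [IsDecreasingFiltration F] {M : Type*} [AddCommGroup M] [Module R M] (G : ℕ → Submodule R M)
  (ρ : A →ₐ[R] Module.End R M)
  (hρ : ∀ j k, ∀ z ∈ F j, ∀ u ∈ G k, ρ.toLinearMap z u ∈ G (j + k))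

theorem grPairing_one (s : Gr G) : grPairing F G G ρ.toLinearMap hρ 1 s = s := by
  induction s using Gr.induction with
  | h0 => rw [map_zero]
  | hadd a c ha hc => rw [map_add, ha, hc]
  | hmk i m =>
    rw [Gr.one_eq, grPairing_mk]
    refine Gr.mk_congr G (zero_add i) ?_
    change ρ 1 m = m
    rw [map_one, Module.End.one_apply]

theorem grPairing_mul (a c : Gr F) (s : Gr G) : grPairing F G G ρ.toLinearMap hρ (a * c) s =
    grPairing F G G ρ.toLinearMap hρ a (grPairing F G G ρ.toLinearMap hρ c s) := by
  induction s using Gr.induction with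
  | h0 => rw [map_zero, map_zero, map_zero]
  | hadd s t hs ht => rw [map_add, hs, ht, map_add, map_add]
  | hmk k m =>
    induction a using Gr.induction with
    | h0 => rw [zero_mul, map_zero, LinearMap.zero_apply, LinearMap.zero_apply]
    | hadd a a' h h' => rw [add_mul, map_add, map_add, LinearMap.add_apply, LinearMap.add_apply, h, h']
    | hmk i a =>
      induction c using Gr.induction with
      | h0 => rw [mul_zero, map_zero, LinearMap.zero_apply, map_zero]
      | hadd c c' h h' => rw [mul_add, map_add, map_add, LinearMap.add_apply, LinearMap.add_apply,
          map_add, h, h']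
      | hmk j c =>
        rw [Gr.mk_mul_mk, grPairing_mk, grPairing_mk, grPairing_mk]
        refine Gr.mk_congr G (add_assoc i j k) ?_
        change ρ (a * c) m = ρ a (ρ c m)
        rw [map_mul, Module.End.mul_apply]

/-- The action of the associated graded ring on the associated graded module. -/
def grAction : Gr F →ₐ[R] Module.End R (Gr G) :=
  AlgHom.ofLinearMap (grPairing F G G ρ.toLinearMap hρ)
    (LinearMap.ext fun s => grPairing_one F G ρ hρ s)
    fun a c => LinearMap.ext fun s => grPairing_mul F G ρ hρ a c s

end GrAction

/-! ### The polynomial representation of the degenerate affine Hecke algebra -/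

section PolyAction

variable {R : Type*} [CommRing R]
  {κ Λ Λ' : Type*} [AddCommGroup Λ] [AddCommGroup Λ'] {P : RootDatum κ Λ Λ'} (b : P.Base)

/-- The actions of the degenerate affine Hecke algebra on the symmetric algebra, over `R`. -/
abbrev PolyAction (R : Type*) [CommRing R] (b : P.Base) : Type _ :=
  R ⊗[ℤ] DegHecke b →ₐ[R] Module.End R (R ⊗[ℤ] SymEps Λ)

/-- An action on the symmetric algebra in which `ε` and the weights act by multiplication and the
`θ_i` fix `1`. -/
structure IsPolyAction (A : PolyAction R b) : Prop where
  lin : ∀ m t, A (1 ⊗ₜ degLin b m) t = (1 ⊗ₜ SymmetricAlgebra.ι ℤ (ℤ × Λ) m) * t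
  one : ∀ i : b.support, A (1 ⊗ₜ degTheta b (simpleRefl P i)) 1 = 1

variable {b} {A A' : PolyAction R b}

theorem one_tmul_mul {S T : Type*} [CommRing S] [Ring T] (a c : T) :
    (1 : S) ⊗ₜ[ℤ] (a * c) = (1 ⊗ₜ a) * (1 ⊗ₜ c) := by
  rw [Algebra.TensorProduct.tmul_mul_tmul, one_mul]

theorem one_tmul_intCast {S T : Type*} [CommRing S] [Ring T] (n : ℤ) :
    (1 : S) ⊗ₜ[ℤ] (n : T) = n :=
  map_intCast (Algebra.TensorProduct.includeRight (R := ℤ) (A := S) (B := T)) n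

theorem IsPolyAction.symToDeg (hA : IsPolyAction b A) (u : SymEps Λ) :
    A (1 ⊗ₜ symToDeg b u) = LinearMap.mulLeft R (1 ⊗ₜ u) := by
  induction u using SymmetricAlgebra.induction with
  | algebraMap n =>
    rw [eq_intCast, map_intCast, one_tmul_intCast, one_tmul_intCast, map_intCast]
    refine LinearMap.ext fun t => ?_
    rw [Module.End.intCast_apply, LinearMap.mulLeft_apply, zsmul_eq_mul]
  | ι m => exact LinearMap.ext fun t => by rw [symToDeg_ι, hA.lin, LinearMap.mulLeft_apply]
  | mul u v hu hv =>
    rw [map_mul, one_tmul_mul, map_mul, hu, hv, one_tmul_mul, LinearMap.mulLeft_mul]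
    rfl
  | add u v hu hv =>
    rw [map_add, TensorProduct.tmul_add, map_add, hu, hv, TensorProduct.tmul_add]
    exact LinearMap.ext fun t => (add_mul _ _ t).symm

/-- The operator `θ_i` is `u ↦ ε Δ_i(u) + s_i(u)`. -/
theorem IsPolyAction.theta (hA : IsPolyAction b A) (i : b.support) {u v : SymEps Λ}
    (h : degTheta b (simpleRefl P i) * FormalHecke.symToDeg b u =
      FormalHecke.symToDeg b (SymEps.refl P i u) * degTheta b (simpleRefl P i) +
        FormalHecke.symToDeg b v) :
    A (1 ⊗ₜ degTheta b (simpleRefl P i)) (1 ⊗ₜ u) = 1 ⊗ₜ (v + SymEps.refl P i u) := by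
  have h1 (w : SymEps Λ) : A (1 ⊗ₜ FormalHecke.symToDeg b w) 1 = 1 ⊗ₜ w := by
    rw [hA.symToDeg, LinearMap.mulLeft_apply, mul_one]
  rw [← h1 u, ← Module.End.mul_apply, ← map_mul, ← one_tmul_mul, h, TensorProduct.tmul_add, map_add,
    LinearMap.add_apply, one_tmul_mul, map_mul, Module.End.mul_apply, hA.one, h1, h1,
    TensorProduct.tmul_add, add_comm]

/-- There is at most one such action: the commutation relations move `θ_i` past elements of the
symmetric algebra, which generates its regular module from `1`. -/
theorem IsPolyAction.eq [Finite κ] [P.IsReduced] (hA : IsPolyAction b A) (hA' : IsPolyAction b A') :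
    A = A' := by
  have hlin (m : ℤ × Λ) : A (1 ⊗ₜ degLin b m) = A' (1 ⊗ₜ degLin b m) :=
    LinearMap.ext fun t => by rw [hA.lin, hA'.lin]
  have hsimple (i : b.support) : A (1 ⊗ₜ degTheta b (simpleRefl P i)) =
      A' (1 ⊗ₜ degTheta b (simpleRefl P i)) := by
    refine LinearMap.ext fun t => ?_
    induction t with
    | zero => rw [map_zero, map_zero]
    | add t t' h h' => rw [map_add, map_add, h, h']
    | tmul r u =>
      obtain ⟨v, -, h⟩ := exists_theta_mul_symToDeg b i u
      have h1 : r ⊗ₜ[ℤ] u = r • ((1 : R) ⊗ₜ[ℤ] u) := by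
        rw [TensorProduct.smul_tmul', smul_eq_mul, mul_one]
      rw [h1, map_smul, map_smul, hA.theta i h, hA'.theta i h]
  have htheta (w : P.weylGroup) : A (1 ⊗ₜ degTheta b w) = A' (1 ⊗ₜ degTheta b w) := by
    obtain ⟨I, rfl⟩ := exists_wordProd_eq b w
    induction I with
    | nil =>
      rw [wordProd_nil, map_one, ← Algebra.TensorProduct.one_def, map_one, map_one]
    | cons i I ih => rw [wordProd_cons, map_mul, one_tmul_mul, map_mul, map_mul, ih, hsimple]
  have hdeg (a : DegHecke b) : A (1 ⊗ₜ a) = A' (1 ⊗ₜ a) := by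
    induction a using DegHecke.induction with
    | hint n => rw [one_tmul_intCast, map_intCast, map_intCast]
    | hgen g =>
      cases g with
      | eps => rw [← degLin_one_zero, hlin]
      | wt l => rw [← degLin_zero_left, hlin]
      | theta w => exact htheta w
    | hadd a c ha hc => rw [TensorProduct.tmul_add, map_add, map_add, ha, hc]
    | hmul a c ha hc => rw [one_tmul_mul, map_mul, map_mul, ha, hc]
  refine AlgHom.ext fun a => ?_
  induction a with
  | zero => rw [map_zero, map_zero]
  | add a c ha hc => rw [map_add, map_add, ha, hc]
  | tmul r a =>
    have h1 : r ⊗ₜ[ℤ] a = r • ((1 : R) ⊗ₜ[ℤ] a) := by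
      rw [TensorProduct.smul_tmul', smul_eq_mul, mul_one]
    rw [h1, map_smul, map_smul, hdeg]

/-- Over `ℤ` the base change can be removed. -/
theorem exists_isPolynomialRep {A : PolyAction ℤ b}
    (hA : IsPolyAction b A) : ∃ π : DegHecke b →ₐ[ℤ] Module.End ℤ (SymEps Λ),
      IsPolynomialRep b π ∧ ∀ i : b.support, π (degTheta b (simpleRefl P i)) 1 = 1 := by
  let π : DegHecke b →ₐ[ℤ] Module.End ℤ (SymEps Λ) :=
    (((TensorProduct.lid ℤ (SymEps Λ)).conjRingEquiv.toRingHom.comp A.toRingHom).comp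
      (Algebra.TensorProduct.includeRight (R := ℤ) (A := ℤ)
        (B := DegHecke b)).toRingHom).toIntAlgHom
  have hπ (a : DegHecke b) (u : SymEps Λ) :
      π a u = TensorProduct.lid ℤ (SymEps Λ) (A (1 ⊗ₜ a) (1 ⊗ₜ u)) := rfl
  have hlin (m : ℤ × Λ) (u : SymEps Λ) :
      π (degLin b m) u = SymmetricAlgebra.ι ℤ (ℤ × Λ) m * u := by
    rw [hπ, hA.lin, ← one_tmul_mul, TensorProduct.lid_tmul, one_smul]
  refine ⟨π, ⟨fun u => ?_, fun l u => ?_, fun i hi u => ?_⟩, fun i => ?_⟩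
  · rw [← degLin_one_zero, hlin]
    rfl
  · rw [← degLin_zero_left, hlin]
    rfl
  · obtain ⟨v, hv, h⟩ := exists_theta_mul_symToDeg b ⟨i, hi⟩ u
    refine ⟨v, hv, ?_⟩
    have h1 := hA.theta ⟨i, hi⟩ h
    rw [← degTheta_apply, hπ, h1, TensorProduct.lid_tmul, one_smul]
  · rw [hπ, ← Algebra.TensorProduct.one_def, hA.one, Algebra.TensorProduct.one_def,
      TensorProduct.lid_tmul, one_smul]

theorem isPolyAction_baseChangeAction {π : DegHecke b →ₐ[ℤ] Module.End ℤ (SymEps Λ)}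
    (hπ : IsPolynomialRep b π) (hone : ∀ i : b.support, π (degTheta b (simpleRefl P i)) 1 = 1) :
    IsPolyAction b (baseChangeAction R b π) where
  lin m t := by
    have h1 : SymmetricAlgebra.ι ℤ (ℤ × Λ) m = m.1 • SymEps.gamma Λ + SymEps.wt m.2 := by
      rw [SymEps.gamma, SymEps.wt, ← map_zsmul, ← map_add]
      congr 1
      ext <;> simp
    induction t with
    | zero => rw [map_zero, mul_zero]
    | add t t' h h' => rw [map_add, mul_add, h, h']
    | tmul r u =>
      rw [baseChangeAction_tmul, degLin_apply b m.1 m.2, map_add, map_zsmul, LinearMap.add_apply,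
        LinearMap.smul_apply, hπ.eps, hπ.wt, Algebra.TensorProduct.tmul_mul_tmul, h1, add_mul,
        smul_mul_assoc]
  one i := by
    rw [Algebra.TensorProduct.one_def, baseChangeAction_tmul, hone, mul_one]

end PolyAction

/-! ### The action on the associated graded ring of the formal group algebra -/

section Main

variable {R : Type*} [CommRing R] (F : FormalGroup R)
  {ι Λ Λ' : Type*} [AddCommGroup Λ] [AddCommGroup Λ'] {P : RootDatum ι Λ Λ'} (b : P.Base)
  [F.IsComm] [Module.Finite ℤ Λ] [Module.Free ℤ Λ] [Finite ι] [P.IsReduced]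
  (hreg : IsSigmaRegular F P)
  {ρ : heckeAlgebra F P b →ₐ[R] Module.End R (BaseAlgebra F Λ)}
  (hρ : ∀ z u, algebraMap (BaseAlgebra F Λ) (LocalizedAlgebra F P) (ρ z u) =
    twistedAct F P z (algebraMap _ _ u))
  (hρ' : ∀ j k, ∀ z ∈ heckeFiltration F P b j, ∀ u ∈ baseFiltration F Λ k,
    ρ.toLinearMap z u ∈ baseFiltration F Λ (j + k))

/-- The action of the degenerate affine Hecke algebra on the symmetric algebra obtained from the
action of the associated graded rings. -/
def gradedPolyAction : PolyAction R b :=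
  (((grSymEquiv F Λ).symm.toLinearEquiv.conjAlgEquiv R : _ →ₐ[R] _).comp
    (grAction (heckeFiltration F P b) (baseFiltration F Λ) ρ hρ')).comp (degToGr F b)

theorem gradedPolyAction_apply (a : R ⊗[ℤ] DegHecke b) (t : R ⊗[ℤ] SymEps Λ) :
    gradedPolyAction F b hρ' a t = (grSymEquiv F Λ).symm
      (grPairing (heckeFiltration F P b) (baseFiltration F Λ) (baseFiltration F Λ) ρ.toLinearMap hρ'
        (degToGr F b a) (grSymEquiv F Λ t)) := rfl

include hreg hρ in
theorem isPolyAction_gradedPolyAction : IsPolyAction b (gradedPolyAction F b hρ') where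
  lin m t := by
    rw [gradedPolyAction_apply, degToGr_degLin, AlgEquiv.symm_apply_eq, map_mul, grSymEquiv_ι]
    generalize grSymEquiv F Λ t = s
    induction s using Gr.induction with
    | h0 => rw [map_zero, mul_zero]
    | hadd s s' h h' => rw [map_add, mul_add, h, h']
    | hmk k u =>
      rw [grX, grScalar_mk, grPairing_mk, Gr.mk_mul_mk]
      exact Gr.mk_congr _ rfl (heckeAction_scalar hreg hρ _ _)
  one i := by
    rw [gradedPolyAction_apply, degToGr_degTheta, AlgEquiv.symm_apply_eq, map_one, grT_simpleRefl,
      Gr.one_eq, grPairing_mk]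
    exact Gr.mk_congr _ rfl (heckeAction_T_one hreg hρ i)

omit [F.IsComm] [Finite ι] [P.IsReduced] in
/-- The formal group algebra is a domain, in which `x_α` has a nonzero linear term. -/
theorem isSigmaRegular_of_charZero [IsDomain R] [CharZero R] [F.IsComm] [Finite ι] :
    IsSigmaRegular F P := by
  intro i
  refine IsRegular.of_ne_zero fun h => ?_
  let β := Module.Free.chooseBasis ℤ Λ
  refine P.ne_zero i (β.repr.injective (Finsupp.ext fun j => ?_))
  have h1 := coeff_single_chi F β j (P.root i)
  rw [← coordEquiv_x, h, map_zero, map_zero] at h1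
  rw [map_zero, Finsupp.zero_apply]
  exact Int.cast_eq_zero.mp h1.symm

/-- The polynomial representation is the associated graded action for the additive formal group law
over `ℤ`. -/
theorem exists_polynomialRep : ∃ π : DegHecke b →ₐ[ℤ] Module.End ℤ (SymEps Λ),
    IsPolynomialRep b π ∧ ∀ i : b.support, π (degTheta b (simpleRefl P i)) 1 = 1 := by
  have hreg : IsSigmaRegular (FormalGroup.𝔾ₐ : FormalGroup ℤ) P := isSigmaRegular_of_charZero _
  obtain ⟨ρ, hρ⟩ := exists_heckeAction (FormalGroup.𝔾ₐ : FormalGroup ℤ) b hreg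
  exact exists_isPolynomialRep (isPolyAction_gradedPolyAction _ b hreg hρ
    fun _ _ _ hz _ hu => heckeAction_mem hreg hρ hz hu)

theorem free_weightLattice {ι Λ Λ' : Type*} [AddCommGroup Λ] [AddCommGroup Λ'] [Module.Finite ℤ Λ]
    (P : RootDatum ι Λ Λ') : Module.Free ℤ Λ := by
  have : Module.IsReflexive ℤ Λ := .of_isPerfPair P.toLinearMap
  infer_instance

end Main

end FormalHecke

end

theorem mainTheorem8 {R : Type*} [CommRing R] (F : FormalGroup R) [F.IsComm]
    {ι Λ Λ' : Type*} [Finite ι] [Nonempty ι] [AddCommGroup Λ] [AddCommGroup Λ']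
    [Module.Finite ℤ Λ] [Module.Finite ℤ Λ'] (P : RootDatum ι Λ Λ') [P.IsReduced]
    (hP : IsSemisimpleRootDatum P) (b : P.Base) (hreg : IsSigmaRegular F P) :
    -- the action of the formal affine Hecke algebra on `S`, and its compatibility with filtrations
    ∃ (ρ : heckeAlgebra F P b →ₐ[R] Module.End R (BaseAlgebra F Λ))
      (_ : ∀ z u, algebraMap (BaseAlgebra F Λ) (LocalizedAlgebra F P) (ρ z u) =
        twistedAct F P z (algebraMap (BaseAlgebra F Λ) (LocalizedAlgebra F P) u))
      (hρ : ∀ j k, ∀ z ∈ heckeFiltration F P b j, ∀ u ∈ baseFiltration F Λ k,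
        ρ.toLinearMap z u ∈ baseFiltration F Λ (j + k))
      (_ : IsDecreasingFiltration (heckeFiltration F P b))
      -- the action of the degenerate affine Hecke algebra
      (π : DegHecke b →ₐ[ℤ] Module.End ℤ (SymEps Λ)) (_ : IsPolynomialRep b π)
      -- the identification of `Gr S` with the symmetric algebra
      (θ : Gr (baseFiltration F Λ) ≃ₐ[R] R ⊗[ℤ] SymEps Λ)
      (_ : ∀ m : ℤ × Λ, θ (Gr.mk (baseFiltration F Λ) 1
          ⟨FormalGroupAlgebra.x F m, x_mem_baseFiltration F m⟩) =
        1 ⊗ₜ SymmetricAlgebra.ι ℤ (ℤ × Λ) m)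
      (e : Gr (heckeFiltration F P b) ≃ₐ[R] R ⊗[ℤ] DegHecke b),
      -- `e` is graded
      (∀ n, (Gr.component (heckeFiltration F P b) n).map e.toLinearMap =
        (DegHecke.component b n).baseChange R) ∧
      -- `e` sends the classes of `x_γ`, `x_λ`, `T_i` to `ε`, `λ`, `θ_i`
      e (Gr.mk (heckeFiltration F P b) 1 ⟨heckeScalar F P b (xGamma F Λ),
          heckeScalar_mem F P b (x_mem_baseFiltration F _)⟩) =
        1 ⊗ₜ DegHecke.gen b DegGen.eps ∧
      (∀ l : Λ, e (Gr.mk (heckeFiltration F P b) 1 ⟨heckeScalar F P b (xWeight F l),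
          heckeScalar_mem F P b (x_mem_baseFiltration F _)⟩) =
        1 ⊗ₜ DegHecke.gen b (DegGen.wt l)) ∧
      (∀ i : b.support, e (Gr.mk (heckeFiltration F P b) 0
          ⟨heckeT F P b i, heckeT_mem F P b i⟩) =
        1 ⊗ₜ DegHecke.gen b (DegGen.theta (simpleRefl P i))) ∧
      -- `e` intertwines the actions of both sides on `Gr S`
      ∀ (a : Gr (heckeFiltration F P b)) (s : Gr (baseFiltration F Λ)),
        θ (grPairing (heckeFiltration F P b) (baseFiltration F Λ) (baseFiltration F Λ)
            ρ.toLinearMap hρ a s) =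
          baseChangeAction R b π (e a) (θ s) := by
  have : Module.Free ℤ Λ := free_weightLattice P
  obtain ⟨ρ, hρ⟩ := exists_heckeAction F b hreg
  have hρ' : ∀ j k, ∀ z ∈ heckeFiltration F P b j, ∀ u ∈ baseFiltration F Λ k,
      ρ.toLinearMap z u ∈ baseFiltration F Λ (j + k) :=
    fun _ _ _ hz _ hu => heckeAction_mem hreg hρ hz hu
  obtain ⟨π, hπ, hone⟩ := exists_polynomialRep b
  have hA : gradedPolyAction F b hρ' = baseChangeAction R b π :=
    (isPolyAction_gradedPolyAction F b hreg hρ hρ').eq (isPolyAction_baseChangeAction hπ hone)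
  have he (a : R ⊗[ℤ] DegHecke b) {g : Gr (heckeFiltration F P b)} (h : degToGr F b a = g) :
      (degEquivGr F b hreg).symm g = a := by
    rw [← h, degEquivGr_symm_degToGr]
  refine ⟨ρ, hρ, hρ', inferInstance, π, hπ, (grSymEquiv F Λ).symm, fun m => ?_,
    (degEquivGr F b hreg).symm, map_component F b hreg, he _ ?_, fun l => he _ ?_, fun i => he _ ?_,
    fun a s => ?_⟩
  · rw [AlgEquiv.symm_apply_eq, grSymEquiv_ι]
    rfl
  · rw [← degLin_one_zero, degToGr_degLin, grX, grScalar_mk]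
    rfl
  · rw [← degLin_zero_left, degToGr_degLin, grX, grScalar_mk]
    rfl
  · rw [← degTheta_apply, degToGr_degTheta, grT_simpleRefl]
  · have h : degToGr F b ((degEquivGr F b hreg).symm a) = a :=
      (degEquivGr F b hreg).apply_symm_apply a
    rw [← hA, gradedPolyAction_apply, h, AlgEquiv.apply_symm_apply]
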